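/- Let $M=\mathbb H^3/\Gamma$ be an orientable complete hyperbolic $3$-manifold of finite volume with hyperbolic metric $h_0$ (so $\Gamma<\mathrm{PSL}_2(\mathbb C)$ is discrete and acts freely). For symmetric covariant $2$-tensors $l$ on $M$ put $A_{h_0}(l)=\Delta_L l-4l$, where $\Delta_L$ is the Lichnerowicz Laplacian of $h_0$, $$(\Delta_L l)_{ij}=(\Delta l)_{ij}+2R_{iklj}l^{kl}-R_i^k l_{kj}-R_j^k l_{ki},$$ with $\Delta$ the connection Laplacian and the curvature sign chosen so that $R_{ijji}$ is the sectional curvature of an orthonormal pair. Let $\bigcup_i T_i\times[0,\infty)\subset M$ be a finite union of pairwise disjoint embedded cusps, where each $T_i$ is a flat torus and $h_0=e^{-2r}g_{\mathrm{flat}}+dr^2$ on $T_i\times[0,\infty)$; for instance, all the cusps of $M$. There is an absolute constant $\alpha>0$, a constant $C_1$ depending only on $M$ and the chosen cusps, and a constant $C_2$ depending only on $M$, such that every symmetric $2$-tensor $\bar l\in C^2_{loc}(\mathrm{Sym}^2(T^*M))\cap H^1(M)$ with $A_{h_0}(\bar l)=-\bar l$ satisfies: 1. $\|\bar l\|_{L^1(\bigcup_i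 T_i\times[r,\infty))}\le C_1\,e^{-\alpha r}\,\|\bar l\|_{L^2(M)}$ for all $r\ge 0$; 2. $\|\bar l\|_{C^0(M)}=\sup_M|\bar l|_{h_0}\le C_2\,\|\bar l\|_{L^2(M)}<\infty$. -/

import Mathlib

open scoped ENNReal

noncomputable section

/-! ### Riemannian geometry of a metric given in one coordinate chart of `ℝⁿ` -/

namespace ChartGeom

variable {n : ℕ}

/-- The coordinate derivative `∂ₖ f` at `p`. -/
def pd (k : Fin n) (f : (Fin n → ℝ) → ℝ) (p : Fin n → ℝ) : ℝ :=
  fderiv ℝ f p (Pi.single k 1)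

/-- The components of a covariant `2`-tensor field. -/
abbrev Tensor2 (n : ℕ) := (Fin n → ℝ) → Fin n → Fin n → ℝ

/-- The components of a covariant `3`-tensor field. -/
abbrev Tensor3 (n : ℕ) := (Fin n → ℝ) → Fin n → Fin n → Fin n → ℝ

/-- The inverse metric `g^{ij}`. -/
def inv (g : Tensor2 n) (p : Fin n → ℝ) (i j : Fin n) : ℝ :=
  (Matrix.of (g p))⁻¹ i j

/-- The Christoffel symbol `Γᵏᵢⱼ` of the Levi-Civita connection. -/
def christoffel (g : Tensor2 n) (k i j : Fin n) (p : Fin n → ℝ) : ℝ :=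
  (1 / 2) * ∑ m, inv g p k m *
    (pd i (fun x => g x j m) p + pd j (fun x => g x i m) p - pd m (fun x => g x i j) p)

/-- The covariant derivative `∇ₖ lᵢⱼ`; the index of differentiation comes first. -/
def cov2 (g l : Tensor2 n) : Tensor3 n := fun p k i j =>
  pd k (fun x => l x i j) p
    - ∑ m, christoffel g m k i p * l p m j
    - ∑ m, christoffel g m k j p * l p i m

/-- The covariant derivative `∇ₘ Tₖᵢⱼ` of a covariant `3`-tensor field. -/
def cov3 (g : Tensor2 n) (T : Tensor3 n) (p : Fin n → ℝ) (m k i j : Fin n) : ℝ :=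
  pd m (fun x => T x k i j) p
    - ∑ a, christoffel g a m k p * T p a i j
    - ∑ a, christoffel g a m i p * T p k a j
    - ∑ a, christoffel g a m j p * T p k i a

/-- The connection Laplacian `(Δ l)ᵢⱼ = g^{mk} ∇ₘ ∇ₖ lᵢⱼ`. -/
def roughLaplacian (g l : Tensor2 n) : Tensor2 n := fun p i j =>
  ∑ m, ∑ k, inv g p m k * cov3 g (cov2 g l) p m k i j

/-- The component `Rᵢⱼₖᵐ` of the curvature, `R(∂ᵢ, ∂ⱼ) ∂ₖ = Rᵢⱼₖᵐ ∂ₘ`. -/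
def riemUp (g : Tensor2 n) (p : Fin n → ℝ) (i j k m : Fin n) : ℝ :=
  pd i (christoffel g m j k) p - pd j (christoffel g m i k) p
    + ∑ a, christoffel g m i a p * christoffel g a j k p
    - ∑ a, christoffel g m j a p * christoffel g a i k p

/-- The curvature tensor `Rᵢⱼₖₗ = ⟨R(∂ᵢ, ∂ⱼ) ∂ₖ, ∂ₗ⟩`, so that `Rᵢⱼⱼᵢ` is the sectional curvature
of an orthonormal pair. -/
def riem (g : Tensor2 n) (p : Fin n → ℝ) (i j k l : Fin n) : ℝ :=
  ∑ m, riemUp g p i j k m * g p m l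

/-- The Ricci tensor `Rᵢⱼ = g^{kl} Rₖᵢⱼₗ`. -/
def ricci (g : Tensor2 n) : Tensor2 n := fun p i j =>
  ∑ k, ∑ l, inv g p k l * riem g p k i j l

/-- The Lichnerowicz Laplacian
`(Δ_L l)ᵢⱼ = (Δ l)ᵢⱼ + 2 Rᵢₖₘⱼ l^{km} - Rᵢᵏ lₖⱼ - Rⱼᵏ lₖᵢ`. -/
def lichnerowicz (g l : Tensor2 n) : Tensor2 n := fun p i j =>
  roughLaplacian g l p i j
    + 2 * ∑ k, ∑ m, riem g p i k m j * (∑ a, ∑ b, inv g p k a * inv g p m b * l p a b)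
    - ∑ k, (∑ a, ricci g p i a * inv g p a k) * l p k j
    - ∑ k, (∑ a, ricci g p j a * inv g p a k) * l p k i

/-- The operator `l ↦ Δ_L l - 4 l`. -/
def opA (g l : Tensor2 n) : Tensor2 n := fun p i j =>
  lichnerowicz g l p i j - 4 * l p i j

/-- The squared pointwise norm `|l|²` with respect to `g`. -/
def normSq2 (g l : Tensor2 n) (p : Fin n → ℝ) : ℝ :=
  ∑ i, ∑ j, ∑ a, ∑ b, inv g p i a * inv g p j b * l p i j * l p a b

/-- The squared pointwise norm `|T|²` with respect to `g`. -/
def normSq3 (g : Tensor2 n) (T : Tensor3 n) (p : Fin n → ℝ) : ℝ :=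
  ∑ k, ∑ i, ∑ j, ∑ c, ∑ a, ∑ b,
    inv g p k c * inv g p i a * inv g p j b * T p k i j * T p c a b

/-- The pointwise norm `|l|` with respect to `g`. -/
def norm2 (g l : Tensor2 n) (p : Fin n → ℝ) : ℝ := Real.sqrt (normSq2 g l p)

/-- The Riemannian volume `√(det g) dx`. -/
def riemVol (g : Tensor2 n) : MeasureTheory.Measure (Fin n → ℝ) :=
  MeasureTheory.volume.withDensity
    (fun p => ENNReal.ofReal (Real.sqrt (Matrix.of (g p)).det))

end ChartGeom

open ChartGeom

/-! ### Hyperbolic 3-space and its quotients -/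

namespace Hyp3

/-- The upper half-space `{(x, y, t) | t > 0}`. -/
def halfSpace : Set (Fin 3 → ℝ) := {p | 0 < p 2}

/-- The hyperbolic metric `(dx² + dy² + dt²) / t²`. -/
def metric : Tensor2 3 := fun p i j => if i = j then 1 / p 2 ^ 2 else 0

/-- The group `SL(2, ℂ)`. -/
abbrev SL2C := Matrix.SpecialLinearGroup (Fin 2) ℂ

/-- The point with coordinates `(Re z, Im z, t)`. -/
def mkPt (z : ℂ) (t : ℝ) : Fin 3 → ℝ := ![z.re, z.im, t]

/-- The complex coordinate `z = x + i y` of a point. -/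
def zco (p : Fin 3 → ℝ) : ℂ := ⟨p 0, p 1⟩

/-- The action of `SL(2, ℂ)` on upper half-space by orientation preserving isometries (the Poincaré
extension of Möbius transformations):
`γ (z, t) = (((a z + b) (c z + d)̄ + a c̄ t²) / N, t / N)` with `N = |c z + d|² + |c|² t²`. -/
def act (γ : SL2C) (p : Fin 3 → ℝ) : Fin 3 → ℝ :=
  let z := zco p
  let t := p 2
  let N : ℝ := ‖γ 1 0 * z + γ 1 1‖ ^ 2 + ‖γ 1 0‖ ^ 2 * t ^ 2
  mkPt (((γ 0 0 * z + γ 0 1) * (starRingEnd ℂ) (γ 1 0 * z + γ 1 1)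
      + γ 0 0 * (starRingEnd ℂ) (γ 1 0) * (t : ℂ) ^ 2) / (N : ℂ)) (t / N)

/-- Two points of upper half-space with the same image in the quotient by `Γ`. -/
def SameOrbit (Γ : Subgroup SL2C) (p q : Fin 3 → ℝ) : Prop := ∃ γ ∈ Γ, act γ p = q

/-- `Γ` is the preimage in `SL(2, ℂ)` (or a lift) of a discrete subgroup of `PSL(2, ℂ)` that acts
freely on hyperbolic space: the quotient is a complete orientable hyperbolic `3`-manifold. -/
structure IsManifoldGroup (Γ : Subgroup SL2C) : Prop where
  discrete : DiscreteTopology Γ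
  free : ∀ γ ∈ Γ, (∃ p ∈ halfSpace, act γ p = p) → ∀ q ∈ halfSpace, act γ q = q

/-- The integral over the image of `A` in `M = ℍ³/Γ`, with respect to the hyperbolic volume, of the
function on `M` induced by a `Γ`-invariant function `f ≥ 0`; here `A` is a `Γ`-invariant set. It is
the supremum of the integrals of `f` over the measurable subsets of `A` that inject into `M`;
the supremum is attained at the intersection of `A` with any exact fundamental domain. -/
def quotLIntegral (Γ : Subgroup SL2C) (A : Set (Fin 3 → ℝ)) (f : (Fin 3 → ℝ) → ℝ≥0∞) : ℝ≥0∞ :=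
  ⨆ (S : Set (Fin 3 → ℝ)) (_ : MeasurableSet S ∧ S ⊆ A ∩ halfSpace ∧
      ∀ p ∈ S, ∀ q ∈ S, SameOrbit Γ p q → p = q),
    ∫⁻ p in S, f p ∂(riemVol metric)

/-- The quotient `ℍ³/Γ` is a manifold of finite volume. -/
structure IsFiniteVolume (Γ : Subgroup SL2C) : Prop extends IsManifoldGroup Γ where
  finite_volume : quotLIntegral Γ Set.univ (fun _ => 1) < ∞

/-- `l` is (the lift to upper half-space of) a symmetric covariant `2`-tensor field on `ℍ³/Γ`
of class `C²`. -/
structure IsC2SymTensor (Γ : Subgroup SL2C) (l : Tensor2 3) : Prop where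
  contDiff : ContDiffOn ℝ 2 l halfSpace
  symm : ∀ p ∈ halfSpace, ∀ i j, l p i j = l p j i
  invariant : ∀ γ ∈ Γ, ∀ p ∈ halfSpace, ∀ a b,
    ∑ i, ∑ j, l (act γ p) i j * pd a (fun x => act γ x i) p * pd b (fun x => act γ x j) p
      = l p a b

/-- The `L²` norm over `ℍ³/Γ`. -/
def L2norm (Γ : Subgroup SL2C) (l : Tensor2 3) : ℝ≥0∞ :=
  (quotLIntegral Γ Set.univ (fun p => ENNReal.ofReal (normSq2 metric l p))) ^ (1 / 2 : ℝ)

/-- The `L¹` norm over the image of the `Γ`-invariant set `A` in `ℍ³/Γ`. -/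
def L1normOn (Γ : Subgroup SL2C) (A : Set (Fin 3 → ℝ)) (l : Tensor2 3) : ℝ≥0∞ :=
  quotLIntegral Γ A (fun p => ENNReal.ofReal (norm2 metric l p))

/-- The `C⁰` norm (for an invariant tensor field, the supremum over `ℍ³/Γ` of the pointwise
norm). -/
def C0norm (l : Tensor2 3) : ℝ≥0∞ :=
  ⨆ p ∈ halfSpace, ENNReal.ofReal (norm2 metric l p)

/-- A `C²` tensor field belongs to `H¹`: the integral of `|l|² + |∇l|²` over `ℍ³/Γ` is finite. -/
def MemH1 (Γ : Subgroup SL2C) (l : Tensor2 3) : Prop :=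
  quotLIntegral Γ Set.univ
    (fun p => ENNReal.ofReal (normSq2 metric l p + normSq3 metric (cov2 metric l) p)) < ∞

/-- `l` is a symmetric `2`-tensor field on `ℍ³/Γ` in `C²_loc ∩ H¹` with `Δ_L l - 4 l = -l`. -/
structure IsEigentensor (Γ : Subgroup SL2C) (l : Tensor2 3) : Prop
    extends IsC2SymTensor Γ l where
  memH1 : MemH1 Γ l
  eigen : ∀ p ∈ halfSpace, ∀ i j, opA metric l p i j = - l p i j

/-- A finite family of pairwise disjoint cusps `Tᵢ × [0, ∞)` embedded in `ℍ³/Γ`, where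
`Tᵢ = ℂ/Λᵢ` is a flat torus and the metric is `e^{-2r} g_flat + dr²`. With `t = e^r`, the `i`-th cusp
is the image of the map `(z, r) ↦ Γ · κᵢ (z, e^r)`, where `κᵢ` moves a standard horoball into
position; `embedded` says that this map descends to an injective map on `Tᵢ × [0, ∞)`. -/
structure CuspFamily (Γ : Subgroup SL2C) where
  num : ℕ
  Λ : Fin num → Submodule ℤ ℂ
  discrete : ∀ i, DiscreteTopology (Λ i)
  spans : ∀ i, Submodule.span ℝ (Λ i : Set ℂ) = ⊤
  κ : Fin num → SL2C
  embedded : ∀ i, ∀ z w : ℂ, ∀ r s : ℝ, 0 ≤ r → 0 ≤ s →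
    (SameOrbit Γ (act (κ i) (mkPt z (Real.exp r))) (act (κ i) (mkPt w (Real.exp s)))
      ↔ r = s ∧ w - z ∈ Λ i)
  disjoint : ∀ i j, i ≠ j → ∀ z w : ℂ, ∀ r s : ℝ, 0 ≤ r → 0 ≤ s →
    ¬ SameOrbit Γ (act (κ i) (mkPt z (Real.exp r))) (act (κ j) (mkPt w (Real.exp s)))

/-- The preimage in upper half-space of `⋃ᵢ Tᵢ × [r, ∞)`. -/
def CuspFamily.region {Γ : Subgroup SL2C} (𝒞 : CuspFamily Γ) (r : ℝ) : Set (Fin 3 → ℝ) :=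
  {p | ∃ i, ∃ z : ℂ, ∃ s : ℝ, r ≤ s ∧ SameOrbit Γ (act (𝒞.κ i) (mkPt z (Real.exp s))) p}

end Hyp3

end

/-!
# Eigentensors of the Einstein operator on finite volume hyperbolic three-manifolds

The manifold is `ℍ³ / Γ`, and tensors on it are `Γ`-invariant tensor fields on upper half-space.
The action of `SL(2, ℂ)` is transported to positive Hermitian matrices (`herm_act`); this makes it an
action that preserves `|p - q|² / (p₂ q₂)` (`eDist_act`). Differentiating the invariance shows that
the Jacobians are conformal (`jac_transpose_mul`), and differentiating once more gives the
transformation law of the Christoffel symbols (`pd_jac`), hence the naturality of `Δ_L - 4`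
(`opA_pull`) and the invariance of the volume (`setLIntegral_act_image`). It is therefore possible
to conjugate `Γ` at will, and to put tubes and cusps into standard position.

In the orthonormal frame `t ∂_x, t ∂_y, t ∂_t` the equation `Δ_L l - 4 l = - l` has constant zeroth
order coefficients, and contraction with `l` gives the Bochner formula
`Δ |l|² = 2 |∇ l|² - 6 |l|² + 4 (tr l)²` (`bochner`). So `|l|²` is almost subharmonic, and it
satisfies a mean value inequality on balls of fixed hyperbolic size (`exists_mean_value`).

*Decay of the `L¹` norm.* A cusp over a flat torus of area `A` has volume `A e^{-2 r} / 2` beyond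
`r`. By Cauchy–Schwarz, the `L¹` norm there is at most a constant times `e^{-r}` times the `L²` norm
(`exists_volume_region_le`, `L1normOn_region_le`), so that the exponent `1` works.

*Boundedness.* The mean value inequality bounds `|l|²` at a point by the energy over a ball, but such
a ball covers its image in the quotient a number of times that is unbounded far out in the cusps.
Elements of `Γ` that displace a point by little commute (`IsFreeDiscrete.commute_of_disp_lt`, a form
of Margulis' lemma). Disjoint balls around thick points have images of volume bounded below, so
finite volume makes the thick part compact (`IsFreeDiscrete.thick_subset`); the components of the
thin part are tubes, each of which has a frontier point in the thick part, so that finitely many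
tubes suffice (`IsFreeDiscrete.thin_subset`). A tube around a closed geodesic is compact modulo `Γ`
(`IsFreeDiscrete.tube_diag`). A tube at a parabolic fixed point lies in a horoball
(`IsFreeDiscrete.tube_transl`), whose stabilizer is a lattice of translations because the volume is
finite (`IsFreeDiscrete.exists_indep`). Hence only horoballs remain.

In a horoball the bound comes from means over the horizontal tori (`exists_cusp_bound`). The mean of
the trace-free horizontal part of `l` solves the Euler equation `t² A'' - t A' + A = 0`, whose
nonzero solutions `t (E log t + d)` are not square integrable for the weight `t⁻³`; so it vanishes
(`IsCuspSol.torusMean_eq_zero`). For tensors without this part, the zeroth order terms of the Bochner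
formula are nonnegative (`zeroOrder_nonneg`), and high up in the cusp the Poincaré inequality on the
small tori absorbs the deviation of `l` from its mean. The mean `y` of `|l|²` then satisfies
`(y' / t)' ≥ 0` (`IsCuspSol.convex`). As `y` is integrable for the weight `t⁻³`, it is nonincreasing
(`antitoneOn_of_weighted_convex`), hence bounded by the energy. A ball at height `t` meets `O(t²)`
prisms over a torus, each of which carries energy `O(t⁻²)`, and the mean value inequality gives the
pointwise bound.
-/

open scoped ENNReal
open ChartGeom Hyp3 Matrix Filter Topology MeasureTheory

/-! ### The action of `SL(2, ℂ)` on upper half-space -/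

namespace Hyp3

/-- The squared Euclidean distance of two points in coordinates. -/
noncomputable def eDist (p q : Fin 3 → ℝ) : ℝ := ∑ i, (p i - q i) ^ 2

/-- The denominator `|c z + d|² + |c|² t²` of the Poincaré extension. -/
noncomputable def den (γ : SL2C) (p : Fin 3 → ℝ) : ℝ :=
  ‖γ 1 0 * zco p + γ 1 1‖ ^ 2 + ‖γ 1 0‖ ^ 2 * p 2 ^ 2

/-- The positive Hermitian matrix of determinant `1` that represents a point of hyperbolic space;
`SL(2, ℂ)` acts on it by `X ↦ γ X γᴴ`. -/
noncomputable def herm (p : Fin 3 → ℝ) : Matrix (Fin 2) (Fin 2) ℂ :=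
  !![(zco p * (starRingEnd ℂ) (zco p) + (p 2 : ℂ) ^ 2) / p 2, zco p / p 2;
    (starRingEnd ℂ) (zco p) / p 2, 1 / p 2]

@[simp] lemma zco_mkPt (z : ℂ) (t : ℝ) : zco (mkPt z t) = z := by
  simp [zco, mkPt]

@[simp] lemma mkPt_two (z : ℂ) (t : ℝ) : mkPt z t 2 = t := by
  simp [mkPt]

@[simp] lemma mkPt_zco (p : Fin 3 → ℝ) : mkPt (zco p) (p 2) = p := by
  ext i; fin_cases i <;> simp [zco, mkPt]

lemma ext_zco {p q : Fin 3 → ℝ} (h : zco p = zco q) (h2 : p 2 = q 2) : p = q := by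
  rw [← mkPt_zco p, ← mkPt_zco q, h, h2]

lemma det_eq (γ : SL2C) : γ 0 0 * γ 1 1 - γ 0 1 * γ 1 0 = 1 := by
  have := γ.2
  rwa [Matrix.det_fin_two] at this

lemma den_pos (γ : SL2C) {p : Fin 3 → ℝ} (hp : p ∈ halfSpace) : 0 < den γ p := by
  have ht : 0 < p 2 := hp
  unfold den
  by_cases hc : γ 1 0 = 0
  · have hd : γ 1 1 ≠ 0 := by
      intro hd
      have := det_eq γ
      simp [hc, hd] at this
    have : 0 < ‖γ 1 1‖ := norm_pos_iff.2 hd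
    simp [hc]; positivity
  · have : 0 < ‖γ 1 0‖ := norm_pos_iff.2 hc
    positivity

lemma act_two (γ : SL2C) (p : Fin 3 → ℝ) : act γ p 2 = p 2 / den γ p := by
  simp [act, den]

lemma zco_act (γ : SL2C) (p : Fin 3 → ℝ) : zco (act γ p) =
    ((γ 0 0 * zco p + γ 0 1) * (starRingEnd ℂ) (γ 1 0 * zco p + γ 1 1)
      + γ 0 0 * (starRingEnd ℂ) (γ 1 0) * (p 2 : ℂ) ^ 2) / (den γ p : ℂ) := by
  simp [act, den]

lemma act_mem (γ : SL2C) {p : Fin 3 → ℝ} (hp : p ∈ halfSpace) : act γ p ∈ halfSpace := by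
  have ht : 0 < p 2 := hp
  have := den_pos γ hp
  show 0 < act γ p 2
  rw [act_two]; positivity

lemma den_eq (γ : SL2C) (p : Fin 3 → ℝ) : (den γ p : ℂ) =
    (γ 1 0 * zco p + γ 1 1) * (starRingEnd ℂ) (γ 1 0 * zco p + γ 1 1)
      + γ 1 0 * (starRingEnd ℂ) (γ 1 0) * (p 2 : ℂ) ^ 2 := by
  rw [Complex.mul_conj, Complex.mul_conj, Complex.normSq_eq_norm_sq, Complex.normSq_eq_norm_sq]
  simp [den]

/-- Equivariance of `herm`. As `herm` is injective, this is what makes `act` a group action. -/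
lemma herm_act (γ : SL2C) {p : Fin 3 → ℝ} (hp : p ∈ halfSpace) :
    herm (act γ p) = (γ : Matrix (Fin 2) (Fin 2) ℂ) * herm p * (γ : Matrix (Fin 2) (Fin 2) ℂ)ᴴ := by
  have ht : (p 2 : ℂ) ≠ 0 := by
    have : 0 < p 2 := hp
    exact_mod_cast this.ne'
  have hN : (den γ p : ℂ) ≠ 0 := by exact_mod_cast (den_pos γ hp).ne'
  have hdet := det_eq γ
  have hdet' := congrArg (starRingEnd ℂ) hdet
  simp only [map_sub, map_mul, map_one] at hdet'
  have hNe := den_eq γ p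
  simp only [map_add, map_mul] at hNe
  have h2 : ((act γ p 2 : ℝ) : ℂ) = p 2 / den γ p := by rw [act_two]; push_cast; rfl
  have hz := zco_act γ p
  have hzc := congrArg (starRingEnd ℂ) hz
  simp only [map_add, map_mul, map_div₀, Complex.conj_conj, map_pow, Complex.conj_ofReal] at hz hzc
  -- the upper left entry is the only one that needs the determinant
  have e00 : ((γ 0 0 * zco p + γ 0 1) * ((starRingEnd ℂ) (γ 1 0) * (starRingEnd ℂ) (zco p) +
        (starRingEnd ℂ) (γ 1 1)) + γ 0 0 * (starRingEnd ℂ) (γ 1 0) * (p 2 : ℂ) ^ 2) *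
      (((starRingEnd ℂ) (γ 0 0) * (starRingEnd ℂ) (zco p) + (starRingEnd ℂ) (γ 0 1)) *
        (γ 1 0 * zco p + γ 1 1) + (starRingEnd ℂ) (γ 0 0) * γ 1 0 * (p 2 : ℂ) ^ 2) + (p 2 : ℂ) ^ 2 =
      den γ p * ((γ 0 0 * zco p + γ 0 1) * ((starRingEnd ℂ) (γ 0 0) * (starRingEnd ℂ) (zco p) +
        (starRingEnd ℂ) (γ 0 1)) + γ 0 0 * (starRingEnd ℂ) (γ 0 0) * (p 2 : ℂ) ^ 2) := by
    rw [hNe]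
    linear_combination (-(p 2 : ℂ) ^ 2) * (((starRingEnd ℂ) (γ 0 0) * (starRingEnd ℂ) (γ 1 1) -
      (starRingEnd ℂ) (γ 0 1) * (starRingEnd ℂ) (γ 1 0)) * hdet + hdet')
  ext i j
  fin_cases i <;> fin_cases j <;>
    simp only [herm, Matrix.mul_apply, Fin.sum_univ_two, h2, Matrix.conjTranspose_apply,
      Matrix.of_apply, Matrix.cons_val', Matrix.cons_val_zero, Matrix.cons_val_one,
      Fin.zero_eta, Fin.mk_one, Fin.isValue, Matrix.cons_val_fin_one, RCLike.star_def]
  · rw [hzc, hz]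
    field_simp
    linear_combination e00
  · rw [hz]
    field_simp
    ring
  · rw [hzc]
    field_simp
    ring
  · rw [hNe]
    field_simp
    ring

lemma herm_injOn {p q : Fin 3 → ℝ} (hp : p ∈ halfSpace)
    (h : herm p = herm q) : p = q := by
  have hp' : (p 2 : ℂ) ≠ 0 := by exact_mod_cast (show 0 < p 2 from hp).ne'
  have h1 := congrFun (congrFun h 1) 1
  have h2 := congrFun (congrFun h 0) 1
  simp [herm] at h1 h2
  rw [← h1] at h2
  refine ext_zco ?_ h1
  field_simp at h2
  exact h2

lemma act_mul (γ η : SL2C) {p : Fin 3 → ℝ} (hp : p ∈ halfSpace) :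
    act (γ * η) p = act γ (act η p) := by
  refine herm_injOn (act_mem _ hp) ?_
  rw [herm_act _ hp, herm_act _ (act_mem _ hp), herm_act _ hp, Matrix.SpecialLinearGroup.coe_mul,
    Matrix.conjTranspose_mul]
  simp only [Matrix.mul_assoc]

@[simp] lemma act_one (p : Fin 3 → ℝ) : act 1 p = p := by
  refine ext_zco ?_ ?_
  · rw [zco_act]; simp [den]
  · rw [act_two]; simp [den]

lemma act_inv_act (γ : SL2C) {p : Fin 3 → ℝ} (hp : p ∈ halfSpace) : act γ⁻¹ (act γ p) = p := by
  rw [← act_mul _ _ hp]; simp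

lemma act_act_inv (γ : SL2C) {p : Fin 3 → ℝ} (hp : p ∈ halfSpace) : act γ (act γ⁻¹ p) = p := by
  rw [← act_mul _ _ hp]; simp

@[simp] lemma act_neg (γ : SL2C) (p : Fin 3 → ℝ) : act (-γ) p = act γ p := by
  have hN : den (-γ) p = den γ p := by
    simp only [den, Matrix.SpecialLinearGroup.coe_neg, Matrix.neg_apply, norm_neg]
    rw [show -γ 1 0 * zco p + -γ 1 1 = -(γ 1 0 * zco p + γ 1 1) by ring, norm_neg]
  refine ext_zco ?_ ?_
  · rw [zco_act, zco_act, hN]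
    congr 1
    simp only [Matrix.SpecialLinearGroup.coe_neg, Matrix.neg_apply, map_add, map_mul, map_neg]
    ring
  · rw [act_two, act_two, hN]

/-- `tr (X adj(Y))` is invariant under the action on Hermitian matrices; in coordinates it is a
function of the hyperbolic distance. -/
lemma trace_herm {p q : Fin 3 → ℝ} (hp : p ∈ halfSpace) (hq : q ∈ halfSpace) :
    (herm p * (herm q).adjugate).trace = ((2 + eDist p q / (p 2 * q 2) : ℝ) : ℂ) := by
  have hp' : (p 2 : ℂ) ≠ 0 := by exact_mod_cast (show 0 < p 2 from hp).ne'
  have hq' : (q 2 : ℂ) ≠ 0 := by exact_mod_cast (show 0 < q 2 from hq).ne'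
  have h1 : ∀ p : Fin 3 → ℝ, zco p = p 0 + p 1 * Complex.I := fun p => by
    apply Complex.ext <;> simp [zco]
  have h2 : ∀ p : Fin 3 → ℝ, (starRingEnd ℂ) (zco p) = p 0 - p 1 * Complex.I := fun p => by
    apply Complex.ext <;> simp [zco]
  simp only [herm, Matrix.adjugate_fin_two_of, Matrix.trace_fin_two, Matrix.mul_apply,
    Fin.sum_univ_two, Matrix.of_apply, Matrix.cons_val', Matrix.cons_val_zero, Matrix.cons_val_one,
    Matrix.cons_val_fin_one, eDist, Fin.sum_univ_three, h2]
  simp only [h1]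
  push_cast
  field_simp
  linear_combination ((p 1 - q 1 : ℂ) ^ 2 * (-1)) * Complex.I_sq

/-- The quantity `|p - q|² / (p₂ q₂) = 2 (cosh d(p, q) - 1)` is invariant under the action. -/
lemma eDist_act (γ : SL2C) {p q : Fin 3 → ℝ} (hp : p ∈ halfSpace) (hq : q ∈ halfSpace) :
    eDist (act γ p) (act γ q) / (act γ p 2 * act γ q 2) = eDist p q / (p 2 * q 2) := by
  have h1 := trace_herm (act_mem γ hp) (act_mem γ hq)
  have h2 := trace_herm hp hq
  have hg : (γ : Matrix (Fin 2) (Fin 2) ℂ).adjugate * (γ : Matrix (Fin 2) (Fin 2) ℂ) = 1 := by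
    rw [Matrix.adjugate_mul, γ.2, one_smul]
  have hg' : (γ : Matrix (Fin 2) (Fin 2) ℂ)ᴴ * (γ : Matrix (Fin 2) (Fin 2) ℂ)ᴴ.adjugate = 1 := by
    rw [Matrix.mul_adjugate, Matrix.det_conjTranspose, γ.2, star_one, one_smul]
  rw [herm_act _ hp, herm_act _ hq, Matrix.adjugate_mul_distrib, Matrix.adjugate_mul_distrib] at h1
  have : ((γ : Matrix (Fin 2) (Fin 2) ℂ) * herm p * (γ : Matrix (Fin 2) (Fin 2) ℂ)ᴴ *
      ((γ : Matrix (Fin 2) (Fin 2) ℂ)ᴴ.adjugate * ((herm q).adjugate *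
        (γ : Matrix (Fin 2) (Fin 2) ℂ).adjugate))).trace = (herm p * (herm q).adjugate).trace := by
    calc _ = ((γ : Matrix (Fin 2) (Fin 2) ℂ) * (herm p * ((γ : Matrix (Fin 2) (Fin 2) ℂ)ᴴ *
        (γ : Matrix (Fin 2) (Fin 2) ℂ)ᴴ.adjugate) * (herm q).adjugate *
          (γ : Matrix (Fin 2) (Fin 2) ℂ).adjugate)).trace := by simp only [Matrix.mul_assoc]
      _ = _ := by
        rw [hg', Matrix.mul_one, Matrix.trace_mul_comm, Matrix.mul_assoc, hg, Matrix.mul_one]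
  rw [this, h2] at h1
  have h3 := Complex.ofReal_injective h1
  linarith
end Hyp3

/-! ### Coordinate derivatives and conformality of the action -/

namespace ChartGeom

variable {n : ℕ}

lemma fderiv_apply_eq_sum_pd {f : (Fin n → ℝ) → ℝ} (p v : Fin n → ℝ) :
    fderiv ℝ f p v = ∑ k, v k * pd k f p := by
  conv_lhs => rw [pi_eq_sum_univ' v]
  simp [pd, map_sum]

lemma pd_congr {f g : (Fin n → ℝ) → ℝ} {p : Fin n → ℝ} (h : f =ᶠ[𝓝 p] g) (k : Fin n) :
    pd k f p = pd k g p := by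
  unfold pd; rw [h.fderiv_eq]

lemma pd_add {f g : (Fin n → ℝ) → ℝ} {p : Fin n → ℝ} (hf : DifferentiableAt ℝ f p)
    (hg : DifferentiableAt ℝ g p) (k : Fin n) :
    pd k (fun x => f x + g x) p = pd k f p + pd k g p := by
  unfold pd; rw [fderiv_fun_add hf hg]; rfl

lemma pd_sub {f g : (Fin n → ℝ) → ℝ} {p : Fin n → ℝ} (hf : DifferentiableAt ℝ f p)
    (hg : DifferentiableAt ℝ g p) (k : Fin n) :
    pd k (fun x => f x - g x) p = pd k f p - pd k g p := by
  unfold pd; rw [fderiv_fun_sub hf hg]; rfl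

lemma pd_mul {f g : (Fin n → ℝ) → ℝ} {p : Fin n → ℝ} (hf : DifferentiableAt ℝ f p)
    (hg : DifferentiableAt ℝ g p) (k : Fin n) :
    pd k (fun x => f x * g x) p = pd k f p * g p + f p * pd k g p := by
  unfold pd; rw [fderiv_fun_mul hf hg]; simp; ring

lemma pd_const (c : ℝ) (p : Fin n → ℝ) (k : Fin n) : pd k (fun _ => c) p = 0 := by
  simp [pd]

lemma pd_const_mul {f : (Fin n → ℝ) → ℝ} {p : Fin n → ℝ} (hf : DifferentiableAt ℝ f p) (c : ℝ)
    (k : Fin n) : pd k (fun x => c * f x) p = c * pd k f p := by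
  unfold pd; rw [fderiv_const_mul hf]; simp

lemma pd_sum {ι : Type*} {s : Finset ι} {f : ι → (Fin n → ℝ) → ℝ} {p : Fin n → ℝ}
    (hf : ∀ i ∈ s, DifferentiableAt ℝ (f i) p) (k : Fin n) :
    pd k (fun x => ∑ i ∈ s, f i x) p = ∑ i ∈ s, pd k (f i) p := by
  unfold pd; rw [fderiv_fun_sum hf]; simp

lemma pd_proj (i k : Fin n) (p : Fin n → ℝ) :
    pd k (fun x => x i) p = if i = k then 1 else 0 := by
  unfold pd
  rw [show (fun x : Fin n → ℝ => x i) = ContinuousLinearMap.proj (R := ℝ) i from rfl,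
    ContinuousLinearMap.fderiv]
  simp [Pi.single_apply]

lemma pd_pow {f : (Fin n → ℝ) → ℝ} {p : Fin n → ℝ} (hf : DifferentiableAt ℝ f p) (m : ℕ)
    (k : Fin n) : pd k (fun x => f x ^ m) p = m * f p ^ (m - 1) * pd k f p := by
  unfold pd; rw [fderiv_fun_pow m hf]; simp

lemma pd_inv {f : (Fin n → ℝ) → ℝ} {p : Fin n → ℝ} (hf : DifferentiableAt ℝ f p) (h0 : f p ≠ 0)
    (k : Fin n) : pd k (fun x => (f x)⁻¹) p = - pd k f p / f p ^ 2 := by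
  unfold pd
  have h : HasFDerivAt (fun x => (f x)⁻¹) ((-(f p ^ 2)⁻¹) • fderiv ℝ f p) p :=
    (hasDerivAt_inv h0).comp_hasFDerivAt p hf.hasFDerivAt
  rw [h.fderiv]; simp; ring

lemma pd_comp {f : (Fin n → ℝ) → ℝ} {φ : (Fin n → ℝ) → (Fin n → ℝ)} {p : Fin n → ℝ}
    (hf : DifferentiableAt ℝ f (φ p)) (hφ : DifferentiableAt ℝ φ p) (k : Fin n) :
    pd k (fun x => f (φ x)) p = ∑ i, pd i f (φ p) * pd k (fun x => φ x i) p := by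
  have h1 : pd k (fun x => f (φ x)) p = fderiv ℝ f (φ p) (fderiv ℝ φ p (Pi.single k 1)) := by
    unfold pd
    rw [show (fun x => f (φ x)) = f ∘ φ from rfl, fderiv_comp p hf hφ]; rfl
  rw [h1, fderiv_apply_eq_sum_pd]
  refine Finset.sum_congr rfl fun i _ => ?_
  rw [mul_comm]
  congr 1
  unfold pd
  rw [fderiv_pi fun j => (differentiableAt_pi.1 hφ j)]; rfl

lemma contDiffAt_pd {f : (Fin n → ℝ) → ℝ} {p : Fin n → ℝ} {m m' : WithTop ℕ∞}
    (hf : ContDiffAt ℝ m f p) (h : m' + 1 ≤ m) (k : Fin n) : ContDiffAt ℝ m' (pd k f) p := by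
  unfold pd
  exact (hf.fderiv_right h).clm_apply contDiffAt_const

/-- Equality of mixed partial derivatives. -/
lemma pd_pd_comm {f : (Fin n → ℝ) → ℝ} {p : Fin n → ℝ} (hf : ContDiffAt ℝ 2 f p) (k l : Fin n) :
    pd k (pd l f) p = pd l (pd k f) p := by
  have hd : DifferentiableAt ℝ (fderiv ℝ f) p :=
    (hf.fderiv_right (m := 1) (by norm_num)).differentiableAt (by norm_num)
  have key : ∀ a b : Fin n, pd a (pd b f) p =
      fderiv ℝ (fderiv ℝ f) p (Pi.single a 1) (Pi.single b 1) := fun a b => by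
    unfold pd
    rw [fderiv_clm_apply hd (differentiableAt_const _)]
    simp
  rw [key, key]
  exact (hf.isSymmSndFDerivAt (by simp)).eq _ _

end ChartGeom

namespace Hyp3

lemma isOpen_halfSpace : IsOpen halfSpace :=
  isOpen_lt continuous_const (continuous_apply 2)

lemma contDiff_zco {m : WithTop ℕ∞} : ContDiff ℝ m zco := by
  have : zco = fun p : Fin 3 → ℝ => (p 0 : ℂ) + (p 1 : ℂ) * Complex.I := by
    funext p
    apply Complex.ext <;> simp [zco]
  rw [this]
  have h : ∀ i : Fin 3, ContDiff ℝ m (fun p : Fin 3 → ℝ => (p i : ℂ)) := fun i =>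
    Complex.ofRealCLM.contDiff.comp (contDiff_apply ℝ ℝ i)
  exact (h 0).add ((h 1).mul contDiff_const)

lemma contDiff_den (γ : SL2C) {m : WithTop ℕ∞} : ContDiff ℝ m (den γ) := by
  unfold den
  refine ContDiff.add (ContDiff.norm_sq ℝ ?_) (contDiff_const.mul ((contDiff_apply ℝ ℝ 2).pow 2))
  exact (contDiff_const.mul contDiff_zco).add contDiff_const

lemma contDiffAt_act (γ : SL2C) {m : WithTop ℕ∞} {p : Fin 3 → ℝ} (hp : p ∈ halfSpace) :
    ContDiffAt ℝ m (act γ) p := by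
  have hN : den γ p ≠ 0 := (den_pos γ hp).ne'
  have hN' : (den γ p : ℂ) ≠ 0 := by exact_mod_cast hN
  have h2 : ContDiffAt ℝ m (fun p => act γ p 2) p := by
    simp only [act_two]
    exact (contDiff_apply ℝ ℝ 2).contDiffAt.div (contDiff_den γ).contDiffAt hN
  have hd : ContDiffAt ℝ m (fun p => (den γ p : ℂ)) p :=
    (Complex.ofRealCLM.contDiff.comp (contDiff_den γ)).contDiffAt
  have ht : ContDiffAt ℝ m (fun p : Fin 3 → ℝ => (p 2 : ℂ)) p :=
    (Complex.ofRealCLM.contDiff.comp (contDiff_apply ℝ ℝ 2)).contDiffAt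
  have hz : ContDiffAt ℝ m (fun p => zco (act γ p)) p := by
    simp only [zco_act, div_eq_mul_inv]
    refine ContDiffAt.mul (ContDiffAt.add (ContDiffAt.mul ?_ ?_) ?_) (hd.inv hN')
    · exact ((contDiff_const.mul contDiff_zco).add contDiff_const).contDiffAt
    · exact (Complex.conjCLE.contDiff.comp
        ((contDiff_const.mul contDiff_zco).add contDiff_const)).contDiffAt
    · exact contDiffAt_const.mul (ht.pow 2)
  rw [contDiffAt_pi]
  intro i
  fin_cases i
  · exact (Complex.reCLM.contDiff.contDiffAt).comp p hz
  · exact (Complex.imCLM.contDiff.contDiffAt).comp p hz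
  · exact h2

/-- The Jacobian matrix `∂_a φ^i` of a map. -/
noncomputable def jac (φ : (Fin 3 → ℝ) → (Fin 3 → ℝ)) (p : Fin 3 → ℝ) (i a : Fin 3) : ℝ :=
  pd a (fun x => φ x i) p

lemma differentiableAt_act (γ : SL2C) {p : Fin 3 → ℝ} (hp : p ∈ halfSpace) :
    DifferentiableAt ℝ (act γ) p :=
  (contDiffAt_act γ (m := 1) hp).differentiableAt (by norm_num)

/-- The conformal factor of the action. -/
noncomputable def conf (γ : SL2C) (p : Fin 3 → ℝ) : ℝ := act γ p 2 / p 2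

lemma conf_pos (γ : SL2C) {p : Fin 3 → ℝ} (hp : p ∈ halfSpace) : 0 < conf γ p :=
  div_pos (act_mem γ hp) hp

/-- The derivative of the action multiplies Euclidean lengths by the ratio of the heights. This is
the infinitesimal form of `eDist_act`: the invariance of `|p - q|² / (p₂ q₂)` for `q = p + s v`,
divided by `s²`, in the limit `s → 0`. -/
lemma sum_fderiv_act_sq (γ : SL2C) {p : Fin 3 → ℝ} (hp : p ∈ halfSpace) (v : Fin 3 → ℝ) :
    ∑ i, (∑ a, v a * jac (act γ) p i a) ^ 2 = conf γ p ^ 2 * ∑ i, v i ^ 2 := by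
  have hd := differentiableAt_act γ hp
  have hline : HasDerivAt (fun s : ℝ => p + s • v) v 0 := by
    simpa using ((hasDerivAt_id (0 : ℝ)).smul_const v).const_add p
  have hpl : p + (0 : ℝ) • v = p := by simp
  have hder : ∀ i, HasDerivAt (fun s : ℝ => act γ (p + s • v) i) (∑ a, v a * jac (act γ) p i a) 0 := by
    intro i
    have hdi : DifferentiableAt ℝ (fun x => act γ x i) (p + (0 : ℝ) • v) := by
      rw [hpl]; exact differentiableAt_pi.1 hd i
    have := hdi.hasFDerivAt.comp_hasDerivAt 0 hline
    rw [hpl, fderiv_apply_eq_sum_pd] at this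
    exact this
  have hlim : Tendsto (fun s : ℝ => ∑ i, (s⁻¹ * (act γ (p + s • v) i - act γ p i)) ^ 2) (𝓝[≠] 0)
      (𝓝 (∑ i, (∑ a, v a * jac (act γ) p i a) ^ 2)) := by
    refine tendsto_finsetSum _ fun i _ => Tendsto.pow ?_ 2
    have := (hasDerivAt_iff_tendsto_slope_zero.1 (hder i))
    simpa using this
  have hcont : ContinuousAt (fun s : ℝ => p + s • v) 0 := hline.continuousAt
  have hact2 : Tendsto (fun s : ℝ => act γ (p + s • v) 2) (𝓝[≠] 0) (𝓝 (act γ p 2)) := by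
    have := (hder 2).continuousAt.tendsto
    simp only [zero_smul, add_zero] at this
    exact this.mono_left nhdsWithin_le_nhds
  have hp2 : Tendsto (fun s : ℝ => (p + s • v) 2) (𝓝[≠] 0) (𝓝 (p 2)) := by
    have := ((continuous_apply (2 : Fin 3)).continuousAt.comp hcont).tendsto
    simp only [Function.comp_def, zero_smul, add_zero] at this
    exact this.mono_left nhdsWithin_le_nhds
  have ht : p 2 ≠ 0 := (show 0 < p 2 from hp).ne'
  -- by the invariance, the difference quotients are `|v|²` times a ratio of heights that
  -- converges
  have hlim2 : Tendsto (fun s : ℝ => (∑ i, v i ^ 2) *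
      (act γ (p + s • v) 2 * act γ p 2 / ((p + s • v) 2 * p 2))) (𝓝[≠] 0)
      (𝓝 ((∑ i, v i ^ 2) * (act γ p 2 * act γ p 2 / (p 2 * p 2)))) :=
    ((hact2.mul_const _).div (hp2.mul_const _) (mul_ne_zero ht ht)).const_mul _
  have hev : (fun s : ℝ => ∑ i, (s⁻¹ * (act γ (p + s • v) i - act γ p i)) ^ 2) =ᶠ[𝓝[≠] 0]
      (fun s : ℝ => (∑ i, v i ^ 2) *
      (act γ (p + s • v) 2 * act γ p 2 / ((p + s • v) 2 * p 2))) := by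
    have hmem : ∀ᶠ s : ℝ in 𝓝[≠] 0, p + s • v ∈ halfSpace := by
      refine (hcont.eventually ?_).filter_mono nhdsWithin_le_nhds
      show ∀ᶠ y in 𝓝 (p + (0 : ℝ) • v), y ∈ halfSpace
      rw [hpl]
      exact isOpen_halfSpace.mem_nhds hp
    filter_upwards [hmem, self_mem_nhdsWithin] with s hs hs0
    have hs0 : s ≠ 0 := hs0
    have h := eDist_act γ hs hp
    have a1 : act γ (p + s • v) 2 ≠ 0 := ne_of_gt (act_mem γ hs)
    have a2 : act γ p 2 ≠ 0 := ne_of_gt (act_mem γ hp)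
    have a3 : (p + s • v) 2 ≠ 0 := ne_of_gt hs
    have hE : eDist (act γ (p + s • v)) (act γ p) =
        eDist (p + s • v) p * (act γ (p + s • v) 2 * act γ p 2 / ((p + s • v) 2 * p 2)) := by
      rw [div_eq_iff (mul_ne_zero a1 a2)] at h
      rw [h]; field_simp
    have h2 : eDist (p + s • v) p = s ^ 2 * ∑ i, v i ^ 2 := by
      simp [eDist, Finset.mul_sum, mul_pow]
    have h3 : ∑ i, (s⁻¹ * (act γ (p + s • v) i - act γ p i)) ^ 2 =
        s⁻¹ ^ 2 * eDist (act γ (p + s • v)) (act γ p) := by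
      simp [eDist, Finset.mul_sum, mul_pow]
    rw [h3, hE, h2]
    field_simp
  have := tendsto_nhds_unique (hlim.congr' hev) hlim2
  rw [this, conf]; field_simp

/-- The action is conformal: `Jᵀ J = λ² 1`. -/
lemma jac_transpose_mul (γ : SL2C) {p : Fin 3 → ℝ} (hp : p ∈ halfSpace) (a b : Fin 3) :
    ∑ i, jac (act γ) p i a * jac (act γ) p i b = if a = b then conf γ p ^ 2 else 0 := by
  have h1 := fun c => sum_fderiv_act_sq γ hp (Pi.single c 1)
  have h2 := sum_fderiv_act_sq γ hp (Pi.single a 1 + Pi.single b 1)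
  simp only [Pi.add_apply, add_mul, Finset.sum_add_distrib, Pi.single_apply, ite_mul, one_mul,
    zero_mul, Finset.sum_ite_eq', Finset.mem_univ, if_true, ite_pow, one_pow] at h1 h2
  have ha := h1 a
  have hb := h1 b
  simp only [add_sq, Finset.sum_add_distrib, mul_assoc, ← Finset.mul_sum, ha, hb, ite_pow, one_pow] at h2
  split_ifs with hab
  · subst hab
    simpa [sq] using ha
  · have : ∑ x, (if x = a then (1 : ℝ) else 0) * (if x = b then 1 else 0) = 0 := by
      simp [Ne.symm hab]
    rw [this] at h2
    simp at h2
    linarith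

/-- `J Jᵀ = λ² 1`, as a left inverse of a square matrix is a right inverse. -/
lemma jac_mul_transpose (γ : SL2C) {p : Fin 3 → ℝ} (hp : p ∈ halfSpace) (i j : Fin 3) :
    ∑ a, jac (act γ) p i a * jac (act γ) p j a = if i = j then conf γ p ^ 2 else 0 := by
  have hc := (conf_pos γ hp).ne'
  set A : Matrix (Fin 3) (Fin 3) ℝ := Matrix.of (jac (act γ) p) with hA
  have h1 : ((conf γ p ^ 2)⁻¹ • Aᵀ) * A = 1 := by
    ext a b
    rw [Matrix.smul_mul]
    simp only [Matrix.smul_apply, Matrix.mul_apply, Matrix.transpose_apply, hA,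
      Matrix.of_apply, jac_transpose_mul γ hp, Matrix.one_apply]
    split_ifs <;> simp [hc]
  have h1' : A * ((conf γ p ^ 2)⁻¹ • Aᵀ) = 1 := mul_eq_one_comm.1 h1
  have h2 := congrFun (congrFun h1' i) j
  simp only [Matrix.smul_apply, Matrix.mul_apply, Matrix.transpose_apply, hA,
      Matrix.of_apply, Matrix.one_apply, smul_eq_mul, mul_left_comm _ (conf γ p ^ 2)⁻¹,
      ← Finset.mul_sum] at h2
  rw [inv_mul_eq_iff_eq_mul₀ (pow_ne_zero 2 hc)] at h2
  rw [h2]; split_ifs <;> simp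

/-- The change of volume, from `det (Jᵀ J) = λ⁶`. -/
lemma abs_det_fderiv_act (γ : SL2C) {p : Fin 3 → ℝ} (hp : p ∈ halfSpace) :
    |(fderiv ℝ (act γ) p).det| = conf γ p ^ 3 := by
  have hc := conf_pos γ hp
  set A : Matrix (Fin 3) (Fin 3) ℝ := Matrix.of (jac (act γ) p) with hA
  have h0 : (fderiv ℝ (act γ) p : (Fin 3 → ℝ) →ₗ[ℝ] (Fin 3 → ℝ)) = Matrix.toLin' A := by
    refine LinearMap.pi_ext' fun a => LinearMap.ext_ring ?_
    ext i
    simp only [LinearMap.comp_apply, LinearMap.coe_single, ContinuousLinearMap.coe_coe,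
      Matrix.toLin'_apply, Matrix.mulVec_single_one, hA, Matrix.col_apply, Matrix.of_apply, jac, pd]
    rw [fderiv_pi fun j => (differentiableAt_pi.1 (differentiableAt_act γ hp) j)]; rfl
  have h1 : (fderiv ℝ (act γ) p).det = A.det := by
    rw [ContinuousLinearMap.det, h0, LinearMap.det_toLin']
  have h2 : Aᵀ * A = (conf γ p ^ 2) • (1 : Matrix (Fin 3) (Fin 3) ℝ) := by
    ext a b
    simp only [Matrix.mul_apply, Matrix.transpose_apply, hA,
      Matrix.of_apply, jac_transpose_mul γ hp, Matrix.smul_apply, Matrix.one_apply]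
    split_ifs <;> simp
  have h3 := congrArg Matrix.det h2
  rw [Matrix.det_mul, Matrix.det_transpose, Matrix.det_smul, Matrix.det_one] at h3
  simp at h3
  rw [h1, ← Real.sqrt_sq_eq_abs, sq, h3, show (conf γ p ^ 2) ^ 3 = (conf γ p ^ 3) ^ 2 by ring,
    Real.sqrt_sq (by positivity)]

end Hyp3

/-! ### Curvature of the hyperbolic metric -/

namespace Hyp3

lemma metric_eq_diagonal (p : Fin 3 → ℝ) :
    Matrix.of (metric p) = Matrix.diagonal fun _ => 1 / p 2 ^ 2 := by
  ext i j; simp [metric, Matrix.diagonal_apply]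

lemma inv_metric {p : Fin 3 → ℝ} (hp : p ∈ halfSpace) (i j : Fin 3) :
    ChartGeom.inv metric p i j = if i = j then p 2 ^ 2 else 0 := by
  have ht : p 2 ≠ 0 := ne_of_gt hp
  have : (Matrix.of (metric p))⁻¹ = Matrix.diagonal fun _ => p 2 ^ 2 := by
    refine Matrix.inv_eq_left_inv ?_
    rw [metric_eq_diagonal, Matrix.diagonal_mul_diagonal]
    ext i j
    simp [Matrix.diagonal_apply, Matrix.one_apply, ht]
  rw [ChartGeom.inv, this, Matrix.diagonal_apply]

/-- The integers `chr k i j` with `Γᵏᵢⱼ = - chr k i j / t`. -/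
def chr (k i j : Fin 3) : ℤ :=
  (if k = i ∧ j = 2 then 1 else 0) + (if k = j ∧ i = 2 then 1 else 0)
    - (if k = 2 ∧ i = j then 1 else 0)

lemma pd_inv_height {p : Fin 3 → ℝ} (hp : p ∈ halfSpace) (k : Fin 3) :
    pd k (fun x => (x 2)⁻¹) p = if k = 2 then - 1 / p 2 ^ 2 else 0 := by
  have h := pd_inv (f := fun x : Fin 3 → ℝ => x 2) (p := p) (by fun_prop) (ne_of_gt hp) k
  rw [h, pd_proj, if_congr eq_comm rfl rfl]
  split_ifs <;> simp

lemma pd_metric {p : Fin 3 → ℝ} (hp : p ∈ halfSpace) (i j k : Fin 3) :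
    pd k (fun x => metric x i j) p = if i = j ∧ k = 2 then -2 / p 2 ^ 3 else 0 := by
  have ht : p 2 ≠ 0 := ne_of_gt hp
  by_cases hij : i = j
  · have : (fun x => metric x i j) = fun x : Fin 3 → ℝ => ((x 2)⁻¹) ^ 2 := by
      funext x; simp [metric, hij]
    rw [this, pd_pow (f := fun x : Fin 3 → ℝ => (x 2)⁻¹) (by fun_prop (disch := exact ht)),
      pd_inv_height hp]
    by_cases hk : k = 2
    · simp [hij, hk]; field_simp
    · simp [hk]
  · have : (fun x => metric x i j) = fun _ : Fin 3 → ℝ => (0 : ℝ) := by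
      funext x; simp [metric, hij]
    rw [this, pd_const]; simp [hij]

lemma christoffel_metric {p : Fin 3 → ℝ} (hp : p ∈ halfSpace) (k i j : Fin 3) :
    christoffel metric k i j p = -(chr k i j : ℝ) * (p 2)⁻¹ := by
  have ht : p 2 ≠ 0 := ne_of_gt hp
  unfold christoffel
  simp only [inv_metric hp, pd_metric hp, ite_mul, zero_mul, Finset.sum_ite_eq, Finset.mem_univ,
    if_true]
  have : ∀ c1 c2 c3 : Prop, [Decidable c1] → [Decidable c2] → [Decidable c3] →
      1 / 2 * (p 2 ^ 2 * ((if c1 then -2 / p 2 ^ 3 else 0) + (if c2 then -2 / p 2 ^ 3 else 0)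
        - (if c3 then -2 / p 2 ^ 3 else 0)))
      = -(((if c1 then 1 else 0) + (if c2 then 1 else 0) - (if c3 then 1 else 0) : ℤ) : ℝ) *
        (p 2)⁻¹ := by
    intro c1 c2 c3 _ _ _
    split_ifs <;> push_cast <;> field_simp <;> ring
  rw [this]
  congr 3
  revert i j k; decide

/-- The hyperbolic metric has constant curvature `-1`. -/
lemma riem_metric {p : Fin 3 → ℝ} (hp : p ∈ halfSpace) (i j k l : Fin 3) :
    riem metric p i j k l = (((if i = k ∧ j = l then 1 else 0) - (if i = l ∧ j = k then 1 else 0) : ℤ) : ℝ)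
      * (p 2 ^ 4)⁻¹ := by
  have ht : p 2 ≠ 0 := ne_of_gt hp
  have hpd : ∀ (a m b c : Fin 3), pd a (christoffel metric m b c) p =
      ((if a = 2 then chr m b c else 0 : ℤ) : ℝ) * (p 2 ^ 2)⁻¹ := by
    intro a m b c
    have : christoffel metric m b c =ᶠ[𝓝 p] fun x => -(chr m b c : ℝ) * (x 2)⁻¹ := by
      filter_upwards [isOpen_halfSpace.mem_nhds hp] with x hx
      exact christoffel_metric hx _ _ _
    rw [pd_congr this, pd_const_mul (f := fun x : Fin 3 → ℝ => (x 2)⁻¹)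
      (by fun_prop (disch := exact ht)), pd_inv_height hp]
    split_ifs <;> push_cast <;> ring
  have hup : ∀ m, riemUp metric p i j k m = (((if i = 2 then chr m j k else 0)
      - (if j = 2 then chr m i k else 0) + ∑ a, chr m i a * chr a j k
      - ∑ a, chr m j a * chr a i k : ℤ) : ℝ) * (p 2 ^ 2)⁻¹ := by
    intro m
    unfold riemUp
    simp only [hpd, christoffel_metric hp]
    push_cast
    simp only [sub_mul, add_mul, Finset.sum_mul]
    congr 1
    · congr 1
      refine Finset.sum_congr rfl fun a _ => ?_
      ring
    · refine Finset.sum_congr rfl fun a _ => ?_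
      ring
  have hdec : ∀ i j k l : Fin 3, (if i = 2 then chr l j k else 0)
      - (if j = 2 then chr l i k else 0) + ∑ a, chr l i a * chr a j k
      - ∑ a, chr l j a * chr a i k =
      (if i = k ∧ j = l then 1 else 0) - (if i = l ∧ j = k then 1 else 0) := by decide
  unfold riem
  simp only [metric, mul_ite, mul_zero, Finset.sum_ite_eq', Finset.mem_univ, if_true, hup, hdec]
  rw [mul_assoc]
  congr 1
  field_simp

lemma ricci_metric {p : Fin 3 → ℝ} (hp : p ∈ halfSpace) (i j : Fin 3) :
    ricci metric p i j = if i = j then -2 / p 2 ^ 2 else 0 := by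
  have ht : p 2 ≠ 0 := ne_of_gt hp
  unfold ricci
  simp only [inv_metric hp, riem_metric hp, ite_mul, zero_mul, Finset.sum_ite_eq, Finset.mem_univ,
    if_true, Fin.sum_univ_three]
  fin_cases i <;> fin_cases j <;> simp <;> field_simp <;> norm_num

/-- The hyperbolic metric has constant curvature, so the curvature terms are algebraic. -/
lemma opA_metric {l : Tensor2 3} {p : Fin 3 → ℝ} (hp : p ∈ halfSpace)
    (hs : ∀ i j, l p i j = l p j i) (i j : Fin 3) :
    opA metric l p i j = roughLaplacian metric l p i j + 2 * l p i j
      - if i = j then 2 * ∑ k, l p k k else 0 := by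
  have ht : p 2 ≠ 0 := ne_of_gt hp
  unfold opA lichnerowicz
  simp only [inv_metric hp, ricci_metric hp, riem_metric hp, ite_mul, zero_mul, mul_ite, mul_zero,
    Finset.sum_ite_eq, Finset.sum_ite_eq', Finset.mem_univ, if_true, Fin.sum_univ_three]
  have h10 := hs 1 0
  have h20 := hs 2 0
  have h21 := hs 2 1
  fin_cases i <;> fin_cases j <;> simp [h10, h20, h21] <;> field_simp <;> ring

lemma normSq2_metric {l : Tensor2 3} {p : Fin 3 → ℝ} (hp : p ∈ halfSpace) :
    normSq2 metric l p = ∑ i, ∑ j, (p 2 ^ 2 * l p i j) ^ 2 := by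
  unfold normSq2
  simp only [inv_metric hp, ite_mul, zero_mul, mul_ite, mul_zero,
    Finset.sum_ite_eq, Finset.mem_univ, if_true]
  refine Finset.sum_congr rfl fun i _ => Finset.sum_congr rfl fun j _ => ?_
  ring

lemma normSq3_metric_nonneg {T : Tensor3 3} {p : Fin 3 → ℝ} (hp : p ∈ halfSpace) :
    0 ≤ normSq3 metric T p := by
  have : normSq3 metric T p = ∑ k, ∑ i, ∑ j, (p 2 ^ 3 * T p k i j) ^ 2 := by
    unfold normSq3
    simp only [inv_metric hp, ite_mul, zero_mul, mul_ite, mul_zero,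
      Finset.sum_ite_eq, Finset.mem_univ, if_true]
    refine Finset.sum_congr rfl fun k _ => Finset.sum_congr rfl fun i _ =>
      Finset.sum_congr rfl fun j _ => ?_
    ring
  rw [this]; positivity

end Hyp3

/-! ### Naturality of the equation under isometries -/

namespace Hyp3

/-- The pull-back of a covariant `2`-tensor field under a map. -/
noncomputable def pull (φ : (Fin 3 → ℝ) → (Fin 3 → ℝ)) (l : Tensor2 3) : Tensor2 3 := fun p a b =>
  ∑ i, ∑ j, l (φ p) i j * jac φ p i a * jac φ p j b

lemma contDiffAt_jac (γ : SL2C) {m : WithTop ℕ∞} {p : Fin 3 → ℝ} (hp : p ∈ halfSpace)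
    (i a : Fin 3) : ContDiffAt ℝ m (fun x => jac (act γ) x i a) p := by
  by_cases hm : m = ⊤
  · subst hm
    have h := contDiffAt_pi.1 (contDiffAt_act γ (m := ⊤) hp) i
    exact contDiffAt_pd h (by simp) a
  · have h := contDiffAt_pi.1 (contDiffAt_act γ (m := ⊤) hp) i
    exact (contDiffAt_pd h (m' := ⊤) (by simp) a).of_le le_top

lemma differentiableAt_jac (γ : SL2C) {p : Fin 3 → ℝ} (hp : p ∈ halfSpace)
    (i a : Fin 3) : DifferentiableAt ℝ (fun x => jac (act γ) x i a) p :=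
  (contDiffAt_jac γ (m := 1) hp i a).differentiableAt (by norm_num)

lemma pd_conf (γ : SL2C) {p : Fin 3 → ℝ} (hp : p ∈ halfSpace) (c : Fin 3) :
    pd c (conf γ) p = conf γ p * (jac (act γ) p 2 c / act γ p 2 - (if c = 2 then 1 else 0) / p 2) := by
  have ht : p 2 ≠ 0 := ne_of_gt hp
  have ht' : act γ p 2 ≠ 0 := ne_of_gt (act_mem γ hp)
  have : conf γ = fun x => act γ x 2 * (x 2)⁻¹ := by
    funext x; simp [conf, div_eq_mul_inv]
  rw [this, pd_mul (differentiableAt_pi.1 (differentiableAt_act γ hp) 2)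
    (by fun_prop (disch := exact ht)), pd_inv_height hp]
  change jac (act γ) p 2 c * _ + _ = _
  split_ifs <;> field_simp <;> ring

/-- The second derivatives of an isometry are given by its first derivatives: the transformation
law of the Christoffel symbols. It comes from differentiating `Jᵀ J = λ² 1`, by the permutation of
indices that determines the Levi-Civita connection from its metric. -/
lemma pd_jac (γ : SL2C) {p : Fin 3 → ℝ} (hp : p ∈ halfSpace) (i a b : Fin 3) :
    pd b (fun x => jac (act γ) x i a) p = ∑ c, christoffel metric c b a p * jac (act γ) p i c
      - ∑ n, ∑ m, christoffel metric i n m (act γ p) * jac (act γ) p n b * jac (act γ) p m a := by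
  have ht : p 2 ≠ 0 := ne_of_gt hp
  have ht' : act γ p 2 ≠ 0 := ne_of_gt (act_mem γ hp)
  have hl := (conf_pos γ hp).ne'
  set J := jac (act γ) p with hJ
  set K : Fin 3 → Fin 3 → Fin 3 → ℝ := fun i a b => pd b (fun x => jac (act γ) x i a) p with hK
  have hKsymm : ∀ i a b, K i a b = K i b a := fun i a b =>
    pd_pd_comm (contDiffAt_pi.1 (contDiffAt_act γ (m := 2) hp) i) b a
  -- the derivative of `Jᵀ J = λ² 1` in the direction `c`
  have hE : ∀ a b c, ∑ i, (K i a c * J i b + J i a * K i b c) = if a = b then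
      2 * conf γ p ^ 2 * (J 2 c / act γ p 2 - (if c = 2 then 1 else 0) / p 2) else 0 := by
    intro a b c
    have h1 : (fun x => ∑ i, jac (act γ) x i a * jac (act γ) x i b) =ᶠ[𝓝 p]
        fun x => (if a = b then 1 else 0) * conf γ x ^ 2 := by
      filter_upwards [isOpen_halfSpace.mem_nhds hp] with x hx
      rw [jac_transpose_mul γ hx]; split_ifs <;> simp
    have hdc : DifferentiableAt ℝ (conf γ) p := by
      have := differentiableAt_pi.1 (differentiableAt_act γ hp) 2
      have hcf : conf γ = fun x => act γ x 2 * (x 2)⁻¹ := by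
        funext x; simp [conf, div_eq_mul_inv]
      rw [hcf]
      exact this.fun_mul (by fun_prop (disch := exact ht))
    have h2 := pd_congr h1 c
    rw [pd_sum (fun i _ => (differentiableAt_jac γ hp i a).fun_mul (differentiableAt_jac γ hp i b)),
      pd_const_mul (hdc.fun_pow 2), pd_pow hdc, pd_conf γ hp] at h2
    have h3 : ∀ i, pd c (fun x => jac (act γ) x i a * jac (act γ) x i b) p =
        K i a c * J i b + J i a * K i b c := fun i =>
      pd_mul (differentiableAt_jac γ hp i a) (differentiableAt_jac γ hp i b) c
    simp only [h3] at h2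
    rw [h2]
    split_ifs <;> simp <;> ring
  -- the Koszul permutation: `K` is symmetric in its last two indices, as second derivatives are
  have hS : ∀ a b c, ∑ i, K i a b * J i c = conf γ p ^ 2 *
      ((if a = c then (J 2 b / act γ p 2 - (if b = 2 then 1 else 0) / p 2) else 0)
      + (if b = c then (J 2 a / act γ p 2 - (if a = 2 then 1 else 0) / p 2) else 0)
      - (if a = b then (J 2 c / act γ p 2 - (if c = 2 then 1 else 0) / p 2) else 0)) := by
    set S : Fin 3 → Fin 3 → Fin 3 → ℝ := fun a b c => ∑ i, K i a b * J i c with hSdef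
    have hSs : ∀ a b c, S a b c = S b a c := fun a b c => by simp only [hSdef, hKsymm _ a b]
    have hES : ∀ a b c, S a c b + S b c a = if a = b then
        2 * conf γ p ^ 2 * (J 2 c / act γ p 2 - (if c = 2 then 1 else 0) / p 2) else 0 := by
      intro a b c
      rw [← hE a b c, Finset.sum_add_distrib]
      simp only [hSdef, mul_comm (K _ b c)]
    intro a b c
    change S a b c = _
    have e1 := hES a c b
    have e2 := hES b c a
    have e3 := hES a b c
    rw [hSs b a c] at e2
    rw [hSs c b a] at e1
    rw [hSs c a b] at e2
    split_ifs at e1 e2 e3 ⊢ <;> linarith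
  -- the sums in `hS` determine `K`, because `J Jᵀ = λ² 1`
  have hKi : conf γ p ^ 2 * K i a b = ∑ c, (∑ i', K i' a b * J i' c) * J i c := by
    calc conf γ p ^ 2 * K i a b = ∑ i', K i' a b * (if i' = i then conf γ p ^ 2 else 0) := by
          simp [mul_comm]
      _ = ∑ i', K i' a b * ∑ c, J i' c * J i c := by
          simp only [hJ, jac_mul_transpose γ hp]
      _ = _ := by
          simp only [Finset.mul_sum, Finset.sum_mul]
          rw [Finset.sum_comm]
          simp only [mul_assoc]
  have hJJ : ∑ c, J 2 c * J i c = if i = 2 then conf γ p ^ 2 else 0 := by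
    rw [hJ, jac_mul_transpose γ hp]; simp only [eq_comm]
  have hJJ2 : ∑ c, J c b * J c a = if b = a then conf γ p ^ 2 else 0 := by
    rw [hJ, jac_transpose_mul γ hp]
  simp only [hS] at hKi
  -- the second derivatives of the action in terms of its first derivatives
  have hK2 : K i a b = J 2 b / act γ p 2 * J i a - (if b = 2 then 1 else 0) / p 2 * J i a
      + (J 2 a / act γ p 2 * J i b - (if a = 2 then 1 else 0) / p 2 * J i b)
      - (if a = b then ((∑ c, J 2 c * J i c) / act γ p 2 - J i 2 / p 2) else 0) := by
    have : conf γ p ^ 2 * K i a b = conf γ p ^ 2 *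
      (J 2 b / act γ p 2 * J i a - (if b = 2 then 1 else 0) / p 2 * J i a
      + (J 2 a / act γ p 2 * J i b - (if a = 2 then 1 else 0) / p 2 * J i b)
      - (if a = b then ((∑ c, J 2 c * J i c) / act γ p 2 - J i 2 / p 2) else 0)) := by
      rw [hKi]
      simp only [mul_assoc, ← Finset.mul_sum, sub_mul, add_mul, Finset.sum_sub_distrib,
        Finset.sum_add_distrib, ite_mul, zero_mul, Finset.sum_ite_eq, Finset.mem_univ, if_true,
        Finset.sum_div]
      congr 1
      by_cases hab : a = b
      · simp only [if_pos hab, Finset.sum_sub_distrib]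
        congr 2
        · refine Finset.sum_congr rfl fun c _ => by ring
        · rw [Finset.sum_eq_single 2] <;> simp +contextual
          ring
      · simp only [if_neg hab, Finset.sum_const_zero]
    exact mul_left_cancel₀ (pow_ne_zero 2 hl) this
  change K i a b = _
  rw [hK2, hJJ]
  simp only [christoffel_metric hp, christoffel_metric (act_mem γ hp)]
  -- the Christoffel symbols in terms of Kronecker symbols, which can be contracted with `J`
  have hchr : ∀ k i j, (chr k i j : ℝ) = (if k = i then 1 else 0) * (if j = 2 then 1 else 0)
      + (if k = j then 1 else 0) * (if i = 2 then 1 else 0)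
      - (if k = 2 then 1 else 0) * (if i = j then 1 else 0) := by
    intro k i j; unfold chr; push_cast; simp only [ite_and]; congr 1 <;> [congr 1; skip] <;>
      split_ifs <;> simp
  have g1 : ∑ c, -(chr c b a : ℝ) * (p 2)⁻¹ * J i c = - (p 2)⁻¹ *
      ((if a = 2 then 1 else 0) * J i b + (if b = 2 then 1 else 0) * J i a
        - (if b = a then 1 else 0) * J i 2) := by
    simp only [hchr, Fin.sum_univ_three]
    fin_cases a <;> fin_cases b <;> simp
  have g2 : ∑ n, ∑ m, -(chr i n m : ℝ) * (act γ p 2)⁻¹ * J n b * J m a = - (act γ p 2)⁻¹ *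
      (J i b * J 2 a + J 2 b * J i a - (if i = 2 then 1 else 0) * ∑ c, J c b * J c a) := by
    simp only [hchr, Fin.sum_univ_three]
    fin_cases i <;> simp <;> ring
  rw [g1, g2, hJJ2]
  simp only [eq_comm (a := b) (b := a)]
  split_ifs <;> field_simp <;> ring

lemma differentiableAt_pull (γ : SL2C) {l : Tensor2 3} {p : Fin 3 → ℝ} (hp : p ∈ halfSpace)
    (hl : ∀ i j, DifferentiableAt ℝ (fun x => l x i j) (act γ p)) (a b : Fin 3) :
    DifferentiableAt ℝ (fun x => pull (act γ) l x a b) p := by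
  unfold pull
  have h1 : ∀ i j, DifferentiableAt ℝ (fun x => l (act γ x) i j) p := fun i j =>
    (hl i j).comp p (differentiableAt_act γ hp)
  have h2 := differentiableAt_jac γ hp
  exact DifferentiableAt.fun_sum fun i _ => DifferentiableAt.fun_sum fun j _ =>
    ((h1 i j).fun_mul (h2 i a)).fun_mul (h2 j b)

/-- Naturality of the covariant derivative of a `2`-tensor field under isometries. -/
lemma cov2_pull (γ : SL2C) {l : Tensor2 3} {p : Fin 3 → ℝ} (hp : p ∈ halfSpace)
    (hl : ∀ i j, DifferentiableAt ℝ (fun x => l x i j) (act γ p)) (k a b : Fin 3) :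
    cov2 metric (pull (act γ) l) p k a b = ∑ n, jac (act γ) p n k *
      pull (act γ) (fun x i j => cov2 metric l x n i j) p a b := by
  have h1 : ∀ i j, DifferentiableAt ℝ (fun x => l (act γ x) i j) p := fun i j =>
    (hl i j).comp p (differentiableAt_act γ hp)
  have h2 := differentiableAt_jac γ hp
  have hpd : pd k (fun x => pull (act γ) l x a b) p = ∑ i, ∑ j,
      ((∑ n, pd n (fun x => l x i j) (act γ p) * jac (act γ) p n k) * jac (act γ) p i a *
        jac (act γ) p j b + l (act γ p) i j * pd k (fun x => jac (act γ) x i a) p * jac (act γ) p j b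
        + l (act γ p) i j * jac (act γ) p i a * pd k (fun x => jac (act γ) x j b) p) := by
    unfold pull
    rw [pd_sum (fun i _ => DifferentiableAt.fun_sum fun j _ =>
      ((h1 i j).fun_mul (h2 i a)).fun_mul (h2 j b))]
    refine Finset.sum_congr rfl fun i _ => ?_
    rw [pd_sum (fun j _ => ((h1 i j).fun_mul (h2 i a)).fun_mul (h2 j b))]
    refine Finset.sum_congr rfl fun j _ => ?_
    rw [pd_mul ((h1 i j).fun_mul (h2 i a)) (h2 j b), pd_mul (h1 i j) (h2 i a),
      pd_comp (hl i j) (differentiableAt_act γ hp)]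
    simp only [jac]
    ring
  unfold cov2
  rw [hpd]
  simp only [pd_jac γ hp]
  simp only [pull]
  generalize jac (act γ) p = J
  generalize l (act γ p) = L
  simp only [Fin.sum_univ_three]
  ring

/-- The second covariant derivative treats the first index of `∇ l` as a parameter, up to one
Christoffel term; this allows `cov2_pull` to be used twice. -/
lemma cov3_eq (T : Tensor3 3) (p : Fin 3 → ℝ) (m k i j : Fin 3) :
    cov3 metric T p m k i j = cov2 metric (fun x i j => T x k i j) p m i j
      - ∑ a, christoffel metric a m k p * T p a i j := by
  unfold cov3 cov2; ring

/-- Naturality of the connection Laplacian under isometries. -/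
lemma roughLaplacian_pull (γ : SL2C) {l : Tensor2 3} {p : Fin 3 → ℝ} (hp : p ∈ halfSpace)
    (hl : ∀ q ∈ halfSpace, ∀ i j, DifferentiableAt ℝ (fun x => l x i j) q)
    (hl2 : ∀ q ∈ halfSpace, ∀ n i j, DifferentiableAt ℝ (fun x => cov2 metric l x n i j) q)
    (a b : Fin 3) :
    roughLaplacian metric (pull (act γ) l) p a b =
      pull (act γ) (roughLaplacian metric l) p a b := by
  have ht : p 2 ≠ 0 := ne_of_gt hp
  have hp' := act_mem γ hp
  set L : Fin 3 → Tensor2 3 := fun n x i j => cov2 metric l x n i j with hL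
  have hcov : ∀ k i j, (fun x => cov2 metric (pull (act γ) l) x k i j) =ᶠ[𝓝 p]
      fun x => ∑ n, jac (act γ) x n k * pull (act γ) (L n) x i j := by
    intro k i j
    filter_upwards [isOpen_halfSpace.mem_nhds hp] with x hx
    exact cov2_pull γ hx (hl _ (act_mem γ hx)) k i j
  have hdp : ∀ n i j, DifferentiableAt ℝ (fun x => pull (act γ) (L n) x i j) p := fun n i j =>
    differentiableAt_pull γ hp (fun i j => hl2 _ hp' n i j) i j
  have hj := differentiableAt_jac γ hp
  -- second covariant derivatives are natural: the derivatives of the outer Jacobian cancel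
  -- against the Christoffel term of `cov3_eq`, by `pd_jac`
  have key : ∀ m, cov3 metric (cov2 metric (pull (act γ) l)) p m m a b =
      ∑ q, ∑ s, jac (act γ) p q m * jac (act γ) p s m *
        pull (act γ) (fun x i j => cov3 metric (cov2 metric l) x q s i j) p a b := by
    intro m
    have h1 : cov3 metric (cov2 metric (pull (act γ) l)) p m m a b =
        ∑ n, (pd m (fun x => jac (act γ) x n m) p * pull (act γ) (L n) p a b +
          jac (act γ) p n m * cov2 metric (pull (act γ) (L n)) p m a b)
        - ∑ c, christoffel metric c m m p * ∑ n, jac (act γ) p n c * pull (act γ) (L n) p a b := by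
      rw [cov3_eq]
      congr 1
      · unfold cov2
        change pd m (fun x => cov2 metric (pull (act γ) l) x m a b) p -
          ∑ c, _ * cov2 metric (pull (act γ) l) p m c b -
          ∑ c, _ * cov2 metric (pull (act γ) l) p m a c = _
        rw [pd_congr (hcov m a b), pd_sum (fun n _ => (hj n m).fun_mul (hdp n a b))]
        simp only [(hcov m _ _).eq_of_nhds]
        simp only [pd_mul (hj _ m) (hdp _ a b)]
        simp only [Fin.sum_univ_three]
        ring
      · simp only [(hcov _ a b).eq_of_nhds]
    rw [h1]
    have h3 : ∀ n, cov2 metric (pull (act γ) (L n)) p m a b = ∑ q, jac (act γ) p q m *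
        pull (act γ) (fun x i j => cov2 metric (L n) x q i j) p a b := fun n =>
      cov2_pull γ hp (hl2 _ hp' n) m a b
    simp only [pd_jac γ hp, h3]
    have h2 : ∀ q s, pull (act γ) (fun x i j => cov3 metric (cov2 metric l) x q s i j) p a b =
        pull (act γ) (fun x i j => cov2 metric (L s) x q i j) p a b -
        ∑ n, christoffel metric n q s (act γ p) * pull (act γ) (L n) p a b := by
      intro q s
      simp only [pull, cov3_eq, Finset.mul_sum, sub_mul, Finset.sum_sub_distrib, Finset.sum_mul]
      congr 1
      rw [Finset.sum_comm' (t' := Finset.univ) (s' := fun _ => Finset.univ) (by simp)]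
      simp only [Fin.sum_univ_three, hL]
      ring
    simp only [h2]
    generalize hX : (fun n => pull (act γ) (L n) p a b) = X
    have hX' : ∀ n, pull (act γ) (L n) p a b = X n := fun n => congrFun hX n
    generalize hY : (fun s q => pull (act γ) (fun x i j => cov2 metric (L s) x q i j) p a b) = Y
    have hY' : ∀ s q, pull (act γ) (fun x i j => cov2 metric (L s) x q i j) p a b = Y s q :=
      fun s q => congrFun (congrFun hY s) q
    simp only [hX', hY']
    simp only [Fin.sum_univ_three]
    ring
  -- the trace over the two derivative indices uses `J Jᵀ = λ² 1`
  have hsum : ∀ f : Fin 3 → Fin 3 → ℝ, ∑ m, ∑ q, ∑ s, jac (act γ) p q m * jac (act γ) p s m * f q s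
      = conf γ p ^ 2 * ∑ q, f q q := by
    intro f
    rw [Finset.sum_comm]
    simp only [Finset.sum_comm (s := Finset.univ (α := Fin 3)) (t := Finset.univ (α := Fin 3))
      (f := fun m s => jac (act γ) p _ m * jac (act γ) p s m * f _ s), ← Finset.sum_mul,
      jac_mul_transpose γ hp]
    simp [Finset.mul_sum]
  have hR : ∀ (l : Tensor2 3) {q : Fin 3 → ℝ}, q ∈ halfSpace → ∀ i j,
      roughLaplacian metric l q i j = q 2 ^ 2 * ∑ m, cov3 metric (cov2 metric l) q m m i j := by
    intro l q hq i j
    unfold roughLaplacian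
    simp [inv_metric hq, Finset.mul_sum]
  rw [hR _ hp]
  simp only [key, hsum]
  unfold pull
  simp only [hR _ hp', conf, Fin.sum_univ_three]
  field_simp
  ring

/-- Naturality of the operator `Δ_L - 4` under isometries. -/
lemma opA_pull (γ : SL2C) {l : Tensor2 3} {p : Fin 3 → ℝ} (hp : p ∈ halfSpace)
    (hl : ∀ q ∈ halfSpace, ∀ i j, DifferentiableAt ℝ (fun x => l x i j) q)
    (hl2 : ∀ q ∈ halfSpace, ∀ n i j, DifferentiableAt ℝ (fun x => cov2 metric l x n i j) q)
    (hs : ∀ q ∈ halfSpace, ∀ i j, l q i j = l q j i) (a b : Fin 3) :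
    opA metric (pull (act γ) l) p a b = pull (act γ) (opA metric l) p a b := by
  have hp' := act_mem γ hp
  have hsym : ∀ i j, pull (act γ) l p i j = pull (act γ) l p j i := by
    intro i j
    unfold pull
    rw [Finset.sum_comm]
    refine Finset.sum_congr rfl fun x _ => Finset.sum_congr rfl fun y _ => ?_
    rw [hs _ hp' y x]; ring
  rw [opA_metric hp hsym, roughLaplacian_pull γ hp hl hl2]
  have htr : ∑ k, pull (act γ) l p k k = conf γ p ^ 2 * ∑ i, l (act γ p) i i := by
    have h := jac_mul_transpose γ hp
    calc ∑ k, pull (act γ) l p k k = ∑ i, ∑ j, l (act γ p) i j *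
        ∑ k, jac (act γ) p i k * jac (act γ) p j k := by
          unfold pull; simp only [Fin.sum_univ_three]; ring
      _ = _ := by simp [h, Finset.mul_sum, mul_comm]
  have hdelta : (if a = b then 2 * ∑ k, pull (act γ) l p k k else 0) =
      ∑ i, ∑ j, (if i = j then 2 * ∑ k, l (act γ p) k k else 0) * jac (act γ) p i a *
        jac (act γ) p j b := by
    have h := jac_transpose_mul γ hp a b
    calc _ = (2 * ∑ k, l (act γ p) k k) * ∑ i, jac (act γ) p i a * jac (act γ) p i b := by
          rw [h, htr]; split_ifs <;> ring
      _ = _ := by simp [Finset.mul_sum, mul_assoc]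
  rw [hdelta]
  unfold pull
  simp only [opA_metric hp' (hs _ hp'), Finset.mul_sum, ← Finset.sum_add_distrib,
    ← Finset.sum_sub_distrib]
  refine Finset.sum_congr rfl fun i _ => Finset.sum_congr rfl fun j _ => ?_
  ring

end Hyp3

/-! ### The equation in an orthonormal frame -/

namespace Hyp3

/-- A symmetric `C²` tensor field on upper half-space with `Δ_L l - 4 l = - l`, without any
invariance or integrability. -/
structure IsSol (l : Tensor2 3) : Prop where
  contDiff : ∀ i j, ContDiffOn ℝ 2 (fun x => l x i j) halfSpace
  symm : ∀ p ∈ halfSpace, ∀ i j, l p i j = l p j i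
  eigen : ∀ p ∈ halfSpace, ∀ i j, opA metric l p i j = - l p i j

/-- The components of a tensor field in the orthonormal frame `t ∂_x, t ∂_y, t ∂_t`. -/
def frame (l : Tensor2 3) : Tensor2 3 := fun p i j => p 2 ^ 2 * l p i j

/-- The action on `2`-tensors of the connection form of the frame `t ∂_x, t ∂_y, t ∂_t` in the
`k`-th direction: `∇_{e_k} = t ∂_k + W_k` on frame components. -/
def conn (k : Fin 3) (A : Fin 3 → Fin 3 → ℝ) (i j : Fin 3) : ℝ :=
  (if i = 2 then A k j else 0) - (if k = i then A 2 j else 0)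
    + (if j = 2 then A i k else 0) - (if k = j then A i 2 else 0)

/-- The eigenvalue equation `Δ_L m - 4 m = - m` in frame components. -/
structure IsFrameSol (m : Tensor2 3) : Prop where
  contDiff : ∀ i j, ContDiffOn ℝ 2 (fun x => m x i j) halfSpace
  symm : ∀ p ∈ halfSpace, ∀ i j, m p i j = m p j i
  eqn : ∀ p ∈ halfSpace, ∀ i j,
    p 2 ^ 2 * ∑ k, pd k (pd k fun x => m x i j) p - p 2 * pd 2 (fun x => m x i j) p
      + 2 * p 2 * ∑ k, conn k (fun a b => pd k (fun x => m x a b) p) i j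
      + ∑ k, conn k (conn k (m p)) i j + 3 * m p i j - (if i = j then 2 * ∑ k, m p k k else 0) = 0

lemma contDiffAt_of_halfSpace {f : (Fin 3 → ℝ) → ℝ} {m : WithTop ℕ∞}
    (hf : ContDiffOn ℝ m f halfSpace) {p : Fin 3 → ℝ} (hp : p ∈ halfSpace) : ContDiffAt ℝ m f p :=
  hf.contDiffAt (isOpen_halfSpace.mem_nhds hp)

lemma IsSol.contDiffAt {l : Tensor2 3} (h : IsSol l) {p : Fin 3 → ℝ} (hp : p ∈ halfSpace)
    (i j : Fin 3) : ContDiffAt ℝ 2 (fun x => l x i j) p :=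
  contDiffAt_of_halfSpace (h.contDiff i j) hp

lemma IsFrameSol.contDiffAt {l : Tensor2 3} (h : IsFrameSol l) {p : Fin 3 → ℝ} (hp : p ∈ halfSpace)
    (i j : Fin 3) : ContDiffAt ℝ 2 (fun x => l x i j) p :=
  contDiffAt_of_halfSpace (h.contDiff i j) hp

lemma contDiffOn_frame {l : Tensor2 3} {i j : Fin 3}
    (h : ContDiffOn ℝ 2 (fun x => l x i j) halfSpace) :
    ContDiffOn ℝ 2 (fun x => frame l x i j) halfSpace :=
  ((contDiff_apply ℝ ℝ 2).pow 2).contDiffOn.mul h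

/-- In the frame, `∇_{e_k} = t ∂_k + conn k`; the factor `t⁻³` converts frame components back to
coordinates. -/
lemma cov2_eq_frame {l : Tensor2 3} {p : Fin 3 → ℝ} (hp : p ∈ halfSpace)
    (h : ∀ i j, DifferentiableAt ℝ (fun x => l x i j) p) (k i j : Fin 3) :
    cov2 metric l p k i j = (p 2)⁻¹ ^ 3 *
      (p 2 * pd k (fun x => frame l x i j) p + conn k (frame l p) i j) := by
  have ht : p 2 ≠ 0 := ne_of_gt hp
  have h1 : pd k (fun x => frame l x i j) p = (if k = 2 then 2 * p 2 else 0) * l p i j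
      + p 2 ^ 2 * pd k (fun x => l x i j) p := by
    unfold frame
    rw [pd_mul (by fun_prop) (h i j), pd_pow (by fun_prop), pd_proj, if_congr eq_comm rfl rfl]
    split_ifs <;> simp
  unfold cov2
  rw [h1]
  simp only [christoffel_metric hp, conn, frame, Fin.sum_univ_three]
  generalize pd k (fun x => l x i j) p = P
  fin_cases k <;> fin_cases i <;> fin_cases j <;> simp [chr] <;> field_simp <;> ring

lemma differentiableAt_pd {f : (Fin 3 → ℝ) → ℝ} {p : Fin 3 → ℝ} (hf : ContDiffAt ℝ 2 f p)
    (k : Fin 3) : DifferentiableAt ℝ (pd k f) p :=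
  (contDiffAt_pd hf (m' := 1) (by norm_num) k).differentiableAt (by norm_num)

lemma pd_conn {m : Tensor2 3} {p : Fin 3 → ℝ} (h : ∀ i j, DifferentiableAt ℝ (fun x => m x i j) p)
    (n k i j : Fin 3) : pd n (fun x => conn k (m x) i j) p =
      conn k (fun a b => pd n (fun x => m x a b) p) i j ∧
      DifferentiableAt ℝ (fun x => conn k (m x) i j) p := by
  have h1 : ∀ (c : Prop) [Decidable c] (a b : Fin 3),
      pd n (fun x => if c then m x a b else 0) p = (if c then pd n (fun x => m x a b) p else 0) ∧
      DifferentiableAt ℝ (fun x => if c then m x a b else 0) p := by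
    intro c _ a b
    split_ifs
    · exact ⟨rfl, h a b⟩
    · exact ⟨pd_const 0 p n, differentiableAt_const _⟩
  unfold conn
  have a1 := h1 (i = 2) k j
  have a2 := h1 (k = i) 2 j
  have a3 := h1 (j = 2) i k
  have a4 := h1 (k = j) i 2
  refine ⟨?_, ((a1.2.fun_sub a2.2).fun_add a3.2).fun_sub a4.2⟩
  rw [pd_sub ((a1.2.fun_sub a2.2).fun_add a3.2) a4.2, pd_add (a1.2.fun_sub a2.2) a3.2,
    pd_sub a1.2 a2.2, a1.1, a2.1, a3.1, a4.1]

lemma cov2_eventuallyEq {l : Tensor2 3} (hl : ∀ i j, ContDiffOn ℝ 2 (fun x => l x i j) halfSpace)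
    {p : Fin 3 → ℝ} (hp : p ∈ halfSpace) (k i j : Fin 3) :
    (fun x => cov2 metric l x k i j) =ᶠ[𝓝 p] fun x => (x 2)⁻¹ ^ 3 *
      (x 2 * pd k (fun x => frame l x i j) x + conn k (frame l x) i j) := by
  filter_upwards [isOpen_halfSpace.mem_nhds hp] with x hx
  exact cov2_eq_frame hx (fun i j => (contDiffAt_of_halfSpace (hl i j) hx).differentiableAt
    (by norm_num)) k i j

lemma differentiableAt_cov2 {l : Tensor2 3} (hl : ∀ i j, ContDiffOn ℝ 2 (fun x => l x i j) halfSpace)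
    {p : Fin 3 → ℝ} (hp : p ∈ halfSpace) (k i j : Fin 3) :
    DifferentiableAt ℝ (fun x => cov2 metric l x k i j) p := by
  have ht : p 2 ≠ 0 := ne_of_gt hp
  have hf : ∀ i j, ContDiffAt ℝ 2 (fun x => frame l x i j) p := fun i j =>
    contDiffAt_of_halfSpace (contDiffOn_frame (hl i j)) hp
  have h1 := differentiableAt_pd (hf i j) k
  have h2 := (pd_conn (fun i j => (hf i j).differentiableAt (by norm_num)) k k i j).2
  refine DifferentiableAt.congr_of_eventuallyEq ?_ (cov2_eventuallyEq hl hp k i j)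
  exact DifferentiableAt.fun_mul (by fun_prop (disch := exact ht))
    (DifferentiableAt.fun_add (DifferentiableAt.fun_mul (by fun_prop) h1) h2)

/-- The connection Laplacian in the frame is `∑ (t ∂_k + conn k)²` together with a first order term
from the covariant derivatives of the frame. -/
lemma roughLaplacian_eq_frame {l : Tensor2 3}
    (hl : ∀ i j, ContDiffOn ℝ 2 (fun x => l x i j) halfSpace)
    {p : Fin 3 → ℝ} (hp : p ∈ halfSpace) (i j : Fin 3) :
    p 2 ^ 2 * roughLaplacian metric l p i j =
      p 2 ^ 2 * ∑ k, pd k (pd k fun x => frame l x i j) p - p 2 * pd 2 (fun x => frame l x i j) p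
      + 2 * p 2 * ∑ k, conn k (fun a b => pd k (fun x => frame l x a b) p) i j
      + ∑ k, conn k (conn k (frame l p)) i j := by
  have ht : p 2 ≠ 0 := ne_of_gt hp
  have hf : ∀ i j, ContDiffAt ℝ 2 (fun x => frame l x i j) p := fun i j =>
    contDiffAt_of_halfSpace (contDiffOn_frame (hl i j)) hp
  have hfd : ∀ i j, DifferentiableAt ℝ (fun x => frame l x i j) p := fun i j =>
    (hf i j).differentiableAt (by norm_num)
  have hpd : ∀ k i j, pd k (fun x => cov2 metric l x k i j) p =
      (if k = 2 then -3 * (p 2)⁻¹ ^ 4 else 0) *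
        (p 2 * pd k (fun x => frame l x i j) p + conn k (frame l p) i j)
      + (p 2)⁻¹ ^ 3 * ((if k = 2 then 1 else 0) * pd k (fun x => frame l x i j) p
        + p 2 * pd k (pd k fun x => frame l x i j) p
        + conn k (fun a b => pd k (fun x => frame l x a b) p) i j) := by
    intro k i j
    have h1 := differentiableAt_pd (hf i j) k
    have h2 := pd_conn hfd k k i j
    rw [pd_congr (cov2_eventuallyEq hl hp k i j),
      pd_mul (by fun_prop (disch := exact ht))
        (DifferentiableAt.fun_add (DifferentiableAt.fun_mul (by fun_prop) h1) h2.2),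
      pd_add (DifferentiableAt.fun_mul (by fun_prop) h1) h2.2,
      pd_mul (by fun_prop) h1, h2.1, pd_proj, if_congr eq_comm rfl rfl,
      pd_pow (f := fun x : Fin 3 → ℝ => (x 2)⁻¹) (by fun_prop (disch := exact ht)),
      pd_inv_height hp]
    congr 2
    by_cases hk : k = 2
    · simp [hk]; ring
    · simp [hk]
  have hc : ∀ k i j, cov2 metric l p k i j = (p 2)⁻¹ ^ 3 *
      (p 2 * pd k (fun x => frame l x i j) p + conn k (frame l p) i j) :=
    fun k i j => (cov2_eventuallyEq hl hp k i j).eq_of_nhds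
  unfold roughLaplacian
  simp only [inv_metric hp, ite_mul, zero_mul, Finset.sum_ite_eq, Finset.mem_univ, if_true]
  unfold cov3
  simp only [hpd, hc, christoffel_metric hp]
  -- with the derivatives of the components as free variables, the identity is algebraic
  generalize hP : (fun k i j => pd k (fun x => frame l x i j) p) = P
  have hP' : ∀ k i j, pd k (fun x => frame l x i j) p = P k i j := fun k i j =>
    congrFun (congrFun (congrFun hP k) i) j
  generalize hQ : (fun k i j => pd k (pd k fun x => frame l x i j) p) = Q
  have hQ' : ∀ k i j, pd k (pd k fun x => frame l x i j) p = Q k i j := fun k i j =>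
    congrFun (congrFun (congrFun hQ k) i) j
  simp only [hP', hQ']
  generalize frame l p = F
  clear hpd hc hP' hQ' hfd hf
  generalize p 2 = t at ht
  simp only [Fin.sum_univ_three, conn]
  fin_cases i <;> fin_cases j <;> simp [chr] <;> field_simp <;> ring

end Hyp3

/-! ### The Bochner formula -/

namespace Hyp3

lemma IsEigentensor.isSol {Γ : Subgroup SL2C} {l : Tensor2 3} (h : IsEigentensor Γ l) :
    IsSol l where
  contDiff i j := contDiffOn_pi.1 (contDiffOn_pi.1 h.contDiff i) j
  symm := h.symm
  eigen := h.eigen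

lemma IsSol.isFrameSol {l : Tensor2 3} (h : IsSol l) : IsFrameSol (frame l) where
  contDiff i j := contDiffOn_frame (h.contDiff i j)
  symm p hp i j := by simp [frame, h.symm p hp i j]
  eqn p hp i j := by
    have h1 := h.eigen p hp i j
    rw [opA_metric hp (h.symm p hp)] at h1
    rw [← roughLaplacian_eq_frame h.contDiff hp]
    simp only [frame, ← Finset.mul_sum]
    split_ifs at h1 ⊢
    · linear_combination (p 2 ^ 2) * h1
    · linear_combination (p 2 ^ 2) * h1

/-- The equation is invariant under orientation preserving isometries. -/
lemma IsSol.pull {l : Tensor2 3} (h : IsSol l) (γ : SL2C) : IsSol (pull (act γ) l) where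
  contDiff i j := by
    intro p hp
    refine ContDiffAt.contDiffWithinAt ?_
    unfold Hyp3.pull
    refine ContDiffAt.sum fun a _ => ContDiffAt.sum fun b _ => ?_
    exact ((ContDiffAt.comp p (h.contDiffAt (act_mem γ hp) a b) (contDiffAt_act γ hp)).mul
      (contDiffAt_jac γ hp a i)).mul (contDiffAt_jac γ hp b j)
  symm p hp i j := by
    unfold Hyp3.pull
    rw [Finset.sum_comm]
    refine Finset.sum_congr rfl fun x _ => Finset.sum_congr rfl fun y _ => ?_
    rw [h.symm _ (act_mem γ hp) y x]; ring
  eigen p hp i j := by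
    rw [opA_pull γ hp (fun q hq i j => (h.contDiffAt hq i j).differentiableAt (by norm_num))
      (fun q hq => differentiableAt_cov2 h.contDiff hq) h.symm]
    unfold Hyp3.pull
    simp only [h.eigen _ (act_mem γ hp), neg_mul, Finset.sum_neg_distrib]

/-- The squared Euclidean norm of a matrix of components. -/
def sqNorm (A : Fin 3 → Fin 3 → ℝ) : ℝ := ∑ i, ∑ j, A i j ^ 2

lemma sqNorm_nonneg (A : Fin 3 → Fin 3 → ℝ) : 0 ≤ sqNorm A := by unfold sqNorm; positivity

lemma normSq2_eq_sqNorm {l : Tensor2 3} {p : Fin 3 → ℝ} (hp : p ∈ halfSpace) :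
    normSq2 metric l p = sqNorm (frame l p) := normSq2_metric hp

/-- Isometries preserve the pointwise norm. -/
lemma normSq2_pull (γ : SL2C) (l : Tensor2 3) {p : Fin 3 → ℝ} (hp : p ∈ halfSpace) :
    normSq2 metric (pull (act γ) l) p = normSq2 metric l (act γ p) := by
  have ht : p 2 ≠ 0 := ne_of_gt hp
  rw [normSq2_metric hp, normSq2_metric (act_mem γ hp)]
  have h := jac_mul_transpose γ hp
  have key : ∑ a, ∑ b, pull (act γ) l p a b ^ 2 = conf γ p ^ 4 * ∑ i, ∑ j, l (act γ p) i j ^ 2 := by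
    calc ∑ a, ∑ b, pull (act γ) l p a b ^ 2 = ∑ i, ∑ j, ∑ i', ∑ j', l (act γ p) i j *
        l (act γ p) i' j' * (∑ a, jac (act γ) p i a * jac (act γ) p i' a) *
        (∑ b, jac (act γ) p j b * jac (act γ) p j' b) := by
          unfold pull
          simp only [sq, Finset.mul_sum, Finset.sum_mul]
          generalize jac (act γ) p = J
          generalize l (act γ p) = L
          simp only [Fin.sum_univ_three]; ring
      _ = _ := by
          simp only [h, mul_ite, mul_zero, Finset.sum_ite_eq,
            Finset.mem_univ, if_true, ite_mul, zero_mul, Finset.mul_sum]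
          refine Finset.sum_congr rfl fun i _ => Finset.sum_congr rfl fun j _ => ?_
          ring
  simp only [mul_pow, ← Finset.mul_sum, key, conf]
  field_simp

/-- The connection form takes values in skew endomorphisms, as the frame is orthonormal. -/
lemma conn_skew (k : Fin 3) (A B : Fin 3 → Fin 3 → ℝ) :
    ∑ i, ∑ j, A i j * conn k B i j = - ∑ i, ∑ j, conn k A i j * B i j := by
  simp only [conn, Fin.sum_univ_three]
  fin_cases k <;> simp <;> ring

/-- The frame is parallel along vertical geodesics. -/
lemma conn_two (A : Fin 3 → Fin 3 → ℝ) (i j : Fin 3) : conn 2 A i j = 0 := by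
  unfold conn
  simp only [eq_comm (a := (2 : Fin 3))]
  ring

lemma contDiffOn_sqNorm {m : Tensor2 3} (h : IsFrameSol m) :
    ContDiffOn ℝ 2 (fun x => sqNorm (m x)) halfSpace := by
  unfold sqNorm
  exact ContDiffOn.sum fun i _ => ContDiffOn.sum fun j _ => (h.contDiff i j).pow 2

lemma pd_sqNorm {m : Tensor2 3} {p : Fin 3 → ℝ}
    (h : ∀ i j, DifferentiableAt ℝ (fun x => m x i j) p) (k : Fin 3) :
    pd k (fun x => sqNorm (m x)) p = 2 * ∑ i, ∑ j, m p i j * pd k (fun x => m x i j) p := by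
  unfold sqNorm
  rw [pd_sum (fun i _ => DifferentiableAt.fun_sum fun j _ => (h i j).fun_pow 2), Finset.mul_sum]
  refine Finset.sum_congr rfl fun i _ => ?_
  rw [pd_sum (fun j _ => (h i j).fun_pow 2), Finset.mul_sum]
  refine Finset.sum_congr rfl fun j _ => ?_
  rw [pd_pow (h i j)]; norm_num; ring

lemma pd_pd_sqNorm {m : Tensor2 3} (hm : IsFrameSol m) {p : Fin 3 → ℝ} (hp : p ∈ halfSpace)
    (k : Fin 3) : pd k (pd k fun x => sqNorm (m x)) p = 2 * ∑ i, ∑ j,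
      (pd k (fun x => m x i j) p ^ 2 + m p i j * pd k (pd k fun x => m x i j) p) := by
  have hd : ∀ {q : Fin 3 → ℝ}, q ∈ halfSpace → ∀ i j, DifferentiableAt ℝ (fun x => m x i j) q :=
    fun hq i j => (hm.contDiffAt hq i j).differentiableAt (by norm_num)
  have h1 : pd k (fun x => sqNorm (m x)) =ᶠ[𝓝 p]
      fun x => 2 * ∑ i, ∑ j, m x i j * pd k (fun x => m x i j) x := by
    filter_upwards [isOpen_halfSpace.mem_nhds hp] with x hx
    exact pd_sqNorm (hd hx) k
  have h2 : ∀ i j, DifferentiableAt ℝ (fun x => m x i j * pd k (fun x => m x i j) x) p := fun i j =>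
    (hd hp i j).fun_mul (differentiableAt_pd (hm.contDiffAt hp i j) k)
  rw [pd_congr h1, pd_const_mul (DifferentiableAt.fun_sum fun i _ =>
    DifferentiableAt.fun_sum fun j _ => h2 i j),
    pd_sum (fun i _ => DifferentiableAt.fun_sum fun j _ => h2 i j)]
  congr 1
  refine Finset.sum_congr rfl fun i _ => ?_
  rw [pd_sum (fun j _ => h2 i j)]
  refine Finset.sum_congr rfl fun j _ => ?_
  rw [pd_mul (hd hp i j) (differentiableAt_pd (hm.contDiffAt hp i j) k)]; ring

/-- The Bochner formula `Δ |m|² = 2 |∇ m|² - 6 |m|² + 4 (tr m)²` for an eigentensor. -/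
lemma bochner {m : Tensor2 3} (hm : IsFrameSol m) {p : Fin 3 → ℝ} (hp : p ∈ halfSpace) :
    p 2 ^ 2 * ∑ k, pd k (pd k fun x => sqNorm (m x)) p - p 2 * pd 2 (fun x => sqNorm (m x)) p =
      2 * ∑ k, sqNorm (fun i j => p 2 * pd k (fun x => m x i j) p + conn k (m p) i j)
      - 6 * sqNorm (m p) + 4 * (∑ k, m p k k) ^ 2 := by
  have hd : ∀ i j, DifferentiableAt ℝ (fun x => m x i j) p :=
    fun i j => (hm.contDiffAt hp i j).differentiableAt (by norm_num)
  -- the contraction of the equation with `m`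
  have hE : ∑ i, ∑ j, m p i j * (p 2 ^ 2 * ∑ k, pd k (pd k fun x => m x i j) p
      - p 2 * pd 2 (fun x => m x i j) p
      + 2 * p 2 * ∑ k, conn k (fun a b => pd k (fun x => m x a b) p) i j
      + ∑ k, conn k (conn k (m p)) i j + 3 * m p i j
      - (if i = j then 2 * ∑ k, m p k k else 0)) = 0 := by
    simp only [hm.eqn p hp, mul_zero, Finset.sum_const_zero]
  rw [pd_sqNorm hd]
  simp only [pd_pd_sqNorm hm hp]
  -- what remains is an identity in the components and their derivatives, a form of `conn_skew`
  generalize hP : (fun k i j => pd k (fun x => m x i j) p) = P at *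
  have hP' : ∀ k i j, pd k (fun x => m x i j) p = P k i j := fun k i j =>
    congrFun (congrFun (congrFun hP k) i) j
  generalize hQ : (fun k i j => pd k (pd k fun x => m x i j) p) = Q
  have hQ' : ∀ k i j, pd k (pd k fun x => m x i j) p = Q k i j := fun k i j =>
    congrFun (congrFun (congrFun hQ k) i) j
  simp only [hP', hQ'] at *
  clear hP' hQ' hP hQ hd
  unfold sqNorm
  generalize m p = F at *
  generalize p 2 = t at *
  simp only [Fin.sum_univ_three, conn, Fin.isValue, if_true, Fin.reduceEq, if_false] at hE ⊢
  linear_combination 2 * hE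

end Hyp3

/-! ### A weighted mean value inequality on the unit ball -/

namespace ChartGeom

/-- The radial weights `(1 - |y|²)₊ⁿ`. -/
noncomputable def cut (n : ℕ) (y : Fin 3 → ℝ) : ℝ := (max 0 (1 - ∑ i, y i ^ 2)) ^ n

lemma hasDerivAt_max_pow (n : ℕ) (s : ℝ) :
    HasDerivAt (fun s : ℝ => (max 0 s) ^ (n + 2)) ((n + 2) * (max 0 s) ^ (n + 1)) s := by
  rcases lt_trichotomy s 0 with h | h | h
  · have : (fun s : ℝ => (max 0 s) ^ (n + 2)) =ᶠ[𝓝 s] fun _ => 0 := by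
      filter_upwards [Iio_mem_nhds h] with x hx
      rw [max_eq_left (le_of_lt hx)]; simp
    rw [max_eq_left h.le]
    simpa using (hasDerivAt_const s (0 : ℝ)).congr_of_eventuallyEq this
  · subst h
    have h1 : HasDerivWithinAt (fun s : ℝ => (max 0 s) ^ (n + 2)) 0 (Set.Iic 0) 0 :=
      (hasDerivWithinAt_const (0 : ℝ) (Set.Iic 0) (0 : ℝ)).congr
        (fun x hx => by rw [max_eq_left hx]; simp) (by simp)
    have h2 : HasDerivWithinAt (fun s : ℝ => (max 0 s) ^ (n + 2)) 0 (Set.Ici 0) 0 := by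
      have := (hasDerivAt_pow (n + 2) (0 : ℝ)).hasDerivWithinAt (s := Set.Ici 0)
      simp only [Nat.add_succ_sub_one, ne_eq, Nat.add_eq_zero_iff, one_ne_zero, and_false,
        not_false_eq_true, zero_pow, mul_zero] at this
      exact this.congr (fun x hx => by rw [max_eq_right hx]) (by simp)
    have h3 := h1.union h2
    rw [Set.Iic_union_Ici, hasDerivWithinAt_univ] at h3
    simpa using h3
  · have : (fun s : ℝ => (max 0 s) ^ (n + 2)) =ᶠ[𝓝 s] fun s => s ^ (n + 2) := by
      filter_upwards [Ioi_mem_nhds h] with x hx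
      rw [max_eq_right (le_of_lt hx)]
    rw [max_eq_right h.le]
    have h4 := (hasDerivAt_pow (n + 2) s).congr_of_eventuallyEq this
    simpa using h4

lemma continuous_cut (n : ℕ) : Continuous (cut n) := by unfold cut; fun_prop

lemma cut_nonneg (n : ℕ) (y : Fin 3 → ℝ) : 0 ≤ cut n y := by unfold cut; positivity

lemma cut_eq_zero {n : ℕ} (hn : n ≠ 0) {y : Fin 3 → ℝ} (hy : 1 ≤ ∑ i, y i ^ 2) : cut n y = 0 := by
  unfold cut; rw [max_eq_left (by linarith)]; simp [hn]

lemma cut_le_one (n : ℕ) (y : Fin 3 → ℝ) : cut n y ≤ 1 := by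
  unfold cut
  refine pow_le_one₀ (by positivity) (max_le (by norm_num) ?_)
  have : 0 ≤ ∑ i, y i ^ 2 := by positivity
  linarith

lemma cut_succ_le (n : ℕ) (y : Fin 3 → ℝ) : cut (n + 1) y ≤ cut n y := by
  unfold cut
  refine pow_le_pow_of_le_one (by positivity) (max_le (by norm_num) ?_) (Nat.le_succ n)
  have : 0 ≤ ∑ i, y i ^ 2 := by positivity
  linarith

lemma hasCompactSupport_cut {n : ℕ} (hn : n ≠ 0) : HasCompactSupport (cut n) := by
  refine HasCompactSupport.of_support_subset_isCompact (isCompact_closedBall (0 : Fin 3 → ℝ) 1) ?_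
  intro y hy
  by_contra hcon
  refine hy (cut_eq_zero hn ?_)
  rw [mem_closedBall_zero_iff, pi_norm_le_iff_of_nonneg zero_le_one] at hcon
  push Not at hcon
  obtain ⟨i, hi⟩ := hcon
  have h1 : 1 ≤ y i ^ 2 := by
    rw [← sq_abs]; rw [Real.norm_eq_abs] at hi; nlinarith
  exact h1.trans (Finset.single_le_sum (f := fun i => y i ^ 2) (fun j _ => sq_nonneg _)
    (Finset.mem_univ i))

lemma hasFDerivAt_cut_comp (n : ℕ) (y : Fin 3 → ℝ) :
    DifferentiableAt ℝ (cut (n + 2)) y ∧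
      ∀ i, pd i (cut (n + 2)) y = -(2 * (n + 2)) * (y i * cut (n + 1) y) := by
  have hq : DifferentiableAt ℝ (fun y : Fin 3 → ℝ => 1 - ∑ i, y i ^ 2) y := by fun_prop
  have h : HasFDerivAt (cut (n + 2)) (((n + 2) * (max 0 (1 - ∑ i, y i ^ 2)) ^ (n + 1)) •
      fderiv ℝ (fun y : Fin 3 → ℝ => 1 - ∑ i, y i ^ 2) y) y :=
    (hasDerivAt_max_pow n _).comp_hasFDerivAt y hq.hasFDerivAt
  refine ⟨h.differentiableAt, fun i => ?_⟩
  have h2 : pd i (fun y : Fin 3 → ℝ => 1 - ∑ i, y i ^ 2) y = - (2 * y i) := by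
    rw [pd_sub (by fun_prop) (by fun_prop), pd_const, pd_sum (fun j _ => by fun_prop)]
    have hj : ∀ j, pd i (fun y : Fin 3 → ℝ => y j ^ 2) y = 2 * y j * if j = i then 1 else 0 := by
      intro j
      rw [pd_pow (by fun_prop), pd_proj]; norm_num
    simp [hj]
  unfold pd at h2 ⊢
  rw [h.fderiv]
  simp only [_root_.smul_apply, h2, smul_eq_mul, cut]
  ring

/-- Integration by parts: the gradient of each radial weight is `y` times a multiple of the
preceding one. -/
lemma integral_pd_mul_cut {w : (Fin 3 → ℝ) → ℝ} (hw : ContDiff ℝ 1 w) (i : Fin 3) :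
    ∫ y, w y * (y i * cut 2 y) = (1 / 6) * ∫ y, pd i w y * cut 3 y := by
  have h3 : ∀ y, pd i (cut 3) y = -6 * (y i * cut 2 y) := by
    intro y
    have := (hasFDerivAt_cut_comp 1 y).2 i
    norm_num at this
    rw [this]; ring
  have hcs2 := hasCompactSupport_cut (n := 2) (by norm_num)
  have hcs3 := hasCompactSupport_cut (n := 3) (by norm_num)
  have hpdw : Continuous (pd i w) := by
    unfold pd
    exact (hw.continuous_fderiv (by norm_num)).clm_apply continuous_const
  have hibp := integral_mul_fderiv_eq_neg_fderiv_mul_of_integrable (μ := volume) (f := w)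
    (g := cut 3) (v := Pi.single i 1)
    ((hpdw.mul (continuous_cut 3)).integrable_of_hasCompactSupport (hcs3.mul_left))
    (by
      have : Continuous fun y => w y * (-6 * (y i * cut 2 y)) := by
        have := continuous_cut 2
        have := hw.continuous
        fun_prop
      simp only [show ∀ y, fderiv ℝ (cut 3) y (Pi.single i 1) = -6 * (y i * cut 2 y) from h3]
      exact this.integrable_of_hasCompactSupport (hcs2.mul_left.mul_left.mul_left))
    ((hw.continuous.mul (continuous_cut 3)).integrable_of_hasCompactSupport (hcs3.mul_left))
    (fun x _ => hw.differentiable (by norm_num) x) (fun x _ => (hasFDerivAt_cut_comp 1 x).1)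
  simp only [show ∀ y, fderiv ℝ (cut 3) y (Pi.single i 1) = -6 * (y i * cut 2 y) from h3] at hibp
  have h6 : ∫ y, w y * (-6 * (y i * cut 2 y)) = -6 * ∫ y, w y * (y i * cut 2 y) := by
    rw [← integral_const_mul]; congr 1; funext y; ring
  rw [h6] at hibp
  have : ∫ y, pd i w y * cut 3 y = ∫ y, fderiv ℝ w y (Pi.single i 1) * cut 3 y := rfl
  rw [this]; linarith

/-- The mean value inequality for `Δ v ≥ - k v` on the unit ball, with the weight `(1 - |y|²)₊²`:
the mean of `v (s y)` against the weight has a derivative in `s` that is a mean of `s Δ v (s y)`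
against the next weight. -/
lemma mean_value_aux {v : (Fin 3 → ℝ) → ℝ} (hv : ContDiff ℝ 2 v) (hvs : HasCompactSupport v)
    {k : ℝ} (hk : 0 ≤ k) (h0 : ∀ y, ∑ i, y i ^ 2 < 1 → 0 ≤ v y)
    (hΔ : ∀ y, ∑ i, y i ^ 2 < 1 → -k * v y ≤ ∑ i, pd i (pd i v) y) :
    v 0 * ∫ y, cut 2 y ≤ Real.exp (k / 6) * ∫ y, v y * cut 2 y := by
  have hcs2 := hasCompactSupport_cut (n := 2) (by norm_num)
  have hcs3 := hasCompactSupport_cut (n := 3) (by norm_num)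
  have hpd1 : ∀ i, ContDiff ℝ 1 (pd i v) := fun i =>
    contDiff_iff_contDiffAt.2 fun y => contDiffAt_pd hv.contDiffAt (by norm_num) i
  have hpd2 : ∀ i, Continuous (pd i (pd i v)) := fun i => by
    refine continuous_iff_continuousAt.2 fun y => ?_
    exact (contDiffAt_pd (m' := 0) (hpd1 i).contDiffAt (by norm_num) i).continuousAt
  have hvd : Differentiable ℝ v := hv.differentiable (by norm_num)
  obtain ⟨C, hC⟩ := (hvs.fderiv (𝕜 := ℝ)).exists_bound_of_continuous
    (hv.continuous_fderiv (by norm_num))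
  -- `F` interpolates between `v 0` times the total weight and the weighted integral of `v`
  set F : ℝ → ℝ := fun s => ∫ y, v (s • y) * cut 2 y with hF
  set F' : ℝ → ℝ := fun s => ∫ y, (∑ i, y i * pd i v (s • y)) * cut 2 y with hF'
  have hcont : Continuous v := hv.continuous
  have hc2 := continuous_cut 2
  have hc3 := continuous_cut 3
  have hint : ∀ s : ℝ, Integrable (fun y => v (s • y) * cut 2 y) := fun s =>
    (by fun_prop : Continuous fun y => v (s • y) * cut 2 y).integrable_of_hasCompactSupport
      hcs2.mul_left
  have hder : ∀ s, HasDerivAt F (F' s) s := by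
    intro s
    have hpc : ∀ i, Continuous (pd i v) := fun i => (hpd1 i).continuous
    refine (hasDerivAt_integral_of_dominated_loc_of_deriv_le (s := Set.univ)
      (F' := fun s y => (∑ i, y i * pd i v (s • y)) * cut 2 y)
      (bound := fun y => C * ‖y‖ * cut 2 y) Filter.univ_mem
      (Eventually.of_forall fun s => (hint s).aestronglyMeasurable) (hint s)
      (by
        refine Continuous.aestronglyMeasurable ?_
        refine Continuous.mul (continuous_finsetSum _ fun i _ => ?_) hc2
        exact (continuous_apply i).mul ((hpc i).comp (continuous_const_smul s)))
      (Eventually.of_forall fun y s _ => ?_)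
      (Continuous.integrable_of_hasCompactSupport (by fun_prop) hcs2.mul_left)
      (Eventually.of_forall fun y s _ => ?_)).2
    · rw [norm_mul, Real.norm_of_nonneg (cut_nonneg 2 y)]
      refine mul_le_mul_of_nonneg_right ?_ (cut_nonneg 2 y)
      rw [← fderiv_apply_eq_sum_pd]
      exact (ContinuousLinearMap.le_opNorm _ _).trans
        (mul_le_mul_of_nonneg_right (hC _) (norm_nonneg _))
    · have h1 : HasDerivAt (fun s : ℝ => s • y) y s := by
        simpa using (hasDerivAt_id s).smul_const y
      have h2 := (hvd (s • y)).hasFDerivAt.comp_hasDerivAt s h1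
      rw [fderiv_apply_eq_sum_pd] at h2
      exact h2.mul_const _
  have hF'eq : ∀ s, F' s = (s / 6) * ∫ y, (∑ i, pd i (pd i v) (s • y)) * cut 3 y := by
    intro s
    have hw : ∀ i, ContDiff ℝ 1 (fun y => pd i v (s • y)) := fun i =>
      (hpd1 i).comp (contDiff_const_smul s)
    have hpw : ∀ i y, pd i (fun y => pd i v (s • y)) y = s * pd i (pd i v) (s • y) := by
      intro i y
      unfold pd
      have : HasFDerivAt (fun y : Fin 3 → ℝ => s • y) (s • ContinuousLinearMap.id ℝ _) y :=
        (ContinuousLinearMap.hasFDerivAt (s • ContinuousLinearMap.id ℝ (Fin 3 → ℝ)))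
      have h2 := ((hpd1 i).differentiable (by norm_num) (s • y)).hasFDerivAt.comp y this
      have h3 := h2.fderiv
      simp only [Function.comp_def] at h3
      unfold pd at h3
      rw [h3]; simp
    have hI1 : ∀ i ∈ Finset.univ, Integrable (fun y : Fin 3 → ℝ => pd i v (s • y) * (y i * cut 2 y)) :=
      fun i _ => ((hw i).continuous.mul ((continuous_apply i).mul hc2)).integrable_of_hasCompactSupport
        hcs2.mul_left.mul_left
    have hI2 : ∀ i ∈ Finset.univ, Integrable (fun y : Fin 3 → ℝ => s * pd i (pd i v) (s • y) * cut 3 y) :=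
      fun i _ => ((continuous_const.mul ((hpd2 i).comp (continuous_const_smul s))).mul
        hc3).integrable_of_hasCompactSupport hcs3.mul_left
    calc F' s = ∫ y, ∑ i, pd i v (s • y) * (y i * cut 2 y) := by
          simp only [hF', Finset.sum_mul]; congr 1; funext y
          exact Finset.sum_congr rfl fun i _ => by ring
      _ = ∑ i, (1 / 6) * ∫ y, s * pd i (pd i v) (s • y) * cut 3 y := by
          rw [integral_finsetSum _ hI1]
          refine Finset.sum_congr rfl fun i _ => ?_
          rw [integral_pd_mul_cut (hw i) i]
          simp only [hpw]
      _ = (1 / 6) * ∫ y, ∑ i, s * pd i (pd i v) (s • y) * cut 3 y := by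
          rw [integral_finsetSum _ hI2, Finset.mul_sum]
      _ = _ := by
          rw [← integral_const_mul, ← integral_const_mul]
          congr 1; funext y
          simp only [Finset.sum_mul, Finset.mul_sum]
          exact Finset.sum_congr rfl fun i _ => by ring
  -- the next weight is smaller, and `s ≤ 1`, so that the integral of `- k v (s y)` against it is
  -- bounded by `F`
  have hle : ∀ s ∈ Set.Icc (0 : ℝ) 1, - (k / 6) * F s ≤ F' s := by
    intro s hs
    rw [hF'eq]
    have hcΔ : Continuous fun y : Fin 3 → ℝ => (∑ i, pd i (pd i v) (s • y)) * cut 3 y :=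
      (continuous_finsetSum _ fun i _ => (hpd2 i).comp (continuous_const_smul s)).mul hc3
    rw [hF]
    simp only
    rw [← integral_const_mul, ← integral_const_mul]
    refine integral_mono ((hint s).const_mul _)
      ((hcΔ.integrable_of_hasCompactSupport hcs3.mul_left).const_mul _) fun y => ?_
    simp only
    by_cases hy : ∑ i, y i ^ 2 < 1
    · have hsy : ∑ i, (s • y) i ^ 2 < 1 := by
        simp only [Pi.smul_apply, smul_eq_mul, mul_pow, ← Finset.mul_sum]
        have : s ^ 2 ≤ 1 := by nlinarith [hs.1, hs.2]
        have h' : 0 ≤ ∑ i, y i ^ 2 := by positivity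
        nlinarith
      have a1 := h0 _ hsy
      have a2 := hΔ _ hsy
      have a3 := cut_nonneg 3 y
      have a4 := cut_succ_le 2 y
      have e1 : s / 6 * ((-k * v (s • y)) * cut 3 y) ≤
          s / 6 * ((∑ i, pd i (pd i v) (s • y)) * cut 3 y) :=
        mul_le_mul_of_nonneg_left (mul_le_mul_of_nonneg_right a2 a3) (by linarith [hs.1])
      refine le_trans ?_ e1
      have e2 : v (s • y) * cut 3 y ≤ v (s • y) * cut 2 y := mul_le_mul_of_nonneg_left a4 a1
      have e3 : s * (v (s • y) * cut 3 y) ≤ v (s • y) * cut 2 y := by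
        have : 0 ≤ v (s • y) * cut 3 y := mul_nonneg a1 a3
        nlinarith [hs.1, hs.2]
      nlinarith
    · rw [cut_eq_zero (by norm_num) (not_lt.1 hy), cut_eq_zero (by norm_num) (not_lt.1 hy)]
      simp
  -- the differential inequality, with its integrating factor
  have hmono : MonotoneOn (fun s => F s * Real.exp (k / 6 * s)) (Set.Icc 0 1) := by
    have hd : ∀ s, HasDerivAt (fun s => F s * Real.exp (k / 6 * s))
        (F' s * Real.exp (k / 6 * s) + F s * (Real.exp (k / 6 * s) * (k / 6))) s := fun s => by
      have : HasDerivAt (fun s : ℝ => k / 6 * s) (k / 6) s := by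
        simpa using (hasDerivAt_id s).const_mul (k / 6)
      exact (hder s).mul this.exp
    refine monotoneOn_of_deriv_nonneg (convex_Icc 0 1)
      (fun s _ => (hd s).continuousAt.continuousWithinAt)
      (fun s _ => (hd s).differentiableAt.differentiableWithinAt) fun s hs => ?_
    rw [interior_Icc] at hs
    rw [(hd s).deriv]
    have := hle s ⟨hs.1.le, hs.2.le⟩
    have he := Real.exp_pos (k / 6 * s)
    nlinarith
  have hfin := hmono (Set.left_mem_Icc.2 zero_le_one) (Set.right_mem_Icc.2 zero_le_one) zero_le_one
  simp only [hF, zero_smul, one_smul, mul_zero, Real.exp_zero, mul_one] at hfin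
  rw [integral_const_mul] at hfin
  linarith

end ChartGeom

/-! ### Invariance of the volume and the local mean value inequality -/

namespace Hyp3

lemma measurable_density :
    Measurable fun p : Fin 3 → ℝ => ENNReal.ofReal (Real.sqrt (Matrix.of (metric p)).det) := by
  simp only [metric_eq_diagonal, Matrix.det_diagonal]
  fun_prop

lemma setLIntegral_riemVol {S : Set (Fin 3 → ℝ)} (hS : MeasurableSet S) (hSH : S ⊆ halfSpace)
    (f : (Fin 3 → ℝ) → ℝ≥0∞) :
    ∫⁻ p in S, f p ∂(riemVol metric) = ∫⁻ p in S, ENNReal.ofReal ((p 2)⁻¹ ^ 3) * f p := by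
  unfold riemVol
  rw [restrict_withDensity hS, lintegral_withDensity_eq_lintegral_mul_non_measurable _
    measurable_density (by simp)]
  refine setLIntegral_congr_fun hS fun p hp => ?_
  have ht : 0 < p 2 := hSH hp
  simp only [Pi.mul_apply]
  congr 2
  rw [metric_eq_diagonal, Matrix.det_diagonal]
  simp only [Finset.prod_const, Finset.card_univ, Fintype.card_fin]
  rw [show (1 / p 2 ^ 2) ^ 3 = ((p 2)⁻¹ ^ 3) ^ 2 by field_simp, Real.sqrt_sq (by positivity)]

lemma act_injOn (γ : SL2C) : Set.InjOn (act γ) halfSpace := fun _ hp _ hq h => by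
  rw [← act_inv_act γ hp, h, act_inv_act γ hq]

lemma measurableSet_halfSpace : MeasurableSet halfSpace := isOpen_halfSpace.measurableSet

lemma measurableSet_act_image (γ : SL2C) {S : Set (Fin 3 → ℝ)} (hS : MeasurableSet S)
    (hSH : S ⊆ halfSpace) : MeasurableSet (act γ '' S) :=
  measurable_image_of_fderivWithin hS
    (fun _ hp => (differentiableAt_act γ (hSH hp)).hasFDerivAt.hasFDerivWithinAt)
    ((act_injOn γ).mono hSH)

/-- The hyperbolic volume is invariant under isometries. -/
lemma setLIntegral_act_image (γ : SL2C) {S : Set (Fin 3 → ℝ)} (hS : MeasurableSet S)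
    (hSH : S ⊆ halfSpace) (f : (Fin 3 → ℝ) → ℝ≥0∞) :
    ∫⁻ p in act γ '' S, f p ∂(riemVol metric) = ∫⁻ p in S, f (act γ p) ∂(riemVol metric) := by
  have him : act γ '' S ⊆ halfSpace := by
    rintro _ ⟨p, hp, rfl⟩; exact act_mem γ (hSH hp)
  rw [setLIntegral_riemVol hS hSH, setLIntegral_riemVol (measurableSet_act_image γ hS hSH) him,
    lintegral_image_eq_lintegral_abs_det_fderiv_mul volume hS
    (fun _ hp => (differentiableAt_act γ (hSH hp)).hasFDerivAt.hasFDerivWithinAt)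
    ((act_injOn γ).mono hSH)]
  refine setLIntegral_congr_fun hS fun p hp => ?_
  have ht : 0 < p 2 := hSH hp
  have ht' : 0 < act γ p 2 := act_mem γ (hSH hp)
  rw [abs_det_fderiv_act γ (hSH hp), ← mul_assoc, ← ENNReal.ofReal_mul (by
    have := conf_pos γ (hSH hp); positivity)]
  congr 2
  rw [conf]; field_simp

/-- The Euclidean ball about `x` with radius half the height of `x`. -/
def eBall (x : Fin 3 → ℝ) : Set (Fin 3 → ℝ) := {y | eDist y x < (x 2 / 2) ^ 2}

lemma isOpen_eBall (x : Fin 3 → ℝ) : IsOpen (eBall x) := by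
  unfold eBall eDist
  exact isOpen_lt (by fun_prop) continuous_const

lemma abs_sub_lt_of_mem_eBall {x y : Fin 3 → ℝ} (hx : x ∈ halfSpace) (hy : y ∈ eBall x)
    (i : Fin 3) : |y i - x i| < x 2 / 2 := by
  have ht : 0 < x 2 := hx
  have h1 : (y i - x i) ^ 2 < (x 2 / 2) ^ 2 :=
    lt_of_le_of_lt (Finset.single_le_sum (f := fun i => (y i - x i) ^ 2) (fun j _ => sq_nonneg _)
      (Finset.mem_univ i)) hy
  exact abs_lt_of_sq_lt_sq h1 (by positivity)

lemma height_of_mem_eBall {x y : Fin 3 → ℝ} (hx : x ∈ halfSpace) (hy : y ∈ eBall x) :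
    x 2 / 2 < y 2 ∧ y 2 < 3 / 2 * x 2 := by
  have := abs_lt.1 (abs_sub_lt_of_mem_eBall hx hy 2)
  constructor <;> linarith

lemma eBall_subset {x : Fin 3 → ℝ} (hx : x ∈ halfSpace) : eBall x ⊆ halfSpace := fun y hy => by
  have ht : 0 < x 2 := hx
  have := (height_of_mem_eBall hx hy).1
  show 0 < y 2
  linarith

lemma lintegral_comp_affine (x : Fin 3 → ℝ) {R : ℝ} (hR : 0 < R) (g : (Fin 3 → ℝ) → ℝ≥0∞) :
    ∫⁻ y, g (x + R • y) = ENNReal.ofReal (R⁻¹ ^ 3) * ∫⁻ y, g y := by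
  have h1 : ∫⁻ y, g (x + R • y) = ∫⁻ y, g (x + y) ∂(Measure.map (R • ·) volume) := by
    exact ((Homeomorph.smulOfNeZero R hR.ne').measurableEmbedding.lintegral_map
      (fun y => g (x + y))).symm
  rw [h1, Measure.map_addHaar_smul _ hR.ne', lintegral_smul_measure, lintegral_add_left_eq_self]
  simp [abs_of_pos hR]

lemma pd_comp_affine {f : (Fin 3 → ℝ) → ℝ} (x : Fin 3 → ℝ) (R : ℝ) {y : Fin 3 → ℝ}
    (hf : DifferentiableAt ℝ f (x + R • y)) (i : Fin 3) :
    pd i (fun y => f (x + R • y)) y = R * pd i f (x + R • y) := by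
  rw [pd_comp (φ := fun y => x + R • y) hf (by fun_prop)]
  have : ∀ j, pd i (fun y : Fin 3 → ℝ => (x + R • y) j) y = R * if j = i then 1 else 0 := by
    intro j
    simp only [Pi.add_apply, Pi.smul_apply, smul_eq_mul]
    rw [pd_add (by fun_prop) (by fun_prop), pd_const, pd_const_mul (by fun_prop), pd_proj, zero_add]
  simp only [this]
  simp [mul_comm]

/-- The local mean value inequality in upper half-space for functions with `t² Δ u ≥ - K u`
(Euclidean Laplacian); by scaling, the constant does not depend on the point. -/
lemma exists_mean_value {K : ℝ} (hK : 0 ≤ K) : ∃ C : ℝ, 0 < C ∧ ∀ u : (Fin 3 → ℝ) → ℝ,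
    ContDiffOn ℝ 2 u halfSpace → (∀ p ∈ halfSpace, 0 ≤ u p) →
    (∀ p ∈ halfSpace, -K * u p ≤ p 2 ^ 2 * ∑ k, pd k (pd k u) p) →
    ∀ x ∈ halfSpace, ENNReal.ofReal (u x) ≤
      ENNReal.ofReal C * ∫⁻ p in eBall x, ENNReal.ofReal (u p) ∂(riemVol metric) := by
  have hc0 : 0 < ∫ y, cut 2 y := by
    refine (continuous_cut 2).integral_pos_of_hasCompactSupport_nonneg_nonzero
      (hasCompactSupport_cut (by norm_num)) (cut_nonneg 2) (x := 0) ?_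
    simp [cut]
  set c0 := ∫ y, cut 2 y with hc0def
  refine ⟨Real.exp (K / 6) * 27 / c0, by positivity, fun u hu h0 hΔ x hx => ?_⟩
  have ht : 0 < x 2 := hx
  -- `y ↦ x + R y` maps the unit ball to `eBall x`
  set R := x 2 / 2 with hR
  have hRpos : 0 < R := by positivity
  -- a cutoff makes `u` globally defined, without changing it on the unit ball
  let η : ContDiffBump (0 : Fin 3 → ℝ) := ⟨1, 3 / 2, by norm_num, by norm_num⟩
  have hmem : ∀ y : Fin 3 → ℝ, ‖y‖ < 2 → x + R • y ∈ halfSpace := by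
    intro y hy
    have h1 : |y 2| < 2 := lt_of_le_of_lt (norm_le_pi_norm y 2) hy
    show 0 < (x + R • y) 2
    simp only [Pi.add_apply, Pi.smul_apply, smul_eq_mul]
    have := (abs_lt.1 h1).1
    nlinarith
  set v : (Fin 3 → ℝ) → ℝ := fun y => η y * u (x + R • y) with hv
  have hvs : HasCompactSupport v := η.hasCompactSupport.mul_right
  have hvc : ContDiff ℝ 2 v := by
    refine contDiff_iff_contDiffAt.2 fun y => ?_
    by_cases hy : ‖y‖ < 2
    · refine (η.contDiff.contDiffAt).mul ?_
      exact ContDiffAt.comp y (contDiffAt_of_halfSpace hu (hmem y hy))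
        (contDiffAt_const.add (contDiffAt_id.const_smul R))
    · have : y ∉ tsupport η := by
        rw [η.tsupport_eq, mem_closedBall_zero_iff]
        show ¬ ‖y‖ ≤ 3 / 2
        linarith [not_lt.1 hy]
      have h2 : v =ᶠ[𝓝 y] fun _ => 0 := by
        filter_upwards [notMem_tsupport_iff_eventuallyEq.1 this] with z hz
        simp [hv, hz]
      exact contDiffAt_const.congr_of_eventuallyEq h2
  have hnorm : ∀ y : Fin 3 → ℝ, ∑ i, y i ^ 2 < 1 → ‖y‖ < 1 := by
    intro y hy
    rw [pi_norm_lt_iff zero_lt_one]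
    intro i
    have h1 : y i ^ 2 < 1 ^ 2 := by
      rw [one_pow]
      exact lt_of_le_of_lt (Finset.single_le_sum (f := fun i => y i ^ 2) (fun j _ => sq_nonneg _)
        (Finset.mem_univ i)) hy
    exact abs_lt_of_sq_lt_sq h1 zero_le_one
  have heq : ∀ y : Fin 3 → ℝ, ‖y‖ < 1 → v y = u (x + R • y) := by
    intro y hy
    have : η y = 1 := η.one_of_mem_closedBall (by
      rw [mem_closedBall_zero_iff]; exact hy.le)
    simp [hv, this]
  have hev : ∀ y : Fin 3 → ℝ, ‖y‖ < 1 → v =ᶠ[𝓝 y] fun y => u (x + R • y) := by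
    intro y hy
    filter_upwards [(isOpen_lt continuous_norm continuous_const).mem_nhds hy] with z hz
    exact heq z hz
  have hpd : ∀ y : Fin 3 → ℝ, ‖y‖ < 1 → ∀ i, pd i v y = R * pd i u (x + R • y) := by
    intro y hy i
    rw [pd_congr (hev y hy)]
    exact pd_comp_affine x R ((contDiffAt_of_halfSpace hu (hmem y (by linarith))).differentiableAt
      (by norm_num)) i
  have hpd2 : ∀ y : Fin 3 → ℝ, ‖y‖ < 1 → ∀ i, pd i (pd i v) y = R * (R * pd i (pd i u) (x + R • y)) := by
    intro y hy i
    have h1 : pd i v =ᶠ[𝓝 y] fun y => R * pd i u (x + R • y) := by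
      filter_upwards [(isOpen_lt continuous_norm continuous_const).mem_nhds hy] with z hz
      exact hpd z hz i
    have hd := differentiableAt_pd (contDiffAt_of_halfSpace hu (hmem y (by linarith))) i
    have hd2 : DifferentiableAt ℝ (fun y => pd i u (x + R • y)) y :=
      hd.comp (f := fun y => x + R • y) y (by fun_prop)
    rw [pd_congr h1, pd_const_mul hd2, pd_comp_affine x R hd]
  have h0v : ∀ y, ∑ i, y i ^ 2 < 1 → 0 ≤ v y := fun y hy => by
    rw [heq y (hnorm y hy)]
    exact h0 _ (hmem y (by linarith [hnorm y hy]))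
  have hmv := mean_value_aux hvc hvs (k := K) hK h0v (fun y hy => by
    have hy1 := hnorm y hy
    have hm := hmem y (by linarith)
    have h1 := hΔ _ hm
    have h2 := h0 _ hm
    simp only [hpd2 y hy1, heq y hy1, ← Finset.mul_sum]
    -- heights in the ball are at least `R`, so the scaled Laplacian `R² Δ u` is controlled by
    -- `t² Δ u`
    have h3 : R ≤ (x + R • y) 2 := by
      have h1 : |y 2| < 1 := lt_of_le_of_lt (norm_le_pi_norm y 2) hy1
      simp only [Pi.add_apply, Pi.smul_apply, smul_eq_mul]
      have := (abs_lt.1 h1).1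
      nlinarith
    by_cases hs : 0 ≤ ∑ i, pd i (pd i u) (x + R • y)
    · have : 0 ≤ R * (R * ∑ i, pd i (pd i u) (x + R • y)) := by positivity
      have h4 : 0 ≤ K * u (x + R • y) := by positivity
      linarith
    · push Not at hs
      have h5 : R * R ≤ (x + R • y) 2 ^ 2 := by nlinarith
      have h6 : 0 ≤ K * u (x + R • y) := by positivity
      have h7 : (x + R • y) 2 ^ 2 * ∑ i, pd i (pd i u) (x + R • y) ≤
          R * R * ∑ i, pd i (pd i u) (x + R • y) := mul_le_mul_of_nonpos_right h5 hs.le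
      linarith)
  have hv0 : v 0 = u x := by rw [heq 0 (by simp)]; simp
  rw [hv0] at hmv
  have hnn : ∀ y, 0 ≤ v y * cut 2 y := by
    intro y
    by_cases hy : ∑ i, y i ^ 2 < 1
    · exact mul_nonneg (h0v y hy) (cut_nonneg 2 y)
    · rw [cut_eq_zero (by norm_num) (not_lt.1 hy)]; simp
  have hint : Integrable (fun y => v y * cut 2 y) :=
    (hvc.continuous.mul (continuous_cut 2)).integrable_of_hasCompactSupport hvs.mul_right
  -- the integral is bounded by the integral of `u` over the ball
  have hI : ENNReal.ofReal (∫ y, v y * cut 2 y) ≤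
      27 * ∫⁻ p in eBall x, ENNReal.ofReal (u p) ∂(riemVol metric) := by
    rw [ofReal_integral_eq_lintegral_ofReal hint (Eventually.of_forall hnn)]
    set g : (Fin 3 → ℝ) → ℝ≥0∞ := (eBall x).indicator fun p => ENNReal.ofReal (u p) with hg
    have hball : ∀ y : Fin 3 → ℝ, ∑ i, y i ^ 2 < 1 → x + R • y ∈ eBall x := by
      intro y hy
      show ∑ i, ((x + R • y) i - x i) ^ 2 < R ^ 2
      simp only [Pi.add_apply, Pi.smul_apply, smul_eq_mul, add_sub_cancel_left, mul_pow,
        ← Finset.mul_sum]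
      nlinarith [sq_pos_of_pos hRpos]
    calc ∫⁻ y, ENNReal.ofReal (v y * cut 2 y) ≤ ∫⁻ y, g (x + R • y) := by
          refine lintegral_mono fun y => ?_
          by_cases hy : ∑ i, y i ^ 2 < 1
          · rw [hg, Set.indicator_of_mem (hball y hy)]
            refine ENNReal.ofReal_le_ofReal ?_
            rw [← heq y (hnorm y hy)]
            exact mul_le_of_le_one_right (h0v y hy) (cut_le_one 2 y)
          · simp [cut_eq_zero (n := 2) (by norm_num) (not_lt.1 hy)]
      _ = ENNReal.ofReal (R⁻¹ ^ 3) * ∫⁻ p in eBall x, ENNReal.ofReal (u p) := by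
          rw [lintegral_comp_affine x hRpos, hg, lintegral_indicator (isOpen_eBall x).measurableSet]
      _ ≤ _ := by
          rw [setLIntegral_riemVol (isOpen_eBall x).measurableSet (eBall_subset hx),
            ← lintegral_const_mul' _ _ ENNReal.ofReal_ne_top, ← lintegral_const_mul' _ _ (by simp)]
          refine setLIntegral_mono' (isOpen_eBall x).measurableSet fun p hp => ?_
          rw [← mul_assoc]
          refine mul_le_mul_left ?_ _
          rw [show (27 : ℝ≥0∞) = ENNReal.ofReal 27 by simp, ← ENNReal.ofReal_mul (by norm_num)]
          refine ENNReal.ofReal_le_ofReal ?_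
          have h1 := height_of_mem_eBall hx hp
          have h2 : 0 < p 2 := by linarith
          -- heights in the ball are at most `3 R`, hence the factor `27` in the density
          have h3 : R⁻¹ ≤ 3 * (p 2)⁻¹ := by
            rw [← div_eq_mul_inv, inv_eq_one_div, div_le_div_iff₀ hRpos h2]
            rw [hR]; linarith
          calc R⁻¹ ^ 3 ≤ (3 * (p 2)⁻¹) ^ 3 := pow_le_pow_left₀ (by positivity) h3 3
            _ = _ := by ring
  calc ENNReal.ofReal (u x) ≤ ENNReal.ofReal (Real.exp (K / 6) / c0 * ∫ y, v y * cut 2 y) := by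
        refine ENNReal.ofReal_le_ofReal ?_
        rw [div_mul_eq_mul_div, le_div_iff₀ hc0]
        exact hmv
    _ = ENNReal.ofReal (Real.exp (K / 6) / c0) * ENNReal.ofReal (∫ y, v y * cut 2 y) :=
        ENNReal.ofReal_mul (by positivity)
    _ ≤ ENNReal.ofReal (Real.exp (K / 6) / c0) * (27 * _) := by gcongr
    _ = _ := by
        rw [← mul_assoc, show (27 : ℝ≥0∞) = ENNReal.ofReal 27 by simp,
          ← ENNReal.ofReal_mul (by positivity)]
        congr 2; ring

/-- The squared norm of an eigentensor is almost subharmonic. -/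
lemma IsFrameSol.laplacian_ge {m : Tensor2 3} (hm : IsFrameSol m) {p : Fin 3 → ℝ}
    (hp : p ∈ halfSpace) :
    -7 * sqNorm (m p) ≤ p 2 ^ 2 * ∑ k, pd k (pd k fun x => sqNorm (m x)) p := by
  have hd : ∀ i j, DifferentiableAt ℝ (fun x => m x i j) p :=
    fun i j => (hm.contDiffAt hp i j).differentiableAt (by norm_num)
  have hb := bochner hm hp
  rw [pd_sqNorm hd 2] at hb
  rw [Fin.sum_univ_three (f := fun k => sqNorm (fun i j => p 2 * pd k (fun x => m x i j) p +
    conn k (m p) i j))] at hb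
  have h0 := sqNorm_nonneg (fun i j => p 2 * pd 0 (fun x => m x i j) p + conn 0 (m p) i j)
  have h1 := sqNorm_nonneg (fun i j => p 2 * pd 1 (fun x => m x i j) p + conn 1 (m p) i j)
  simp only [conn_two, add_zero] at hb
  -- vertical covariant derivatives in the frame are plain derivatives; so the first order term of
  -- the Laplacian is absorbed by half of the vertical part of `|∇ m|²`
  have h2 : - sqNorm (m p) - sqNorm (fun i j => p 2 * pd 2 (fun x => m x i j) p) ≤
      2 * (p 2 * ∑ i, ∑ j, m p i j * pd 2 (fun x => m x i j) p) := by
    unfold sqNorm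
    simp only [Finset.mul_sum, ← Finset.sum_neg_distrib, ← Finset.sum_sub_distrib]
    refine Finset.sum_le_sum fun i _ => Finset.sum_le_sum fun j _ => ?_
    nlinarith [sq_nonneg (m p i j + p 2 * pd 2 (fun x => m x i j) p)]
  have h3 := sqNorm_nonneg (fun i j => p 2 * pd 2 (fun x => m x i j) p)
  have h4 := sq_nonneg (∑ k, m p k k)
  nlinarith

end Hyp3

/-! ### Integrals over the quotient -/

namespace Hyp3

lemma IsManifoldGroup.countable {Γ : Subgroup SL2C} (h : IsManifoldGroup Γ) : Countable Γ := by
  have := h.discrete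
  have h1 : SecondCountableTopology (Matrix (Fin 2) (Fin 2) ℂ) :=
    inferInstanceAs (SecondCountableTopology (Fin 2 → Fin 2 → ℂ))
  have h2 : SecondCountableTopology SL2C := Topology.IsEmbedding.subtypeVal.secondCountableTopology
  exact countable_of_Lindelof_of_discrete

lemma measurable_act (γ : SL2C) : Measurable (act γ) := by
  have hz : Measurable zco := (contDiff_zco (m := 0)).continuous.measurable
  have hN : Measurable (den γ) := (contDiff_den γ (m := 0)).continuous.measurable
  have h1 : Measurable fun p => zco (act γ p) := by
    simp only [zco_act]
    have hc : Measurable (starRingEnd ℂ : ℂ → ℂ) := Complex.continuous_conj.measurable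
    fun_prop
  have h2 : Measurable fun p => act γ p 2 := by
    simp only [act_two]; fun_prop
  refine measurable_pi_iff.2 fun i => ?_
  fin_cases i
  · exact Complex.measurable_re.comp h1
  · exact Complex.measurable_im.comp h1
  · exact h2

/-- A set whose points are pairwise inequivalent under `Γ`: it injects into the quotient. -/
def Injects (Γ : Subgroup SL2C) (S : Set (Fin 3 → ℝ)) : Prop :=
  ∀ p ∈ S, ∀ q ∈ S, SameOrbit Γ p q → p = q

/-- A function on upper half-space that descends to the quotient. -/
def InvariantFun (Γ : Subgroup SL2C) (f : (Fin 3 → ℝ) → ℝ≥0∞) : Prop :=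
  ∀ γ ∈ Γ, ∀ p ∈ halfSpace, f (act γ p) = f p

lemma le_quotLIntegral {Γ : Subgroup SL2C} {A S : Set (Fin 3 → ℝ)} (f : (Fin 3 → ℝ) → ℝ≥0∞)
    (hS : MeasurableSet S) (hSA : S ⊆ A ∩ halfSpace) (hinj : Injects Γ S) :
    ∫⁻ p in S, f p ∂(riemVol metric) ≤ quotLIntegral Γ A f :=
  le_iSup₂ (f := fun (S : Set (Fin 3 → ℝ)) (_ : MeasurableSet S ∧ S ⊆ A ∩ halfSpace ∧
      ∀ p ∈ S, ∀ q ∈ S, SameOrbit Γ p q → p = q) => ∫⁻ p in S, f p ∂(riemVol metric)) S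
    ⟨hS, hSA, hinj⟩

/-- An integral over a set that injects into the quotient is bounded by the integral over any set
that meets all the orbits involved. -/
lemma lintegral_le_of_injects {Γ : Subgroup SL2C} [Countable Γ] {S D : Set (Fin 3 → ℝ)}
    {f : (Fin 3 → ℝ) → ℝ≥0∞} (hf : InvariantFun Γ f) (hS : MeasurableSet S) (hSH : S ⊆ halfSpace)
    (hinj : Injects Γ S) (hD : MeasurableSet D)
    (hcov : ∀ p ∈ S, ∃ γ ∈ Γ, act γ p ∈ D) :
    ∫⁻ p in S, f p ∂(riemVol metric) ≤ ∫⁻ p in D, f p ∂(riemVol metric) := by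
  obtain ⟨e, he⟩ := exists_surjective_nat Γ
  -- the part of `S` that the `n`-th group element moves into `D`; the disjoint pieces have
  -- disjoint images, as `S` injects into the quotient
  set T : ℕ → Set (Fin 3 → ℝ) := fun n => S ∩ act (e n) ⁻¹' D with hT
  have hTm : ∀ n, MeasurableSet (T n) := fun n => hS.inter (measurable_act _ hD)
  have hdm : ∀ n, MeasurableSet (disjointed T n) := fun n => MeasurableSet.disjointed hTm n
  have hdT : ∀ n, disjointed T n ⊆ T n := disjointed_subset T
  have hU : S = ⋃ n, disjointed T n := by
    rw [iUnion_disjointed]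
    refine Set.Subset.antisymm (fun p hp => ?_) (Set.iUnion_subset fun n => Set.inter_subset_left)
    obtain ⟨γ, hγ, hp'⟩ := hcov p hp
    obtain ⟨n, hn⟩ := he ⟨γ, hγ⟩
    refine Set.mem_iUnion.2 ⟨n, hp, ?_⟩
    show act (e n) p ∈ D
    rw [hn]; exact hp'
  have hdH : ∀ n, disjointed T n ⊆ halfSpace := fun n => (hdT n).trans (Set.inter_subset_left.trans hSH)
  have hpiece : ∀ n, ∫⁻ p in disjointed T n, f p ∂(riemVol metric) =
      ∫⁻ p in act (e n) '' disjointed T n, f p ∂(riemVol metric) := by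
    intro n
    rw [setLIntegral_act_image _ (hdm n) (hdH n)]
    exact setLIntegral_congr_fun (hdm n) fun p hp => (hf _ (e n).2 p (hdH n hp)).symm
  calc ∫⁻ p in S, f p ∂(riemVol metric)
      = ∑' n, ∫⁻ p in disjointed T n, f p ∂(riemVol metric) := by
        conv_lhs => rw [hU]
        exact lintegral_iUnion hdm (disjoint_disjointed T) f
    _ = ∑' n, ∫⁻ p in act (e n) '' disjointed T n, f p ∂(riemVol metric) := by simp only [hpiece]
    _ = ∫⁻ p in ⋃ n, act (e n) '' disjointed T n, f p ∂(riemVol metric) := by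
        refine (lintegral_iUnion (fun n => measurableSet_act_image _ (hdm n) (hdH n)) ?_ f).symm
        intro n k hnk
        refine Set.disjoint_left.2 ?_
        rintro _ ⟨p, hp, rfl⟩ ⟨q, hq, hpq⟩
        have hpS : p ∈ S := (hdT n hp).1
        have hqS : q ∈ S := (hdT k hq).1
        have : p = q := by
          refine hinj p hpS q hqS ⟨(e k : SL2C)⁻¹ * e n, Γ.mul_mem (Γ.inv_mem (e k).2) (e n).2, ?_⟩
          rw [act_mul _ _ (hSH hpS), ← hpq, act_inv_act _ (hSH hqS)]
        subst this
        exact Set.disjoint_left.1 (disjoint_disjointed T hnk) hp hq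
    _ ≤ _ := by
        refine lintegral_mono_set (Set.iUnion_subset fun n => ?_)
        rintro _ ⟨p, hp, rfl⟩
        exact (hdT n hp).2

/-- If the points of `A` have at most `#s` equivalent points in `A`, the integral over `A` is at
most `#s` times the integral over the quotient. -/
lemma lintegral_le_card_mul_quot {Γ : Subgroup SL2C} {A : Set (Fin 3 → ℝ)} (s : Finset SL2C)
    {f : (Fin 3 → ℝ) → ℝ≥0∞} (hf : InvariantFun Γ f) (hA : MeasurableSet A) (hAH : A ⊆ halfSpace)
    (hs : ∀ σ ∈ s, σ ∈ Γ)
    (hmult : ∀ p ∈ A, ∀ γ ∈ Γ, act γ p ∈ A → ∃ σ ∈ s, act γ p = act σ p) :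
    ∫⁻ p in A, f p ∂(riemVol metric) ≤ s.card * quotLIntegral Γ Set.univ f := by
  classical
  -- every finite set of equivalent points has a first element for a measurable linear order
  set e := MeasureTheory.embeddingReal (Fin 3 → ℝ)
  have he := MeasureTheory.measurableEmbedding_embeddingReal (Fin 3 → ℝ)
  -- the points of `A` that come first in their orbits; they inject into the quotient, and the
  -- translates of this set by `s` cover `A`
  set A' : Set (Fin 3 → ℝ) := {p | p ∈ A ∧ ∀ σ ∈ s, act σ p ∈ A → e p ≤ e (act σ p)}
  have hA'm : MeasurableSet A' := by
    have : A' = A ∩ ⋂ σ ∈ s, ((act σ ⁻¹' A)ᶜ ∪ {p | e p ≤ e (act σ p)}) := by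
      ext p
      simp only [A', Set.mem_ofPred_eq, Set.mem_inter_iff, Set.mem_iInter, Set.mem_union,
        Set.mem_compl_iff, Set.mem_preimage, imp_iff_not_or]
    rw [this]
    refine hA.inter (Finset.measurableSet_biInter _ fun σ _ => ?_)
    exact (measurable_act σ hA).compl.union
      (measurableSet_le he.measurable (he.measurable.comp (measurable_act σ)))
  have hA'inj : Injects Γ A' := by
    have key : ∀ p ∈ A', ∀ q ∈ A', SameOrbit Γ p q → e p ≤ e q := by
      rintro p hp q hq ⟨γ, hγ, rfl⟩
      obtain ⟨σ, hσ, hσp⟩ := hmult p hp.1 γ hγ hq.1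
      rw [hσp]
      exact hp.2 σ hσ (hσp ▸ hq.1)
    intro p hp q hq hpq
    have hqp : SameOrbit Γ q p := by
      obtain ⟨γ, hγ, rfl⟩ := hpq
      exact ⟨γ⁻¹, Γ.inv_mem hγ, act_inv_act γ (hAH hp.1)⟩
    exact he.injective (le_antisymm (key p hp q hq hpq) (key q hq p hp hqp))
  have hcov : A ⊆ ⋃ σ ∈ s, (A ∩ act σ ⁻¹' A') := by
    intro p hp
    have hne : (s.filter fun σ => act σ p ∈ A).Nonempty := by
      obtain ⟨σ, hσ, hσp⟩ := hmult p hp 1 Γ.one_mem (by simpa using hp)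
      exact ⟨σ, Finset.mem_filter.2 ⟨hσ, by rw [← hσp]; simpa using hp⟩⟩
    obtain ⟨σ, hσ, hmin⟩ := Finset.exists_min_image _ (fun σ => e (act σ p)) hne
    rw [Finset.mem_filter] at hσ
    refine Set.mem_iUnion₂.2 ⟨σ, hσ.1, hp, hσ.2, fun τ hτ hτA => ?_⟩
    rw [← act_mul _ _ (hAH hp)] at hτA ⊢
    obtain ⟨ρ, hρ, hρp⟩ := hmult p hp _ (Γ.mul_mem (hs τ hτ) (hs σ hσ.1)) hτA
    rw [hρp] at hτA ⊢
    exact hmin ρ (Finset.mem_filter.2 ⟨hρ, hτA⟩)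
  have hpiece : ∀ σ ∈ s, ∫⁻ p in A ∩ act σ ⁻¹' A', f p ∂(riemVol metric) ≤
      quotLIntegral Γ Set.univ f := by
    intro σ hσ
    have hm : MeasurableSet (A ∩ act σ ⁻¹' A') := hA.inter (measurable_act σ hA'm)
    have hH : A ∩ act σ ⁻¹' A' ⊆ halfSpace := Set.inter_subset_left.trans hAH
    calc _ = ∫⁻ p in act σ '' (A ∩ act σ ⁻¹' A'), f p ∂(riemVol metric) := by
          rw [setLIntegral_act_image _ hm hH]
          exact setLIntegral_congr_fun hm fun p hp => (hf _ (hs σ hσ) p (hH hp)).symm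
      _ ≤ ∫⁻ p in A', f p ∂(riemVol metric) := by
          refine lintegral_mono_set ?_
          rintro _ ⟨p, hp, rfl⟩
          exact hp.2
      _ ≤ _ := le_quotLIntegral f hA'm (fun p hp => ⟨trivial, hAH hp.1⟩) hA'inj
  calc ∫⁻ p in A, f p ∂(riemVol metric)
      ≤ ∫⁻ p in ⋃ σ ∈ s, (A ∩ act σ ⁻¹' A'), f p ∂(riemVol metric) := lintegral_mono_set hcov
    _ ≤ ∑ σ ∈ s, ∫⁻ p in A ∩ act σ ⁻¹' A', f p ∂(riemVol metric) := by
        have h1 := lintegral_iUnion_le (μ := riemVol metric) (fun σ : s => A ∩ act (σ : SL2C) ⁻¹' A') f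
        rw [tsum_fintype, Finset.sum_coe_sort s
          (fun σ => ∫⁻ p in A ∩ act σ ⁻¹' A', f p ∂(riemVol metric))] at h1
        convert h1 using 3
        simp [Set.iUnion_subtype]
    _ ≤ ∑ σ ∈ s, quotLIntegral Γ Set.univ f := Finset.sum_le_sum hpiece
    _ = _ := by simp

lemma lintegral_fin_three {f : (Fin 3 → ℝ) → ℝ≥0∞} (hf : Measurable f) :
    ∫⁻ p, f p = ∫⁻ t, ∫⁻ x, ∫⁻ y, f ![x, y, t] := by
  have h1 := (volume_preserving_piFinSuccAbove (fun _ : Fin 3 => ℝ) 2).symm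
  rw [← h1.lintegral_comp hf, Measure.volume_eq_prod, lintegral_prod _ (by
    exact (hf.comp h1.measurable).aemeasurable)]
  congr 1; funext t
  have h2 := (volume_preserving_piFinTwo (fun _ : Fin 2 => ℝ)).symm
  have hm : Measurable fun q : Fin 2 → ℝ => f ((MeasurableEquiv.piFinSuccAbove (fun _ => ℝ) 2).symm (t, q)) :=
    (hf.comp h1.measurable).comp measurable_prodMk_left
  rw [← h2.lintegral_comp hm, Measure.volume_eq_prod, lintegral_prod _ (by
    exact (hm.comp h2.measurable).aemeasurable)]
  congr 1; funext x; congr 1; funext y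
  congr 1
  ext i
  fin_cases i <;> rfl

end Hyp3

/-! ### Volume of cusps and decay of the `L¹` norm -/

namespace Hyp3

/-- Two complex numbers that are linearly independent over `ℝ`: the oriented area of the
parallelogram that they span is not `0`. -/
def Indep (b₁ b₂ : ℂ) : Prop := ((starRingEnd ℂ) b₁ * b₂).im ≠ 0

lemma Indep.exists_coords {b₁ b₂ : ℂ} (h : Indep b₁ b₂) (z : ℂ) :
    ∃ s₁ s₂ : ℝ, z = s₁ * b₁ + s₂ * b₂ := by
  unfold Indep at h
  set D := ((starRingEnd ℂ) b₁ * b₂).im with hD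
  refine ⟨((starRingEnd ℂ) z * b₂).im / D, ((starRingEnd ℂ) b₁ * z).im / D, ?_⟩
  simp only [Complex.mul_im, Complex.conj_re, Complex.conj_im] at hD ⊢
  apply Complex.ext
  · simp; field_simp; rw [hD]; ring
  · simp; field_simp; rw [hD]; ring

/-- A subgroup that spans `ℂ` over `ℝ` contains two independent elements: otherwise it lies on a
line. -/
lemma exists_indep (Λ : Submodule ℤ ℂ) (h : Submodule.span ℝ (Λ : Set ℂ) = ⊤) :
    ∃ b₁ ∈ Λ, ∃ b₂ ∈ Λ, Indep b₁ b₂ := by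
  by_contra hcon
  push Not at hcon
  have h1 : ∃ b₁ ∈ Λ, b₁ ≠ 0 := by
    by_contra h0
    push Not at h0
    have : Submodule.span ℝ (Λ : Set ℂ) ≤ ⊥ := Submodule.span_le.2 fun x hx => by simp [h0 x hx]
    rw [h] at this
    exact one_ne_zero (α := ℂ) (by simpa using this (Submodule.mem_top : (1 : ℂ) ∈ ⊤))
  obtain ⟨b, hb, hb0⟩ := h1
  have h2 : Submodule.span ℝ (Λ : Set ℂ) ≤ LinearMap.ker (Complex.imLm ∘ₗ
      (LinearMap.mulLeft ℝ ((starRingEnd ℂ) b))) := Submodule.span_le.2 fun x hx => by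
    have := hcon b hb x hx
    unfold Indep at this
    push Not at this
    simpa using this
  rw [h] at h2
  have h3 := h2 (Submodule.mem_top : Complex.I * b ∈ ⊤)
  simp only [LinearMap.mem_ker, LinearMap.comp_apply, LinearMap.mulLeft_apply,
    Complex.imLm_coe] at h3
  rw [show (starRingEnd ℂ) b * (Complex.I * b) = Complex.I * (b * (starRingEnd ℂ) b) by ring,
    Complex.mul_conj] at h3
  simp at h3
  exact hb0 h3

/-- The cusp-shaped box `[-M, M]² × [T, ∞)`. -/
def cuspBox (M T : ℝ) : Set (Fin 3 → ℝ) := {p | |p 0| ≤ M ∧ |p 1| ≤ M ∧ T ≤ p 2}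

lemma measurableSet_cuspBox (M T : ℝ) : MeasurableSet (cuspBox M T) := by
  unfold cuspBox
  refine IsClosed.measurableSet ?_
  have h := fun i => continuous_apply (A := fun _ : Fin 3 => ℝ) i
  exact (isClosed_le (h 0).abs continuous_const).inter
    ((isClosed_le (h 1).abs continuous_const).inter (isClosed_le continuous_const (h 2)))

lemma cuspBox_subset {M T : ℝ} (hT : 0 < T) : cuspBox M T ⊆ halfSpace := fun p hp => by
  show 0 < p 2
  exact hT.trans_le hp.2.2

lemma lintegral_inv_pow_three {T : ℝ} (hT : 0 < T) :
    ∫⁻ t in Set.Ici T, ENNReal.ofReal (t⁻¹ ^ 3) = ENNReal.ofReal (T⁻¹ ^ 2 / 2) := by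
  rw [setLIntegral_congr (Ioi_ae_eq_Ici (a := T)).symm]
  have h1 := integral_Ioi_rpow_of_lt (a := (-3 : ℝ)) (by norm_num) hT
  have h2 := integrableOn_Ioi_rpow_of_lt (a := (-3 : ℝ)) (by norm_num) hT
  have h3 : ∀ t ∈ Set.Ioi T, t ^ (-3 : ℝ) = t⁻¹ ^ 3 := by
    intro t ht
    have : 0 < t := hT.trans ht
    rw [show (-3 : ℝ) = ((-3 : ℤ) : ℝ) by norm_num, Real.rpow_intCast]
    rw [_root_.zpow_neg, inv_pow]; norm_cast
  rw [← setLIntegral_congr_fun measurableSet_Ioi (f := fun t => ENNReal.ofReal (t ^ (-3 : ℝ)))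
    (fun t ht => by simp only [h3 t ht]),
    ← ofReal_integral_eq_lintegral_ofReal h2, h1]
  · congr 1
    have : T ^ (-3 + 1 : ℝ) = T⁻¹ ^ 2 := by
      rw [show (-3 + 1 : ℝ) = ((-2 : ℤ) : ℝ) by norm_num, Real.rpow_intCast]
      rw [_root_.zpow_neg, inv_pow]; norm_cast
    rw [this]; ring
  · filter_upwards [ae_restrict_mem measurableSet_Ioi] with t ht
    have : 0 < t := hT.trans ht
    positivity

lemma volume_cuspBox {M T : ℝ} (hT : 0 < T) :
    ∫⁻ _ in cuspBox M T, 1 ∂(riemVol metric) = ENNReal.ofReal (2 * M) ^ 2 * ENNReal.ofReal (T⁻¹ ^ 2 / 2) := by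
  rw [setLIntegral_riemVol (measurableSet_cuspBox M T) (cuspBox_subset hT),
    ← lintegral_indicator (measurableSet_cuspBox M T)]
  simp only [mul_one]
  rw [lintegral_fin_three (Measurable.indicator (by fun_prop) (measurableSet_cuspBox M T))]
  have h : ∀ x y t : ℝ, (cuspBox M T).indicator (fun p => ENNReal.ofReal ((p 2)⁻¹ ^ 3)) ![x, y, t] =
      (Set.Icc (-M) M).indicator 1 y * ((Set.Icc (-M) M).indicator 1 x *
      (Set.Ici T).indicator (fun t => ENNReal.ofReal (t⁻¹ ^ 3)) t) := by
    intro x y t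
    simp only [Set.indicator_apply, cuspBox, Set.mem_ofPred_eq, Set.mem_Icc, Set.mem_Ici, abs_le]
    simp only [Matrix.cons_val_zero, Matrix.cons_val_one, Matrix.cons_val]
    by_cases h1 : -M ≤ x ∧ x ≤ M <;> by_cases h2 : -M ≤ y ∧ y ≤ M <;> by_cases h3 : T ≤ t <;>
      simp [h1, h2, h3]
  simp only [h]
  have hI : ∫⁻ y, (Set.Icc (-M) M).indicator (1 : ℝ → ℝ≥0∞) y = ENNReal.ofReal (2 * M) := by
    rw [lintegral_indicator_one measurableSet_Icc, Real.volume_Icc]; congr 1; ring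
  have hm : Measurable ((Set.Icc (-M) M).indicator (1 : ℝ → ℝ≥0∞)) :=
    measurable_one.indicator measurableSet_Icc
  simp only [lintegral_mul_const _ hm, hI]
  simp only [lintegral_const_mul' _ _ ENNReal.ofReal_ne_top]
  simp only [lintegral_mul_const _ hm, hI]
  rw [lintegral_const_mul' _ _ ENNReal.ofReal_ne_top, lintegral_indicator measurableSet_Ici, lintegral_inv_pow_three hT, ← mul_assoc,
    sq (ENNReal.ofReal (2 * M))]

/-- Every point of `ℂ` is congruent to a point of a fixed square modulo a lattice. -/
lemma exists_box_rep {b₁ b₂ : ℂ} (h : Indep b₁ b₂) :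
    ∃ M : ℝ, 0 < M ∧ ∀ z : ℂ, ∃ n₁ n₂ : ℤ, |(z + (n₁ * b₁ + n₂ * b₂)).re| ≤ M ∧
      |(z + (n₁ * b₁ + n₂ * b₂)).im| ≤ M := by
  refine ⟨‖b₁‖ + ‖b₂‖ + 1, by positivity, fun z => ?_⟩
  obtain ⟨s₁, s₂, rfl⟩ := h.exists_coords z
  refine ⟨-⌊s₁⌋, -⌊s₂⌋, ?_⟩
  have h1 : (s₁ * b₁ + s₂ * b₂ + ((-⌊s₁⌋ : ℤ) * b₁ + (-⌊s₂⌋ : ℤ) * b₂) : ℂ) =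
      (Int.fract s₁ : ℝ) * b₁ + (Int.fract s₂ : ℝ) * b₂ := by
    simp only [Int.fract]; push_cast; ring
  have h2 : ‖((Int.fract s₁ : ℝ) * b₁ + (Int.fract s₂ : ℝ) * b₂ : ℂ)‖ ≤ ‖b₁‖ + ‖b₂‖ + 1 := by
    refine (norm_add_le _ _).trans ?_
    rw [norm_mul, norm_mul, Complex.norm_real, Complex.norm_real,
      Real.norm_of_nonneg (Int.fract_nonneg _), Real.norm_of_nonneg (Int.fract_nonneg _)]
    have a1 := Int.fract_lt_one s₁
    have a2 := Int.fract_lt_one s₂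
    have a3 := norm_nonneg b₁
    have a4 := norm_nonneg b₂
    nlinarith
  rw [h1]
  exact ⟨(Complex.abs_re_le_norm _).trans h2, (Complex.abs_im_le_norm _).trans h2⟩

lemma mkPt_mem (z : ℂ) {t : ℝ} (ht : 0 < t) : mkPt z t ∈ halfSpace := by
  show 0 < mkPt z t 2
  rwa [mkPt_two]

/-- The end of a family of cusps has volume `O(e^{-2r})`. -/
lemma exists_volume_region_le {Γ : Subgroup SL2C} [Countable Γ] (𝒞 : CuspFamily Γ) :
    ∃ C : ℝ, 0 < C ∧ ∀ r : ℝ, 0 ≤ r → ∀ S : Set (Fin 3 → ℝ), MeasurableSet S →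
      S ⊆ 𝒞.region r ∩ halfSpace → Injects Γ S →
      ∫⁻ _ in S, 1 ∂(riemVol metric) ≤ ENNReal.ofReal (C * Real.exp (-r) ^ 2) := by
  have hb : ∀ i, ∃ M : ℝ, 0 < M ∧ ∀ z : ℂ, ∃ w : ℂ, w - z ∈ 𝒞.Λ i ∧ |w.re| ≤ M ∧ |w.im| ≤ M := by
    intro i
    obtain ⟨b₁, h₁, b₂, h₂, hind⟩ := exists_indep _ (𝒞.spans i)
    obtain ⟨M, hM, hrep⟩ := exists_box_rep hind
    refine ⟨M, hM, fun z => ?_⟩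
    obtain ⟨n₁, n₂, h3⟩ := hrep z
    refine ⟨_, ?_, h3⟩
    rw [add_sub_cancel_left]
    have e1 := (𝒞.Λ i).smul_mem n₁ h₁
    have e2 := (𝒞.Λ i).smul_mem n₂ h₂
    rw [zsmul_eq_mul] at e1 e2
    exact (𝒞.Λ i).add_mem e1 e2
  choose M hM hrep using hb
  refine ⟨∑ i, (2 * M i) ^ 2 / 2 + 1, by positivity, fun r hr S hS hSr hinj => ?_⟩
  have hT : 0 < Real.exp r := Real.exp_pos r
  -- every cusp end is covered by the image of one box, because the lattice translations move any
  -- point above a fixed square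
  set D : Set (Fin 3 → ℝ) := ⋃ i, act (𝒞.κ i) '' cuspBox (M i) (Real.exp r)
  have hDm : MeasurableSet D := MeasurableSet.iUnion fun i =>
    measurableSet_act_image _ (measurableSet_cuspBox _ _) (cuspBox_subset hT)
  have h1 := lintegral_le_of_injects (f := fun _ => 1) (fun _ _ _ _ => rfl) hS
    (hSr.trans Set.inter_subset_right) hinj hDm (fun p hp => by
      obtain ⟨⟨i, z, s, hs, hzp⟩, hpH⟩ := hSr hp
      obtain ⟨w, hw, hwM⟩ := hrep i z
      obtain ⟨γ, hγ, hγp⟩ := hzp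
      obtain ⟨η, hη, hηw⟩ := ((𝒞.embedded i z w s s (hr.trans hs) (hr.trans hs)).2 ⟨rfl, hw⟩)
      refine ⟨η * γ⁻¹, Γ.mul_mem hη (Γ.inv_mem hγ), Set.mem_iUnion.2 ⟨i, mkPt w (Real.exp s), ?_, ?_⟩⟩
      · refine ⟨hwM.1, hwM.2, ?_⟩
        rw [mkPt_two]; exact Real.exp_le_exp.2 hs
      · rw [← hγp, act_mul _ _ (act_mem _ (act_mem _ (mkPt_mem z (Real.exp_pos s)))),
          act_inv_act _ (act_mem _ (mkPt_mem z (Real.exp_pos s))), hηw])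
  refine h1.trans ?_
  calc ∫⁻ _ in D, 1 ∂(riemVol metric)
      ≤ ∑ i, ∫⁻ _ in act (𝒞.κ i) '' cuspBox (M i) (Real.exp r), 1 ∂(riemVol metric) := by
        have := lintegral_iUnion_le (μ := riemVol metric)
          (fun i => act (𝒞.κ i) '' cuspBox (M i) (Real.exp r)) (fun _ => 1)
        rwa [tsum_fintype] at this
    _ = ∑ i, ENNReal.ofReal ((2 * M i) ^ 2 / 2 * Real.exp (-r) ^ 2) := by
        refine Finset.sum_congr rfl fun i _ => ?_
        rw [setLIntegral_act_image _ (measurableSet_cuspBox _ _) (cuspBox_subset hT),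
          volume_cuspBox hT, ← ENNReal.ofReal_pow (by have := hM i; positivity),
          ← ENNReal.ofReal_mul (by positivity), Real.exp_neg]
        congr 1; ring
    _ ≤ _ := by
        rw [← ENNReal.ofReal_sum_of_nonneg (fun i _ => by positivity)]
        refine ENNReal.ofReal_le_ofReal ?_
        rw [← Finset.sum_mul]
        exact mul_le_mul_of_nonneg_right (by linarith) (by positivity)

lemma normSq2_nonneg {l : Tensor2 3} {p : Fin 3 → ℝ} (hp : p ∈ halfSpace) :
    0 ≤ normSq2 metric l p := by
  rw [normSq2_metric hp]; positivity

lemma contDiffOn_normSq2 {l : Tensor2 3} (h : IsSol l) :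
    ContDiffOn ℝ 2 (normSq2 metric l) halfSpace :=
  (contDiffOn_sqNorm h.isFrameSol).congr fun _ hp => normSq2_eq_sqNorm hp

/-- Cauchy–Schwarz on the end of the cusps, whose volume is `O(e^{-2r})`. -/
lemma L1normOn_region_le {Γ : Subgroup SL2C} [Countable Γ] (𝒞 : CuspFamily Γ) :
    ∃ C : ℝ, 0 < C ∧ ∀ l : Tensor2 3, IsEigentensor Γ l → ∀ r : ℝ, 0 ≤ r →
      L1normOn Γ (𝒞.region r) l ≤ ENNReal.ofReal (C * Real.exp (-1 * r)) * L2norm Γ l := by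
  obtain ⟨C, hC, hvol⟩ := exists_volume_region_le 𝒞
  refine ⟨Real.sqrt C, Real.sqrt_pos.2 hC, fun l hl r hr => ?_⟩
  refine iSup₂_le fun S hS => ?_
  obtain ⟨hSm, hSr, hinj⟩ := hS
  have hSH : S ⊆ halfSpace := hSr.trans Set.inter_subset_right
  have hc : ContinuousOn (normSq2 metric l) halfSpace := (contDiffOn_normSq2 hl.isSol).continuousOn
  have hmeas : AEMeasurable (fun p => ENNReal.ofReal (norm2 metric l p)) ((riemVol metric).restrict S) := by
    have h1 : AEMeasurable (normSq2 metric l) ((riemVol metric).restrict S) :=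
      (hc.mono hSH).aemeasurable hSm
    exact (Real.continuous_sqrt.measurable.comp_aemeasurable h1).ennreal_ofReal
  have hCS := ENNReal.lintegral_mul_le_Lp_mul_Lq ((riemVol metric).restrict S)
    (Real.HolderConjugate.two_two) (f := fun _ => (1 : ℝ≥0∞)) aemeasurable_const hmeas
  simp only [Pi.mul_apply, one_mul, ENNReal.one_rpow] at hCS
  refine hCS.trans (mul_le_mul' ?_ ?_)
  · calc (∫⁻ _ in S, 1 ∂(riemVol metric)) ^ (1 / 2 : ℝ)
        ≤ (ENNReal.ofReal (C * Real.exp (-r) ^ 2)) ^ (1 / 2 : ℝ) :=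
          ENNReal.rpow_le_rpow (hvol r hr S hSm hSr hinj) (by norm_num)
      _ = _ := by
          rw [ENNReal.ofReal_rpow_of_nonneg (by positivity) (by norm_num), ← Real.sqrt_eq_rpow,
            Real.sqrt_mul hC.le, Real.sqrt_sq (Real.exp_pos _).le]
          norm_num
  · refine ENNReal.rpow_le_rpow ?_ (by norm_num)
    refine le_trans (le_of_eq ?_) (le_quotLIntegral (A := Set.univ)
      (fun p => ENNReal.ofReal (normSq2 metric l p)) hSm (fun p hp => ⟨trivial, hSH hp⟩) hinj)
    refine setLIntegral_congr_fun hSm fun p hp => ?_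
    rw [norm2, ENNReal.ofReal_rpow_of_nonneg (Real.sqrt_nonneg _) (by norm_num)]
    congr 1
    rw [Real.rpow_two, Real.sq_sqrt (normSq2_nonneg (hSH hp))]

lemma L2norm_lt_top {Γ : Subgroup SL2C} {l : Tensor2 3} (h : IsEigentensor Γ l) :
    L2norm Γ l < ∞ := by
  refine ENNReal.rpow_lt_top_of_nonneg (by norm_num) (ne_of_lt (lt_of_le_of_lt ?_ h.memH1))
  refine iSup₂_mono fun S hS => ?_
  refine setLIntegral_mono' hS.1 fun p hp => ENNReal.ofReal_le_ofReal ?_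
  have := normSq3_metric_nonneg (T := cov2 metric l) (hS.2.1 hp).2
  linarith

end Hyp3

/-! ### Means over horizontal tori -/

namespace Hyp3

/-- The point of height `t` over `s₁ b₁ + s₂ b₂`. -/
def latPt (b₁ b₂ : ℂ) (s : ℝ × ℝ) (t : ℝ) : Fin 3 → ℝ :=
  ![s.1 * b₁.re + s.2 * b₂.re, s.1 * b₁.im + s.2 * b₂.im, t]

/-- The unit square, the parameter domain of the torus `ℂ / (ℤ b₁ + ℤ b₂)`. -/
def unitSq : Set (ℝ × ℝ) := Set.Icc 0 1 ×ˢ Set.Icc 0 1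

/-- The mean of `f` over the horizontal torus of height `t`. -/
noncomputable def torusMean (b₁ b₂ : ℂ) (f : (Fin 3 → ℝ) → ℝ) (t : ℝ) : ℝ :=
  ∫ s in unitSq, f (latPt b₁ b₂ s t)

/-- Horizontal translation by `b`. -/
def shift (b : ℂ) : Fin 3 → ℝ := ![b.re, b.im, 0]

/-- Invariance under the horizontal translation by `b`. -/
def PeriodicIn (b : ℂ) (f : (Fin 3 → ℝ) → ℝ) : Prop := ∀ p ∈ halfSpace, f (shift b + p) = f p

lemma latPt_mem (b₁ b₂ : ℂ) (s : ℝ × ℝ) {t : ℝ} (ht : 0 < t) : latPt b₁ b₂ s t ∈ halfSpace := by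
  show 0 < latPt b₁ b₂ s t 2
  simpa [latPt] using ht

lemma contDiff_latPt (b₁ b₂ : ℂ) {n : WithTop ℕ∞} :
    ContDiff ℝ n (fun q : (ℝ × ℝ) × ℝ => latPt b₁ b₂ q.1 q.2) := by
  unfold latPt
  rw [contDiff_pi]
  intro i
  fin_cases i <;> simp <;> fun_prop

lemma isCompact_unitSq : IsCompact unitSq := isCompact_Icc.prod isCompact_Icc

lemma measurableSet_unitSq : MeasurableSet unitSq := measurableSet_Icc.prod measurableSet_Icc

lemma volume_unitSq : (volume : Measure (ℝ × ℝ)) unitSq = 1 := by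
  rw [unitSq, Measure.volume_eq_prod, Measure.prod_prod]; simp

instance : IsProbabilityMeasure ((volume : Measure (ℝ × ℝ)).restrict unitSq) :=
  ⟨by rw [Measure.restrict_apply_univ, volume_unitSq]⟩

lemma continuousOn_comp_latPt (b₁ b₂ : ℂ) {f : (Fin 3 → ℝ) → ℝ} (hf : ContinuousOn f halfSpace) :
    ContinuousOn (fun q : (ℝ × ℝ) × ℝ => f (latPt b₁ b₂ q.1 q.2)) (Set.univ ×ˢ Set.Ioi 0) :=
  hf.comp (contDiff_latPt b₁ b₂ (n := 0)).continuous.continuousOn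
    fun q hq => latPt_mem b₁ b₂ q.1 hq.2

lemma continuous_comp_latPt (b₁ b₂ : ℂ) {f : (Fin 3 → ℝ) → ℝ} (hf : ContinuousOn f halfSpace)
    {t : ℝ} (ht : 0 < t) : Continuous fun s : ℝ × ℝ => f (latPt b₁ b₂ s t) :=
  (continuousOn_comp_latPt b₁ b₂ hf).comp_continuous (f := fun s : ℝ × ℝ => (s, t))
    (by fun_prop) fun _ => ⟨trivial, ht⟩

lemma integrable_comp_latPt (b₁ b₂ : ℂ) {f : (Fin 3 → ℝ) → ℝ} (hf : ContinuousOn f halfSpace)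
    {t : ℝ} (ht : 0 < t) :
    Integrable (fun s : ℝ × ℝ => f (latPt b₁ b₂ s t)) (volume.restrict unitSq) :=
  (continuous_comp_latPt b₁ b₂ hf ht).continuousOn.integrableOn_compact isCompact_unitSq

lemma continuousOn_of_contDiffAt {f : (Fin 3 → ℝ) → ℝ} {n : WithTop ℕ∞}
    (h : ∀ p ∈ halfSpace, ContDiffAt ℝ n f p) : ContinuousOn f halfSpace :=
  fun p hp => (h p hp).continuousAt.continuousWithinAt

lemma hasDerivAt_latPt_height (b₁ b₂ : ℂ) {f : (Fin 3 → ℝ) → ℝ} (s : ℝ × ℝ) {t : ℝ}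
    (h : DifferentiableAt ℝ f (latPt b₁ b₂ s t)) :
    HasDerivAt (fun t => f (latPt b₁ b₂ s t)) (pd 2 f (latPt b₁ b₂ s t)) t := by
  have h1 : HasDerivAt (fun t => latPt b₁ b₂ s t) (Pi.single 2 1) t := by
    rw [hasDerivAt_pi]
    intro i
    fin_cases i
    · simpa [latPt, Pi.single_apply] using hasDerivAt_const t (s.1 * b₁.re + s.2 * b₂.re)
    · simpa [latPt, Pi.single_apply] using hasDerivAt_const t (s.1 * b₁.im + s.2 * b₂.im)
    · simpa [latPt] using hasDerivAt_id' t
  exact h.hasFDerivAt.comp_hasDerivAt t h1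

/-- Differentiation of the mean over horizontal tori with respect to the height. -/
lemma hasDerivAt_torusMean (b₁ b₂ : ℂ) {f : (Fin 3 → ℝ) → ℝ}
    (hf : ∀ p ∈ halfSpace, ContDiffAt ℝ 1 f p) {t : ℝ} (ht : 0 < t) :
    HasDerivAt (torusMean b₁ b₂ f) (torusMean b₁ b₂ (pd 2 f) t) t := by
  have hfc := continuousOn_of_contDiffAt hf
  have hpc : ContinuousOn (pd 2 f) halfSpace := continuousOn_of_contDiffAt (n := 0)
    fun p hp => contDiffAt_pd (hf p hp) (by norm_num) 2
  have hK : IsCompact (unitSq ×ˢ Set.Icc (t / 2) (3 / 2 * t)) := isCompact_unitSq.prod isCompact_Icc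
  obtain ⟨C, hC⟩ := hK.exists_bound_of_continuousOn ((continuousOn_comp_latPt b₁ b₂ hpc).mono
    (fun q hq => ⟨trivial, lt_of_lt_of_le (by positivity) hq.2.1⟩))
  have hpos : ∀ x ∈ Set.Icc (t / 2) (3 / 2 * t), 0 < x := fun x hx =>
    lt_of_lt_of_le (by positivity) hx.1
  have hnhds : Set.Icc (t / 2) (3 / 2 * t) ∈ 𝓝 t := Icc_mem_nhds (by linarith) (by linarith)
  refine (hasDerivAt_integral_of_dominated_loc_of_deriv_le (μ := volume.restrict unitSq)
    (F := fun t s => f (latPt b₁ b₂ s t)) (F' := fun t s => pd 2 f (latPt b₁ b₂ s t))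
    (bound := fun _ => C) hnhds ?_ (integrable_comp_latPt b₁ b₂ hfc ht)
    (integrable_comp_latPt b₁ b₂ hpc ht).aestronglyMeasurable ?_ (integrable_const C) ?_).2
  · filter_upwards [hnhds] with x hx
    exact (integrable_comp_latPt b₁ b₂ hfc (hpos x hx)).aestronglyMeasurable
  · filter_upwards [ae_restrict_mem measurableSet_unitSq] with s hs x hx
    exact hC (s, x) ⟨hs, hx⟩
  · refine Eventually.of_forall fun s x hx => ?_
    exact hasDerivAt_latPt_height b₁ b₂ s
      ((hf _ (latPt_mem b₁ b₂ s (hpos x hx))).differentiableAt (by norm_num))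

lemma torusMean_add (b₁ b₂ : ℂ) {f g : (Fin 3 → ℝ) → ℝ} (hf : ContinuousOn f halfSpace)
    (hg : ContinuousOn g halfSpace) {t : ℝ} (ht : 0 < t) :
    torusMean b₁ b₂ (fun p => f p + g p) t = torusMean b₁ b₂ f t + torusMean b₁ b₂ g t :=
  integral_add (integrable_comp_latPt b₁ b₂ hf ht) (integrable_comp_latPt b₁ b₂ hg ht)

lemma torusMean_sub (b₁ b₂ : ℂ) {f g : (Fin 3 → ℝ) → ℝ} (hf : ContinuousOn f halfSpace)
    (hg : ContinuousOn g halfSpace) {t : ℝ} (ht : 0 < t) :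
    torusMean b₁ b₂ (fun p => f p - g p) t = torusMean b₁ b₂ f t - torusMean b₁ b₂ g t :=
  integral_sub (integrable_comp_latPt b₁ b₂ hf ht) (integrable_comp_latPt b₁ b₂ hg ht)

lemma torusMean_const_mul (b₁ b₂ : ℂ) (f : (Fin 3 → ℝ) → ℝ) (c t : ℝ) :
    torusMean b₁ b₂ (fun p => c * f p) t = c * torusMean b₁ b₂ f t :=
  integral_const_mul _ _

lemma torusMean_sum (b₁ b₂ : ℂ) {ι : Type*} {S : Finset ι} {f : ι → (Fin 3 → ℝ) → ℝ}
    (hf : ∀ i ∈ S, ContinuousOn (f i) halfSpace) {t : ℝ} (ht : 0 < t) :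
    torusMean b₁ b₂ (fun p => ∑ i ∈ S, f i p) t = ∑ i ∈ S, torusMean b₁ b₂ (f i) t :=
  integral_finsetSum S fun i hi => integrable_comp_latPt b₁ b₂ (hf i hi) ht

lemma torusMean_const (b₁ b₂ : ℂ) (c t : ℝ) : torusMean b₁ b₂ (fun _ => c) t = c := by
  simp [torusMean]

lemma torusMean_mono (b₁ b₂ : ℂ) {f g : (Fin 3 → ℝ) → ℝ} (hf : ContinuousOn f halfSpace)
    (hg : ContinuousOn g halfSpace) {t : ℝ} (ht : 0 < t) (h : ∀ p : Fin 3 → ℝ, p 2 = t → f p ≤ g p) :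
    torusMean b₁ b₂ f t ≤ torusMean b₁ b₂ g t :=
  integral_mono (integrable_comp_latPt b₁ b₂ hf ht) (integrable_comp_latPt b₁ b₂ hg ht)
    fun s => h _ (by simp [latPt])

/-- The mean only depends on the values at the given height. -/
lemma torusMean_congr (b₁ b₂ : ℂ) {f g : (Fin 3 → ℝ) → ℝ} {t : ℝ}
    (h : ∀ p : Fin 3 → ℝ, p 2 = t → f p = g p) : torusMean b₁ b₂ f t = torusMean b₁ b₂ g t := by
  unfold torusMean
  congr 1; funext s
  exact h _ (by simp [latPt])

/-- The variance is nonnegative. -/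
lemma sq_integral_le {α : Type*} [MeasurableSpace α] {μ : Measure α} [IsProbabilityMeasure μ]
    {f : α → ℝ} (hf : Integrable f μ) (hf2 : Integrable (fun x => f x ^ 2) μ) :
    (∫ x, f x ∂μ) ^ 2 ≤ ∫ x, f x ^ 2 ∂μ := by
  set c := ∫ x, f x ∂μ with hc
  have h1 : 0 ≤ ∫ x, (f x - c) ^ 2 ∂μ := integral_nonneg fun x => sq_nonneg _
  have h2 : ∫ x, (f x - c) ^ 2 ∂μ = ∫ x, f x ^ 2 ∂μ - c ^ 2 := by
    have : ∀ x, (f x - c) ^ 2 = f x ^ 2 - 2 * c * f x + c ^ 2 := fun x => by ring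
    simp only [this]
    have i1 : Integrable (fun x => 2 * c * f x) μ := hf.const_mul _
    have i2 : Integrable (fun x => f x ^ 2 - 2 * c * f x) μ := hf2.sub i1
    rw [integral_add i2 (integrable_const _), integral_sub hf2 i1, integral_const_mul, ← hc]
    simp; ring
  linarith

lemma sq_torusMean_le (b₁ b₂ : ℂ) {f : (Fin 3 → ℝ) → ℝ} (hf : ContinuousOn f halfSpace) {t : ℝ}
    (ht : 0 < t) : torusMean b₁ b₂ f t ^ 2 ≤ torusMean b₁ b₂ (fun p => f p ^ 2) t :=
  sq_integral_le (integrable_comp_latPt b₁ b₂ hf ht) (integrable_comp_latPt b₁ b₂ (hf.pow 2) ht)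

/-- The horizontal derivative in the direction `b`. -/
noncomputable def hd (b : ℂ) (f : (Fin 3 → ℝ) → ℝ) (p : Fin 3 → ℝ) : ℝ :=
  b.re * pd 0 f p + b.im * pd 1 f p

lemma continuousOn_hd (b : ℂ) {f : (Fin 3 → ℝ) → ℝ} (hf : ∀ p ∈ halfSpace, ContDiffAt ℝ 1 f p) :
    ContinuousOn (hd b f) halfSpace := by
  have hpc : ∀ k, ContinuousOn (pd k f) halfSpace := fun k => continuousOn_of_contDiffAt (n := 0)
    fun p hp => contDiffAt_pd (hf p hp) (by norm_num) k
  exact (continuousOn_const.mul (hpc 0)).add (continuousOn_const.mul (hpc 1))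

lemma hasDerivAt_latPt_fst (b₁ b₂ : ℂ) {f : (Fin 3 → ℝ) → ℝ} (x y t : ℝ)
    (h : DifferentiableAt ℝ f (latPt b₁ b₂ (x, y) t)) :
    HasDerivAt (fun x => f (latPt b₁ b₂ (x, y) t)) (hd b₁ f (latPt b₁ b₂ (x, y) t)) x := by
  have h1 : HasDerivAt (fun x => latPt b₁ b₂ (x, y) t) (shift b₁) x := by
    rw [hasDerivAt_pi]
    intro i
    fin_cases i
    · simpa [latPt, shift] using ((hasDerivAt_id x).mul_const b₁.re).add_const (y * b₂.re)
    · simpa [latPt, shift] using ((hasDerivAt_id x).mul_const b₁.im).add_const (y * b₂.im)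
    · simpa [latPt, shift] using hasDerivAt_const x t
  have h2 := h.hasFDerivAt.comp_hasDerivAt x h1
  rw [fderiv_apply_eq_sum_pd] at h2
  have h3 : ∑ k, shift b₁ k * pd k f (latPt b₁ b₂ (x, y) t) = hd b₁ f (latPt b₁ b₂ (x, y) t) := by
    simp [Fin.sum_univ_three, shift, hd]
  rw [h3] at h2
  exact h2

lemma hasDerivAt_latPt_snd (b₁ b₂ : ℂ) {f : (Fin 3 → ℝ) → ℝ} (x y t : ℝ)
    (h : DifferentiableAt ℝ f (latPt b₁ b₂ (x, y) t)) :
    HasDerivAt (fun y => f (latPt b₁ b₂ (x, y) t)) (hd b₂ f (latPt b₁ b₂ (x, y) t)) y := by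
  have h1 : HasDerivAt (fun y => latPt b₁ b₂ (x, y) t) (shift b₂) y := by
    rw [hasDerivAt_pi]
    intro i
    fin_cases i
    · simpa [latPt, shift] using ((hasDerivAt_id y).mul_const b₂.re).const_add (x * b₁.re)
    · simpa [latPt, shift] using ((hasDerivAt_id y).mul_const b₂.im).const_add (x * b₁.im)
    · simpa [latPt, shift] using hasDerivAt_const y t
  have h2 := h.hasFDerivAt.comp_hasDerivAt y h1
  rw [fderiv_apply_eq_sum_pd] at h2
  have h3 : ∑ k, shift b₂ k * pd k f (latPt b₁ b₂ (x, y) t) = hd b₂ f (latPt b₁ b₂ (x, y) t) := by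
    simp [Fin.sum_univ_three, shift, hd]
  rw [h3] at h2
  exact h2

lemma torusMean_eq_intervalIntegral (b₁ b₂ : ℂ) {f : (Fin 3 → ℝ) → ℝ}
    (hf : ContinuousOn f halfSpace) {t : ℝ} (ht : 0 < t) :
    torusMean b₁ b₂ f t = ∫ x in (0 : ℝ)..1, ∫ y in (0 : ℝ)..1, f (latPt b₁ b₂ (x, y) t) := by
  have h := integrable_comp_latPt b₁ b₂ hf ht
  unfold torusMean unitSq at *
  rw [Measure.volume_eq_prod] at h ⊢
  rw [setIntegral_prod _ h]
  simp only [intervalIntegral.integral_of_le zero_le_one, integral_Icc_eq_integral_Ioc]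

lemma torusMean_eq_intervalIntegral_swap (b₁ b₂ : ℂ) {f : (Fin 3 → ℝ) → ℝ}
    (hf : ContinuousOn f halfSpace) {t : ℝ} (ht : 0 < t) :
    torusMean b₁ b₂ f t = ∫ y in (0 : ℝ)..1, ∫ x in (0 : ℝ)..1, f (latPt b₁ b₂ (x, y) t) := by
  have h := integrable_comp_latPt b₁ b₂ hf ht
  unfold torusMean unitSq at *
  rw [Measure.volume_eq_prod] at h ⊢
  rw [← Measure.prod_restrict] at h ⊢
  rw [integral_prod_symm _ h]
  simp only [intervalIntegral.integral_of_le zero_le_one, integral_Icc_eq_integral_Ioc]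

/-- The derivative of a periodic function integrates to zero over a period. -/
lemma torusMean_hd_fst (b₁ b₂ : ℂ) {f : (Fin 3 → ℝ) → ℝ} (hf : ∀ p ∈ halfSpace, ContDiffAt ℝ 1 f p)
    (hp : PeriodicIn b₁ f) {t : ℝ} (ht : 0 < t) : torusMean b₁ b₂ (hd b₁ f) t = 0 := by
  have hc := continuousOn_hd b₁ hf
  rw [torusMean_eq_intervalIntegral_swap b₁ b₂ hc ht]
  have : ∀ y, ∫ x in (0 : ℝ)..1, hd b₁ f (latPt b₁ b₂ (x, y) t) = 0 := by
    intro y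
    rw [intervalIntegral.integral_eq_sub_of_hasDerivAt (f := fun x => f (latPt b₁ b₂ (x, y) t))
      (fun x _ => hasDerivAt_latPt_fst b₁ b₂ x y t
        ((hf _ (latPt_mem b₁ b₂ _ ht)).differentiableAt (by norm_num)))
      (((continuous_comp_latPt b₁ b₂ hc ht).comp (by fun_prop : Continuous fun x : ℝ => (x, y))).intervalIntegrable _ _)]
    have h1 : latPt b₁ b₂ (1, y) t = shift b₁ + latPt b₁ b₂ (0, y) t := by
      ext i; fin_cases i <;> simp [latPt, shift]
    simp only [h1, hp _ (latPt_mem b₁ b₂ _ ht), sub_self]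
  simp [this]

lemma torusMean_hd_snd (b₁ b₂ : ℂ) {f : (Fin 3 → ℝ) → ℝ} (hf : ∀ p ∈ halfSpace, ContDiffAt ℝ 1 f p)
    (hp : PeriodicIn b₂ f) {t : ℝ} (ht : 0 < t) : torusMean b₁ b₂ (hd b₂ f) t = 0 := by
  have hc := continuousOn_hd b₂ hf
  rw [torusMean_eq_intervalIntegral b₁ b₂ hc ht]
  have : ∀ x, ∫ y in (0 : ℝ)..1, hd b₂ f (latPt b₁ b₂ (x, y) t) = 0 := by
    intro x
    rw [intervalIntegral.integral_eq_sub_of_hasDerivAt (f := fun y => f (latPt b₁ b₂ (x, y) t))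
      (fun y _ => hasDerivAt_latPt_snd b₁ b₂ x y t
        ((hf _ (latPt_mem b₁ b₂ _ ht)).differentiableAt (by norm_num)))
      (((continuous_comp_latPt b₁ b₂ hc ht).comp (by fun_prop : Continuous fun y : ℝ => (x, y))).intervalIntegrable _ _)]
    have h1 : latPt b₁ b₂ (x, 1) t = shift b₂ + latPt b₁ b₂ (x, 0) t := by
      ext i; fin_cases i <;> simp [latPt, shift] <;> ring
    simp only [h1, hp _ (latPt_mem b₁ b₂ _ ht), sub_self]
  simp [this]

/-- The horizontal derivatives of a function on the torus have mean zero. -/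
lemma torusMean_pd (b₁ b₂ : ℂ) (hb : Indep b₁ b₂) {f : (Fin 3 → ℝ) → ℝ}
    (hf : ∀ p ∈ halfSpace, ContDiffAt ℝ 1 f p) (hp₁ : PeriodicIn b₁ f) (hp₂ : PeriodicIn b₂ f)
    {t : ℝ} (ht : 0 < t) : torusMean b₁ b₂ (pd 0 f) t = 0 ∧ torusMean b₁ b₂ (pd 1 f) t = 0 := by
  have hpc : ∀ k, ContinuousOn (pd k f) halfSpace := fun k => continuousOn_of_contDiffAt (n := 0)
    fun p hp => contDiffAt_pd (hf p hp) (by norm_num) k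
  have key : ∀ b : ℂ, torusMean b₁ b₂ (hd b f) t =
      b.re * torusMean b₁ b₂ (pd 0 f) t + b.im * torusMean b₁ b₂ (pd 1 f) t := by
    intro b
    rw [← torusMean_const_mul, ← torusMean_const_mul]
    exact torusMean_add b₁ b₂ (continuousOn_const.mul (hpc 0)) (continuousOn_const.mul (hpc 1)) ht
  have e1 := torusMean_hd_fst b₁ b₂ hf hp₁ ht
  have e2 := torusMean_hd_snd b₁ b₂ hf hp₂ ht
  rw [key] at e1 e2
  unfold Indep at hb
  simp only [Complex.mul_im, Complex.conj_re, Complex.conj_im] at hb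
  constructor
  · have : (b₁.re * b₂.im + -b₁.im * b₂.re) * torusMean b₁ b₂ (pd 0 f) t = 0 := by
      linear_combination b₂.im * e1 - b₁.im * e2
    exact (mul_eq_zero.1 this).resolve_left hb
  · have : (b₁.re * b₂.im + -b₁.im * b₂.re) * torusMean b₁ b₂ (pd 1 f) t = 0 := by
      linear_combination b₁.re * e2 - b₂.re * e1
    exact (mul_eq_zero.1 this).resolve_left hb

lemma PeriodicIn.pd {b : ℂ} {f : (Fin 3 → ℝ) → ℝ} (h : PeriodicIn b f)
    (hf : ∀ p ∈ halfSpace, DifferentiableAt ℝ f p) (k : Fin 3) : PeriodicIn b (pd k f) := by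
  intro p hp
  have hmem : ∀ q ∈ halfSpace, shift b + q ∈ halfSpace := fun q hq => by
    show 0 < (shift b + q) 2
    have : 0 < q 2 := hq
    simpa [shift] using this
  have h1 : (fun q => f (shift b + (1 : ℝ) • q)) =ᶠ[𝓝 p] f := by
    filter_upwards [isOpen_halfSpace.mem_nhds hp] with q hq
    rw [one_smul]; exact h q hq
  have h2 := pd_comp_affine (f := f) (shift b) 1 (y := p) (by rw [one_smul]; exact hf _ (hmem p hp)) k
  rw [one_smul, one_mul] at h2
  rw [← h2]
  exact pd_congr h1 k

/-- The one-dimensional form of the Poincaré inequality. -/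
lemma sq_sub_le_integral {φ φ' : ℝ → ℝ} (h : ∀ x, HasDerivAt φ (φ' x) x) (hc : Continuous φ')
    {a b : ℝ} (ha : a ∈ Set.Icc (0 : ℝ) 1) (hb : b ∈ Set.Icc (0 : ℝ) 1) :
    (φ a - φ b) ^ 2 ≤ ∫ x in (0 : ℝ)..1, φ' x ^ 2 := by
  have h1 : φ a - φ b = ∫ x in b..a, φ' x :=
    (intervalIntegral.integral_eq_sub_of_hasDerivAt (fun x _ => h x) (hc.intervalIntegrable _ _)).symm
  have h2 : |φ a - φ b| ≤ ∫ x in (0 : ℝ)..1, |φ' x| := by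
    rw [h1, intervalIntegral.integral_of_le zero_le_one]
    refine (intervalIntegral.norm_integral_le_integral_norm_uIoc (f := φ') (μ := volume)).trans ?_
    refine setIntegral_mono_set (f := fun x => |φ' x|) ?_ (Eventually.of_forall fun x => abs_nonneg _)
      (LE.le.eventuallyLE fun x hx => ?_)
    · exact (hc.abs.continuousOn.integrableOn_compact isCompact_Icc).mono_set
        Set.Ioc_subset_Icc_self
    · exact ⟨(le_min hb.1 ha.1).trans_lt hx.1, hx.2.trans (max_le hb.2 ha.2)⟩
  have h3 : (∫ x in (0 : ℝ)..1, |φ' x|) ^ 2 ≤ ∫ x in (0 : ℝ)..1, φ' x ^ 2 := by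
    rw [intervalIntegral.integral_of_le zero_le_one, intervalIntegral.integral_of_le zero_le_one]
    have : IsProbabilityMeasure (volume.restrict (Set.Ioc (0 : ℝ) 1)) := ⟨by simp⟩
    have i1 : IntegrableOn (fun x => |φ' x|) (Set.Ioc 0 1) :=
      (hc.abs.continuousOn.integrableOn_compact isCompact_Icc).mono_set Set.Ioc_subset_Icc_self
    have i2 : IntegrableOn (fun x => |φ' x| ^ 2) (Set.Ioc 0 1) :=
      ((hc.abs.pow 2).continuousOn.integrableOn_compact isCompact_Icc).mono_set Set.Ioc_subset_Icc_self
    have := sq_integral_le (μ := volume.restrict (Set.Ioc (0 : ℝ) 1)) (f := fun x => |φ' x|) i1 i2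
    simpa only [sq_abs] using this
  rw [← sq_abs]
  exact (pow_le_pow_left₀ (abs_nonneg _) h2 2).trans h3

end Hyp3

/-! ### The Poincaré inequality on tori and two ordinary differential inequalities -/

namespace Hyp3

/-- The Poincaré inequality on a horizontal torus. -/
lemma torusMean_sub_sq_le (b₁ b₂ : ℂ) {f : (Fin 3 → ℝ) → ℝ}
    (hf : ∀ p ∈ halfSpace, ContDiffAt ℝ 1 f p) {t : ℝ} (ht : 0 < t) :
    torusMean b₁ b₂ (fun p => (f p - torusMean b₁ b₂ f t) ^ 2) t ≤
      2 * torusMean b₁ b₂ (fun p => hd b₁ f p ^ 2) t +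
      2 * torusMean b₁ b₂ (fun p => hd b₂ f p ^ 2) t := by
  have hfc := continuousOn_of_contDiffAt hf
  set c := torusMean b₁ b₂ f t with hc
  have h1c := continuousOn_hd b₁ hf
  have h2c := continuousOn_hd b₂ hf
  set g : ℝ × ℝ → ℝ := fun s => f (latPt b₁ b₂ s t) with hg
  set g₁ : ℝ × ℝ → ℝ := fun s => hd b₁ f (latPt b₁ b₂ s t) with hg₁
  set g₂ : ℝ × ℝ → ℝ := fun s => hd b₂ f (latPt b₁ b₂ s t) with hg₂
  have hgc : Continuous g := continuous_comp_latPt b₁ b₂ hfc ht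
  have hg₁c : Continuous g₁ := continuous_comp_latPt b₁ b₂ h1c ht
  have hg₂c : Continuous g₂ := continuous_comp_latPt b₁ b₂ h2c ht
  have hd₁ : ∀ x y, HasDerivAt (fun x => g (x, y)) (g₁ (x, y)) x := fun x y =>
    hasDerivAt_latPt_fst b₁ b₂ x y t ((hf _ (latPt_mem b₁ b₂ _ ht)).differentiableAt (by norm_num))
  have hd₂ : ∀ x y, HasDerivAt (fun y => g (x, y)) (g₂ (x, y)) y := fun x y =>
    hasDerivAt_latPt_snd b₁ b₂ x y t ((hf _ (latPt_mem b₁ b₂ _ ht)).differentiableAt (by norm_num))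
  set A : ℝ → ℝ := fun y => ∫ x in (0 : ℝ)..1, g₁ (x, y) ^ 2 with hA
  set B : ℝ → ℝ := fun x => ∫ y in (0 : ℝ)..1, g₂ (x, y) ^ 2 with hB
  have hAc : Continuous A := intervalIntegral.continuous_parametric_intervalIntegral_of_continuous'
    (f := fun y x => g₁ (x, y) ^ 2) (by fun_prop) 0 1
  have hBc : Continuous B := intervalIntegral.continuous_parametric_intervalIntegral_of_continuous'
    (f := fun x y => g₂ (x, y) ^ 2) (by fun_prop) 0 1
  have hint : ∀ {φ : ℝ × ℝ → ℝ}, Continuous φ → Integrable φ (volume.restrict unitSq) :=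
    fun hφ => hφ.continuousOn.integrableOn_compact isCompact_unitSq
  have hIA : ∫ s in unitSq, A s.2 = torusMean b₁ b₂ (fun p => hd b₁ f p ^ 2) t := by
    rw [torusMean_eq_intervalIntegral_swap b₁ b₂ (f := fun p => hd b₁ f p ^ 2) (h1c.pow 2) ht]
    have h : Integrable (fun s : ℝ × ℝ => A s.2) (volume.restrict unitSq) := hint (by fun_prop)
    unfold unitSq at *
    rw [Measure.volume_eq_prod] at h ⊢
    rw [setIntegral_prod _ h]
    simp [hA, hg₁, integral_Icc_eq_integral_Ioc, intervalIntegral.integral_of_le zero_le_one]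
  have hIB : ∫ s in unitSq, B s.1 = torusMean b₁ b₂ (fun p => hd b₂ f p ^ 2) t := by
    rw [torusMean_eq_intervalIntegral b₁ b₂ (f := fun p => hd b₂ f p ^ 2) (h2c.pow 2) ht]
    have h : Integrable (fun s : ℝ × ℝ => B s.1) (volume.restrict unitSq) := hint (by fun_prop)
    unfold unitSq at *
    rw [Measure.volume_eq_prod] at h ⊢
    rw [setIntegral_prod _ h]
    simp [hB, hg₂, integral_Icc_eq_integral_Ioc, intervalIntegral.integral_of_le zero_le_one]
  -- two points are joined by a path in the direction `b₁`, followed by a path in the direction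
  -- `b₂`
  have hpt : ∀ s ∈ unitSq, (g s - c) ^ 2 ≤ 2 * A s.2 +
      2 * torusMean b₁ b₂ (fun p => hd b₂ f p ^ 2) t := by
    intro s hs
    have e1 : g s - c = ∫ s' in unitSq, (g s - g s') := by
      rw [integral_sub (integrable_const _) (hint hgc)]
      simp [hc, torusMean, hg]
    have e2 : (g s - c) ^ 2 ≤ ∫ s' in unitSq, (g s - g s') ^ 2 := by
      rw [e1]
      exact sq_integral_le (hint (by fun_prop)) (hint (by fun_prop))
    have e3 : ∫ s' in unitSq, (g s - g s') ^ 2 ≤ ∫ s' in unitSq, (2 * A s.2 + 2 * B s'.1) := by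
      refine setIntegral_mono_on (hint (by fun_prop)) (hint (by fun_prop)) measurableSet_unitSq ?_
      intro s' hs'
      have a1 : (g (s.1, s.2) - g (s'.1, s.2)) ^ 2 ≤ A s.2 :=
        sq_sub_le_integral (φ := fun x => g (x, s.2)) (fun x => hd₁ x s.2) (by fun_prop) hs.1 hs'.1
      have a2 : (g (s'.1, s.2) - g (s'.1, s'.2)) ^ 2 ≤ B s'.1 :=
        sq_sub_le_integral (φ := fun y => g (s'.1, y)) (fun y => hd₂ s'.1 y) (by fun_prop)
          hs.2 hs'.2
      show (g (s.1, s.2) - g (s'.1, s'.2)) ^ 2 ≤ _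
      nlinarith [sq_nonneg (g (s.1, s.2) - g (s'.1, s.2) - (g (s'.1, s.2) - g (s'.1, s'.2)))]
    have e4 : ∫ s' in unitSq, (2 * A s.2 + 2 * B s'.1) = 2 * A s.2 +
        2 * torusMean b₁ b₂ (fun p => hd b₂ f p ^ 2) t := by
      rw [integral_add (integrable_const _) (hint (by fun_prop)), integral_const_mul 2 fun a : ℝ × ℝ => B a.1, hIB]
      simp
    linarith
  calc torusMean b₁ b₂ (fun p => (f p - c) ^ 2) t = ∫ s in unitSq, (g s - c) ^ 2 := rfl
    _ ≤ ∫ s in unitSq, (2 * A s.2 + 2 * torusMean b₁ b₂ (fun p => hd b₂ f p ^ 2) t) :=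
        setIntegral_mono_on (hint (by fun_prop)) (hint (by fun_prop)) measurableSet_unitSq hpt
    _ = _ := by
        rw [integral_add (hint (by fun_prop)) (integrable_const _), integral_const_mul, hIA]
        simp

lemma hd_sq_le (b : ℂ) (f : (Fin 3 → ℝ) → ℝ) (p : Fin 3 → ℝ) :
    hd b f p ^ 2 ≤ ‖b‖ ^ 2 * (pd 0 f p ^ 2 + pd 1 f p ^ 2) := by
  rw [Complex.sq_norm, Complex.normSq_apply, hd]
  nlinarith [sq_nonneg (b.re * pd 1 f p - b.im * pd 0 f p)]

lemma torusMean_sub_sq_le_pd (b₁ b₂ : ℂ) {f : (Fin 3 → ℝ) → ℝ}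
    (hf : ∀ p ∈ halfSpace, ContDiffAt ℝ 1 f p) {t : ℝ} (ht : 0 < t) :
    torusMean b₁ b₂ (fun p => (f p - torusMean b₁ b₂ f t) ^ 2) t ≤
      2 * (‖b₁‖ ^ 2 + ‖b₂‖ ^ 2) *
        torusMean b₁ b₂ (fun p => pd 0 f p ^ 2 + pd 1 f p ^ 2) t := by
  have hpc : ∀ k, ContinuousOn (pd k f) halfSpace := fun k => continuousOn_of_contDiffAt (n := 0)
    fun p hp => contDiffAt_pd (hf p hp) (by norm_num) k
  have h : ∀ b, torusMean b₁ b₂ (fun p => hd b f p ^ 2) t ≤ ‖b‖ ^ 2 *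
      torusMean b₁ b₂ (fun p => pd 0 f p ^ 2 + pd 1 f p ^ 2) t := fun b => by
    rw [← torusMean_const_mul]
    exact torusMean_mono b₁ b₂ ((continuousOn_hd b hf).pow 2)
      (continuousOn_const.mul (((hpc 0).pow 2).add ((hpc 1).pow 2))) ht fun p _ => hd_sq_le b f p
  have h1 := torusMean_sub_sq_le b₁ b₂ hf ht
  nlinarith [h b₁, h b₂]

/-- The integral of `ε / t` at infinity diverges; lower bounds of this form exclude growing
solutions. -/
lemma lintegral_div_eq_top {k : ℝ → ℝ} {ε T : ℝ} (hε : 0 < ε) (hk : ∀ t ≥ T, ε * t⁻¹ ≤ k t)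
    (S : ℝ) : ∫⁻ t in Set.Ioi S, ENNReal.ofReal (k t) = ∞ := by
  set R := max (max T S) 1 with hR
  have hR1 : 1 ≤ R := le_max_right _ _
  have h1 : ∫⁻ t in Set.Ioi R, ENNReal.ofReal (ε * t⁻¹) = ∞ := by
    by_contra hne
    refine not_integrableOn_Ioi_inv (a := R) ?_
    have h2 : IntegrableOn (fun t => ε * t⁻¹) (Set.Ioi R) := by
      refine (lintegral_ofReal_ne_top_iff_integrable (by fun_prop) ?_).1 hne
      filter_upwards [ae_restrict_mem measurableSet_Ioi] with t ht
      have : 0 < t := lt_of_lt_of_le (by positivity) ht.le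
      positivity
    have h3 := h2.const_mul ε⁻¹
    simp only [← mul_assoc, inv_mul_cancel₀ hε.ne', one_mul] at h3
    exact h3
  rw [eq_top_iff, ← h1]
  refine (lintegral_mono_set (Set.Ioi_subset_Ioi ((le_max_right T S).trans (le_max_left _ _)))).trans'
    (setLIntegral_mono' measurableSet_Ioi fun t ht => ENNReal.ofReal_le_ofReal (hk t ?_))
  exact ((le_max_left T S).trans (le_max_left _ _)).trans (le_of_lt ht)

/-- The solutions `t (E log t + d)` of the Euler equation `t² A'' - t A' + A = 0` are not square
integrable for the weight `t⁻³`, unless they vanish. -/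
lemma eq_zero_of_euler {A A' A'' : ℝ → ℝ} (h1 : ∀ t > 0, HasDerivAt A (A' t) t)
    (h2 : ∀ t > 0, HasDerivAt A' (A'' t) t) (h : ∀ t > 0, t ^ 2 * A'' t - t * A' t + A t = 0) {S : ℝ}
    (hfin : ∫⁻ t in Set.Ioi S, ENNReal.ofReal (A t ^ 2 * t⁻¹ ^ 3) ≠ ∞) : ∀ t > 0, A t = 0 := by
  have hconst : ∀ {φ : ℝ → ℝ}, (∀ t > 0, HasDerivAt φ 0 t) → ∀ t > 0, φ t = φ 1 := by
    intro φ hφ t ht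
    refine (convex_Ioi (0 : ℝ)).is_const_of_fderivWithin_eq_zero (𝕜 := ℝ)
      (fun x hx => (hφ x hx).differentiableAt.differentiableWithinAt) (fun x hx => ?_) ht (Set.mem_Ioi.2 one_pos)
    rw [fderivWithin_of_isOpen isOpen_Ioi hx, (hφ x hx).hasFDerivAt.fderiv]
    ext; simp
  -- two first integrals of the equation
  obtain ⟨E, hE⟩ : ∃ E, ∀ t > 0, A' t - A t * t⁻¹ = E := by
    refine ⟨_, hconst (φ := fun t => A' t - A t * t⁻¹) fun t ht => ?_⟩
    refine ((h2 t ht).sub ((h1 t ht).mul (hasDerivAt_inv ht.ne'))).congr_deriv ?_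
    have := h t ht
    field_simp
    linarith
  obtain ⟨d, hd⟩ : ∃ d, ∀ t > 0, A t * t⁻¹ - E * Real.log t = d := by
    refine ⟨_, hconst (φ := fun t => A t * t⁻¹ - E * Real.log t) fun t ht => ?_⟩
    refine (((h1 t ht).mul (hasDerivAt_inv ht.ne')).sub
      ((Real.hasDerivAt_log ht.ne').const_mul E)).congr_deriv ?_
    rw [← hE t ht]
    field_simp
    ring
  have hsol : ∀ t > 0, A t = t * (E * Real.log t + d) := fun t ht => by
    rw [← hd t ht]; field_simp; ring
  -- the weight turns the square of the solution into `(E log t + d)² / t`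
  have hno : ∀ ε > 0, ¬ ∀ᶠ t in atTop, ε ≤ |E * Real.log t + d| := by
    intro ε hε hev
    obtain ⟨T, hT⟩ := eventually_atTop.1 (hev.and (eventually_gt_atTop 0))
    refine hfin (lintegral_div_eq_top (ε := ε ^ 2) (T := T) (by positivity) (fun t ht => ?_) S)
    obtain ⟨a, b⟩ := hT t ht
    rw [hsol t b]
    have : ε ^ 2 ≤ (E * Real.log t + d) ^ 2 := by rw [← sq_abs (E * Real.log t + d)]; gcongr
    calc ε ^ 2 * t⁻¹ ≤ (E * Real.log t + d) ^ 2 * t⁻¹ := by gcongr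
      _ = _ := by field_simp
  have hE0 : E = 0 := by
    by_contra hE0
    refine hno 1 one_pos ?_
    have hlog : Tendsto (fun t => |E| * Real.log t - |d|) atTop atTop :=
      tendsto_atTop_add_const_right _ _ (Real.tendsto_log_atTop.const_mul_atTop (abs_pos.2 hE0))
    filter_upwards [hlog.eventually_ge_atTop 1, eventually_ge_atTop 1] with t ht ht1
    have a1 : |E * Real.log t| = |E| * Real.log t := by
      rw [abs_mul, abs_of_nonneg (Real.log_nonneg ht1)]
    have a2 := abs_sub_abs_le_abs_sub (E * Real.log t) (-d)
    rw [abs_neg, sub_neg_eq_add] at a2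
    linarith
  have hd0 : d = 0 := by
    by_contra hd0
    refine hno |d| (abs_pos.2 hd0) (Eventually.of_forall fun t => by rw [hE0]; simp)
  intro t ht
  rw [hsol t ht, hE0, hd0]; ring

/-- A nonnegative function with `(y' / t)' ≥ 0` that is integrable for the weight `t⁻³` is
nonincreasing: otherwise it would grow like `t²`. -/
lemma antitoneOn_of_weighted_convex {y y' y'' : ℝ → ℝ} {T S : ℝ} (hT : 0 < T)
    (h1 : ∀ t > 0, HasDerivAt y (y' t) t) (h2 : ∀ t > 0, HasDerivAt y' (y'' t) t)
    (h0 : ∀ t > 0, 0 ≤ y t) (h : ∀ t ≥ T, 0 ≤ t ^ 2 * y'' t - t * y' t)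
    (hfin : ∫⁻ t in Set.Ioi S, ENNReal.ofReal (y t * t⁻¹ ^ 3) ≠ ∞) : AntitoneOn y (Set.Ici T) := by
  have hpos : ∀ t ∈ Set.Ici T, 0 < t := fun t ht => hT.trans_le ht
  have hw : ∀ t > 0, HasDerivAt (fun t => y' t * t⁻¹) (y'' t * t⁻¹ + y' t * (-(t ^ 2)⁻¹)) t :=
    fun t ht => (h2 t ht).mul (hasDerivAt_inv ht.ne')
  have hmono : MonotoneOn (fun t => y' t * t⁻¹) (Set.Ici T) := by
    refine monotoneOn_of_deriv_nonneg (convex_Ici T)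
      (fun t ht => (hw t (hpos t ht)).continuousAt.continuousWithinAt)
      (fun t ht => (hw t (hpos t (interior_subset ht))).differentiableAt.differentiableWithinAt)
      fun t ht => ?_
    have ht0 := hpos t (interior_subset ht)
    rw [(hw t ht0).deriv]
    have e : y'' t * t⁻¹ + y' t * (-(t ^ 2)⁻¹) = (t ^ 2 * y'' t - t * y' t) * t⁻¹ ^ 3 := by
      field_simp
      ring
    rw [e]
    exact mul_nonneg (h t (interior_subset ht)) (by positivity)
  have hneg : ∀ t ≥ T, y' t ≤ 0 := by
    intro t₁ ht₁
    by_contra hcon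
    push Not at hcon
    have hp₁ := hpos t₁ ht₁
    set ε := y' t₁ * t₁⁻¹ with hε
    have hε0 : 0 < ε := by positivity
    -- if `y' / t ≥ ε > 0` from `t₁` on, then `y - ε t² / 2` increases
    have hm2 : MonotoneOn (fun t => y t - ε / 2 * t ^ 2) (Set.Ici t₁) := by
      have hder : ∀ t > 0, HasDerivAt (fun t => y t - ε / 2 * t ^ 2) (y' t - ε * t) t := by
        intro t ht
        refine ((h1 t ht).sub ((hasDerivAt_pow 2 t).const_mul (ε / 2))).congr_deriv ?_
        simp; ring
      refine monotoneOn_of_deriv_nonneg (convex_Ici t₁)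
        (fun t ht => (hder t (hp₁.trans_le ht)).continuousAt.continuousWithinAt)
        (fun t ht => (hder t (hp₁.trans_le (interior_subset ht : t ∈ Set.Ici t₁))).differentiableAt.differentiableWithinAt)
        fun t ht => ?_
      have htt : t₁ ≤ t := (interior_subset ht : t ∈ Set.Ici t₁)
      have ht0 := hp₁.trans_le htt
      rw [(hder t ht0).deriv]
      have : ε ≤ y' t * t⁻¹ := hmono ht₁ (show T ≤ t from le_trans ht₁ htt) htt
      have := mul_le_mul_of_nonneg_right this ht0.le
      rw [mul_assoc (y' t), inv_mul_cancel₀ ht0.ne', mul_one] at this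
      linarith
    refine hfin (lintegral_div_eq_top (ε := ε / 4) (T := 2 * t₁) (by positivity) (fun t ht => ?_) S)
    have ht' : t₁ ≤ t := by linarith
    have ht0 : 0 < t := by linarith
    have h3 := hm2 (Set.self_mem_Ici (a := t₁)) ht' ht'
    have h4 := h0 t₁ hp₁
    simp only at h3
    have h5 : ε / 4 * t ^ 2 ≤ y t := by nlinarith [mul_nonneg hε0.le (sub_nonneg.2 (pow_le_pow_left₀ (by linarith) ht 2))]
    calc ε / 4 * t⁻¹ = ε / 4 * t ^ 2 * t⁻¹ ^ 3 := by field_simp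
      _ ≤ _ := by gcongr
  refine antitoneOn_of_deriv_nonpos (convex_Ici T)
    (fun t ht => (h1 t (hpos t ht)).continuousAt.continuousWithinAt)
    (fun t ht => (h1 t (hpos t (interior_subset ht))).differentiableAt.differentiableWithinAt)
    fun t ht => ?_
  rw [(h1 t (hpos t (interior_subset ht))).deriv]
  exact hneg t (interior_subset ht)

end Hyp3

/-! ### Means of solutions in a cusp -/

namespace Hyp3

lemma torusMean_linearComb (b₁ b₂ : ℂ) {ι : Type*} [Fintype ι] (c : ι → ℝ)
    {F : ι → (Fin 3 → ℝ) → ℝ} (hF : ∀ i, ContinuousOn (F i) halfSpace) {t : ℝ} (ht : 0 < t) :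
    torusMean b₁ b₂ (fun p => ∑ i, c i * F i p) t = ∑ i, c i * torusMean b₁ b₂ (F i) t := by
  rw [torusMean_sum b₁ b₂ (f := fun i p => c i * F i p) (fun i _ => continuousOn_const.mul (hF i)) ht]
  simp only [torusMean_const_mul]

lemma contDiffAt_one_pd {f : (Fin 3 → ℝ) → ℝ} (hf : ∀ p ∈ halfSpace, ContDiffAt ℝ 2 f p)
    (k : Fin 3) : ∀ p ∈ halfSpace, ContDiffAt ℝ 1 (pd k f) p :=
  fun p hp => contDiffAt_pd (hf p hp) (by norm_num) k

lemma continuousOn_pd {f : (Fin 3 → ℝ) → ℝ} (hf : ∀ p ∈ halfSpace, ContDiffAt ℝ 1 f p)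
    (k : Fin 3) : ContinuousOn (pd k f) halfSpace :=
  continuousOn_of_contDiffAt (n := 0) fun p hp => contDiffAt_pd (hf p hp) (by norm_num) k

lemma torusMean_pd_pd (b₁ b₂ : ℂ) (hb : Indep b₁ b₂) {f : (Fin 3 → ℝ) → ℝ}
    (hf : ∀ p ∈ halfSpace, ContDiffAt ℝ 2 f p) (hp₁ : PeriodicIn b₁ f) (hp₂ : PeriodicIn b₂ f)
    {t : ℝ} (ht : 0 < t) :
    torusMean b₁ b₂ (pd 0 (pd 0 f)) t = 0 ∧ torusMean b₁ b₂ (pd 1 (pd 1 f)) t = 0 := by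
  have hd : ∀ p ∈ halfSpace, DifferentiableAt ℝ f p := fun p hp =>
    (hf p hp).differentiableAt (by norm_num)
  exact ⟨(torusMean_pd b₁ b₂ hb (contDiffAt_one_pd hf 0) (hp₁.pd hd 0) (hp₂.pd hd 0) ht).1,
    (torusMean_pd b₁ b₂ hb (contDiffAt_one_pd hf 1) (hp₁.pd hd 1) (hp₂.pd hd 1) ht).2⟩

/-- A solution of the eigenvalue equation that is periodic under a lattice of horizontal
translations, in frame components. -/
structure IsCuspSol (b₁ b₂ : ℂ) (m : Tensor2 3) : Prop extends IsFrameSol m where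
  periodic₁ : ∀ i j, PeriodicIn b₁ fun x => m x i j
  periodic₂ : ∀ i j, PeriodicIn b₂ fun x => m x i j

lemma PeriodicIn.const_mul {b : ℂ} {f : (Fin 3 → ℝ) → ℝ} (hf : PeriodicIn b f) (c : ℝ) :
    PeriodicIn b fun x => c * f x := fun p hp => by simp only [hf p hp]

lemma PeriodicIn.sub {b : ℂ} {f g : (Fin 3 → ℝ) → ℝ} (hf : PeriodicIn b f) (hg : PeriodicIn b g) :
    PeriodicIn b fun x => f x - g x := fun p hp => by simp only [hf p hp, hg p hp]

/-- If the mean value of `f` is governed by the Euler operator up to terms that are horizontal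
derivatives of periodic functions, and is square integrable in the cusp, then it vanishes. -/
lemma torusMean_eq_zero_of_pde {b₁ b₂ : ℂ} (hb : Indep b₁ b₂) {f g₀ g₁ : (Fin 3 → ℝ) → ℝ}
    (hf : ∀ p ∈ halfSpace, ContDiffAt ℝ 2 f p) (hg₀ : ∀ p ∈ halfSpace, ContDiffAt ℝ 1 g₀ p)
    (hg₁ : ∀ p ∈ halfSpace, ContDiffAt ℝ 1 g₁ p)
    (hf1 : PeriodicIn b₁ f) (hf2 : PeriodicIn b₂ f)
    (h01 : PeriodicIn b₁ g₀) (h02 : PeriodicIn b₂ g₀) (h11 : PeriodicIn b₁ g₁)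
    (h12 : PeriodicIn b₂ g₁)
    (hpde : ∀ p ∈ halfSpace, p 2 ^ 2 * ∑ k, pd k (pd k f) p - p 2 * pd 2 f p
      + p 2 * (pd 0 g₀ p + pd 1 g₁ p) + f p = 0) {S : ℝ}
    (hfin : ∫⁻ t in Set.Ioi S, ENNReal.ofReal (torusMean b₁ b₂ f t ^ 2 * t⁻¹ ^ 3) ≠ ∞) :
    ∀ t > 0, torusMean b₁ b₂ f t = 0 := by
  have hf' : ∀ p ∈ halfSpace, ContDiffAt ℝ 1 f p := fun p hp => (hf p hp).of_le (by norm_num)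
  refine eq_zero_of_euler (A' := torusMean b₁ b₂ (pd 2 f)) (A'' := torusMean b₁ b₂ (pd 2 (pd 2 f)))
    (fun t ht => hasDerivAt_torusMean b₁ b₂ hf' ht)
    (fun t ht => hasDerivAt_torusMean b₁ b₂ (contDiffAt_one_pd hf 2) ht) (fun t ht => ?_) hfin
  have e1 := torusMean_pd_pd b₁ b₂ hb hf hf1 hf2 ht
  have e2 := (torusMean_pd b₁ b₂ hb hg₀ h01 h02 ht).1
  have e3 := (torusMean_pd b₁ b₂ hb hg₁ h11 h12 ht).2
  have hpp := fun k => continuousOn_pd (contDiffAt_one_pd hf k) k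
  have key := torusMean_linearComb b₁ b₂ (ι := Fin 7) ![t ^ 2, t ^ 2, t ^ 2, -t, t, t, 1]
    (F := ![pd 0 (pd 0 f), pd 1 (pd 1 f), pd 2 (pd 2 f), pd 2 f, pd 0 g₀, pd 1 g₁, f])
    (by
      intro i
      fin_cases i
      exacts [hpp 0, hpp 1, hpp 2, continuousOn_pd hf' 2, continuousOn_pd hg₀ 0,
        continuousOn_pd hg₁ 1, continuousOn_of_contDiffAt hf]) ht
  rw [torusMean_congr b₁ b₂ (g := fun _ => 0) (fun p hp => ?_), torusMean_const] at key
  · simp [Fin.sum_univ_succ, e1.1, e1.2, e2, e3] at key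
    linarith
  · subst hp
    have := hpde p ht
    simp [Fin.sum_univ_succ] at this ⊢
    linarith

lemma sq_le_sqNorm (A : Fin 3 → Fin 3 → ℝ) (i j : Fin 3) : A i j ^ 2 ≤ sqNorm A := by
  unfold sqNorm
  refine (Finset.single_le_sum (f := fun j => A i j ^ 2) (fun _ _ => sq_nonneg _)
    (Finset.mem_univ j)).trans ?_
  exact Finset.single_le_sum (f := fun i => ∑ j, A i j ^ 2)
    (fun _ _ => Finset.sum_nonneg fun _ _ => sq_nonneg _) (Finset.mem_univ i)

section
variable {b₁ b₂ : ℂ} {m : Tensor2 3}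

lemma continuousOn_sqNorm (hm : IsFrameSol m) : ContinuousOn (fun p => sqNorm (m p)) halfSpace :=
  (contDiffOn_sqNorm hm).continuousOn

/-- Square integrability of a solution passes to the means of its components, by Jensen's
inequality. -/
lemma lintegral_sq_torusMean_ne_top (hm : IsFrameSol m) {S : ℝ} (hS : 0 ≤ S)
    (hfin : ∫⁻ t in Set.Ioi S,
      ENNReal.ofReal (torusMean b₁ b₂ (fun p => sqNorm (m p)) t * t⁻¹ ^ 3) ≠ ∞)
    {f : (Fin 3 → ℝ) → ℝ} (hf : ContinuousOn f halfSpace)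
    (hle : ∀ p, f p ^ 2 ≤ 4 * sqNorm (m p)) :
    ∫⁻ t in Set.Ioi S, ENNReal.ofReal (torusMean b₁ b₂ f t ^ 2 * t⁻¹ ^ 3) ≠ ∞ := by
  have h1 : ∫⁻ t in Set.Ioi S, ENNReal.ofReal (torusMean b₁ b₂ f t ^ 2 * t⁻¹ ^ 3) ≤
      ∫⁻ t in Set.Ioi S, ENNReal.ofReal 4 *
        ENNReal.ofReal (torusMean b₁ b₂ (fun p => sqNorm (m p)) t * t⁻¹ ^ 3) := by
    refine setLIntegral_mono' measurableSet_Ioi fun t ht => ?_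
    have ht0 : 0 < t := hS.trans_lt ht
    rw [← ENNReal.ofReal_mul (by norm_num), ← mul_assoc, ← torusMean_const_mul]
    refine ENNReal.ofReal_le_ofReal (mul_le_mul_of_nonneg_right ?_ (by positivity))
    exact (sq_torusMean_le b₁ b₂ hf ht0).trans (torusMean_mono b₁ b₂ (hf.pow 2)
      (continuousOn_const.mul (continuousOn_sqNorm hm)) ht0 fun p _ => hle p)
  rw [lintegral_const_mul' _ _ ENNReal.ofReal_ne_top] at h1
  exact ne_top_of_le_ne_top (ENNReal.mul_ne_top ENNReal.ofReal_ne_top hfin) h1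

/-- The trace-free horizontal part of the mean of a square integrable solution vanishes. -/
lemma IsCuspSol.torusMean_eq_zero (hb : Indep b₁ b₂) (hm : IsCuspSol b₁ b₂ m) {S : ℝ} (hS : 0 ≤ S)
    (hfin : ∫⁻ t in Set.Ioi S,
      ENNReal.ofReal (torusMean b₁ b₂ (fun p => sqNorm (m p)) t * t⁻¹ ^ 3) ≠ ∞) {t : ℝ}
    (ht : 0 < t) :
    torusMean b₁ b₂ (fun p => m p 0 1) t = 0 ∧
    torusMean b₁ b₂ (fun p => m p 0 0) t = torusMean b₁ b₂ (fun p => m p 1 1) t := by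
  have hc2 : ∀ i j, ∀ p ∈ halfSpace, ContDiffAt ℝ 2 (fun x => m x i j) p := fun i j p hp =>
    hm.contDiffAt hp i j
  have hc1 : ∀ i j, ∀ p ∈ halfSpace, ContDiffAt ℝ 1 (fun x => m x i j) p := fun i j p hp =>
    (hc2 i j p hp).of_le (by norm_num)
  have hd : ∀ i j, ∀ p ∈ halfSpace, DifferentiableAt ℝ (fun x => m x i j) p := fun i j p hp =>
    (hc1 i j p hp).differentiableAt (by norm_num)
  have hc0 : ∀ i j, ContinuousOn (fun x => m x i j) halfSpace := fun i j =>
    (hm.contDiff i j).continuousOn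
  have hdd : ∀ i j k, ∀ p ∈ halfSpace, DifferentiableAt ℝ (pd k fun x => m x i j) p :=
    fun i j k p hp => differentiableAt_pd (hc2 i j p hp) k
  have P1 := hm.periodic₁
  have P2 := hm.periodic₂
  constructor
  -- the two equations for `m₀₁` and `m₀₀ - m₁₁` couple to the other components through horizontal
  -- derivatives only
  · refine torusMean_eq_zero_of_pde hb (hc2 0 1) (g₀ := fun p => -2 * m p 2 1)
      (g₁ := fun p => -2 * m p 0 2) (fun p hp => contDiffAt_const.mul (hc1 2 1 p hp))
      (fun p hp => contDiffAt_const.mul (hc1 0 2 p hp)) (P1 0 1) (P2 0 1) ((P1 2 1).const_mul _)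
      ((P2 2 1).const_mul _) ((P1 0 2).const_mul _) ((P2 0 2).const_mul _) (fun p hp => ?_)
      (lintegral_sq_torusMean_ne_top hm.toIsFrameSol hS hfin (hc0 0 1) fun p => ?_) t ht
    · have h := hm.eqn p hp 0 1
      rw [pd_const_mul (hd 2 1 p hp), pd_const_mul (hd 0 2 p hp)]
      simp [conn, Fin.sum_univ_three] at h ⊢
      linarith
    · linarith [sq_le_sqNorm (m p) 0 1, sqNorm_nonneg (m p)]
  · rw [← sub_eq_zero, ← torusMean_sub b₁ b₂ (hc0 0 0) (hc0 1 1) ht]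
    refine torusMean_eq_zero_of_pde hb (g₀ := fun p => -4 * m p 0 2) (g₁ := fun p => 4 * m p 1 2)
      (fun p hp => (hc2 0 0 p hp).sub (hc2 1 1 p hp))
      (fun p hp => contDiffAt_const.mul (hc1 0 2 p hp))
      (fun p hp => contDiffAt_const.mul (hc1 1 2 p hp)) ((P1 0 0).sub (P1 1 1))
      ((P2 0 0).sub (P2 1 1)) ((P1 0 2).const_mul _)
      ((P2 0 2).const_mul _) ((P1 1 2).const_mul _) ((P2 1 2).const_mul _) (fun p hp => ?_)
      (lintegral_sq_torusMean_ne_top hm.toIsFrameSol hS hfin ((hc0 0 0).sub (hc0 1 1))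
        fun p => ?_) t ht
    · have h := hm.eqn p hp 0 0
      have h' := hm.eqn p hp 1 1
      have hk : ∀ k, pd k (fun x => m x 0 0 - m x 1 1) =ᶠ[𝓝 p]
          fun x => pd k (fun x => m x 0 0) x - pd k (fun x => m x 1 1) x := fun k => by
        filter_upwards [isOpen_halfSpace.mem_nhds hp] with q hq
        exact pd_sub (hd 0 0 q hq) (hd 1 1 q hq) k
      have hkk : ∀ k, pd k (pd k (fun x => m x 0 0 - m x 1 1)) p =
          pd k (pd k (fun x => m x 0 0)) p - pd k (pd k (fun x => m x 1 1)) p := fun k => by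
        rw [pd_congr (hk k)]
        exact pd_sub (hdd 0 0 k p hp) (hdd 1 1 k p hp) k
      have s1 : ∀ i j k, pd k (fun x => m x i j) p = pd k (fun x => m x j i) p := fun i j k => by
        refine pd_congr ?_ k
        filter_upwards [isOpen_halfSpace.mem_nhds hp] with q hq
        exact hm.symm q hq i j
      rw [pd_const_mul (hd 0 2 p hp), pd_const_mul (hd 1 2 p hp), (hk 2).self_of_nhds]
      simp only [hkk]
      simp [conn, Fin.sum_univ_three, s1 2 0, s1 2 1] at h h' ⊢
      linarith
    · have e1 := sq_le_sqNorm (m p) 0 0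
      have e2 := sq_le_sqNorm (m p) 1 1
      nlinarith [sq_nonneg (m p 0 0 + m p 1 1)]

end

end Hyp3

/-! ### Convexity of the mean of the squared norm -/

namespace Hyp3

/-- The zeroth order part of the Bochner identity on tensors that do not depend on the horizontal
coordinates. -/
lemma zeroOrder_nonneg {M : Fin 3 → Fin 3 → ℝ} (hs : ∀ i j, M i j = M j i) (h01 : M 0 1 = 0)
    (h00 : M 0 0 = M 1 1) : 0 ≤ 2 * (sqNorm (conn 0 M) + sqNorm (conn 1 M)) - 6 * sqNorm M
      + 4 * (∑ k, M k k) ^ 2 := by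
  simp only [sqNorm, conn, Fin.sum_univ_three]
  simp [hs 1 0, hs 2 0, hs 2 1, h01, h00]
  nlinarith [sq_nonneg (M 1 1), sq_nonneg (M 0 2), sq_nonneg (M 1 2), sq_nonneg (M 2 2)]

/-- A crude bound for the connection terms of the deviation from the mean. -/
lemma sqNorm_conn_le {v : Fin 3 → Fin 3 → ℝ} (hs : ∀ i j, v i j = v j i) :
    sqNorm (conn 0 v) + sqNorm (conn 1 v) ≤ 8 * sqNorm v := by
  simp only [sqNorm, conn, Fin.sum_univ_three]
  simp [hs 1 0, hs 2 0, hs 2 1]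
  nlinarith [sq_nonneg (v 0 0 + v 2 2), sq_nonneg (v 1 1 + v 2 2), sq_nonneg (v 0 1),
    sq_nonneg (v 0 2), sq_nonneg (v 1 2), sq_nonneg (v 0 0), sq_nonneg (v 1 1), sq_nonneg (v 2 2)]

lemma conn_add (k : Fin 3) (A B : Fin 3 → Fin 3 → ℝ) (i j : Fin 3) :
    conn k (A + B) i j = conn k A i j + conn k B i j := by
  simp only [conn, Pi.add_apply]
  split_ifs <;> ring

/-- Expansion of `2 |t D + c + w|²` with half of `2 |t D|²` spent on the mixed term of `t D` and
`w`. -/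
lemma sqNorm_smul_add_ge (D c w : Fin 3 → Fin 3 → ℝ) (t : ℝ) :
    t ^ 2 * sqNorm D + 4 * (∑ i, ∑ j, t * c i j * D i j) + 4 * (∑ i, ∑ j, c i j * w i j)
      + 2 * sqNorm c - 2 * sqNorm w ≤ 2 * sqNorm fun i j => t * D i j + (c i j + w i j) := by
  simp only [sqNorm, Finset.mul_sum, ← Finset.sum_add_distrib, ← Finset.sum_sub_distrib]
  refine Finset.sum_le_sum fun i _ => Finset.sum_le_sum fun j _ => ?_
  nlinarith [sq_nonneg (t * D i j + 2 * w i j)]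

/-- The right hand side of the Bochner identity for `m = M + v` with horizontal derivatives `D`:
up to terms that are linear in `D` and `v`, it is bounded below by `|t D|² - 22 |v|²`. -/
lemma bochner_rhs_ge {M v : Fin 3 → Fin 3 → ℝ} (D : Fin 3 → Fin 3 → Fin 3 → ℝ) (t : ℝ)
    (hs : ∀ i j, M i j = M j i) (hv : ∀ i j, v i j = v j i) (h01 : M 0 1 = 0)
    (h00 : M 0 0 = M 1 1) :
    t ^ 2 * (sqNorm (D 0) + sqNorm (D 1)) - 22 * sqNorm v
      + (∑ i, ∑ j, (4 * t * conn 0 M i j * D 0 i j + 4 * t * conn 1 M i j * D 1 i j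
        + (-4 * (conn 0 (conn 0 M) i j + conn 1 (conn 1 M) i j) - 12 * M i j
          + if i = j then 8 * ∑ k, M k k else 0) * v i j))
      ≤ 2 * ∑ k, sqNorm (fun i j => t * D k i j + conn k (M + v) i j) - 6 * sqNorm (M + v)
        + 4 * (∑ k, (M + v) k k) ^ 2 := by
  have h0 := sqNorm_smul_add_ge (D 0) (conn 0 M) (conn 0 v) t
  have h1 := sqNorm_smul_add_ge (D 1) (conn 1 M) (conn 1 v) t
  have h2 : 0 ≤ sqNorm fun i j => t * D 2 i j + conn 2 (M + v) i j := sqNorm_nonneg _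
  have h3 := sqNorm_conn_le hv
  have h4 := zeroOrder_nonneg hs h01 h00
  have s0 := conn_skew 0 (conn 0 M) v
  have s1 := conn_skew 1 (conn 1 M) v
  have e1 : sqNorm (M + v) = sqNorm M + 2 * (∑ i, ∑ j, M i j * v i j) + sqNorm v := by
    simp only [sqNorm, Pi.add_apply, Finset.mul_sum, ← Finset.sum_add_distrib]
    exact Finset.sum_congr rfl fun i _ => Finset.sum_congr rfl fun j _ => by ring
  have e2 : ∑ k, (M + v) k k = ∑ k, M k k + ∑ k, v k k := by
    simp [Finset.sum_add_distrib]
  have e3 : ∑ i, ∑ j, (4 * t * conn 0 M i j * D 0 i j + 4 * t * conn 1 M i j * D 1 i j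
        + (-4 * (conn 0 (conn 0 M) i j + conn 1 (conn 1 M) i j) - 12 * M i j
          + if i = j then 8 * ∑ k, M k k else 0) * v i j) =
      4 * (∑ i, ∑ j, t * conn 0 M i j * D 0 i j) + 4 * (∑ i, ∑ j, t * conn 1 M i j * D 1 i j)
      - 4 * (∑ i, ∑ j, conn 0 (conn 0 M) i j * v i j)
      - 4 * (∑ i, ∑ j, conn 1 (conn 1 M) i j * v i j)
      - 12 * (∑ i, ∑ j, M i j * v i j) + 8 * (∑ k, M k k) * ∑ k, v k k := by
    have : (8 * ∑ k, M k k) * ∑ k, v k k =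
        ∑ i, ∑ j, (if i = j then 8 * ∑ k, M k k else 0) * v i j := by
      simp [ite_mul, Finset.mul_sum]
    rw [this]
    simp only [Finset.mul_sum (s := Finset.univ (α := Fin 3)) (a := (4 : ℝ)),
      Finset.mul_sum (s := Finset.univ (α := Fin 3)) (a := (12 : ℝ)),
      ← Finset.sum_add_distrib, ← Finset.sum_sub_distrib]
    exact Finset.sum_congr rfl fun i _ => Finset.sum_congr rfl fun j _ => by ring
  rw [e1, e2, e3, Fin.sum_univ_three (f := fun k => sqNorm fun i j =>
    t * D k i j + conn k (M + v) i j)]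
  simp only [conn_add] at h0 h1 h2 ⊢
  nlinarith [sq_nonneg (∑ k, v k k)]

lemma torusMean_sum_sum (b₁ b₂ : ℂ) {f : Fin 3 → Fin 3 → (Fin 3 → ℝ) → ℝ}
    (hf : ∀ i j, ContinuousOn (f i j) halfSpace) {t : ℝ} (ht : 0 < t) :
    torusMean b₁ b₂ (fun p => ∑ i, ∑ j, f i j p) t = ∑ i, ∑ j, torusMean b₁ b₂ (f i j) t := by
  rw [torusMean_sum b₁ b₂ (f := fun i p => ∑ j, f i j p)
    (fun i _ => continuousOn_finsetSum _ fun j _ => hf i j) ht]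
  exact Finset.sum_congr rfl fun i _ => torusMean_sum b₁ b₂ (fun j _ => hf i j) ht

variable {b₁ b₂ : ℂ} {m : Tensor2 3}

/-- In the cusp, at heights at which the Poincaré inequality beats the connection terms, the mean
of the squared norm satisfies a convexity inequality. -/
lemma IsCuspSol.convex (hb : Indep b₁ b₂) (hm : IsCuspSol b₁ b₂ m) {t : ℝ} (ht : 0 < t)
    (h01 : torusMean b₁ b₂ (fun p => m p 0 1) t = 0)
    (h00 : torusMean b₁ b₂ (fun p => m p 0 0) t = torusMean b₁ b₂ (fun p => m p 1 1) t)
    (hT : 44 * (‖b₁‖ ^ 2 + ‖b₂‖ ^ 2) ≤ t ^ 2) :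
    0 ≤ t ^ 2 * torusMean b₁ b₂ (pd 2 (pd 2 fun p => sqNorm (m p))) t
      - t * torusMean b₁ b₂ (pd 2 fun p => sqNorm (m p)) t := by
  have hc2 : ∀ i j, ∀ p ∈ halfSpace, ContDiffAt ℝ 2 (fun x => m x i j) p := fun i j p hp =>
    hm.contDiffAt hp i j
  have hc1 : ∀ i j, ∀ p ∈ halfSpace, ContDiffAt ℝ 1 (fun x => m x i j) p := fun i j p hp =>
    (hc2 i j p hp).of_le (by norm_num)
  have hc0 : ∀ i j, ContinuousOn (fun x => m x i j) halfSpace := fun i j =>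
    (hm.contDiff i j).continuousOn
  have hcp : ∀ k i j, ContinuousOn (pd k fun x => m x i j) halfSpace := fun k i j =>
    continuousOn_pd (hc1 i j) k
  set u : (Fin 3 → ℝ) → ℝ := fun p => sqNorm (m p) with hu
  have hu2 : ∀ p ∈ halfSpace, ContDiffAt ℝ 2 u p := fun p hp =>
    contDiffAt_of_halfSpace (contDiffOn_sqNorm hm.toIsFrameSol) hp
  have hu1 : ∀ p ∈ halfSpace, ContDiffAt ℝ 1 u p := fun p hp => (hu2 p hp).of_le (by norm_num)
  have hup1 : PeriodicIn b₁ u := fun p hp => by simp only [hu, sqNorm, hm.periodic₁ _ _ p hp]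
  have hup2 : PeriodicIn b₂ u := fun p hp => by simp only [hu, sqNorm, hm.periodic₂ _ _ p hp]
  set M : Fin 3 → Fin 3 → ℝ := fun i j => torusMean b₁ b₂ (fun p => m p i j) t with hM
  set Q : (Fin 3 → ℝ) → ℝ := fun p => ∑ i, ∑ j, (pd 0 (fun x => m x i j) p ^ 2 +
    pd 1 (fun x => m x i j) p ^ 2) with hQ
  set V : (Fin 3 → ℝ) → ℝ := fun p => ∑ i, ∑ j, (m p i j - M i j) ^ 2 with hV
  set P := 2 * (‖b₁‖ ^ 2 + ‖b₂‖ ^ 2) with hP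
  have hQc : ContinuousOn Q halfSpace := continuousOn_finsetSum _ fun i _ =>
    continuousOn_finsetSum _ fun j _ => ((hcp 0 i j).pow 2).add ((hcp 1 i j).pow 2)
  have hVc : ContinuousOn V halfSpace := continuousOn_finsetSum _ fun i _ =>
    continuousOn_finsetSum _ fun j _ => ((hc0 i j).sub continuousOn_const).pow 2
  -- the Poincaré inequality for all components: the deviation from the mean is controlled by the
  -- horizontal derivatives
  have hPoin : torusMean b₁ b₂ V t ≤ P * torusMean b₁ b₂ Q t := by
    have e1 : torusMean b₁ b₂ V t = ∑ i, ∑ j, torusMean b₁ b₂ (fun p => (m p i j - M i j) ^ 2) t :=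
      torusMean_sum_sum b₁ b₂ (f := fun i j p => (m p i j - M i j) ^ 2)
        (fun i j => ((hc0 i j).sub continuousOn_const).pow 2) ht
    have e2 : torusMean b₁ b₂ Q t = ∑ i, ∑ j, torusMean b₁ b₂
        (fun p => pd 0 (fun x => m x i j) p ^ 2 + pd 1 (fun x => m x i j) p ^ 2) t :=
      torusMean_sum_sum b₁ b₂
        (f := fun i j p => pd 0 (fun x => m x i j) p ^ 2 + pd 1 (fun x => m x i j) p ^ 2)
        (fun i j => ((hcp 0 i j).pow 2).add ((hcp 1 i j).pow 2)) ht
    rw [e1, e2]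
    simp only [Finset.mul_sum]
    exact Finset.sum_le_sum fun i _ => Finset.sum_le_sum fun j _ =>
      torusMean_sub_sq_le_pd b₁ b₂ (hc1 i j) ht
  have hQ0 : 0 ≤ torusMean b₁ b₂ Q t := by
    rw [← torusMean_const b₁ b₂ 0 t]
    exact torusMean_mono b₁ b₂ continuousOn_const hQc ht fun p _ => by positivity
  -- the terms that are linear in the derivatives or in the deviation from the mean
  set α : Fin 3 → Fin 3 → ℝ := fun i j => -4 * (conn 0 (conn 0 M) i j + conn 1 (conn 1 M) i j)
    - 12 * M i j + if i = j then 8 * ∑ k, M k k else 0 with hα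
  set L : (Fin 3 → ℝ) → ℝ := fun p => ∑ i, ∑ j, (4 * t * conn 0 M i j * pd 0 (fun x => m x i j) p
    + 4 * t * conn 1 M i j * pd 1 (fun x => m x i j) p + α i j * (m p i j - M i j)) with hL
  have hterm : ∀ i j, ContinuousOn (fun p => 4 * t * conn 0 M i j * pd 0 (fun x => m x i j) p
      + 4 * t * conn 1 M i j * pd 1 (fun x => m x i j) p + α i j * (m p i j - M i j)) halfSpace :=
    fun i j => ((continuousOn_const.mul (hcp 0 i j)).add (continuousOn_const.mul (hcp 1 i j))).add
      (continuousOn_const.mul ((hc0 i j).sub continuousOn_const))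
  have hLc : ContinuousOn L halfSpace := continuousOn_finsetSum _ fun i _ =>
    continuousOn_finsetSum _ fun j _ => hterm i j
  have hL0 : torusMean b₁ b₂ L t = 0 := by
    rw [hL, torusMean_sum_sum b₁ b₂ hterm ht]
    refine Finset.sum_eq_zero fun i _ => Finset.sum_eq_zero fun j _ => ?_
    have e := torusMean_pd b₁ b₂ hb (hc1 i j) (hm.periodic₁ i j) (hm.periodic₂ i j) ht
    have e' := torusMean_linearComb b₁ b₂ (ι := Fin 4)
      ![4 * t * conn 0 M i j, 4 * t * conn 1 M i j, α i j, -(α i j * M i j)]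
      (F := ![pd 0 fun x => m x i j, pd 1 fun x => m x i j, fun x => m x i j, fun _ => 1])
      (by
        intro k
        fin_cases k
        exacts [hcp 0 i j, hcp 1 i j, hc0 i j, continuousOn_const]) ht
    simp [Fin.sum_univ_succ, e.1, e.2, torusMean_const] at e'
    rw [← torusMean_congr b₁ b₂ (fun p _ => ?_), e']
    · simp [hM]
    · ring
  -- the mean of the left hand side of the Bochner identity
  have hpp := fun k => continuousOn_pd (contDiffAt_one_pd hu2 k) k
  have hlhs := torusMean_linearComb b₁ b₂ (ι := Fin 4) ![t ^ 2, t ^ 2, t ^ 2, -t]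
    (F := ![pd 0 (pd 0 u), pd 1 (pd 1 u), pd 2 (pd 2 u), pd 2 u])
    (by
      intro i
      fin_cases i
      exacts [hpp 0, hpp 1, hpp 2, continuousOn_pd hu1 2]) ht
  have hu0 := torusMean_pd_pd b₁ b₂ hb hu2 hup1 hup2 ht
  have hM_symm : ∀ i j, M i j = M j i := fun i j =>
    torusMean_congr b₁ b₂ fun q hq => hm.symm q (show 0 < q 2 by rw [hq]; exact ht) i j
  -- the pointwise lower bound for the right hand side of the Bochner identity, averaged
  have hlow : torusMean b₁ b₂ (fun p => t ^ 2 * Q p - 22 * V p + L p) t ≤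
      torusMean b₁ b₂ (fun p => ∑ i, (![t ^ 2, t ^ 2, t ^ 2, -t] : Fin 4 → ℝ) i *
        (![pd 0 (pd 0 u), pd 1 (pd 1 u), pd 2 (pd 2 u), pd 2 u] : Fin 4 → (Fin 3 → ℝ) → ℝ) i p) t := by
    refine torusMean_mono b₁ b₂ (((continuousOn_const.mul hQc).sub (continuousOn_const.mul hVc)).add
      hLc) ?_ ht fun p hp => ?_
    · refine continuousOn_finsetSum _ fun i _ => continuousOn_const.mul ?_
      fin_cases i
      exacts [hpp 0, hpp 1, hpp 2, continuousOn_pd hu1 2]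
    · subst hp
      have hB := bochner hm.toIsFrameSol (show p ∈ halfSpace from ht)
      have hR := bochner_rhs_ge (M := M) (v := m p - M)
        (fun k i j => pd k (fun x => m x i j) p) (p 2)
        hM_symm (fun i j => ?_) h01 h00
      · rw [add_sub_cancel] at hR
        have hq : Q p = sqNorm (fun i j => pd 0 (fun x => m x i j) p) +
            sqNorm (fun i j => pd 1 (fun x => m x i j) p) := by
          simp only [hQ, sqNorm, Finset.sum_add_distrib]
        have hv : V p = sqNorm (m p - M) := rfl
        have e : ∑ i, (![p 2 ^ 2, p 2 ^ 2, p 2 ^ 2, -p 2] : Fin 4 → ℝ) i *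
            (![pd 0 (pd 0 u), pd 1 (pd 1 u), pd 2 (pd 2 u), pd 2 u] : Fin 4 → (Fin 3 → ℝ) → ℝ) i p =
            p 2 ^ 2 * ∑ k, pd k (pd k u) p - p 2 * pd 2 u p := by
          simp [Fin.sum_univ_succ]; ring
        rw [e, hu, hB]
        show p 2 ^ 2 * Q p - 22 * V p + L p ≤ _
        rw [hq, hv]
        exact hR
      · have e1 := hM_symm i j
        have e2 := hm.symm p ht i j
        simp only [Pi.sub_apply]
        rw [e1, e2]
  have e := torusMean_linearComb b₁ b₂ (ι := Fin 3) ![t ^ 2, -22, 1] (F := ![Q, V, L])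
    (by
      intro k
      fin_cases k
      exacts [hQc, hVc, hLc]) ht
  rw [hlhs, torusMean_congr b₁ b₂ (g := fun p => ∑ i, (![t ^ 2, -22, 1] : Fin 3 → ℝ) i *
      (![Q, V, L] : Fin 3 → (Fin 3 → ℝ) → ℝ) i p)
    (fun p _ => by simp [Fin.sum_univ_succ]; ring), e] at hlow
  simp [Fin.sum_univ_succ, hL0, hu0.1, hu0.2] at hlow
  nlinarith [mul_nonneg (sub_nonneg.2 hT) hQ0]

end Hyp3

/-! ### Integrals over prisms -/

namespace Hyp3

lemma setLIntegral_box {G : (Fin 3 → ℝ) → ℝ≥0∞} (hG : Measurable G) {I : Set ℝ}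
    (hI : MeasurableSet I) {J : Set ℝ} (hJ : MeasurableSet J) :
    ∫⁻ q in {q : Fin 3 → ℝ | q 0 ∈ J ∧ q 1 ∈ J ∧ q 2 ∈ I}, G q =
      ∫⁻ t in I, ∫⁻ x in J, ∫⁻ y in J, G ![x, y, t] := by
  have hs : MeasurableSet {q : Fin 3 → ℝ | q 0 ∈ J ∧ q 1 ∈ J ∧ q 2 ∈ I} :=
    (measurable_pi_apply 0 hJ).inter ((measurable_pi_apply 1 hJ).inter (measurable_pi_apply 2 hI))
  rw [← lintegral_indicator hs, lintegral_fin_three (hG.indicator hs), ← lintegral_indicator hI]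
  congr 1; funext t
  by_cases ht : t ∈ I
  · rw [Set.indicator_of_mem ht, ← lintegral_indicator hJ]
    congr 1; funext x
    by_cases hx : x ∈ J
    · rw [Set.indicator_of_mem hx, ← lintegral_indicator hJ]
      congr 1; funext y
      by_cases hy : y ∈ J <;> simp [ht, hx, hy]
    · rw [Set.indicator_of_notMem hx]
      simp [hx]
  · rw [Set.indicator_of_notMem ht]
    simp [ht]

/-- The part of a fundamental prism for the lattice `ℤ b₁ + ℤ b₂` with heights in `I`. -/
def slab (b₁ b₂ : ℂ) (I : Set ℝ) : Set (Fin 3 → ℝ) :=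
  (fun q : Fin 3 → ℝ => latPt b₁ b₂ (q 0, q 1) (q 2)) ''
    {q | q 0 ∈ Set.Icc (0 : ℝ) 1 ∧ q 1 ∈ Set.Icc (0 : ℝ) 1 ∧ q 2 ∈ I}

/-- The linear map of which `slab` is the image of a box. -/
noncomputable def latMap (b₁ b₂ : ℂ) : (Fin 3 → ℝ) →L[ℝ] (Fin 3 → ℝ) :=
  (Matrix.toLin' !![b₁.re, b₂.re, 0; b₁.im, b₂.im, 0; 0, 0, 1]).toContinuousLinearMap

lemma latMap_apply (b₁ b₂ : ℂ) (q : Fin 3 → ℝ) :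
    latMap b₁ b₂ q = latPt b₁ b₂ (q 0, q 1) (q 2) := by
  ext i
  fin_cases i <;> simp [latMap, latPt, Matrix.mulVec, dotProduct, Fin.sum_univ_three] <;> ring

/-- The area of the parallelogram spanned by `b₁` and `b₂`. -/
noncomputable def area (b₁ b₂ : ℂ) : ℝ := |((starRingEnd ℂ) b₁ * b₂).im|

lemma area_pos {b₁ b₂ : ℂ} (hb : Indep b₁ b₂) : 0 < area b₁ b₂ := abs_pos.2 hb

lemma abs_det_latMap (b₁ b₂ : ℂ) : |(latMap b₁ b₂).det| = area b₁ b₂ := by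
  have : (latMap b₁ b₂).det = ((starRingEnd ℂ) b₁ * b₂).im := by
    rw [latMap, ContinuousLinearMap.det, LinearMap.coe_toContinuousLinearMap,
      LinearMap.det_toLin', Matrix.det_fin_three]
    simp [Complex.mul_im]; ring
  rw [this, area]

lemma latMap_injective {b₁ b₂ : ℂ} (hb : Indep b₁ b₂) : Function.Injective (latMap b₁ b₂) := by
  have h : (latMap b₁ b₂).det ≠ 0 := by
    rw [← abs_ne_zero, abs_det_latMap]; exact (area_pos hb).ne'
  have h2 : IsUnit (LinearMap.det (latMap b₁ b₂ : (Fin 3 → ℝ) →ₗ[ℝ] (Fin 3 → ℝ))) := h.isUnit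
  exact LinearMap.ker_eq_bot.1 ((LinearMap.isUnit_iff_ker_eq_bot _).1
    ((LinearMap.isUnit_iff_isUnit_det _).2 h2))

lemma measurableSet_slab {b₁ b₂ : ℂ} (hb : Indep b₁ b₂) {I : Set ℝ} (hI : MeasurableSet I) :
    MeasurableSet (slab b₁ b₂ I) := by
  have hs : MeasurableSet {q : Fin 3 → ℝ | q 0 ∈ Set.Icc (0 : ℝ) 1 ∧ q 1 ∈ Set.Icc (0 : ℝ) 1 ∧ q 2 ∈ I} :=
    (measurable_pi_apply 0 measurableSet_Icc).inter ((measurable_pi_apply 1 measurableSet_Icc).inter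
      (measurable_pi_apply 2 hI))
  unfold slab
  simp only [← latMap_apply]
  exact hs.image_of_continuousOn_injOn (latMap b₁ b₂).continuous.continuousOn
    (latMap_injective hb).injOn

lemma slab_subset (b₁ b₂ : ℂ) {I : Set ℝ} (hI : I ⊆ Set.Ioi 0) : slab b₁ b₂ I ⊆ halfSpace := by
  rintro _ ⟨q, ⟨-, -, hq⟩, rfl⟩
  exact latPt_mem _ _ _ (hI hq)

/-- The hyperbolic integral over a prism, through the means over horizontal tori. -/
lemma setLIntegral_slab {b₁ b₂ : ℂ} (hb : Indep b₁ b₂) {I : Set ℝ} (hI : MeasurableSet I)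
    (hI0 : I ⊆ Set.Ioi 0) {u : (Fin 3 → ℝ) → ℝ} (hu : ContinuousOn u halfSpace)
    (hu0 : ∀ p ∈ halfSpace, 0 ≤ u p) :
    ∫⁻ p in slab b₁ b₂ I, ENNReal.ofReal (u p) ∂(riemVol metric) =
      ENNReal.ofReal (area b₁ b₂) *
        ∫⁻ t in I, ENNReal.ofReal (torusMean b₁ b₂ u t * t⁻¹ ^ 3) := by
  classical
  set s : Set (Fin 3 → ℝ) :=
    {q | q 0 ∈ Set.Icc (0 : ℝ) 1 ∧ q 1 ∈ Set.Icc (0 : ℝ) 1 ∧ q 2 ∈ I} with hs_def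
  have hs : MeasurableSet s :=
    (measurable_pi_apply 0 measurableSet_Icc).inter ((measurable_pi_apply 1 measurableSet_Icc).inter
      (measurable_pi_apply 2 hI))
  set v : (Fin 3 → ℝ) → ℝ := halfSpace.piecewise u 0 with hv
  have hvm : Measurable v :=
    hu.measurable_piecewise continuousOn_const measurableSet_halfSpace
  have hvu : ∀ p ∈ halfSpace, v p = u p := fun p hp => Set.piecewise_eq_of_mem _ _ _ hp
  have hH : ∀ q ∈ s, latMap b₁ b₂ q ∈ halfSpace := fun q hq => by
    rw [latMap_apply]; exact latPt_mem _ _ _ (hI0 hq.2.2)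
  have himg : slab b₁ b₂ I = latMap b₁ b₂ '' s := by
    unfold slab; simp only [← latMap_apply]; rfl
  rw [setLIntegral_riemVol (measurableSet_slab hb hI) (slab_subset _ _ hI0), himg,
    lintegral_image_eq_lintegral_abs_det_fderiv_mul volume hs
      (fun q _ => (latMap b₁ b₂).hasFDerivAt.hasFDerivWithinAt) (latMap_injective hb).injOn,
    abs_det_latMap, lintegral_const_mul' _ _ ENNReal.ofReal_ne_top]
  congr 1
  have hm : Measurable fun q : Fin 3 → ℝ =>
      ENNReal.ofReal ((q 2)⁻¹ ^ 3) * ENNReal.ofReal (v (latMap b₁ b₂ q)) := by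
    have := (latMap b₁ b₂).continuous.measurable
    fun_prop
  calc ∫⁻ q in s, ENNReal.ofReal ((latMap b₁ b₂ q 2)⁻¹ ^ 3) * ENNReal.ofReal (u (latMap b₁ b₂ q))
      = ∫⁻ q in s, ENNReal.ofReal ((q 2)⁻¹ ^ 3) * ENNReal.ofReal (v (latMap b₁ b₂ q)) := by
        refine setLIntegral_congr_fun hs fun q hq => ?_
        rw [hvu _ (hH q hq)]
        congr 4
        rw [latMap_apply]; simp [latPt]
    _ = ∫⁻ t in I, ∫⁻ x in Set.Icc 0 1, ∫⁻ y in Set.Icc 0 1, ENNReal.ofReal (t⁻¹ ^ 3) *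
          ENNReal.ofReal (v (latMap b₁ b₂ ![x, y, t])) :=
        setLIntegral_box hm hI measurableSet_Icc
    _ = _ := by
        refine setLIntegral_congr_fun hI fun t ht => ?_
        have ht0 : 0 < t := hI0 ht
        have hu' := continuous_comp_latPt b₁ b₂ hu ht0
        simp only [lintegral_const_mul' _ _ ENNReal.ofReal_ne_top]
        rw [mul_comm (torusMean b₁ b₂ u t), ENNReal.ofReal_mul (by positivity)]
        congr 1
        have e : ∀ x y, v (latMap b₁ b₂ ![x, y, t]) = u (latPt b₁ b₂ (x, y) t) := fun x y => by
          rw [latMap_apply]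
          exact hvu _ (latPt_mem _ _ _ ht0)
        simp only [e]
        unfold torusMean
        rw [ofReal_integral_eq_lintegral_ofReal (integrable_comp_latPt b₁ b₂ hu ht0)
          (Eventually.of_forall fun s => hu0 _ (latPt_mem _ _ _ ht0)), unitSq,
          Measure.volume_eq_prod, ← Measure.prod_restrict, lintegral_prod]
        exact (ENNReal.measurable_ofReal.comp hu'.measurable).aemeasurable

/-- The horizontal translation by `b` as an element of `SL(2, ℂ)`. -/
noncomputable def transl (b : ℂ) : SL2C := ⟨!![1, b; 0, 1], by simp⟩

@[simp] lemma shift_zero (b : ℂ) : shift b 0 = b.re := rfl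
@[simp] lemma shift_one (b : ℂ) : shift b 1 = b.im := rfl
@[simp] lemma shift_two (b : ℂ) : shift b 2 = 0 := rfl

lemma act_transl (b : ℂ) (p : Fin 3 → ℝ) : act (transl b) p = shift b + p := by
  ext i
  fin_cases i <;> simp [act, transl, mkPt, zco] <;> ring

lemma PeriodicIn.add {b c : ℂ} {f : (Fin 3 → ℝ) → ℝ} (hb : PeriodicIn b f) (hc : PeriodicIn c f) :
    PeriodicIn (b + c) f := fun p hp => by
  have h : shift (b + c) + p = shift b + (shift c + p) := by
    ext i; fin_cases i <;> simp <;> ring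
  rw [h, hb _ (by rw [← act_transl]; exact act_mem _ hp), hc p hp]

lemma PeriodicIn.neg {b : ℂ} {f : (Fin 3 → ℝ) → ℝ} (hb : PeriodicIn b f) :
    PeriodicIn (-b) f := fun p hp => by
  rw [← hb _ (by rw [← act_transl]; exact act_mem _ hp)]
  congr 1
  ext i; fin_cases i <;> simp

lemma PeriodicIn.zero (f : (Fin 3 → ℝ) → ℝ) : PeriodicIn 0 f := fun p _ => by
  congr 1
  ext i; fin_cases i <;> simp

lemma PeriodicIn.intCast_mul {b : ℂ} {f : (Fin 3 → ℝ) → ℝ} (hb : PeriodicIn b f) (n : ℤ) :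
    PeriodicIn (n * b) f := by
  induction n with
  | zero => simpa using PeriodicIn.zero f
  | succ n ih => simpa [add_mul] using ih.add hb
  | pred n ih => simpa [sub_mul] using by simpa [← sub_eq_add_neg] using ih.add hb.neg

end Hyp3

/-! ### Pointwise bounds in a cusp -/

namespace Hyp3

/-- Coordinates with respect to a basis are bounded by the norm. -/
lemma Indep.exists_coord_bound {b₁ b₂ : ℂ} (hb : Indep b₁ b₂) : ∃ c : ℝ, 0 < c ∧ ∀ (s₁ s₂ : ℝ) (R : ℝ),
    ‖(s₁ * b₁ + s₂ * b₂ : ℂ)‖ ≤ R → |s₁| ≤ c * R ∧ |s₂| ≤ c * R := by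
  have hD : 0 < area b₁ b₂ := area_pos hb
  refine ⟨(‖b₁‖ + ‖b₂‖ + 1) / area b₁ b₂, by positivity, fun s₁ s₂ R h => ?_⟩
  have hR : 0 ≤ R := (norm_nonneg _).trans h
  set w : ℂ := s₁ * b₁ + s₂ * b₂ with hw
  have e1 : ((starRingEnd ℂ) w * b₂).im = s₁ * ((starRingEnd ℂ) b₁ * b₂).im := by
    rw [hw]; simp [Complex.mul_im]; ring
  have e2 : ((starRingEnd ℂ) b₁ * w).im = s₂ * ((starRingEnd ℂ) b₁ * b₂).im := by
    rw [hw]; simp [Complex.mul_im]; ring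
  have f1 : |s₁| * area b₁ b₂ ≤ R * ‖b₂‖ := by
    rw [area, ← abs_mul, ← e1]
    refine (Complex.abs_im_le_norm _).trans ?_
    rw [norm_mul, RCLike.norm_conj]
    gcongr
  have f2 : |s₂| * area b₁ b₂ ≤ ‖b₁‖ * R := by
    rw [area, ← abs_mul, ← e2]
    refine (Complex.abs_im_le_norm _).trans ?_
    rw [norm_mul, RCLike.norm_conj]
    gcongr
  have g1 := mul_nonneg (norm_nonneg b₁) hR
  have g2 := mul_nonneg (norm_nonneg b₂) hR
  constructor <;>
  · rw [div_mul_eq_mul_div, le_div_iff₀ hD]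
    nlinarith

lemma card_Icc_floor_le {x r : ℝ} (hr : 0 ≤ r) :
    ((Finset.Icc ⌊x - r⌋ ⌊x + r⌋).card : ℝ) ≤ 2 * r + 2 := by
  rw [Int.card_Icc]
  have h1 : ⌊x - r⌋ ≤ ⌊x + r⌋ := Int.floor_le_floor (by linarith)
  have h2 : (((⌊x + r⌋ + 1 - ⌊x - r⌋).toNat : ℤ) : ℝ) = ⌊x + r⌋ + 1 - ⌊x - r⌋ := by
    rw [Int.toNat_of_nonneg (by omega)]; push_cast; ring
  rw [Int.cast_natCast] at h2
  rw [h2]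
  have := Int.floor_le (x + r)
  have := Int.lt_floor_add_one (x - r)
  linarith

/-- A Euclidean ball of hyperbolically bounded size at height `t ≥ 1` is covered by `O(t²)`
translates of a fundamental prism. -/
lemma exists_cover_eBall {b₁ b₂ : ℂ} (hb : Indep b₁ b₂) : ∃ c : ℝ, 0 < c ∧ ∀ p : Fin 3 → ℝ,
    1 ≤ p 2 → ∃ F : Finset (ℤ × ℤ), (F.card : ℝ) ≤ c * p 2 ^ 2 ∧
      eBall p ⊆ ⋃ n ∈ F, act (transl (n.1 * b₁ + n.2 * b₂)) ''
        slab b₁ b₂ (Set.Ioo (p 2 / 2) (3 / 2 * p 2)) := by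
  obtain ⟨c, hc, hcb⟩ := hb.exists_coord_bound
  refine ⟨(2 * c + 2) ^ 2, by positivity, fun p hp => ?_⟩
  have hp0 : 0 < p 2 := by linarith
  obtain ⟨x, y, hxy⟩ := hb.exists_coords (zco p)
  set r := c * p 2 with hr
  have hr0 : 0 ≤ r := by positivity
  refine ⟨Finset.Icc ⌊x - r⌋ ⌊x + r⌋ ×ˢ Finset.Icc ⌊y - r⌋ ⌊y + r⌋, ?_, ?_⟩
  · rw [Finset.card_product]
    push_cast
    calc _ ≤ (2 * r + 2) * (2 * r + 2) :=
          mul_le_mul (card_Icc_floor_le hr0) (card_Icc_floor_le hr0) (by positivity) (by positivity)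
      _ ≤ (2 * r + 2 * p 2) * (2 * r + 2 * p 2) := by gcongr <;> linarith
      _ = _ := by rw [hr]; ring
  · intro q hq
    have hh := height_of_mem_eBall (show p ∈ halfSpace from hp0) hq
    have h0 := abs_sub_lt_of_mem_eBall (show p ∈ halfSpace from hp0) hq 0
    have h1 := abs_sub_lt_of_mem_eBall (show p ∈ halfSpace from hp0) hq 1
    obtain ⟨x', y', hxy'⟩ := hb.exists_coords (zco q)
    have hn : ‖((x' - x : ℝ) * b₁ + (y' - y : ℝ) * b₂ : ℂ)‖ ≤ p 2 := by
      have : ((x' - x : ℝ) * b₁ + (y' - y : ℝ) * b₂ : ℂ) = zco q - zco p := by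
        rw [hxy, hxy']; push_cast; ring
      rw [this]
      refine (Complex.norm_le_abs_re_add_abs_im _).trans ?_
      simp only [zco, Complex.sub_re, Complex.sub_im]
      linarith
    obtain ⟨g1, g2⟩ := hcb _ _ _ hn
    rw [abs_le] at g1 g2
    simp only [Set.mem_iUnion]
    refine ⟨(⌊x'⌋, ⌊y'⌋), ?_, latPt b₁ b₂ (Int.fract x', Int.fract y') (q 2), ?_, ?_⟩
    · simp only [Finset.mem_product, Finset.mem_Icc]
      exact ⟨⟨Int.floor_le_floor (by linarith), Int.floor_le_floor (by linarith)⟩,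
        Int.floor_le_floor (by linarith), Int.floor_le_floor (by linarith)⟩
    · exact ⟨![Int.fract x', Int.fract y', q 2], ⟨⟨Int.fract_nonneg _, (Int.fract_lt_one _).le⟩,
        ⟨Int.fract_nonneg _, (Int.fract_lt_one _).le⟩, hh⟩, rfl⟩
    · rw [act_transl]
      refine ext_zco ?_ ?_
      · rw [hxy']
        have e1 : ((⌊x'⌋ : ℝ) + Int.fract x') = x' := Int.floor_add_fract x'
        have e2 : ((⌊y'⌋ : ℝ) + Int.fract y') = y' := Int.floor_add_fract y'
        apply Complex.ext
        · simp [zco, latPt]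
          linear_combination b₁.re * e1 + b₂.re * e2
        · simp [zco, latPt]
          linear_combination b₁.im * e1 + b₂.im * e2
      · simp [latPt]

lemma lintegral_biUnion_finset_le {ι α : Type*} [MeasurableSpace α] {μ : Measure α} (F : Finset ι)
    (S : ι → Set α) (f : α → ℝ≥0∞) : ∫⁻ a in ⋃ i ∈ F, S i, f a ∂μ ≤ ∑ i ∈ F, ∫⁻ a in S i, f a ∂μ := by
  classical
  induction F using Finset.induction_on with
  | empty => simp
  | insert i F hi ih =>
    rw [Finset.set_biUnion_insert, Finset.sum_insert hi]
    exact (lintegral_union_le _ _ _).trans (add_le_add_right ih _)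

lemma setLIntegral_translate {b : ℂ} {f : (Fin 3 → ℝ) → ℝ} (hf : PeriodicIn b f)
    {S : Set (Fin 3 → ℝ)} (hS : MeasurableSet S) (hSH : S ⊆ halfSpace) :
    ∫⁻ p in act (transl b) '' S, ENNReal.ofReal (f p) ∂(riemVol metric) =
      ∫⁻ p in S, ENNReal.ofReal (f p) ∂(riemVol metric) := by
  rw [setLIntegral_act_image _ hS hSH]
  refine setLIntegral_congr_fun hS fun p hp => ?_
  rw [act_transl, hf p (hSH hp)]

/-- A square integrable periodic solution is bounded in the cusp by its `L²` norm. -/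
lemma exists_cusp_bound {b₁ b₂ : ℂ} (hb : Indep b₁ b₂) {T : ℝ} (hT : 0 < T) :
    ∃ C : ℝ, 0 < C ∧ ∃ T' : ℝ, 0 < T' ∧ ∀ m : Tensor2 3, IsCuspSol b₁ b₂ m →
      ∫⁻ p in slab b₁ b₂ (Set.Ioi T), ENNReal.ofReal (sqNorm (m p)) ∂(riemVol metric) ≠ ∞ →
      ∀ p : Fin 3 → ℝ, T' ≤ p 2 → ENNReal.ofReal (sqNorm (m p)) ≤ ENNReal.ofReal C *
        ∫⁻ p in slab b₁ b₂ (Set.Ioi T), ENNReal.ofReal (sqNorm (m p)) ∂(riemVol metric) := by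
  obtain ⟨C, hC, hmv⟩ := exists_mean_value (K := 7) (by norm_num)
  obtain ⟨c, hc, hcov⟩ := exists_cover_eBall hb
  have hD := area_pos hb
  set D := area b₁ b₂ with hD_def
  -- from the height `T₁` on, the convexity inequality holds
  set T₁ : ℝ := max (max T 1) (44 * (‖b₁‖ ^ 2 + ‖b₂‖ ^ 2)) with hT₁
  have hT₁T : T ≤ T₁ := (le_max_left _ _).trans (le_max_left _ _)
  have hT₁1 : 1 ≤ T₁ := (le_max_right _ _).trans (le_max_left _ _)
  have hT₁0 : 0 < T₁ := by linarith
  set K : ℝ := 8 * T₁ ^ 2 / D with hK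
  have hK0 : 0 < K := by positivity
  refine ⟨C * (c * (8 * D * K)), by positivity, 4 * T₁, by positivity, fun m hm hfin p hp => ?_⟩
  set u : (Fin 3 → ℝ) → ℝ := fun p => sqNorm (m p) with hu
  set A := ∫⁻ p in slab b₁ b₂ (Set.Ioi T), ENNReal.ofReal (u p) ∂(riemVol metric) with hA
  have huc : ContinuousOn u halfSpace := continuousOn_sqNorm hm.toIsFrameSol
  have hu0 : ∀ p ∈ halfSpace, 0 ≤ u p := fun p _ => sqNorm_nonneg _
  have hu2 : ∀ p ∈ halfSpace, ContDiffAt ℝ 2 u p := fun p hp =>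
    contDiffAt_of_halfSpace (contDiffOn_sqNorm hm.toIsFrameSol) hp
  set y := torusMean b₁ b₂ u with hy
  have hAy : A = ENNReal.ofReal D * ∫⁻ t in Set.Ioi T, ENNReal.ofReal (y t * t⁻¹ ^ 3) :=
    setLIntegral_slab hb measurableSet_Ioi (Set.Ioi_subset_Ioi hT.le) huc hu0
  have hyfin : ∫⁻ t in Set.Ioi T, ENNReal.ofReal (y t * t⁻¹ ^ 3) ≠ ∞ := by
    intro h
    rw [h, ENNReal.mul_top (by simpa using hD)] at hAy
    exact hfin hAy
  have hy0 : ∀ t > 0, 0 ≤ y t := fun t ht =>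
    integral_nonneg fun s => hu0 _ (latPt_mem b₁ b₂ s ht)
  have hanti : AntitoneOn y (Set.Ici T₁) := by
    refine antitoneOn_of_weighted_convex hT₁0
      (fun t ht => hasDerivAt_torusMean b₁ b₂ (fun p hp => (hu2 p hp).of_le (by norm_num)) ht)
      (fun t ht => hasDerivAt_torusMean b₁ b₂ (contDiffAt_one_pd hu2 2) ht) hy0
      (fun t ht => ?_) hyfin
    have ht0 : 0 < t := by linarith
    obtain ⟨h01, h00⟩ := hm.torusMean_eq_zero hb hT.le hyfin ht0
    refine hm.convex hb ht0 h01 h00 ?_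
    have : 44 * (‖b₁‖ ^ 2 + ‖b₂‖ ^ 2) ≤ t := (le_max_right _ _).trans ht
    nlinarith
  -- a nonincreasing function is bounded at `h` by its average over `[T₁, 2 T₁]`, hence by the
  -- energy
  have hyle : ∀ h ≥ 2 * T₁, ENNReal.ofReal (y h) ≤ ENNReal.ofReal K * A := by
    intro h hh
    have h1 : ENNReal.ofReal (y h * (2 * T₁)⁻¹ ^ 3) * ENNReal.ofReal T₁ ≤
        ∫⁻ t in Set.Ioi T, ENNReal.ofReal (y t * t⁻¹ ^ 3) := by
      have e : ENNReal.ofReal T₁ = volume (Set.Ioo T₁ (2 * T₁)) := by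
        rw [Real.volume_Ioo]; congr 1; ring
      rw [e, ← setLIntegral_const]
      refine (setLIntegral_mono' measurableSet_Ioo fun t ht => ?_).trans (lintegral_mono_set
        fun t ht => lt_of_le_of_lt hT₁T ht.1)
      have ht0 : 0 < t := hT₁0.trans ht.1
      refine ENNReal.ofReal_le_ofReal (mul_le_mul (hanti (show T₁ ≤ t from ht.1.le) (show T₁ ≤ h by linarith) (by linarith [ht.2])) ?_
        (by positivity) (hy0 t ht0))
      have := ht.2.le
      gcongr
    have hpos := hy0 h (by linarith)
    calc ENNReal.ofReal (y h) = ENNReal.ofReal K * (ENNReal.ofReal D *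
          (ENNReal.ofReal (y h * (2 * T₁)⁻¹ ^ 3) * ENNReal.ofReal T₁)) := by
          rw [← ENNReal.ofReal_mul (by positivity), ← ENNReal.ofReal_mul hD.le,
            ← ENNReal.ofReal_mul hK0.le]
          congr 1
          rw [hK]; field_simp; norm_num
      _ ≤ _ := by rw [hAy]; gcongr
  have hp1 : 1 ≤ p 2 := by linarith
  have hp0 : 0 < p 2 := by linarith
  obtain ⟨F, hF, hFc⟩ := hcov p hp1
  set I := Set.Ioo (p 2 / 2) (3 / 2 * p 2) with hI
  have hI0 : I ⊆ Set.Ioi 0 := fun x hx => lt_trans (by positivity) hx.1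
  -- so the energy of a prism with heights comparable to `p 2` is `O((p 2)⁻²)`, which compensates
  -- the number of prisms
  have hV : ∫⁻ q in slab b₁ b₂ I, ENNReal.ofReal (u q) ∂(riemVol metric) ≤
      ENNReal.ofReal (8 * D * (p 2)⁻¹ ^ 2) * (ENNReal.ofReal K * A) := by
    rw [setLIntegral_slab hb measurableSet_Ioo hI0 huc hu0]
    have h2 : ∫⁻ t in I, ENNReal.ofReal (y t * t⁻¹ ^ 3) ≤
        ENNReal.ofReal K * A * ENNReal.ofReal ((p 2 / 2)⁻¹ ^ 3) * ENNReal.ofReal (p 2) := by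
      have e : ENNReal.ofReal (p 2) = volume I := by
        rw [Real.volume_Ioo]; congr 1; ring
      rw [e, ← setLIntegral_const]
      refine setLIntegral_mono' measurableSet_Ioo fun t ht => ?_
      have ht1 : p 2 / 2 < t := ht.1
      rw [ENNReal.ofReal_mul (hy0 t (hI0 ht))]
      refine mul_le_mul' (hyle t (by linarith)) (ENNReal.ofReal_le_ofReal ?_)
      have ht0 : 0 < t := hI0 ht
      gcongr
    refine (mul_le_mul_right h2 _).trans (le_of_eq ?_)
    rw [mul_assoc (ENNReal.ofReal K * A), ← ENNReal.ofReal_mul (by positivity),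
      mul_comm (ENNReal.ofReal K * A), ← mul_assoc, ← ENNReal.ofReal_mul hD.le]
    congr 2
    field_simp; norm_num
  calc ENNReal.ofReal (u p) ≤ ENNReal.ofReal C * ∫⁻ q in eBall p, ENNReal.ofReal (u q) ∂(riemVol metric) :=
        hmv u (contDiffOn_sqNorm hm.toIsFrameSol) hu0 (fun q hq => hm.laplacian_ge hq) p hp0
    _ ≤ ENNReal.ofReal C * (ENNReal.ofReal (c * p 2 ^ 2) *
          (ENNReal.ofReal (8 * D * (p 2)⁻¹ ^ 2) * (ENNReal.ofReal K * A))) := by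
        gcongr
        calc _ ≤ ∫⁻ q in ⋃ n ∈ F, act (transl (n.1 * b₁ + n.2 * b₂)) '' slab b₁ b₂ I,
              ENNReal.ofReal (u q) ∂(riemVol metric) := lintegral_mono_set hFc
          _ ≤ ∑ n ∈ F, ∫⁻ q in act (transl (n.1 * b₁ + n.2 * b₂)) '' slab b₁ b₂ I,
              ENNReal.ofReal (u q) ∂(riemVol metric) := lintegral_biUnion_finset_le F _ _
          _ = ∑ n ∈ F, ∫⁻ q in slab b₁ b₂ I, ENNReal.ofReal (u q) ∂(riemVol metric) := by
              refine Finset.sum_congr rfl fun n _ => setLIntegral_translate ?_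
                (measurableSet_slab hb measurableSet_Ioo) (slab_subset _ _ hI0)
              have P1 : PeriodicIn b₁ u := fun p hp => by
                simp only [hu, sqNorm, hm.periodic₁ _ _ p hp]
              have P2 : PeriodicIn b₂ u := fun p hp => by
                simp only [hu, sqNorm, hm.periodic₂ _ _ p hp]
              exact (P1.intCast_mul n.1).add (P2.intCast_mul n.2)
          _ = F.card * ∫⁻ q in slab b₁ b₂ I, ENNReal.ofReal (u q) ∂(riemVol metric) := by
              rw [Finset.sum_const, nsmul_eq_mul]
          _ ≤ _ := by
              refine mul_le_mul' ?_ hV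
              rw [← ENNReal.ofReal_natCast]
              exact ENNReal.ofReal_le_ofReal hF
    _ = _ := by
        rw [← mul_assoc, ← mul_assoc, ← mul_assoc, ← ENNReal.ofReal_mul hC.le,
          ← ENNReal.ofReal_mul (by positivity), ← ENNReal.ofReal_mul (by positivity)]
        congr 2
        field_simp

end Hyp3

/-! ### Displacement functions -/

namespace Hyp3

/-- The squared Frobenius norm. -/
noncomputable def fro (A : Matrix (Fin 2) (Fin 2) ℂ) : ℝ := ∑ i, ∑ j, ‖A i j‖ ^ 2

lemma fro_nonneg (A : Matrix (Fin 2) (Fin 2) ℂ) : 0 ≤ fro A := by unfold fro; positivity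

lemma norm_sq_le_fro (A : Matrix (Fin 2) (Fin 2) ℂ) (i j : Fin 2) : ‖A i j‖ ^ 2 ≤ fro A := by
  unfold fro
  refine (Finset.single_le_sum (f := fun j => ‖A i j‖ ^ 2) (fun _ _ => sq_nonneg _)
    (Finset.mem_univ j)).trans ?_
  exact Finset.single_le_sum (f := fun i => ∑ j, ‖A i j‖ ^ 2)
    (fun _ _ => Finset.sum_nonneg fun _ _ => sq_nonneg _) (Finset.mem_univ i)

lemma fro_eq_zero {A : Matrix (Fin 2) (Fin 2) ℂ} (h : fro A = 0) : A = 0 := by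
  ext i j
  have := norm_sq_le_fro A i j
  rw [h] at this
  simpa using this

lemma fro_mul_le (A B : Matrix (Fin 2) (Fin 2) ℂ) : fro (A * B) ≤ fro A * fro B := by
  have key : ∀ a b c d : ℂ, ‖a * b + c * d‖ ^ 2 ≤ (‖a‖ ^ 2 + ‖c‖ ^ 2) * (‖b‖ ^ 2 + ‖d‖ ^ 2) := by
    intro a b c d
    have h : ‖a * b + c * d‖ ≤ ‖a‖ * ‖b‖ + ‖c‖ * ‖d‖ := by
      refine (norm_add_le _ _).trans ?_
      rw [norm_mul, norm_mul]
    refine (pow_le_pow_left₀ (norm_nonneg _) h 2).trans ?_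
    nlinarith [sq_nonneg (‖a‖ * ‖d‖ - ‖c‖ * ‖b‖)]
  simp only [fro, Matrix.mul_apply, Fin.sum_univ_two]
  have h1 := key (A 0 0) (B 0 0) (A 0 1) (B 1 0)
  have h2 := key (A 0 0) (B 0 1) (A 0 1) (B 1 1)
  have h3 := key (A 1 0) (B 0 0) (A 1 1) (B 1 0)
  have h4 := key (A 1 0) (B 0 1) (A 1 1) (B 1 1)
  linarith

lemma fro_sub_le (A B : Matrix (Fin 2) (Fin 2) ℂ) : fro (A - B) ≤ 2 * fro A + 2 * fro B := by
  simp only [fro, Finset.mul_sum, ← Finset.sum_add_distrib]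
  refine Finset.sum_le_sum fun i _ => Finset.sum_le_sum fun j _ => ?_
  have h := norm_sub_le (A i j) (B i j)
  refine (pow_le_pow_left₀ (norm_nonneg _) h 2).trans ?_
  nlinarith [sq_nonneg (‖A i j‖ - ‖B i j‖)]

lemma fro_one : fro 1 = 2 := by
  simp [fro, Fin.sum_univ_two]; norm_num

lemma fro_le_of_sub_one (A : Matrix (Fin 2) (Fin 2) ℂ) : fro A ≤ 2 * fro (A - 1) + 4 := by
  have h := fro_sub_le (A - 1) (-1)
  have h1 : fro (-1) = 2 := by simpa [fro] using fro_one
  rw [sub_neg_eq_add, sub_add_cancel, h1] at h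
  linarith

lemma fro_inv (γ : SL2C) : fro (γ⁻¹ : SL2C) = fro γ := by
  rw [Matrix.SpecialLinearGroup.SL2_inv_expl]
  simp [fro, Fin.sum_univ_two]; ring

lemma fro_eq_trace (A : Matrix (Fin 2) (Fin 2) ℂ) : (fro A : ℂ) = (A * Aᴴ).trace := by
  simp only [fro, Matrix.trace_fin_two, Matrix.mul_apply, Matrix.conjTranspose_apply,
    Fin.sum_univ_two, RCLike.star_def, Complex.mul_conj, Complex.normSq_eq_norm_sq]
  push_cast; ring

/-- Unitary conjugation preserves the Frobenius norm, which is `tr (A Aᴴ)`. -/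
lemma fro_conj_unitary {A k k' : Matrix (Fin 2) (Fin 2) ℂ} (h : k * kᴴ = 1) (h' : k' * k = 1) :
    fro (k' * A * k) = fro A := by
  have e : k' = kᴴ := by
    calc k' = k' * (k * kᴴ) := by rw [h, Matrix.mul_one]
      _ = kᴴ := by rw [← Matrix.mul_assoc, h', Matrix.one_mul]
  have : (fro (k' * A * k) : ℂ) = fro A := by
    rw [fro_eq_trace, fro_eq_trace, Matrix.conjTranspose_mul, Matrix.conjTranspose_mul]
    calc (k' * A * k * (kᴴ * (Aᴴ * k'ᴴ))).trace = (k' * (A * (k * kᴴ) * Aᴴ * k'ᴴ)).trace := by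
          simp only [Matrix.mul_assoc]
      _ = (A * Aᴴ * (k'ᴴ * k')).trace := by
          rw [Matrix.trace_mul_comm, h, Matrix.mul_one]; simp only [Matrix.mul_assoc]
      _ = (A * Aᴴ).trace := by rw [e, Matrix.conjTranspose_conjTranspose, h, Matrix.mul_one]
  exact_mod_cast this

/-- The base point `(0, 0, 1)`. -/
noncomputable def basePt : Fin 3 → ℝ := mkPt 0 1

lemma basePt_mem : basePt ∈ halfSpace := mkPt_mem 0 one_pos

/-- An upper triangular matrix that moves the base point to `x`. -/
noncomputable def lift (x : Fin 3 → ℝ) (hx : x ∈ halfSpace) : SL2C :=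
  ⟨!![(Real.sqrt (x 2) : ℂ), zco x / Real.sqrt (x 2); 0, 1 / Real.sqrt (x 2)], by
    have : (Real.sqrt (x 2) : ℂ) ≠ 0 := by exact_mod_cast (Real.sqrt_pos.2 hx).ne'
    rw [Matrix.det_fin_two_of]; field_simp; simp⟩

lemma act_lift (x : Fin 3 → ℝ) (hx : x ∈ halfSpace) : act (lift x hx) basePt = x := by
  have h0 : 0 < x 2 := hx
  have hs := Real.sqrt_pos.2 h0
  have hs' : (Real.sqrt (x 2) : ℂ) ≠ 0 := by exact_mod_cast hs.ne'
  have hden : den (lift x hx) basePt = (x 2)⁻¹ := by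
    simp only [den, lift, basePt, zco_mkPt, mkPt_two]
    simp [Real.sqrt_nonneg, abs_of_nonneg, h0.le]
  refine ext_zco ?_ ?_
  · have e : ((Real.sqrt (x 2) : ℝ) : ℂ) * Real.sqrt (x 2) = x 2 := by
      exact_mod_cast Real.mul_self_sqrt h0.le
    rw [zco_act, hden]
    simp only [lift, basePt, zco_mkPt, mkPt_two]
    simp
    rw [← e]
    field_simp
  · rw [act_two, hden]; simp [basePt]

/-- The displacement of `x` under `γ`: the squared distance to `1` of the conjugate of `γ` by an
isometry that moves the base point to `x`. -/
noncomputable def disp (γ : SL2C) (x : Fin 3 → ℝ) : ℝ :=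
  ‖γ 0 0 - zco x * γ 1 0 - 1‖ ^ 2
    + ‖((γ 0 0 * zco x + γ 0 1) - zco x * (γ 1 0 * zco x + γ 1 1)) / (x 2 : ℂ)‖ ^ 2
    + ‖γ 1 0 * (x 2 : ℂ)‖ ^ 2 + ‖γ 1 0 * zco x + γ 1 1 - 1‖ ^ 2

lemma disp_lift (γ : SL2C) (x : Fin 3 → ℝ) (hx : x ∈ halfSpace) :
    disp γ x = fro (((lift x hx)⁻¹ * γ * lift x hx : SL2C) - 1 : Matrix (Fin 2) (Fin 2) ℂ) := by
  have h0 : 0 < x 2 := hx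
  have hs := Real.sqrt_pos.2 h0
  have hs' : (Real.sqrt (x 2) : ℂ) ≠ 0 := by exact_mod_cast hs.ne'
  have e : (x 2 : ℂ) = ((Real.sqrt (x 2) : ℝ) : ℂ) ^ 2 := by
    exact_mod_cast (Real.sq_sqrt h0.le).symm
  have hM : (((lift x hx)⁻¹ * γ * lift x hx : SL2C) : Matrix (Fin 2) (Fin 2) ℂ) =
      !![γ 0 0 - zco x * γ 1 0, ((γ 0 0 * zco x + γ 0 1) - zco x * (γ 1 0 * zco x + γ 1 1)) / x 2;
        γ 1 0 * x 2, γ 1 0 * zco x + γ 1 1] := by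
    have hl : (lift x hx : Matrix (Fin 2) (Fin 2) ℂ) =
      !![(Real.sqrt (x 2) : ℂ), zco x / Real.sqrt (x 2); 0, 1 / Real.sqrt (x 2)] := rfl
    rw [Matrix.SpecialLinearGroup.coe_mul, Matrix.SpecialLinearGroup.coe_mul,
      Matrix.SpecialLinearGroup.coe_inv, hl, Matrix.adjugate_fin_two_of, e,
      Matrix.eta_fin_two (γ : Matrix (Fin 2) (Fin 2) ℂ)]
    generalize ((Real.sqrt (x 2) : ℝ) : ℂ) = s at hs'
    ext i j
    fin_cases i <;> fin_cases j <;> simp <;> field_simp <;> ring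
  rw [hM]
  simp [fro, Fin.sum_univ_two, disp]
  ring

lemma mul_conjTranspose_of_act_basePt {k : SL2C} (h : act k basePt = basePt) :
    (k : Matrix (Fin 2) (Fin 2) ℂ) * (k : Matrix (Fin 2) (Fin 2) ℂ)ᴴ = 1 := by
  have hb : herm basePt = 1 := by
    ext i j
    fin_cases i <;> fin_cases j <;> simp [herm, basePt]
  have := herm_act k basePt_mem
  rw [h, hb, Matrix.mul_one] at this
  exact this.symm

/-- The displacement does not depend on the isometry that moves the base point to `x`, because
stabilizers of the base point are unitary. -/
lemma disp_eq {g : SL2C} {x : Fin 3 → ℝ} (h : act g basePt = x) (γ : SL2C) :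
    disp γ x = fro ((g⁻¹ * γ * g : SL2C) - 1 : Matrix (Fin 2) (Fin 2) ℂ) := by
  have hx : x ∈ halfSpace := h ▸ act_mem g basePt_mem
  rw [disp_lift γ x hx]
  set k := (lift x hx)⁻¹ * g with hk
  have hfix : act k basePt = basePt := by
    have := act_inv_act (lift x hx) basePt_mem
    rw [act_lift] at this
    rw [hk, act_mul _ _ basePt_mem, h, this]
  have hu := mul_conjTranspose_of_act_basePt hfix
  have hk' : ((k⁻¹ : SL2C) : Matrix (Fin 2) (Fin 2) ℂ) * (k : Matrix (Fin 2) (Fin 2) ℂ) = 1 := by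
    rw [← Matrix.SpecialLinearGroup.coe_mul, inv_mul_cancel, Matrix.SpecialLinearGroup.coe_one]
  rw [← fro_conj_unitary hu hk', Matrix.mul_sub, Matrix.sub_mul, Matrix.mul_one, hk',
    ← Matrix.SpecialLinearGroup.coe_mul, ← Matrix.SpecialLinearGroup.coe_mul]
  have e : k⁻¹ * ((lift x hx)⁻¹ * γ * lift x hx) * k = g⁻¹ * γ * g := by
    rw [hk]; group
  rw [e]

lemma disp_conj (γ η : SL2C) {x : Fin 3 → ℝ} (hx : x ∈ halfSpace) :
    disp (η * γ * η⁻¹) (act η x) = disp γ x := by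
  rw [disp_eq (act_lift x hx) γ, disp_eq (g := η * lift x hx)
    (by rw [act_mul _ _ basePt_mem, act_lift x hx])]
  have e : (η * lift x hx)⁻¹ * (η * γ * η⁻¹) * (η * lift x hx) =
      (lift x hx)⁻¹ * γ * lift x hx := by group
  rw [e]

lemma disp_nonneg (γ : SL2C) (x : Fin 3 → ℝ) : 0 ≤ disp γ x := by unfold disp; positivity

lemma eq_one_of_disp {γ : SL2C} {x : Fin 3 → ℝ} (hx : x ∈ halfSpace) (h : disp γ x = 0) : γ = 1 := by
  rw [disp_eq (act_lift x hx)] at h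
  have h1 : (lift x hx)⁻¹ * γ * lift x hx = 1 :=
    Subtype.ext (sub_eq_zero.1 (fro_eq_zero h))
  calc γ = lift x hx * ((lift x hx)⁻¹ * γ * lift x hx) * (lift x hx)⁻¹ := by group
    _ = 1 := by rw [h1]; group

lemma continuousOn_disp (γ : SL2C) : ContinuousOn (disp γ) halfSpace := by
  have hz : Continuous zco := (contDiff_zco (m := 0)).continuous
  have h2 : Continuous fun x : Fin 3 → ℝ => (x 2 : ℂ) :=
    Complex.continuous_ofReal.comp (continuous_apply 2)
  have hA : Continuous fun x => γ 0 0 - zco x * γ 1 0 - 1 :=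
    (continuous_const.sub (hz.mul continuous_const)).sub continuous_const
  have hD : Continuous fun x => γ 1 0 * zco x + γ 1 1 :=
    (continuous_const.mul hz).add continuous_const
  have hB : Continuous fun x => (γ 0 0 * zco x + γ 0 1) - zco x * (γ 1 0 * zco x + γ 1 1) :=
    ((continuous_const.mul hz).add continuous_const).sub (hz.mul hD)
  have hBt : ContinuousOn (fun x : Fin 3 → ℝ => ((γ 0 0 * zco x + γ 0 1)
      - zco x * (γ 1 0 * zco x + γ 1 1)) / (x 2 : ℂ)) halfSpace :=
    hB.continuousOn.div h2.continuousOn fun x hx => by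
      exact_mod_cast (show 0 < x 2 from hx).ne'
  have c1 : ContinuousOn (fun x => ‖γ 0 0 - zco x * γ 1 0 - 1‖ ^ 2) halfSpace :=
    (hA.norm.pow 2).continuousOn
  have c2 : ContinuousOn (fun x : Fin 3 → ℝ => ‖((γ 0 0 * zco x + γ 0 1)
      - zco x * (γ 1 0 * zco x + γ 1 1)) / (x 2 : ℂ)‖ ^ 2) halfSpace := hBt.norm.pow 2
  have c3 : ContinuousOn (fun x : Fin 3 → ℝ => ‖γ 1 0 * (x 2 : ℂ)‖ ^ 2) halfSpace :=
    ((continuous_const.mul h2).norm.pow 2).continuousOn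
  have c4 : ContinuousOn (fun x => ‖γ 1 0 * zco x + γ 1 1 - 1‖ ^ 2) halfSpace :=
    ((hD.sub continuous_const).norm.pow 2).continuousOn
  unfold disp
  exact ((c1.add c2).add c3).add c4

end Hyp3

/-! ### Discrete groups and Margulis' lemma -/

namespace Hyp3

/-- The groups under consideration, normalized to contain `-1`: every bounded subset is finite and
the action of `Γ / ±1` on upper half-space is free. -/
structure IsFreeDiscrete (Γ : Subgroup SL2C) : Prop where
  finite : ∀ R : ℝ, {γ : SL2C | γ ∈ Γ ∧ fro γ ≤ R}.Finite
  free : ∀ γ ∈ Γ, ∀ p ∈ halfSpace, act γ p = p → γ = 1 ∨ γ = -1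
  neg_one : -1 ∈ Γ

lemma isCompact_fro_le (R : ℝ) : IsCompact {γ : SL2C | fro γ ≤ R} := by
  have hemb : Topology.IsClosedEmbedding
      (Subtype.val : SL2C → Matrix (Fin 2) (Fin 2) ℂ) := by
    refine Topology.IsClosedEmbedding.subtypeVal ?_
    exact isClosed_eq (Continuous.matrix_det continuous_id) continuous_const
  have hK : IsCompact (X := Matrix (Fin 2) (Fin 2) ℂ) (Set.univ.pi fun _ => Set.univ.pi fun _ =>
      Metric.closedBall (0 : ℂ) (Real.sqrt R)) :=
    isCompact_univ_pi fun _ => isCompact_univ_pi fun _ => isCompact_closedBall _ _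
  refine (hemb.isCompact_preimage hK).of_isClosed_subset ?_ fun γ hγ i _ j _ => ?_
  · refine isClosed_le ?_ continuous_const
    unfold fro
    refine continuous_finsetSum _ fun i _ => continuous_finsetSum _ fun j _ => ?_
    have hc : Continuous fun A : Matrix (Fin 2) (Fin 2) ℂ => A i j := continuous_apply_apply i j
    exact (hc.comp hemb.continuous).norm.pow 2
  · rw [mem_closedBall_zero_iff]
    exact Real.le_sqrt_of_sq_le ((norm_sq_le_fro _ i j).trans hγ)

/-- Discrete subgroups are closed, so they meet compact sets in finite sets. -/
lemma finite_of_discrete {Γ : Subgroup SL2C} (h : DiscreteTopology Γ) (R : ℝ) :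
    {γ : SL2C | γ ∈ Γ ∧ fro γ ≤ R}.Finite := by
  have hc : IsClosed (Γ : Set SL2C) := Subgroup.isClosed_of_discrete
  have h1 : IsCompact ((Γ : Set SL2C) ∩ {γ | fro γ ≤ R}) := (isCompact_fro_le R).inter_left hc
  exact h1.finite (IsDiscrete.mono ⟨h⟩ Set.inter_subset_left)

/-- The kernel of the action of `SL(2, ℂ)` is `±1`. -/
lemma eq_one_or_of_act_eq {γ : SL2C} (h : ∀ p ∈ halfSpace, act γ p = p) : γ = 1 ∨ γ = -1 := by
  have hden : ∀ z : ℂ, ∀ t : ℝ, 0 < t → ‖γ 1 0 * z + γ 1 1‖ ^ 2 + ‖γ 1 0‖ ^ 2 * t ^ 2 = 1 := by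
    intro z t ht
    have h1 := congrFun (h (mkPt z t) (mkPt_mem z ht)) 2
    rw [act_two] at h1
    have h2 := den_pos γ (mkPt_mem z ht)
    rw [div_eq_iff h2.ne', mkPt_two] at h1
    have h3 : den γ (mkPt z t) = 1 := by
      have : t * (den γ (mkPt z t) - 1) = 0 := by linarith
      linarith [(mul_eq_zero.1 this).resolve_left ht.ne']
    simpa [den] using h3
  have hc : γ 1 0 = 0 := by
    have h1 := hden 0 1 one_pos
    have h2 := hden 0 2 two_pos
    have : ‖γ 1 0‖ ^ 2 = 0 := by linarith
    simpa using this
  have hdet := det_eq γ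
  have hz : ∀ z : ℂ, (γ 0 0 * z + γ 0 1) * (starRingEnd ℂ) (γ 1 1) = z := by
    intro z
    have h1 := congrArg zco (h (mkPt z 1) (mkPt_mem z one_pos))
    have h3 : den γ (mkPt z 1) = 1 := by
      have := hden z 1 one_pos
      simpa [den] using this
    rw [zco_act, h3] at h1
    simpa [hc] using h1
  rw [hc, mul_zero, sub_zero] at hdet
  have hd : γ 1 1 ≠ 0 := fun hd => by simp [hd] at hdet
  have hb : γ 0 1 = 0 := by
    have := hz 0
    simpa [hd] using this
  have had := hz 1
  rw [hb, mul_one, add_zero] at had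
  have ha : γ 0 0 ≠ 0 := fun ha => by simp [ha] at hdet
  have hreal : (starRingEnd ℂ) (γ 1 1) = γ 1 1 := mul_left_cancel₀ ha (had.trans hdet.symm)
  have hsq : γ 1 1 * γ 1 1 = 1 := by
    have h1 := hden 0 1 one_pos
    simp [hc] at h1
    have h2 : (γ 1 1) * (starRingEnd ℂ) (γ 1 1) = 1 := by
      have h3 : ‖γ 1 1‖ ^ 2 = 1 := by
        rcases h1 with h1 | h1 <;> rw [h1] <;> norm_num
      rw [Complex.mul_conj, Complex.normSq_eq_norm_sq, h3, Complex.ofReal_one]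
    rwa [hreal] at h2
  rcases mul_self_eq_one_iff.1 hsq with h1 | h1
  · left
    ext i j
    rw [h1, mul_one] at hdet
    fin_cases i <;> fin_cases j <;> simp [hc, hb, h1, hdet]
  · right
    ext i j
    have : γ 0 0 = -1 := by rw [h1] at hdet; linear_combination -hdet
    fin_cases i <;> fin_cases j <;> simp [hc, hb, h1, this]

/-- The group generated by `Γ` and `-1`. -/
def adjoinNegOne (Γ : Subgroup SL2C) : Subgroup SL2C where
  carrier := {γ | γ ∈ Γ ∨ -γ ∈ Γ}
  mul_mem' := by
    rintro a b (ha | ha) (hb | hb)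
    · exact Or.inl (Γ.mul_mem ha hb)
    · exact Or.inr (by simpa using Γ.mul_mem ha hb)
    · exact Or.inr (by simpa using Γ.mul_mem ha hb)
    · exact Or.inl (by simpa using Γ.mul_mem ha hb)
  one_mem' := Or.inl Γ.one_mem
  inv_mem' := by
    rintro a (ha | ha)
    · exact Or.inl (Γ.inv_mem ha)
    · exact Or.inr (by simpa using Γ.inv_mem ha)

/-- Adjoining `-1` to the group does not change the quotient. -/
lemma IsManifoldGroup.exists_isFreeDiscrete {Γ : Subgroup SL2C} (h : IsManifoldGroup Γ) :
    ∃ Γ' : Subgroup SL2C, Γ ≤ Γ' ∧ IsFreeDiscrete Γ' ∧ ∀ γ ∈ Γ', ∃ η ∈ Γ, act γ = act η := by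
  refine ⟨adjoinNegOne Γ, fun γ hγ => Or.inl hγ, ⟨fun R => ?_, ?_, ?_⟩, ?_⟩
  · have hf := finite_of_discrete h.discrete R
    refine (hf.union (hf.image fun γ => -γ)).subset ?_
    rintro γ ⟨hγ | hγ, hR⟩
    · exact Or.inl ⟨hγ, hR⟩
    · exact Or.inr ⟨-γ, ⟨hγ, by simpa [fro] using hR⟩, neg_neg γ⟩
  · rintro γ (hγ | hγ) p hp hfix
    · exact eq_one_or_of_act_eq (h.free γ hγ ⟨p, hp, hfix⟩)
    · rw [← act_neg] at hfix
      rcases eq_one_or_of_act_eq (h.free _ hγ ⟨p, hp, hfix⟩) with e | e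
      · exact Or.inr (by rw [← e, neg_neg])
      · exact Or.inl (neg_injective e)
  · exact Or.inr (by simp)
  · rintro γ (hγ | hγ)
    · exact ⟨γ, hγ, rfl⟩
    · exact ⟨-γ, hγ, funext fun p => (act_neg γ p).symm⟩

/-- The conjugate group `κ⁻¹ Γ κ`. -/
def conjGroup (κ : SL2C) (Γ : Subgroup SL2C) : Subgroup SL2C := Γ.comap (MulAut.conj κ).toMonoidHom

lemma mem_conjGroup {κ γ : SL2C} {Γ : Subgroup SL2C} : γ ∈ conjGroup κ Γ ↔ κ * γ * κ⁻¹ ∈ Γ := Iff.rfl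

lemma IsFreeDiscrete.conj {Γ : Subgroup SL2C} (h : IsFreeDiscrete Γ) (κ : SL2C) :
    IsFreeDiscrete (conjGroup κ Γ) where
  finite R := by
    refine Set.Finite.of_finite_image (f := fun γ => κ * γ * κ⁻¹)
      ((h.finite (fro κ * R * fro κ)).subset ?_) fun a _ b _ hab => ?_
    · rintro _ ⟨γ, ⟨hγ, hR⟩, rfl⟩
      refine ⟨hγ, ?_⟩
      rw [Matrix.SpecialLinearGroup.coe_mul, Matrix.SpecialLinearGroup.coe_mul]
      refine (fro_mul_le _ _).trans ?_
      rw [fro_inv]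
      refine mul_le_mul_of_nonneg_right ((fro_mul_le _ _).trans ?_) (fro_nonneg _)
      exact mul_le_mul_of_nonneg_left hR (fro_nonneg _)
    · simpa using hab
  free γ hγ p hp hfix := by
    have h1 := h.free (κ * γ * κ⁻¹) (mem_conjGroup.1 hγ) (act κ p) (act_mem κ hp) (by
      rw [act_mul _ _ (act_mem κ hp), act_inv_act κ hp, act_mul _ _ hp, hfix])
    have e : γ = κ⁻¹ * (κ * γ * κ⁻¹) * κ := by group
    rcases h1 with h1 | h1
    · left; rw [e, h1]; simp
    · right; rw [e, h1]; simp
  neg_one := by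
    rw [mem_conjGroup]; simpa using h.neg_one

/-- Displacement bounds the conjugate of `γ` by a fixed isometry, so it takes small values on
finitely many elements only. -/
lemma IsFreeDiscrete.finite_disp {Γ : Subgroup SL2C} (h : IsFreeDiscrete Γ) {x : Fin 3 → ℝ}
    (hx : x ∈ halfSpace) (r : ℝ) : {γ : SL2C | γ ∈ Γ ∧ disp γ x ≤ r}.Finite := by
  set g := lift x hx with hg
  refine Set.Finite.of_finite_image (f := fun γ => g⁻¹ * γ * g)
    (((h.conj g).finite (2 * r + 4)).subset ?_) fun a _ b _ hab => by simpa using hab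
  rintro _ ⟨γ, ⟨hγ, hr⟩, rfl⟩
  refine ⟨?_, ?_⟩
  · rw [mem_conjGroup]
    convert hγ using 1
    group
  · rw [disp_lift γ x hx] at hr
    refine (fro_le_of_sub_one _).trans ?_
    linarith

/-- The off-diagonal entries and the difference of the diagonal entries are the coordinates modulo
scalars; two matrices commute if and only if these triples are proportional. -/
lemma entries_of_commute {X Y : SL2C} (h : X * Y = Y * X) : X 0 1 * Y 1 0 = Y 0 1 * X 1 0 ∧
    X 0 1 * (Y 0 0 - Y 1 1) = Y 0 1 * (X 0 0 - X 1 1) ∧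
    X 1 0 * (Y 0 0 - Y 1 1) = Y 1 0 * (X 0 0 - X 1 1) := by
  have h1 : (X : Matrix (Fin 2) (Fin 2) ℂ) * Y = Y * X := congrArg Subtype.val h
  have e00 := congrFun (congrFun h1 0) 0
  have e01 := congrFun (congrFun h1 0) 1
  have e10 := congrFun (congrFun h1 1) 0
  simp only [Matrix.mul_apply, Fin.sum_univ_two] at e00 e01 e10
  exact ⟨by linear_combination e00, by linear_combination -e01, by linear_combination e10⟩

/-- A matrix that is not a scalar multiple of the identity has a commutative centralizer. -/
lemma commute_of_commute {A B C : SL2C} (hC : C ≠ 1) (hC' : C ≠ -1) (hA : A * C = C * A)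
    (hB : B * C = C * B) : A * B = B * A := by
  obtain ⟨a1, a2, a3⟩ := entries_of_commute hA
  obtain ⟨b1, b2, b3⟩ := entries_of_commute hB
  -- proportionality of both triples to a nonzero third one implies their proportionality
  have key : A 0 1 * B 1 0 = B 0 1 * A 1 0 ∧ A 0 1 * (B 0 0 - B 1 1) = B 0 1 * (A 0 0 - A 1 1) ∧
      A 1 0 * (B 0 0 - B 1 1) = B 1 0 * (A 0 0 - A 1 1) := by
    by_cases h1 : C 0 1 = 0
    · by_cases h2 : C 1 0 = 0
      · have h3 : C 0 0 - C 1 1 ≠ 0 := by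
          intro h3
          have hdet := det_eq C
          have h4 : C 1 1 = C 0 0 := by linear_combination -h3
          rw [h1, h4, zero_mul, sub_zero] at hdet
          rcases mul_self_eq_one_iff.1 hdet with h5 | h5
          · exact hC (by ext i j; fin_cases i <;> fin_cases j <;> simp [h1, h2, h4, h5])
          · exact hC' (by ext i j; fin_cases i <;> fin_cases j <;> simp [h1, h2, h4, h5])
        simp only [h1, h2, zero_mul, mul_eq_zero, h3, or_false] at a2 a3 b2 b3
        simp [a2, a3, b2, b3]
      · refine ⟨?_, ?_, ?_⟩ <;> refine mul_left_cancel₀ (pow_ne_zero 2 h2) ?_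
        · grind
        · grind
        · grind
    · refine ⟨?_, ?_, ?_⟩ <;> refine mul_left_cancel₀ (pow_ne_zero 2 h1) ?_
      · grind
      · grind
      · grind
  obtain ⟨k1, k2, k3⟩ := key
  refine Subtype.ext ?_
  show (A : Matrix (Fin 2) (Fin 2) ℂ) * B = B * A
  ext i j
  fin_cases i <;> fin_cases j <;> simp only [Matrix.mul_apply, Fin.sum_univ_two, Fin.zero_eta,
    Fin.mk_one]
  · linear_combination k1
  · linear_combination -k2
  · linear_combination k3
  · linear_combination -k1

/-- The commutator of two matrices close to `1` is quadratically close to `1`, by `A B A⁻¹ B⁻¹ - 1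
= ((A - 1)(B - 1) - (B - 1)(A - 1)) A⁻¹ B⁻¹`. -/
lemma fro_commutator_sub_one_le (A B : SL2C) :
    fro ((A * B * A⁻¹ * B⁻¹ : SL2C) - 1 : Matrix (Fin 2) (Fin 2) ℂ) ≤
      4 * fro (A - 1 : Matrix (Fin 2) (Fin 2) ℂ) * fro (B - 1 : Matrix (Fin 2) (Fin 2) ℂ) *
        (fro A * fro B) := by
  have h1 : ((A * B * A⁻¹ * B⁻¹ : SL2C) - 1 : Matrix (Fin 2) (Fin 2) ℂ) =
      ((A - 1) * (B - 1) - (B - 1) * (A - 1)) * ((A⁻¹ : SL2C) * (B⁻¹ : SL2C)) := by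
    have e : (A * B - B * A : Matrix (Fin 2) (Fin 2) ℂ) * ((A⁻¹ : SL2C) * (B⁻¹ : SL2C)) =
        (A * B * A⁻¹ * B⁻¹ : SL2C) - (B * A * A⁻¹ * B⁻¹ : SL2C) := by
      simp only [Matrix.SpecialLinearGroup.coe_mul, Matrix.sub_mul, Matrix.mul_assoc]
    rw [show (B * A * A⁻¹ * B⁻¹ : SL2C) = 1 by group, Matrix.SpecialLinearGroup.coe_one] at e
    rw [← e]
    congr 1
    noncomm_ring
  rw [h1]
  refine (fro_mul_le _ _).trans (mul_le_mul ?_ ?_ (fro_nonneg _) ?_)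
  · refine (fro_sub_le _ _).trans ?_
    have h2 := fro_mul_le (A - 1 : Matrix (Fin 2) (Fin 2) ℂ) (B - 1)
    have h3 := fro_mul_le (B - 1 : Matrix (Fin 2) (Fin 2) ℂ) (A - 1)
    linarith
  · refine (fro_mul_le _ _).trans ?_
    rw [fro_inv, fro_inv]
  · have := fro_nonneg (A - 1 : Matrix (Fin 2) (Fin 2) ℂ)
    have := fro_nonneg (B - 1 : Matrix (Fin 2) (Fin 2) ℂ)
    positivity

/-- The smallness threshold for displacements: below it, `disp_commutator_le` makes the displacement
of a commutator smaller than those of its factors. -/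
noncomputable def thr : ℝ := 1 / 400

lemma disp_commutator_le {A B : SL2C} {x : Fin 3 → ℝ} (hx : x ∈ halfSpace) (hA : disp A x < thr)
    (hB : disp B x < thr) : disp (A * B * A⁻¹ * B⁻¹) x ≤ 100 * disp A x * disp B x := by
  set g := lift x hx
  rw [disp_lift _ x hx] at hA hB ⊢
  rw [disp_lift A x hx, disp_lift B x hx]
  have e : g⁻¹ * (A * B * A⁻¹ * B⁻¹) * g =
      (g⁻¹ * A * g) * (g⁻¹ * B * g) * (g⁻¹ * A * g)⁻¹ * (g⁻¹ * B * g)⁻¹ := by group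
  rw [e]
  generalize g⁻¹ * A * g = A' at *
  generalize g⁻¹ * B * g = B' at *
  refine (fro_commutator_sub_one_le A' B').trans ?_
  have a1 := fro_le_of_sub_one (A' : Matrix (Fin 2) (Fin 2) ℂ)
  have b1 := fro_le_of_sub_one (B' : Matrix (Fin 2) (Fin 2) ℂ)
  have a0 := fro_nonneg (A' - 1 : Matrix (Fin 2) (Fin 2) ℂ)
  have b0 := fro_nonneg (B' - 1 : Matrix (Fin 2) (Fin 2) ℂ)
  unfold thr at hA hB
  have h5 : fro A' * fro B' ≤ 5 * 5 :=
    mul_le_mul (by linarith) (by linarith) (fro_nonneg _) (by norm_num)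
  have := mul_nonneg a0 b0
  nlinarith

lemma disp_neg_one {x : Fin 3 → ℝ} (hx : x ∈ halfSpace) : ¬ disp (-1) x < thr := by
  rw [disp_lift _ x hx]
  have : (lift x hx)⁻¹ * (-1) * lift x hx = -1 := by simp
  rw [this]
  simp [fro, Fin.sum_univ_two, thr]
  norm_num

/-- Margulis' lemma: elements of a discrete group that displace a point by little commute. A
noncommuting pair with minimal displacements would commute with its commutator. -/
lemma IsFreeDiscrete.commute_of_disp_lt {Γ : Subgroup SL2C} (h : IsFreeDiscrete Γ) {A B : SL2C}
    (hA : A ∈ Γ) (hB : B ∈ Γ) {x : Fin 3 → ℝ} (hx : x ∈ halfSpace) (hAx : disp A x < thr)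
    (hBx : disp B x < thr) : A * B = B * A := by
  by_contra hne
  -- the noncommuting pairs with small displacements at `x` form a finite set; consider a minimal
  -- one
  set F : Set (SL2C × SL2C) := {q | (q.1 ∈ Γ ∧ disp q.1 x < thr) ∧ (q.2 ∈ Γ ∧ disp q.2 x < thr) ∧
    q.1 * q.2 ≠ q.2 * q.1} with hF
  have hfin : F.Finite := by
    have h1 := h.finite_disp hx thr
    exact (h1.prod h1).subset fun q hq => ⟨⟨hq.1.1, hq.1.2.le⟩, hq.2.1.1, hq.2.1.2.le⟩
  obtain ⟨⟨a, b⟩, ⟨⟨ha, hax⟩, ⟨hb, hbx⟩, hab⟩, hmin⟩ := Set.exists_min_image F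
    (fun q => disp q.1 x + disp q.2 x) hfin ⟨(A, B), ⟨hA, hAx⟩, ⟨hB, hBx⟩, hne⟩
  set c := a * b * a⁻¹ * b⁻¹ with hc
  have hcΓ : c ∈ Γ := Γ.mul_mem (Γ.mul_mem (Γ.mul_mem ha hb) (Γ.inv_mem ha)) (Γ.inv_mem hb)
  have hcx := disp_commutator_le hx hax hbx
  rw [← hc] at hcx
  have a0 := disp_nonneg a x
  have b0 := disp_nonneg b x
  have hpos : ∀ {γ : SL2C}, γ ≠ 1 → 0 < disp γ x := fun hγ =>
    (disp_nonneg _ x).lt_of_ne fun h0 => hγ (eq_one_of_disp hx h0.symm)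
  have ha1 : 0 < disp a x := hpos fun e => hab (by rw [e]; simp)
  have hb1 : 0 < disp b x := hpos fun e => hab (by rw [e]; simp)
  unfold thr at hax hbx
  have hca : disp c x < disp a x := by nlinarith
  have hcb : disp c x < disp b x := by nlinarith
  have hct : disp c x < thr := by unfold thr; linarith
  have e1 : a * c = c * a := by
    by_contra hac
    have := hmin (a, c) ⟨⟨ha, hax⟩, ⟨hcΓ, hct⟩, hac⟩
    simp only at this
    linarith
  have e2 : b * c = c * b := by
    by_contra hbc
    have := hmin (b, c) ⟨⟨hb, hbx⟩, ⟨hcΓ, hct⟩, hbc⟩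
    simp only at this
    linarith
  -- by minimality the commutator commutes with both elements; as it is not central, they commute
  by_cases hc1 : c = 1
  · refine hab ?_
    calc a * b = c * (b * a) := by rw [hc]; group
      _ = b * a := by rw [hc1, one_mul]
  · refine hab (commute_of_commute hc1 (fun hc2 => ?_) e1 e2)
    rw [hc2] at hct
    exact disp_neg_one hx hct

end Hyp3

/-! ### Balls around thick points -/

namespace Hyp3

/-- A compact box; these boxes exhaust upper half-space. -/
def boxK (R : ℝ) : Set (Fin 3 → ℝ) := {p | ‖zco p‖ ≤ R ∧ R⁻¹ ≤ p 2 ∧ p 2 ≤ R}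

lemma boxK_subset {R : ℝ} (hR : 0 < R) : boxK R ⊆ halfSpace := fun _ hp =>
  lt_of_lt_of_le (inv_pos.2 hR) hp.2.1

lemma measurableSet_boxK (R : ℝ) : MeasurableSet (boxK R) := by
  have hz : Continuous zco := (contDiff_zco (m := 0)).continuous
  refine IsClosed.measurableSet ?_
  exact (isClosed_le hz.norm continuous_const).inter
    ((isClosed_le continuous_const (continuous_apply 2)).inter
      (isClosed_le (continuous_apply 2) continuous_const))

/-- The orbit map at the base point maps bounded sets of matrices into boxes. -/
lemma act_basePt_mem_boxK {γ : SL2C} {R : ℝ} (hR : 1 ≤ R) (h : fro γ ≤ R) :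
    act γ basePt ∈ boxK (R ^ 2) := by
  have hN : den γ basePt = ‖γ 1 1‖ ^ 2 + ‖γ 1 0‖ ^ 2 := by simp [den, basePt]
  have hN0 := den_pos γ basePt_mem
  have h' := h
  simp only [fro, Fin.sum_univ_two] at h'
  have hdet : (1 : ℝ) ≤ ‖γ 0 0‖ * ‖γ 1 1‖ + ‖γ 0 1‖ * ‖γ 1 0‖ := by
    have := norm_sub_le (γ 0 0 * γ 1 1) (γ 0 1 * γ 1 0)
    rw [det_eq, norm_one, norm_mul, norm_mul] at this
    exact this
  have hge : 1 ≤ R * den γ basePt := by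
    rw [hN]
    have a : 1 ≤ (‖γ 0 0‖ ^ 2 + ‖γ 0 1‖ ^ 2) * (‖γ 1 1‖ ^ 2 + ‖γ 1 0‖ ^ 2) := by
      refine (one_le_pow₀ hdet (n := 2)).trans ?_
      nlinarith [sq_nonneg (‖γ 0 0‖ * ‖γ 1 0‖ - ‖γ 0 1‖ * ‖γ 1 1‖)]
    refine a.trans (mul_le_mul_of_nonneg_right ?_ (by positivity))
    nlinarith [sq_nonneg ‖γ 1 0‖, sq_nonneg ‖γ 1 1‖]
  have hle : den γ basePt ≤ R := by
    rw [hN]; nlinarith [sq_nonneg ‖γ 0 0‖, sq_nonneg ‖γ 0 1‖]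
  have hRR : R ≤ R ^ 2 := by nlinarith
  have hb2 : basePt 2 = 1 := by simp [basePt]
  refine ⟨?_, ?_, ?_⟩
  · rw [zco_act, norm_div, Complex.norm_real, Real.norm_of_nonneg hN0.le, div_le_iff₀ hN0]
    have e : (γ 0 0 * zco basePt + γ 0 1) * (starRingEnd ℂ) (γ 1 0 * zco basePt + γ 1 1)
      + γ 0 0 * (starRingEnd ℂ) (γ 1 0) * (basePt 2 : ℂ) ^ 2 =
        γ 0 1 * (starRingEnd ℂ) (γ 1 1) + γ 0 0 * (starRingEnd ℂ) (γ 1 0) := by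
      simp [basePt]
    rw [e]
    refine (norm_add_le _ _).trans ?_
    rw [norm_mul, norm_mul, RCLike.norm_conj, RCLike.norm_conj]
    have : ‖γ 0 1‖ * ‖γ 1 1‖ + ‖γ 0 0‖ * ‖γ 1 0‖ ≤ R := by
      nlinarith [sq_nonneg (‖γ 0 1‖ - ‖γ 1 1‖), sq_nonneg (‖γ 0 0‖ - ‖γ 1 0‖)]
    nlinarith
  · rw [act_two, hb2, one_div]
    exact inv_anti₀ hN0 (hle.trans hRR)
  · rw [act_two, hb2, one_div]
    refine (inv_le_of_inv_le₀ (by positivity) ?_)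
    rw [inv_le_iff_one_le_mul₀ (by positivity)]
    nlinarith

lemma fro_lift_le {x : Fin 3 → ℝ} {R : ℝ} (hR : 1 ≤ R) (hx : x ∈ boxK R) :
    fro (lift x (boxK_subset (by linarith) hx)) ≤ 3 * R ^ 3 := by
  obtain ⟨h1, h2, h3⟩ := hx
  have ht : 0 < x 2 := lt_of_lt_of_le (by positivity) h2
  have h4 : (x 2)⁻¹ ≤ R := inv_le_of_inv_le₀ (by linarith) h2
  have e : fro (lift x ht) = x 2 + ‖zco x‖ ^ 2 * (x 2)⁻¹ + (x 2)⁻¹ := by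
    simp [fro, lift, Fin.sum_univ_two, div_pow, Real.sq_sqrt ht.le, abs_of_nonneg (Real.sqrt_nonneg _)]
    field_simp
  rw [e]
  have h5 : ‖zco x‖ ^ 2 * (x 2)⁻¹ ≤ R ^ 2 * R := by gcongr
  have h6 : R ≤ R ^ 3 := by nlinarith [mul_nonneg (sub_nonneg.2 hR) (by positivity : 0 ≤ R ^ 2 + R)]
  nlinarith

/-- Up to the lifts of `p` and `q`, a matrix that moves `p` to `q` is unitary, of squared norm `2`.
-/
lemma fro_le_of_act_eq {h : SL2C} {p q : Fin 3 → ℝ} (hp : p ∈ halfSpace) (hq : q ∈ halfSpace)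
    (e : act h p = q) : fro h ≤ 2 * fro (lift q hq) * fro (lift p hp) := by
  set k := (lift q hq)⁻¹ * h * lift p hp with hk
  have hfix : act k basePt = basePt := by
    have := act_inv_act (lift q hq) basePt_mem
    rw [act_lift] at this
    rw [hk, act_mul _ _ basePt_mem, act_lift, act_mul _ _ hp, e, this]
  have h2 : fro k = 2 := by
    have := fro_eq_trace (k : Matrix (Fin 2) (Fin 2) ℂ)
    rw [mul_conjTranspose_of_act_basePt hfix] at this
    exact Complex.ofReal_injective (by simpa using this)
  have e2 : h = lift q hq * k * (lift p hp)⁻¹ := by rw [hk]; group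
  have h3 : fro h = fro (lift q hq * k * (lift p hp)⁻¹ : SL2C) := by rw [← e2]
  rw [h3, Matrix.SpecialLinearGroup.coe_mul, Matrix.SpecialLinearGroup.coe_mul]
  refine (fro_mul_le _ _).trans ?_
  rw [fro_inv]
  refine mul_le_mul_of_nonneg_right ((fro_mul_le _ _).trans ?_) (fro_nonneg _)
  rw [h2, mul_comm]

lemma fro_le_of_boxK {h : SL2C} {p q : Fin 3 → ℝ} {R : ℝ} (hR : 1 ≤ R) (hp : p ∈ boxK R)
    (hq : q ∈ boxK R) (e : act h p = q) : fro h ≤ 18 * R ^ 6 := by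
  have hR0 : 0 < R := by linarith
  refine (fro_le_of_act_eq (boxK_subset hR0 hp) (boxK_subset hR0 hq) e).trans ?_
  have h1 := fro_lift_le hR hp
  have h2 := fro_lift_le hR hq
  calc _ ≤ 2 * (3 * R ^ 3) * (3 * R ^ 3) := by
        gcongr
        exact fro_nonneg _
    _ = _ := by ring

lemma eBall_basePt_subset : eBall basePt ⊆ boxK 2 := fun p hp => by
  have hb : basePt 0 = 0 ∧ basePt 1 = 0 ∧ basePt 2 = 1 := by simp [basePt, mkPt]
  have h0 := abs_sub_lt_of_mem_eBall basePt_mem hp 0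
  have h1 := abs_sub_lt_of_mem_eBall basePt_mem hp 1
  have h2 := height_of_mem_eBall basePt_mem hp
  rw [hb.1, hb.2.2, sub_zero] at h0
  rw [hb.2.1, hb.2.2, sub_zero] at h1
  rw [hb.2.2] at h2
  refine ⟨(Complex.norm_le_abs_re_add_abs_im _).trans ?_, ?_, ?_⟩
  · simp only [zco]; linarith
  · norm_num; linarith
  · linarith

lemma volume_eBall_pos : 0 < ∫⁻ _ in eBall basePt, 1 ∂(riemVol metric) := by
  rw [setLIntegral_riemVol (isOpen_eBall _).measurableSet (eBall_subset basePt_mem)]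
  have hne : (eBall basePt).Nonempty := ⟨basePt, by simp [eBall, eDist, basePt]⟩
  have hpos : 0 < volume (eBall basePt) := (isOpen_eBall _).measure_pos _ hne
  refine (setLIntegral_pos_iff (by fun_prop)).2 (hpos.trans_le (measure_mono fun p hp => ⟨?_, hp⟩))
  have : 0 < p 2 := eBall_subset basePt_mem hp
  simp; positivity

/-- Uniformly separated subsets of a bounded set of matrices have bounded cardinality. -/
lemma exists_card_bound (Q : ℝ) {ε : ℝ} (hε : 0 < ε) : ∃ N : ℕ, ∀ S : Finset SL2C,
    (∀ γ ∈ S, fro γ ≤ Q) → (∀ γ ∈ S, ∀ η ∈ S, γ ≠ η →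
      ε ≤ fro (γ - η : Matrix (Fin 2) (Fin 2) ℂ)) → S.card ≤ N := by
  classical
  set U : SL2C → Set SL2C := fun γ₀ => {γ | fro (γ - γ₀ : Matrix (Fin 2) (Fin 2) ℂ) < ε / 4} with hU
  have hcont : ∀ γ₀ : SL2C, Continuous fun γ : SL2C => fro (γ - γ₀ : Matrix (Fin 2) (Fin 2) ℂ) := by
    intro γ₀
    have hv : Continuous fun γ : SL2C => (γ : Matrix (Fin 2) (Fin 2) ℂ) := continuous_subtype_val
    unfold fro
    refine continuous_finsetSum _ fun i _ => continuous_finsetSum _ fun j _ => ?_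
    have hc : Continuous fun A : Matrix (Fin 2) (Fin 2) ℂ => A i j := continuous_apply_apply i j
    exact ((hc.comp hv).sub continuous_const).norm.pow 2
  obtain ⟨t, -, ht⟩ := (isCompact_fro_le Q).elim_nhds_subcover U fun γ₀ _ =>
    (isOpen_lt (hcont γ₀) continuous_const).mem_nhds (by simp [fro, hε])
  refine ⟨t.card, fun S hS hsep => ?_⟩
  have hex : ∀ γ ∈ S, ∃ γ₀ ∈ t, fro (γ - γ₀ : Matrix (Fin 2) (Fin 2) ℂ) < ε / 4 := fun γ hγ => by
    have := ht (hS γ hγ)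
    simpa [hU] using this
  choose! c hc hcε using hex
  refine Finset.card_le_card_of_injOn c hc fun γ hγ η hη hcc => ?_
  by_contra hne
  have h1 := hsep γ hγ η hη hne
  have h2 := fro_sub_le (γ - c γ : Matrix (Fin 2) (Fin 2) ℂ) (η - c γ)
  rw [sub_sub_sub_cancel_right] at h2
  have h3 := hcε γ hγ
  have h4 := hcε η hη
  rw [← hcc] at h4
  linarith

lemma IsFreeDiscrete.countable {Γ : Subgroup SL2C} (h : IsFreeDiscrete Γ) : Countable Γ := by
  have : (Γ : Set SL2C) = ⋃ n : ℕ, {γ | γ ∈ Γ ∧ fro γ ≤ n} := by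
    ext γ
    simp only [Set.mem_iUnion, Set.mem_ofPred_eq, SetLike.mem_coe]
    exact ⟨fun hγ => (exists_nat_ge (fro γ)).imp fun n hn => ⟨hγ, hn⟩, fun ⟨n, hn⟩ => hn.1⟩
  have h2 : (Γ : Set SL2C).Countable := by
    rw [this]; exact Set.countable_iUnion fun n => (h.finite n).countable
  exact h2.to_subtype

/-- Points that are displaced substantially by all nontrivial elements of the group. -/
def Thick (Γ : Subgroup SL2C) (x : Fin 3 → ℝ) : Prop := ∀ γ ∈ Γ, γ ≠ 1 → thr ≤ disp γ x

/-- The hyperbolic ball around `x` that is the image of a standard ball around the base point. -/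
noncomputable def hBall (x : Fin 3 → ℝ) (hx : x ∈ halfSpace) : Set (Fin 3 → ℝ) :=
  act (lift x hx) '' eBall basePt

/-- Balls around thick points cover their image in the quotient a bounded number of times. -/
lemma exists_thick_multiplicity : ∃ N : ℕ, ∀ Γ : Subgroup SL2C, IsFreeDiscrete Γ →
    ∀ x (hx : x ∈ halfSpace), Thick Γ x → ∃ s : Finset SL2C, s.card ≤ N ∧ (∀ σ ∈ s, σ ∈ Γ) ∧
      ∀ p ∈ hBall x hx, ∀ γ ∈ Γ, act γ p ∈ hBall x hx → γ ∈ s := by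
  set Q : ℝ := 18 * 2 ^ 6 with hQ
  obtain ⟨N, hN⟩ := exists_card_bound Q (ε := thr / Q) (by unfold thr; positivity)
  refine ⟨N, fun Γ hΓ x hx hthick => ?_⟩
  set g := lift x hx with hg
  have hfin := (hΓ.conj g).finite Q
  set S := hfin.toFinset with hS
  have hSmem : ∀ {h}, h ∈ S ↔ g * h * g⁻¹ ∈ Γ ∧ fro h ≤ Q := fun {h} => by
    rw [hS, Set.Finite.mem_toFinset]; rfl
  classical
  refine ⟨S.image fun h => g * h * g⁻¹, Finset.card_image_le.trans (hN S (fun h hh => (hSmem.1 hh).2)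
    fun h hh h' hh' hne => ?_), ?_, ?_⟩
  -- thickness separates the conjugated elements from each other, as `h'⁻¹ h - 1 = h'⁻¹ (h - h')`
  · obtain ⟨a1, a2⟩ := hSmem.1 hh
    obtain ⟨b1, b2⟩ := hSmem.1 hh'
    have hΓm : g * (h'⁻¹ * h) * g⁻¹ ∈ Γ := by
      have := Γ.mul_mem (Γ.inv_mem b1) a1
      convert this using 1
      group
    have hne1 : g * (h'⁻¹ * h) * g⁻¹ ≠ 1 := fun e => hne (by
      have : h'⁻¹ * h = 1 := by simpa using e
      exact (inv_mul_eq_one.1 this).symm)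
    have h1 := hthick _ hΓm hne1
    rw [disp_lift _ x hx, show (lift x hx)⁻¹ * (g * (h'⁻¹ * h) * g⁻¹) * lift x hx = h'⁻¹ * h by
      rw [hg]; group] at h1
    have h2 : ((h'⁻¹ * h : SL2C) - 1 : Matrix (Fin 2) (Fin 2) ℂ) = (h'⁻¹ : SL2C) * (h - h') := by
      rw [Matrix.mul_sub, ← Matrix.SpecialLinearGroup.coe_mul, ← Matrix.SpecialLinearGroup.coe_mul,
        inv_mul_cancel, Matrix.SpecialLinearGroup.coe_one]
    rw [h2] at h1
    have h3 := h1.trans (fro_mul_le _ _)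
    rw [fro_inv] at h3
    rw [div_le_iff₀ (by positivity), mul_comm]
    exact h3.trans (mul_le_mul_of_nonneg_right b2 (fro_nonneg _))
  · intro σ hσ
    obtain ⟨h, hh, rfl⟩ := Finset.mem_image.1 hσ
    exact (hSmem.1 hh).1
  -- an element that moves a point of the ball into the ball is bounded after conjugation
  · rintro _ ⟨p, hp, rfl⟩ γ hγ ⟨q, hq, hpq⟩
    have hpH := eBall_subset basePt_mem hp
    have hqH := eBall_subset basePt_mem hq
    rw [Finset.mem_image]
    refine ⟨g⁻¹ * γ * g, hSmem.2 ⟨by convert hγ using 1; group, ?_⟩, by group⟩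
    refine fro_le_of_boxK (by norm_num) (eBall_basePt_subset hp) (eBall_basePt_subset hq) ?_
    rw [act_mul _ _ hpH, act_mul _ _ (act_mem _ hpH), ← hpq, act_inv_act _ hqH]

end Hyp3

/-! ### Compactness of the thick part -/

namespace Hyp3

lemma measurableSet_hBall (x : Fin 3 → ℝ) (hx : x ∈ halfSpace) :
    MeasurableSet (hBall x hx) ∧ hBall x hx ⊆ halfSpace := by
  refine ⟨measurableSet_act_image _ (isOpen_eBall _).measurableSet (eBall_subset basePt_mem), ?_⟩
  rintro _ ⟨p, hp, rfl⟩
  exact act_mem _ (eBall_subset basePt_mem hp)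

lemma volume_hBall (x : Fin 3 → ℝ) (hx : x ∈ halfSpace) :
    ∫⁻ _ in hBall x hx, 1 ∂(riemVol metric) = ∫⁻ _ in eBall basePt, 1 ∂(riemVol metric) :=
  setLIntegral_act_image _ (isOpen_eBall _).measurableSet (eBall_subset basePt_mem) _

/-- The set of points whose orbit meets `B`. -/
def saturation (Γ : Subgroup SL2C) (B : Set (Fin 3 → ℝ)) : Set (Fin 3 → ℝ) :=
  {p | ∃ γ ∈ Γ, act γ p ∈ B}

lemma measurableSet_saturation {Γ : Subgroup SL2C} [Countable Γ] {B : Set (Fin 3 → ℝ)}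
    (hB : MeasurableSet B) : MeasurableSet (saturation Γ B) := by
  have : saturation Γ B = ⋃ γ : Γ, act (γ : SL2C) ⁻¹' B := by
    ext p; simp [saturation]
  rw [this]
  exact MeasurableSet.iUnion fun γ => measurable_act _ hB

lemma saturation_act {Γ : Subgroup SL2C} {B : Set (Fin 3 → ℝ)} {γ : SL2C} (hγ : γ ∈ Γ)
    {p : Fin 3 → ℝ} (hp : p ∈ halfSpace) : act γ p ∈ saturation Γ B ↔ p ∈ saturation Γ B := by
  constructor
  · rintro ⟨η, hη, h⟩
    exact ⟨η * γ, Γ.mul_mem hη hγ, by rwa [act_mul _ _ hp]⟩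
  · rintro ⟨η, hη, h⟩
    exact ⟨η * γ⁻¹, Γ.mul_mem hη (Γ.inv_mem hγ),
      by rwa [act_mul _ _ (act_mem _ hp), act_inv_act _ hp]⟩

/-- The thick part of a quotient of finite volume is compact: disjoint balls around thick points
have images of volume bounded below. -/
lemma IsFreeDiscrete.thick_subset {Γ : Subgroup SL2C} (h : IsFreeDiscrete Γ)
    (hvol : quotLIntegral Γ Set.univ (fun _ => 1) < ∞) :
    ∃ R : ℝ, 1 ≤ R ∧ ∀ x ∈ halfSpace, Thick Γ x → ∃ γ ∈ Γ, act γ x ∈ boxK R := by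
  classical
  have := h.countable
  obtain ⟨N, hN⟩ := exists_thick_multiplicity
  set v := ∫⁻ _ in eBall basePt, 1 ∂(riemVol metric) with hv
  have hv0 : 0 < v := volume_eBall_pos
  -- a pairwise inequivalent family of balls, as a finite set of centers
  by_cases hmax : ∀ F : Finset {x : Fin 3 → ℝ // x ∈ halfSpace ∧ Thick Γ x},
      ∃ x : {x : Fin 3 → ℝ // x ∈ halfSpace ∧ Thick Γ x}, ∀ y ∈ F,
        Disjoint (saturation Γ (hBall x x.2.1) ∩ halfSpace) (saturation Γ (hBall y y.2.1) ∩ halfSpace)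
  -- if every finite family can be enlarged, there are arbitrarily many disjoint images, and the
  -- volume is infinite
  · exfalso
    set W : {x : Fin 3 → ℝ // x ∈ halfSpace ∧ Thick Γ x} → Set (Fin 3 → ℝ) :=
      fun x => saturation Γ (hBall x x.2.1) with hW
    have hWm : ∀ x, MeasurableSet (W x) := fun x =>
      measurableSet_saturation (measurableSet_hBall x.1 x.2.1).1
    have hself : ∀ x, hBall x.1 x.2.1 ⊆ W x := fun x p hp => ⟨1, Γ.one_mem, by rwa [act_one]⟩
    have hne : ∀ x, (W x ∩ halfSpace).Nonempty := fun x => by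
      refine ⟨act (lift x.1 x.2.1) basePt, hself x ⟨basePt, ?_, rfl⟩, act_mem _ basePt_mem⟩
      simp [eBall, eDist, basePt]
    have hfam : ∀ k : ℕ, ∃ F : Finset {x : Fin 3 → ℝ // x ∈ halfSpace ∧ Thick Γ x}, F.card = k ∧
        ∀ x ∈ F, ∀ y ∈ F, x ≠ y → Disjoint (W x ∩ halfSpace) (W y ∩ halfSpace) := by
      intro k
      induction k with
      | zero => exact ⟨∅, by simp, by simp⟩
      | succ k ih =>
        obtain ⟨F, hF, hd⟩ := ih
        obtain ⟨x, hx⟩ := hmax F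
        have hxF : x ∉ F := fun hxF => (hne x).ne_empty (disjoint_self.1 (hx x hxF))
        refine ⟨insert x F, by rw [Finset.card_insert_of_notMem hxF, hF], ?_⟩
        intro a ha b hb hab
        rcases Finset.mem_insert.1 ha with ea | ha' <;> rcases Finset.mem_insert.1 hb with eb | hb'
        · exact absurd (ea.trans eb.symm) hab
        · rw [ea]; exact hx b hb'
        · rw [eb]; exact (hx a ha').symm
        · exact hd a ha' b hb' hab
    -- in the image of each ball, a set that injects into the quotient and has definite volume
    have hq : ∀ x, v ≤ N * quotLIntegral Γ Set.univ ((W x).indicator fun _ => 1) := by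
      intro x
      obtain ⟨s, hs, hsΓ, hmult⟩ := hN Γ h x.1 x.2.1 x.2.2
      obtain ⟨hBm, hBH⟩ := measurableSet_hBall x.1 x.2.1
      have hinv : InvariantFun Γ ((W x).indicator fun _ => 1) := fun γ hγ p hp => by
        simp only [Set.indicator_apply, hW, saturation_act hγ hp]
      have h1 := lintegral_le_card_mul_quot s hinv hBm hBH hsΓ
        (fun p hp γ hγ hγp => ⟨γ, hmult p hp γ hγ hγp, rfl⟩)
      have h2 : ∫⁻ p in hBall x.1 x.2.1, (W x).indicator (fun _ => 1) p ∂(riemVol metric) = v := by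
        rw [hv, ← volume_hBall x.1 x.2.1]
        refine setLIntegral_congr_fun hBm fun p hp => ?_
        rw [Set.indicator_of_mem (hself x hp)]
      rw [h2] at h1
      exact h1.trans (mul_le_mul_left (by exact_mod_cast hs) _)
    have hN0 : (N : ℝ≥0∞) ≠ 0 := by
      intro h0
      obtain ⟨F, hF, -⟩ := hfam 1
      obtain ⟨x, -⟩ := Finset.card_pos.1 (by omega : 0 < F.card)
      have := hq x
      rw [h0, zero_mul] at this
      exact hv0.not_ge this
    have hvfin : v ≠ ∞ := by
      obtain ⟨F, hF, -⟩ := hfam 1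
      obtain ⟨x, -⟩ := Finset.card_pos.1 (by omega : 0 < F.card)
      refine ne_top_of_le_ne_top (ENNReal.mul_ne_top (ENNReal.natCast_ne_top N) ?_) (hq x)
      refine ne_top_of_le_ne_top hvol.ne ?_
      unfold quotLIntegral
      exact iSup₂_mono fun S _ => lintegral_mono fun p => Set.indicator_le_self' (by simp) p
    set w := v / (2 * N) with hw
    have hw0 : w ≠ 0 := (ENNReal.div_pos hv0.ne' (ENNReal.mul_ne_top (by simp)
      (ENNReal.natCast_ne_top N))).ne'
    have hS : ∀ x, ∃ S : Set (Fin 3 → ℝ), MeasurableSet S ∧ S ⊆ W x ∩ halfSpace ∧ Injects Γ S ∧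
        w ≤ ∫⁻ _ in S, 1 ∂(riemVol metric) := by
      intro x
      have h1 : w < quotLIntegral Γ Set.univ ((W x).indicator fun _ => 1) := by
        by_contra hcon
        push Not at hcon
        have h2 := (hq x).trans (mul_le_mul_right hcon _)
        have h3 : (N : ℝ≥0∞) * w = v / 2 := by
          rw [hw, ENNReal.div_eq_inv_mul, ENNReal.div_eq_inv_mul,
            ENNReal.mul_inv (by simp) (by simp), ← mul_assoc, mul_comm (N : ℝ≥0∞), mul_assoc 2⁻¹,
            ENNReal.inv_mul_cancel hN0 (ENNReal.natCast_ne_top N), mul_one]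
        rw [h3] at h2
        exact (ENNReal.half_lt_self hv0.ne' hvfin).not_ge h2
      unfold quotLIntegral at h1
      obtain ⟨S, hS1⟩ := lt_iSup_iff.1 h1
      obtain ⟨⟨hSm, hSH, hinj⟩, hS2⟩ := lt_iSup_iff.1 hS1
      refine ⟨S ∩ W x, hSm.inter (hWm x), fun p hp => ⟨hp.2, (hSH hp.1).2⟩,
        fun p hp q hq => hinj p hp.1 q hq.1, ?_⟩
      rw [lintegral_indicator (hWm x), Measure.restrict_restrict (hWm x), Set.inter_comm] at hS2
      exact hS2.le
    choose S hSm hSW hSinj hSw using hS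
    have hbound : ∀ k : ℕ, (k : ℝ≥0∞) * w ≤ quotLIntegral Γ Set.univ fun _ => 1 := by
      intro k
      obtain ⟨F, hF, hd⟩ := hfam k
      have hdisj : Set.PairwiseDisjoint (F : Set {x : Fin 3 → ℝ // x ∈ halfSpace ∧ Thick Γ x}) S :=
        fun x hx y hy hxy => (hd x hx y hy hxy).mono (hSW x) (hSW y)
      calc (k : ℝ≥0∞) * w = ∑ x ∈ F, w := by rw [Finset.sum_const, hF, nsmul_eq_mul]
        _ ≤ ∑ x ∈ F, ∫⁻ _ in S x, 1 ∂(riemVol metric) := Finset.sum_le_sum fun x _ => hSw x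
        _ = ∫⁻ _ in ⋃ x ∈ F, S x, 1 ∂(riemVol metric) := by
            rw [lintegral_biUnion_finset hdisj fun x _ => hSm x]
        _ ≤ _ := by
            refine le_quotLIntegral _ (F.measurableSet_biUnion fun x _ => hSm x) ?_ ?_
            · refine Set.iUnion₂_subset fun x _ p hp => ⟨trivial, (hSW x hp).2⟩
            · intro p hp q hq hpq
              simp only [Set.mem_iUnion] at hp hq
              obtain ⟨x, hx, hpx⟩ := hp
              obtain ⟨y, hy, hqy⟩ := hq
              by_cases hxy : x = y
              · subst hxy; exact hSinj x p hpx q hqy hpq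
              · exfalso
                obtain ⟨γ, hγ, rfl⟩ := hpq
                have h1 := hSW x hpx
                have h2 := hSW y hqy
                refine Set.disjoint_left.1 (hd x hx y hy hxy) h1 ⟨?_, h1.2⟩
                exact (saturation_act hγ h1.2).1 h2.1
    obtain ⟨k, hk⟩ := ENNReal.exists_nat_mul_gt hw0 hvol.ne
    exact (hbound k).not_gt hk
  -- a maximal family: every ball around a thick point meets a translate of one of its balls
  · push Not at hmax
    obtain ⟨F, hF⟩ := hmax
    obtain ⟨R₀, hR₀⟩ : ∃ R₀ : ℝ, ∀ y ∈ F, fro (lift y.1 y.2.1) ≤ R₀ :=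
      ⟨∑ y ∈ F, fro (lift y.1 y.2.1), fun y hy =>
        Finset.single_le_sum (f := fun y : {x : Fin 3 → ℝ // x ∈ halfSpace ∧ Thick Γ x} =>
          fro (lift y.1 y.2.1)) (fun _ _ => fro_nonneg _) hy⟩
    set R := max (R₀ * (18 * 2 ^ 6)) 1 with hR
    refine ⟨R ^ 2, one_le_pow₀ (le_max_right _ _), fun x hx hthick => ?_⟩
    obtain ⟨y, hyF, hy⟩ := hF ⟨x, hx, hthick⟩
    obtain ⟨p, ⟨⟨γ, hγ, p₁, hp₁, e₁⟩, hpH⟩, ⟨η, hη, p₂, hp₂, e₂⟩, -⟩ := Set.not_disjoint_iff.1 hy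
    have hp₁H := eBall_subset basePt_mem hp₁
    have hp₂H := eBall_subset basePt_mem hp₂
    refine ⟨η * γ⁻¹, Γ.mul_mem hη (Γ.inv_mem hγ), ?_⟩
    set gx := lift x hx with hgx
    set gy := lift y.1 y.2.1 with hgy
    set k := gy⁻¹ * (η * γ⁻¹) * gx with hk
    have hkp : act k p₁ = p₂ := by
      have e3 : act (η * γ⁻¹) (act γ p) = act η p := by
        rw [← act_mul _ _ hpH]; congr 1; group
      rw [hk, act_mul _ _ hp₁H, act_mul _ _ (act_mem _ hp₁H), e₁, e3, ← e₂, act_inv_act _ hp₂H]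
    have hfk := fro_le_of_boxK (by norm_num) (eBall_basePt_subset hp₁) (eBall_basePt_subset hp₂) hkp
    have e4 : act (η * γ⁻¹) x = act (gy * k) basePt := by
      have e5 : gy * k = η * γ⁻¹ * gx := by rw [hk]; group
      rw [e5, act_mul _ _ basePt_mem, hgx, act_lift]
    rw [e4]
    refine act_basePt_mem_boxK (le_max_right _ _) ?_
    rw [Matrix.SpecialLinearGroup.coe_mul]
    refine (fro_mul_le _ _).trans (le_trans ?_ (le_max_left _ _))
    exact mul_le_mul (hR₀ y hyF) hfk (fro_nonneg _) ((fro_nonneg _).trans (hR₀ y hyF))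

end Hyp3

/-! ### Tubes around geodesics and at parabolic fixed points -/

namespace Hyp3

lemma transl_entries (b : ℂ) :
    transl b 0 0 = 1 ∧ transl b 0 1 = b ∧ transl b 1 0 = 0 ∧ transl b 1 1 = 1 := by
  simp [transl]

lemma neg_apply (A : SL2C) (i j : Fin 2) : (-A) i j = -(A i j) := by
  rw [Matrix.SpecialLinearGroup.coe_neg, Matrix.neg_apply]

lemma mul_apply (A B : SL2C) (i j : Fin 2) : (A * B) i j = A i 0 * B 0 j + A i 1 * B 1 j := by
  rw [Matrix.SpecialLinearGroup.coe_mul, Matrix.mul_apply, Fin.sum_univ_two]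

lemma inv_entries (A : SL2C) :
    A⁻¹ 0 0 = A 1 1 ∧ A⁻¹ 0 1 = -A 0 1 ∧ A⁻¹ 1 0 = -A 1 0 ∧ A⁻¹ 1 1 = A 0 0 := by
  rw [Matrix.SpecialLinearGroup.SL2_inv_expl]
  simp

/-- Every element of `SL(2, ℂ)` is conjugate to a diagonal matrix or to an upper triangular matrix
with equal diagonal entries. -/
lemma exists_normal_form (η : SL2C) : ∃ κ : SL2C, (κ⁻¹ * η * κ) 1 0 = 0 ∧
    ((κ⁻¹ * η * κ) 0 1 = 0 ∨ (κ⁻¹ * η * κ) 0 0 = (κ⁻¹ * η * κ) 1 1) := by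
  have tri : ∃ κ : SL2C, (κ⁻¹ * η * κ) 1 0 = 0 := by
    by_cases hc : η 1 0 = 0
    · exact ⟨1, by simpa using hc⟩
    · obtain ⟨s, hs⟩ := IsAlgClosed.exists_pow_nat_eq
        (discrim (η 1 0) (η 1 1 - η 0 0) (-η 0 1)) (n := 2) (by norm_num)
      obtain ⟨z, hz⟩ := exists_quadratic_eq_zero hc ⟨s, by rw [← hs, sq]⟩
      obtain ⟨κ, h00, h01, h10, h11⟩ : ∃ κ : SL2C, κ 0 0 = z ∧ κ 0 1 = -1 ∧ κ 1 0 = 1 ∧ κ 1 1 = 0 :=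
        ⟨⟨!![z, -1; 1, 0], by simp⟩, by simp⟩
      refine ⟨κ, ?_⟩
      obtain ⟨i00, i01, i10, i11⟩ := inv_entries κ
      simp only [Hyp3.mul_apply, i10, i11, h00, h10]
      linear_combination hz
  obtain ⟨κ, hκ⟩ := tri
  set U := κ⁻¹ * η * κ with hU
  by_cases hd : U 0 0 = U 1 1
  · exact ⟨κ, hκ, Or.inr hd⟩
  · refine ⟨κ * transl (U 0 1 / (U 1 1 - U 0 0)), ?_⟩
    have hd' : U 1 1 - U 0 0 ≠ 0 := sub_ne_zero.2 (Ne.symm hd)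
    have e : (κ * transl (U 0 1 / (U 1 1 - U 0 0)))⁻¹ * η * (κ * transl (U 0 1 / (U 1 1 - U 0 0))) =
        (transl (U 0 1 / (U 1 1 - U 0 0)))⁻¹ * U * transl (U 0 1 / (U 1 1 - U 0 0)) := by
      rw [hU]; group
    rw [e]
    set w := U 0 1 / (U 1 1 - U 0 0) with hw
    obtain ⟨i00, i01, i10, i11⟩ := inv_entries (transl w)
    obtain ⟨h00, h01, h10, h11⟩ := transl_entries w
    refine ⟨?_, Or.inl ?_⟩
    · simp only [Hyp3.mul_apply, i10, i11, h00, h10, hκ]; ring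
    · simp only [Hyp3.mul_apply, i00, i01, h01, h11, hκ]
      have : w * (U 1 1 - U 0 0) = U 0 1 := div_mul_cancel₀ _ hd'
      linear_combination -this

lemma ext_entries {A B : SL2C} (h00 : A 0 0 = B 0 0) (h01 : A 0 1 = B 0 1) (h10 : A 1 0 = B 1 0)
    (h11 : A 1 1 = B 1 1) : A = B := by
  ext i j; fin_cases i <;> fin_cases j <;> assumption

lemma transl_zero : transl 0 = 1 := by
  obtain ⟨e00, e01, e10, e11⟩ := transl_entries 0
  exact ext_entries (by simp [e00]) (by simp [e01]) (by simp [e10]) (by simp [e11])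

/-- A triangular matrix with equal diagonal entries is, up to sign, a translation. -/
lemma eq_transl_or_neg {A : SL2C} (h10 : A 1 0 = 0) (h : A 0 0 = A 1 1) :
    ∃ b : ℂ, (A = transl b ∨ A = -transl b) ∧ (b = 0 → A = 1 ∨ A = -1) := by
  have hd := det_eq A
  rw [h10, mul_zero, sub_zero, ← h] at hd
  rcases mul_self_eq_one_iff.1 hd with h1 | h1
  · have e : A = transl (A 0 1) := by
      obtain ⟨e00, e01, e10, e11⟩ := transl_entries (A 0 1)
      exact ext_entries (by rw [e00, h1]) e01.symm (by rw [e10, h10]) (by rw [e11, ← h, h1])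
    exact ⟨A 0 1, Or.inl e, fun h0 => Or.inl (by rw [e, h0, transl_zero])⟩
  · have e : A = -transl (-A 0 1) := by
      obtain ⟨e00, e01, e10, e11⟩ := transl_entries (-A 0 1)
      exact ext_entries (by rw [Hyp3.neg_apply, e00, h1]) (by rw [Hyp3.neg_apply, e01, neg_neg])
        (by rw [Hyp3.neg_apply, e10, h10, neg_zero]) (by rw [Hyp3.neg_apply, e11, ← h, h1])
    exact ⟨-A 0 1, Or.inr e, fun h0 => Or.inr (by rw [e, h0, transl_zero])⟩

/-- The points that are displaced little by some nontrivial element of `Γ` commuting with `η`: a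
neighbourhood of the axis of `η`, or a horoball at its fixed point, or empty. -/
def tube (Γ : Subgroup SL2C) (η : SL2C) : Set (Fin 3 → ℝ) :=
  {x | x ∈ halfSpace ∧ ∃ ζ ∈ Γ, ζ ≠ 1 ∧ ζ * η = η * ζ ∧ disp ζ x < thr}

lemma exists_pos_lower_bound {α : Type*} {S : Set α} (hS : S.Finite) (f : α → ℝ)
    (hf : ∀ a ∈ S, 0 < f a) : ∃ c : ℝ, 0 < c ∧ ∀ a ∈ S, c ≤ f a := by
  rcases S.eq_empty_or_nonempty with h | h
  · exact ⟨1, one_pos, by simp [h]⟩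
  · obtain ⟨a, ha, hmin⟩ := Set.exists_min_image S f hS h
    exact ⟨f a, hf a ha, hmin⟩

lemma fro_le_six {ζ : SL2C} (h : fro (ζ - 1 : Matrix (Fin 2) (Fin 2) ℂ) ≤ 1) : fro ζ ≤ 6 := by
  have := fro_le_of_sub_one (ζ : Matrix (Fin 2) (Fin 2) ℂ)
  linarith

/-- The tube around the axis of a loxodromic element has bounded radius. -/
lemma IsFreeDiscrete.tube_diag_bound {Γ : Subgroup SL2C} (h : IsFreeDiscrete Γ) {D : SL2C}
    (h10 : D 1 0 = 0) (h01 : D 0 1 = 0) (hne : D 0 0 ≠ D 1 1) :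
    ∃ C : ℝ, 0 < C ∧ ∀ x ∈ tube Γ D, ‖zco x‖ ≤ C * x 2 := by
  obtain ⟨c, hc, hmin⟩ := exists_pos_lower_bound (S := {ζ | (ζ ∈ Γ ∧ fro ζ ≤ 6) ∧ ζ 0 0 ≠ ζ 1 1})
    ((h.finite 6).subset fun ζ hζ => hζ.1) (fun ζ => ‖ζ 0 0 - ζ 1 1‖)
    fun ζ hζ => norm_pos_iff.2 (sub_ne_zero.2 hζ.2)
  refine ⟨c⁻¹, inv_pos.2 hc, fun x hx => ?_⟩
  obtain ⟨hx, ζ, hζ, hζ1, hcomm, hsmall⟩ := hx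
  have ht : 0 < x 2 := hx
  obtain ⟨-, e2, e3⟩ := entries_of_commute hcomm
  have hD : D 0 0 - D 1 1 ≠ 0 := sub_ne_zero.2 hne
  rw [h01, zero_mul] at e2
  rw [h10, zero_mul] at e3
  have z01 : ζ 0 1 = 0 := (mul_eq_zero.1 e2).resolve_right hD
  have z10 : ζ 1 0 = 0 := (mul_eq_zero.1 e3).resolve_right hD
  -- a diagonal matrix with equal entries is `±1`, and neither is allowed
  have hζne : ζ 0 0 ≠ ζ 1 1 := by
    intro heq
    obtain ⟨b, hb, hb0⟩ := eq_transl_or_neg z10 heq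
    have : b = 0 := by
      rcases hb with hb | hb <;> rw [hb] at z01 <;> simpa [Hyp3.neg_apply, transl_entries] using z01
    rcases hb0 this with h1 | h1
    · exact hζ1 h1
    · rw [h1] at hsmall; exact disp_neg_one hx hsmall
  have hs : ‖ζ 0 0 - 1‖ ^ 2 + ‖(ζ 0 0 - ζ 1 1) * zco x / (x 2 : ℂ)‖ ^ 2 + ‖ζ 1 1 - 1‖ ^ 2 < thr := by
    have e : disp ζ x =
        ‖ζ 0 0 - 1‖ ^ 2 + ‖(ζ 0 0 - ζ 1 1) * zco x / (x 2 : ℂ)‖ ^ 2 + ‖ζ 1 1 - 1‖ ^ 2 := by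
      simp only [disp, z01, z10]
      rw [show (ζ 0 0 * zco x + 0 - zco x * (0 * zco x + ζ 1 1)) = (ζ 0 0 - ζ 1 1) * zco x by ring]
      simp
    rwa [← e]
  have hthr : thr ≤ 1 := by unfold thr; norm_num
  have h6 : fro ζ ≤ 6 := by
    refine fro_le_six ?_
    have e : fro (ζ - 1 : Matrix (Fin 2) (Fin 2) ℂ) = ‖ζ 0 0 - 1‖ ^ 2 + ‖ζ 1 1 - 1‖ ^ 2 := by
      simp [fro, Fin.sum_univ_two, z01, z10]
    rw [e]
    nlinarith [sq_nonneg ‖(ζ 0 0 - ζ 1 1) * zco x / (x 2 : ℂ)‖]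
  have hcζ := hmin ζ ⟨⟨hζ, h6⟩, hζne⟩
  -- the displacement away from the axis
  have h2 : ‖(ζ 0 0 - ζ 1 1) * zco x / (x 2 : ℂ)‖ ≤ 1 := by
    refine (pow_le_one_iff_of_nonneg (norm_nonneg _) two_ne_zero).1 ?_
    linarith [sq_nonneg ‖ζ 0 0 - 1‖, sq_nonneg ‖ζ 1 1 - 1‖]
  rw [norm_div, norm_mul, Complex.norm_real, Real.norm_of_nonneg ht.le, div_le_one ht] at h2
  rw [← div_eq_inv_mul, le_div_iff₀ hc]
  nlinarith [norm_nonneg (zco x)]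

lemma pow_diag {D : SL2C} (h10 : D 1 0 = 0) (h01 : D 0 1 = 0) (n : ℕ) :
    (D ^ n) 1 0 = 0 ∧ (D ^ n) 0 1 = 0 ∧ (D ^ n) 1 1 = D 1 1 ^ n ∧ (D ^ n) 0 0 = D 0 0 ^ n := by
  induction n with
  | zero => simp
  | succ n ih =>
    obtain ⟨a, b, c, d⟩ := ih
    simp only [pow_succ, Hyp3.mul_apply, a, b, c, d, h10, h01]; simp

lemma zpow_diag {D : SL2C} (h10 : D 1 0 = 0) (h01 : D 0 1 = 0) (n : ℤ) :
    (D ^ n) 1 0 = 0 ∧ (D ^ n) 0 1 = 0 ∧ (D ^ n) 1 1 = D 1 1 ^ n := by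
  have hd := det_eq D
  rw [h10, mul_zero, sub_zero] at hd
  have hd1 : D 1 1 ≠ 0 := right_ne_zero_of_mul_eq_one hd
  obtain ⟨n, rfl | rfl⟩ := n.eq_nat_or_neg
  · obtain ⟨a, b, c, -⟩ := pow_diag h10 h01 n
    simp [zpow_natCast, a, b, c]
  · obtain ⟨a, b, c, d⟩ := pow_diag h10 h01 n
    simp only [_root_.zpow_neg, zpow_natCast]
    rw [Matrix.SpecialLinearGroup.SL2_inv_expl]
    simp only [Matrix.cons_val', Matrix.cons_val_zero, Matrix.cons_val_one, a, b, d,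
      Matrix.cons_val_fin_one, neg_zero, true_and]
    rw [← inv_pow, eq_inv_of_mul_eq_one_left hd]

lemma act_diag {D : SL2C} (h10 : D 1 0 = 0) (h01 : D 0 1 = 0) (x : Fin 3 → ℝ) :
    act D x 2 = x 2 / ‖D 1 1‖ ^ 2 ∧ ‖zco (act D x)‖ = ‖zco x‖ / ‖D 1 1‖ ^ 2 := by
  have hd := det_eq D
  rw [h10, mul_zero, sub_zero] at hd
  have hn : ‖D 0 0‖ * ‖D 1 1‖ = 1 := by rw [← norm_mul, hd, norm_one]
  have hden : den D x = ‖D 1 1‖ ^ 2 := by simp [den, h10]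
  refine ⟨by rw [act_two, hden], ?_⟩
  rw [zco_act, hden, h10, h01]
  simp only [zero_mul, add_zero, zero_add, map_zero, mul_zero, norm_div, norm_mul, RCLike.norm_conj]
  rw [Complex.norm_real, Real.norm_of_nonneg (by positivity)]
  congr 1
  linear_combination ‖zco x‖ * hn

/-- The tube around the axis of a loxodromic element `D` is compact modulo `D`. -/
lemma IsFreeDiscrete.tube_diag {Γ : Subgroup SL2C} (h : IsFreeDiscrete Γ) {D : SL2C} (hDΓ : D ∈ Γ)
    (h10 : D 1 0 = 0) (h01 : D 0 1 = 0) (hne : D 0 0 ≠ D 1 1) :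
    ∃ R : ℝ, 1 ≤ R ∧ ∀ x ∈ tube Γ D, ∃ γ ∈ Γ, act γ x ∈ boxK R := by
  obtain ⟨C, hC, hbound⟩ := h.tube_diag_bound h10 h01 hne
  have hd := det_eq D
  rw [h10, mul_zero, sub_zero] at hd
  have hd1 : D 1 1 ≠ 0 := right_ne_zero_of_mul_eq_one hd
  have hn0 : 0 < ‖D 1 1‖ := norm_pos_iff.2 hd1
  -- an element with `|D₁₁| = 1` fixes the axis pointwise
  have hn1 : ‖D 1 1‖ ≠ 1 := by
    intro h1
    have h2 := act_diag h10 h01 basePt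
    rw [h1] at h2
    have hfix : act D basePt = basePt := by
      refine ext_zco ?_ (by simpa using h2.1)
      have h3 := h2.2
      simp only [basePt, zco_mkPt, norm_zero, zero_div] at h3 ⊢
      exact norm_eq_zero.1 h3
    rcases h.free D hDΓ basePt basePt_mem hfix with e | e <;> exact hne (by simp [e])
  -- a power of `D` that scales by a factor greater than one
  obtain ⟨s, lam, hlam, hs⟩ : ∃ (s : ℤ) (lam : ℝ), 1 < lam ∧ ∀ k : ℤ,
      (‖(D ^ (s * k)) 1 1‖ ^ 2)⁻¹ = lam ^ k := by
    rcases lt_or_gt_of_ne hn1 with h1 | h1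
    · refine ⟨1, (‖D 1 1‖ ^ 2)⁻¹, (one_lt_inv₀ (by positivity)).2 (by nlinarith), fun k => ?_⟩
      rw [one_mul, (zpow_diag h10 h01 k).2.2, norm_zpow, _root_.inv_zpow, ← zpow_natCast, ← zpow_natCast,
        ← _root_.zpow_mul, ← _root_.zpow_mul, mul_comm]
    · refine ⟨-1, ‖D 1 1‖ ^ 2, by nlinarith, fun k => ?_⟩
      rw [neg_one_mul, (zpow_diag h10 h01 (-k)).2.2, norm_zpow, ← zpow_natCast, ← zpow_natCast,
        ← _root_.zpow_mul, ← _root_.zpow_mul, ← _root_.zpow_neg]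
      congr 1; ring
  refine ⟨max lam (C * lam), hlam.le.trans (le_max_left _ _), fun x hx => ?_⟩
  have ht : 0 < x 2 := hx.1
  obtain ⟨k, hk1, hk2⟩ := exists_mem_Ico_zpow ht hlam
  have hzd := zpow_diag h10 h01 (s * (-k))
  obtain ⟨e1, e2⟩ := act_diag hzd.1 hzd.2.1 x
  rw [div_eq_mul_inv, hs, _root_.zpow_neg, ← div_eq_mul_inv] at e1 e2
  have hlk : 0 < lam ^ k := zpow_pos (by linarith) k
  rw [zpow_add_one₀ (by linarith)] at hk2
  have hy1 : 1 ≤ x 2 / lam ^ k := (one_le_div hlk).2 hk1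
  have hy2 : x 2 / lam ^ k ≤ lam := by rw [div_le_iff₀ hlk]; linarith
  refine ⟨D ^ (s * (-k)), Γ.zpow_mem hDΓ _, ?_, ?_, ?_⟩
  · rw [e2]
    refine le_trans ?_ (le_max_right _ _)
    calc ‖zco x‖ / lam ^ k ≤ C * x 2 / lam ^ k := by gcongr; exact hbound x hx
      _ = C * (x 2 / lam ^ k) := by ring
      _ ≤ _ := by gcongr
  · rw [e1]
    refine le_trans (inv_le_one_of_one_le₀ (hlam.le.trans (le_max_left _ _))) hy1
  · rw [e1]; exact hy2.trans (le_max_left _ _)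

/-- The tube of a parabolic element is contained in a horoball. -/
lemma IsFreeDiscrete.tube_transl {Γ : Subgroup SL2C} (h : IsFreeDiscrete Γ) {D : SL2C}
    (h10 : D 1 0 = 0) (h01 : D 0 1 ≠ 0) (he : D 0 0 = D 1 1) :
    ∃ T : ℝ, 0 < T ∧ ∀ x ∈ tube Γ D, T ≤ x 2 := by
  obtain ⟨c, hc, hmin⟩ := exists_pos_lower_bound (S := {ζ | (ζ ∈ Γ ∧ fro ζ ≤ 6) ∧ ζ 0 1 ≠ 0})
    ((h.finite 6).subset fun ζ hζ => hζ.1) (fun ζ => ‖ζ 0 1‖) fun ζ hζ => norm_pos_iff.2 hζ.2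
  refine ⟨min c 1, lt_min hc one_pos, fun x hx => ?_⟩
  obtain ⟨hx, ζ, hζ, hζ1, hcomm, hsmall⟩ := hx
  have ht : 0 < x 2 := hx
  obtain ⟨e1, e2, -⟩ := entries_of_commute hcomm
  rw [h10, mul_zero, eq_comm] at e1
  rw [he, sub_self, mul_zero, eq_comm] at e2
  have z10 : ζ 1 0 = 0 := (mul_eq_zero.1 e1).resolve_left h01
  have zeq : ζ 0 0 = ζ 1 1 := sub_eq_zero.1 ((mul_eq_zero.1 e2).resolve_left h01)
  have hs : disp ζ x = ‖ζ 0 0 - 1‖ ^ 2 + ‖ζ 0 1 / (x 2 : ℂ)‖ ^ 2 + ‖ζ 0 0 - 1‖ ^ 2 := by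
    simp only [disp, z10, ← zeq]
    rw [show (ζ 0 0 * zco x + ζ 0 1 - zco x * (0 * zco x + ζ 0 0)) = ζ 0 1 by ring]
    simp
  rw [hs] at hsmall
  have hthr : thr ≤ 1 := by unfold thr; norm_num
  obtain ⟨b, hb, hb0⟩ := eq_transl_or_neg z10 zeq
  rcases hb with hb | hb
  · have z00 : ζ 0 0 = 1 := by rw [hb]; simp [transl_entries]
    have z01 : ζ 0 1 = b := by rw [hb]; simp [transl_entries]
    have hb1 : b ≠ 0 := fun h0 => by
      rcases hb0 h0 with h1 | h1
      · exact hζ1 h1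
      · rw [h1] at z00; norm_num at z00
    have h2 : ‖ζ 0 1 / (x 2 : ℂ)‖ ≤ 1 := by
      refine (pow_le_one_iff_of_nonneg (norm_nonneg _) two_ne_zero).1 ?_
      linarith [sq_nonneg ‖ζ 0 0 - 1‖]
    rw [norm_div, Complex.norm_real, Real.norm_of_nonneg ht.le, div_le_one ht] at h2
    by_cases hbig : x 2 ≤ 1
    · refine (min_le_left _ _).trans ((hmin ζ ⟨⟨hζ, fro_le_six ?_⟩, z01 ▸ hb1⟩).trans h2)
      have e : fro (ζ - 1 : Matrix (Fin 2) (Fin 2) ℂ) = ‖ζ 0 1‖ ^ 2 := by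
        simp [fro, Fin.sum_univ_two, z10, ← zeq, z00]
      rw [e]
      nlinarith [norm_nonneg (ζ 0 1)]
    · exact (min_le_right _ _).trans (by linarith)
  · have z00 : ζ 0 0 = -1 := by rw [hb]; simp [Hyp3.neg_apply, transl_entries]
    rw [z00] at hsmall
    norm_num at hsmall
    nlinarith [sq_nonneg (‖ζ 0 1‖ / |x 2|), sq_nonneg (‖ζ 0 1‖ / x 2)]

end Hyp3

/-! ### Finitely many tubes cover the thin part -/

namespace Hyp3

lemma conj_mul_conj (κ a b : SL2C) : κ⁻¹ * a * κ * (κ⁻¹ * b * κ) = κ⁻¹ * (a * b) * κ := by group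

/-- Tubes are natural under conjugation. -/
lemma tube_conj {Γ : Subgroup SL2C} {η : SL2C} (κ : SL2C) {x : Fin 3 → ℝ} (hx : x ∈ tube Γ η) :
    act κ⁻¹ x ∈ tube (conjGroup κ Γ) (κ⁻¹ * η * κ) := by
  obtain ⟨hx, ζ, hζ, h1, hc, hs⟩ := hx
  refine ⟨act_mem _ hx, κ⁻¹ * ζ * κ, ?_, ?_, ?_, ?_⟩
  · rw [mem_conjGroup]
    have : κ * (κ⁻¹ * ζ * κ) * κ⁻¹ = ζ := by group
    rwa [this]
  · intro h
    apply h1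
    have : ζ = κ * (κ⁻¹ * ζ * κ) * κ⁻¹ := by group
    rw [this, h]; group
  · rw [conj_mul_conj, conj_mul_conj, hc]
  · have := disp_conj ζ κ⁻¹ hx
    rw [inv_inv] at this
    rwa [this]

lemma act_mem_tube {Γ : Subgroup SL2C} {γ : SL2C} (hγ : γ ∈ Γ) {η : SL2C} {x : Fin 3 → ℝ}
    (hx : x ∈ tube Γ η) : act γ x ∈ tube Γ (γ * η * γ⁻¹) := by
  have h := tube_conj γ⁻¹ hx
  rw [inv_inv] at h
  have e : conjGroup γ⁻¹ Γ = Γ := by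
    ext σ
    rw [mem_conjGroup, inv_inv]
    refine ⟨fun h => ?_, fun h => Γ.mul_mem (Γ.mul_mem (Γ.inv_mem hγ) h) hγ⟩
    have := Γ.mul_mem (Γ.mul_mem hγ h) (Γ.inv_mem hγ)
    have e2 : γ * (γ⁻¹ * σ * γ) * γ⁻¹ = σ := by group
    rwa [e2] at this
  rwa [e] at h

lemma ne_one_conj {κ η : SL2C} (h1 : η ≠ 1) (h2 : η ≠ -1) :
    κ⁻¹ * η * κ ≠ 1 ∧ κ⁻¹ * η * κ ≠ -1 := by
  have e : η = κ * (κ⁻¹ * η * κ) * κ⁻¹ := by group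
  refine ⟨fun h => h1 ?_, fun h => h2 ?_⟩
  · rw [e, h]; group
  · rw [e, h]; simp

/-- The two types of noncentral elements, up to conjugation. -/
lemma exists_conj_diag_or_transl {η : SL2C} (h1 : η ≠ 1) (h2 : η ≠ -1) :
    ∃ κ : SL2C, (κ⁻¹ * η * κ) 1 0 = 0 ∧
      (((κ⁻¹ * η * κ) 0 1 = 0 ∧ (κ⁻¹ * η * κ) 0 0 ≠ (κ⁻¹ * η * κ) 1 1) ∨
        ((κ⁻¹ * η * κ) 0 1 ≠ 0 ∧ (κ⁻¹ * η * κ) 0 0 = (κ⁻¹ * η * κ) 1 1)) := by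
  obtain ⟨κ, h10, h⟩ := exists_normal_form η
  refine ⟨κ, h10, ?_⟩
  obtain ⟨n1, n2⟩ := ne_one_conj (κ := κ) h1 h2
  have key : (κ⁻¹ * η * κ) 0 0 = (κ⁻¹ * η * κ) 1 1 → (κ⁻¹ * η * κ) 0 1 ≠ 0 := by
    intro he h01
    obtain ⟨b, hb, hb0⟩ := eq_transl_or_neg h10 he
    have : b = 0 := by
      rcases hb with hb | hb <;> rw [hb] at h01 <;> simpa [Hyp3.neg_apply, transl_entries] using h01
    rcases hb0 this with h | h
    · exact n1 h
    · exact n2 h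
  by_cases he : (κ⁻¹ * η * κ) 0 0 = (κ⁻¹ * η * κ) 1 1
  · exact Or.inr ⟨key he, he⟩
  · exact Or.inl ⟨h.resolve_right he, he⟩

/-- Tubes are proper subsets of upper half-space. -/
lemma IsFreeDiscrete.exists_notMem_tube {Γ : Subgroup SL2C} (h : IsFreeDiscrete Γ) {η : SL2C}
    (h1 : η ≠ 1) (h2 : η ≠ -1) : ∃ y ∈ halfSpace, y ∉ tube Γ η := by
  obtain ⟨κ, h10, ⟨h01, hne⟩ | ⟨h01, he⟩⟩ := exists_conj_diag_or_transl h1 h2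
  · obtain ⟨C, hC, hb⟩ := (h.conj κ).tube_diag_bound h10 h01 hne
    have hm : mkPt (C + 1 : ℝ) 1 ∈ halfSpace := mkPt_mem _ one_pos
    refine ⟨act κ (mkPt (C + 1 : ℝ) 1), act_mem _ hm, fun hy => ?_⟩
    have := hb _ (tube_conj κ hy)
    rw [act_inv_act _ hm, zco_mkPt, mkPt_two, Complex.norm_real,
      Real.norm_of_nonneg (by positivity)] at this
    linarith
  · obtain ⟨T, hT, hb⟩ := (h.conj κ).tube_transl h10 h01 he
    have hm : mkPt 0 (T / 2) ∈ halfSpace := mkPt_mem _ (by positivity)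
    refine ⟨act κ (mkPt 0 (T / 2)), act_mem _ hm, fun hy => ?_⟩
    have := hb _ (tube_conj κ hy)
    rw [act_inv_act _ hm, mkPt_two] at this
    linarith

lemma isOpen_disp_lt (γ : SL2C) (r : ℝ) : IsOpen {x | x ∈ halfSpace ∧ disp γ x < r} :=
  (continuousOn_disp γ).isOpen_inter_preimage isOpen_halfSpace isOpen_Iio

lemma isOpen_tube (Γ : Subgroup SL2C) (η : SL2C) : IsOpen (tube Γ η) := by
  have : tube Γ η = ⋃ ζ ∈ {ζ | ζ ∈ Γ ∧ ζ ≠ 1 ∧ ζ * η = η * ζ}, {x | x ∈ halfSpace ∧ disp ζ x < thr} := by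
    ext x
    simp only [tube, Set.mem_ofPred_eq, Set.mem_iUnion, exists_prop]
    constructor
    · rintro ⟨hx, ζ, h1, h2, h3, h4⟩; exact ⟨ζ, ⟨h1, h2, h3⟩, hx, h4⟩
    · rintro ⟨ζ, ⟨h1, h2, h3⟩, hx, h4⟩; exact ⟨hx, ζ, h1, h2, h3, h4⟩
  rw [this]
  exact isOpen_biUnion fun ζ _ => isOpen_disp_lt ζ thr

lemma isPreconnected_halfSpace : IsPreconnected halfSpace := by
  refine Convex.isPreconnected ?_
  have h := convex_halfSpace_gt (𝕜 := ℝ) (f := fun p : Fin 3 → ℝ => p 2)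
    ⟨fun _ _ => rfl, fun _ _ => rfl⟩ 0
  exact h

/-- Finitely many elements of the group displace some point of a given box by little. -/
lemma IsFreeDiscrete.finite_disp_boxK {Γ : Subgroup SL2C} (h : IsFreeDiscrete Γ) {R : ℝ} (hR : 1 ≤ R) :
    {η | η ∈ Γ ∧ ∃ q ∈ boxK R, disp η q < thr}.Finite := by
  refine (h.finite ((3 * R ^ 3) * 6 * (3 * R ^ 3))).subset ?_
  rintro η ⟨hη, q, hq, hs⟩
  refine ⟨hη, ?_⟩
  have hqH := boxK_subset (by linarith) hq
  rw [disp_lift _ q hqH] at hs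
  set g := lift q hqH
  have h6 : fro (g⁻¹ * η * g : SL2C) ≤ 6 := by
    refine fro_le_six (hs.le.trans ?_)
    unfold thr; norm_num
  have hg : fro g ≤ 3 * R ^ 3 := fro_lift_le hR hq
  have e : η = g * (g⁻¹ * η * g) * g⁻¹ := by group
  rw [e, Matrix.SpecialLinearGroup.coe_mul, Matrix.SpecialLinearGroup.coe_mul]
  refine (fro_mul_le _ _).trans (mul_le_mul ((fro_mul_le _ _).trans ?_) ?_ (fro_nonneg _) (by positivity))
  · exact mul_le_mul hg h6 (fro_nonneg _) (by positivity)
  · rwa [fro_inv]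

/-- The thin part of a quotient of finite volume is covered by finitely many tubes: each of them has
a thick frontier point, which can be moved into a compact set. -/
lemma IsFreeDiscrete.thin_subset {Γ : Subgroup SL2C} (h : IsFreeDiscrete Γ)
    (hvol : quotLIntegral Γ Set.univ (fun _ => 1) < ∞) :
    ∃ R : ℝ, 1 ≤ R ∧ ∃ E : Set SL2C, E.Finite ∧ (∀ η ∈ E, η ∈ Γ ∧ η ≠ 1 ∧ η ≠ -1) ∧
      ∀ x ∈ halfSpace, (∃ γ ∈ Γ, act γ x ∈ boxK R) ∨ ∃ η ∈ E, ∃ γ ∈ Γ, act γ x ∈ tube Γ η := by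
  obtain ⟨R, hR, hthick⟩ := h.thick_subset hvol
  refine ⟨R, hR, {η | (η ∈ Γ ∧ ∃ q ∈ boxK (2 * R), disp η q < thr) ∧ η ≠ 1},
    (h.finite_disp_boxK (by linarith)).subset fun η hη => hη.1, ?_, fun x hx => ?_⟩
  · rintro η ⟨⟨hη, q, hq, hs⟩, h1⟩
    refine ⟨hη, h1, fun h2 => disp_neg_one (boxK_subset (by linarith) hq) (h2 ▸ hs)⟩
  by_cases hxt : Thick Γ x
  · exact Or.inl (hthick x hx hxt)
  right
  unfold Thick at hxt
  push Not at hxt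
  obtain ⟨γ₀, hγ₀, hne, hs₀⟩ := hxt
  have hne' : γ₀ ≠ -1 := fun h2 => disp_neg_one hx (h2 ▸ hs₀)
  have hxU : x ∈ tube Γ γ₀ := ⟨hx, γ₀, hγ₀, hne, rfl, hs₀⟩
  -- a frontier point of the tube exists since upper half-space is connected
  obtain ⟨y, hyc, hyH, hyU⟩ : ∃ y ∈ closure (tube Γ γ₀), y ∈ halfSpace ∧ y ∉ tube Γ γ₀ := by
    by_contra hcon
    push Not at hcon
    obtain ⟨y, hy, hyU⟩ := h.exists_notMem_tube hne hne'
    exact hyU (isPreconnected_halfSpace.subset_of_closure_inter_subset (isOpen_tube Γ γ₀)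
      ⟨x, hx, hxU⟩ (fun y hy => hcon y hy.1 hy.2) hy)
  -- a small displacement at `y` would persist at nearby points of the tube; by Margulis' lemma
  -- the element would then commute with an element of the tube, hence with `γ₀`, and `y` would
  -- lie in the tube
  have hyT : Thick Γ y := by
    intro γ₁ hγ₁ hne₁
    by_contra hs₁
    push Not at hs₁
    obtain ⟨y', ⟨hy'H, hs'⟩, -, ζ, hζ, hζ1, hζc, hζs⟩ :=
      mem_closure_iff.1 hyc _ (isOpen_disp_lt γ₁ thr) ⟨hyH, hs₁⟩
    have hc := h.commute_of_disp_lt hγ₁ hζ hy'H hs' hζs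
    refine hyU ⟨hyH, γ₁, hγ₁, hne₁, ?_, hs₁⟩
    exact commute_of_commute hζ1 (fun h2 => disp_neg_one hy'H (h2 ▸ hζs)) hc hζc.symm
  -- after moving `y` into the compact box, nearby points of the tube are displaced little by one
  -- of the finitely many elements above
  obtain ⟨γ, hγ, hγy⟩ := hthick y hyH hyT
  have hO : IsOpen {p : Fin 3 → ℝ | ‖zco p‖ < 2 * R ∧ (2 * R)⁻¹ < p 2 ∧ p 2 < 2 * R} := by
    have hz : Continuous zco := (contDiff_zco (m := 0)).continuous
    exact (isOpen_lt hz.norm continuous_const).inter ((isOpen_lt continuous_const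
      (continuous_apply 2)).inter (isOpen_lt (continuous_apply 2) continuous_const))
  have hnear : ∀ᶠ p in 𝓝 y, act γ p ∈ boxK (2 * R) := by
    have hcont : ContinuousAt (act γ) y := (differentiableAt_act γ hyH).continuousAt
    filter_upwards [hcont.preimage_mem_nhds (hO.mem_nhds ⟨by linarith [hγy.1],
      (inv_strictAnti₀ (by linarith) (by linarith)).trans_le hγy.2.1, by linarith [hγy.2.2]⟩)]
      with p hp
    exact ⟨hp.1.le, hp.2.1.le, hp.2.2.le⟩
  obtain ⟨y', hy'B, hy'H, ζ, hζ, hζ1, hζc, hζs⟩ := mem_closure_iff_nhds.1 hyc _ hnear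
  refine ⟨γ * ζ * γ⁻¹, ⟨⟨Γ.mul_mem (Γ.mul_mem hγ hζ) (Γ.inv_mem hγ), act γ y', hy'B, ?_⟩, ?_⟩,
    γ, hγ, ?_⟩
  · rwa [disp_conj _ _ hy'H]
  · intro h1
    apply hζ1
    have : ζ = γ⁻¹ * (γ * ζ * γ⁻¹) * γ := by group
    rw [this, h1]; group
  · exact act_mem_tube hγ ⟨hx, γ₀, hγ₀, hne, hζc.symm, hs₀⟩

end Hyp3

/-! ### Parabolic fixed points -/

namespace Hyp3

lemma zco_shift_add (b : ℂ) (p : Fin 3 → ℝ) : zco (shift b + p) = b + zco p := by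
  apply Complex.ext <;> simp [zco]

lemma fro_transl (b : ℂ) : fro (transl b) = 2 + ‖b‖ ^ 2 := by
  simp [fro, Fin.sum_univ_two, transl_entries]; ring

lemma fro_neg (γ : SL2C) : fro (-γ : SL2C) = fro γ := by
  simp [fro, Fin.sum_univ_two]

/-- Elements that fix `∞` conjugate translations to translations. -/
lemma conj_transl {γ : SL2C} (h10 : γ 1 0 = 0) (w : ℂ) :
    γ * transl w * γ⁻¹ = transl (γ 0 0 ^ 2 * w) := by
  have hd := det_eq γ
  rw [h10, mul_zero, sub_zero] at hd
  obtain ⟨i00, i01, i10, i11⟩ := inv_entries γ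
  obtain ⟨w00, w01, w10, w11⟩ := transl_entries w
  obtain ⟨v00, v01, v10, v11⟩ := transl_entries (γ 0 0 ^ 2 * w)
  refine ext_entries ?_ ?_ ?_ ?_
  · simp only [Hyp3.mul_apply, i00, i10, w00, w01, w10, w11, v00, h10]; linear_combination hd
  · simp only [Hyp3.mul_apply, i01, i11, w00, w01, w10, w11, v01]; ring
  · simp only [Hyp3.mul_apply, i00, i10, w00, w01, w10, w11, v10, h10]; ring
  · simp only [Hyp3.mul_apply, i01, i11, w00, w01, w10, w11, v11, h10]; linear_combination hd

/-- A discrete group that contains a translation has no element that fixes `∞` and contracts: it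
would conjugate the translation to arbitrarily small ones. -/
lemma IsFreeDiscrete.one_le_norm {Γ : Subgroup SL2C} (h : IsFreeDiscrete Γ) {b : ℂ} (hb : b ≠ 0)
    (hbΓ : transl b ∈ Γ) {γ : SL2C} (hγ : γ ∈ Γ) (h10 : γ 1 0 = 0) : 1 ≤ ‖γ 0 0‖ := by
  by_contra hlt
  push Not at hlt
  have hd := det_eq γ
  rw [h10, mul_zero, sub_zero] at hd
  have ha0 : 0 < ‖γ 0 0‖ := norm_pos_iff.2 (left_ne_zero_of_mul_eq_one hd)
  have hmem : ∀ k : ℕ, transl ((γ 0 0 ^ 2) ^ k * b) ∈ Γ := by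
    intro k
    induction k with
    | zero => simpa using hbΓ
    | succ k ih =>
      rw [pow_succ', mul_assoc, ← conj_transl h10]
      exact Γ.mul_mem (Γ.mul_mem hγ ih) (Γ.inv_mem hγ)
  have hinj : Function.Injective fun k : ℕ => transl ((γ 0 0 ^ 2) ^ k * b) := by
    intro k k' hkk
    have h1 := congrArg (fun σ : SL2C => ‖σ 0 1‖) hkk
    simp only [(transl_entries _).2.1, norm_mul, norm_pow] at h1
    have h2 := mul_right_cancel₀ (norm_ne_zero_iff.2 hb) h1
    exact pow_right_injective₀ (by positivity) (by nlinarith) h2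
  have hfro : ∀ k : ℕ, fro (transl ((γ 0 0 ^ 2) ^ k * b)) ≤ 2 + ‖b‖ ^ 2 := by
    intro k
    rw [fro_transl, norm_mul, norm_pow, norm_pow]
    have h1 : (‖γ 0 0‖ ^ 2) ^ k ≤ 1 := pow_le_one₀ (by positivity) (by nlinarith)
    have h2 : (‖γ 0 0‖ ^ 2) ^ k * ‖b‖ ≤ ‖b‖ := mul_le_of_le_one_left (norm_nonneg _) h1
    gcongr
  exact Set.infinite_of_injective_forall_mem (s := {γ | γ ∈ Γ ∧ fro γ ≤ 2 + ‖b‖ ^ 2}) hinj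
    (fun k => ⟨hmem k, hfro k⟩) (h.finite _)

/-- In the presence of a translation, the stabilizer of `∞` consists of translations. -/
lemma IsFreeDiscrete.eq_transl {Γ : Subgroup SL2C} (h : IsFreeDiscrete Γ) {b : ℂ} (hb : b ≠ 0)
    (hbΓ : transl b ∈ Γ) {γ : SL2C} (hγ : γ ∈ Γ) (h10 : γ 1 0 = 0) :
    ∃ β : ℂ, γ = transl β ∨ γ = -transl β := by
  have hd := det_eq γ
  rw [h10, mul_zero, sub_zero] at hd
  obtain ⟨i00, -, i10, -⟩ := inv_entries γ
  have h1 := h.one_le_norm hb hbΓ hγ h10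
  have h2 := h.one_le_norm hb hbΓ (Γ.inv_mem hγ) (by rw [i10, h10, neg_zero])
  rw [i00] at h2
  have h3 : ‖γ 0 0‖ * ‖γ 1 1‖ = 1 := by rw [← norm_mul, hd, norm_one]
  have h4 : ‖γ 1 1‖ = 1 := by nlinarith
  have hconj : (starRingEnd ℂ) (γ 1 1) = γ 0 0 := by
    have h5 := Complex.mul_conj (γ 1 1)
    rw [Complex.normSq_eq_norm_sq, h4] at h5
    have : γ 1 1 ≠ 0 := right_ne_zero_of_mul_eq_one hd
    apply mul_left_cancel₀ this
    rw [h5, mul_comm, hd]; norm_num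
  by_cases he : γ 0 0 = γ 1 1
  · obtain ⟨β, hβ, -⟩ := eq_transl_or_neg h10 he
    exact ⟨β, hβ⟩
  exfalso
  -- an elliptic element fixes the points above its fixed point in the plane
  have hne : 1 - γ 0 0 ^ 2 ≠ 0 := by
    intro h0
    apply he
    have ha : γ 0 0 ≠ 0 := left_ne_zero_of_mul_eq_one hd
    apply mul_left_cancel₀ ha
    rw [hd]; linear_combination -h0
  set z := γ 0 0 * γ 0 1 / (1 - γ 0 0 ^ 2) with hz
  have hz' : z * (1 - γ 0 0 ^ 2) = γ 0 0 * γ 0 1 := div_mul_cancel₀ _ hne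
  have hm : mkPt z 1 ∈ halfSpace := mkPt_mem z one_pos
  have hden : den γ (mkPt z 1) = 1 := by simp [den, h10, h4]
  have hfix : act γ (mkPt z 1) = mkPt z 1 := by
    refine ext_zco ?_ (by rw [act_two, hden, div_one])
    rw [zco_act, hden, h10]
    simp only [zco_mkPt, zero_mul, zero_add, hconj, map_zero, mul_zero, add_zero, Complex.ofReal_one,
      div_one]
    linear_combination -hz'
  rcases h.free γ hγ _ hm hfix with e | e <;> exact he (by simp [e])

/-- A horoball at a parabolic fixed point is precisely invariant. -/
lemma IsFreeDiscrete.exists_height {Γ : Subgroup SL2C} (h : IsFreeDiscrete Γ) {b : ℂ} (hb : b ≠ 0)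
    (hbΓ : transl b ∈ Γ) : ∃ T : ℝ, 0 < T ∧ ∀ p : Fin 3 → ℝ, T < p 2 → ∀ γ ∈ Γ, T < act γ p 2 →
      ∃ β : ℂ, γ = transl β ∨ γ = -transl β := by
  have hb0 : 0 < ‖b‖ := norm_pos_iff.2 hb
  -- the displacement of a translation by `b` at height `t` is `(|b| / t)²`
  have hsmall : ∀ q : Fin 3 → ℝ, 20 * ‖b‖ < q 2 → disp (transl b) q < thr := by
    intro q hq
    have hq0 : 0 < q 2 := by linarith [norm_nonneg b]
    obtain ⟨e00, e01, e10, e11⟩ := transl_entries b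
    have e : disp (transl b) q = (‖b‖ / q 2) ^ 2 := by
      simp only [disp, e00, e01, e10, e11]
      rw [show (1 * zco q + b - zco q * (0 * zco q + 1)) = b by ring]
      simp [abs_of_pos hq0]
    have h1 : ‖b‖ / q 2 < 1 / 20 := by rw [div_lt_iff₀ hq0]; linarith
    have h2 : 0 ≤ ‖b‖ / q 2 := by positivity
    rw [e, thr]
    nlinarith
  refine ⟨20 * ‖b‖, by positivity, fun p hp γ hγ hγp => ?_⟩
  have hpH : p ∈ halfSpace := by show 0 < p 2; linarith
  set A := γ⁻¹ * transl b * γ with hA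
  have hAs : disp A p < thr := by
    have e := disp_conj A γ hpH
    have e2 : γ * A * γ⁻¹ = transl b := by rw [hA]; group
    rw [e2] at e
    rw [← e]; exact hsmall _ hγp
  have hAΓ : A ∈ Γ := Γ.mul_mem (Γ.mul_mem (Γ.inv_mem hγ) hbΓ) hγ
  -- the translation and its conjugate by `γ` both displace `p` by little
  have hc := h.commute_of_disp_lt hAΓ hbΓ hpH hAs (hsmall p hp)
  obtain ⟨e1, -, -⟩ := entries_of_commute hc
  obtain ⟨b00, b01, b10, b11⟩ := transl_entries b
  obtain ⟨i00, i01, i10, i11⟩ := inv_entries γ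
  rw [b10, b01, mul_zero, hA] at e1
  simp only [Hyp3.mul_apply, i10, i11, b00, b01, b10, b11] at e1
  -- a conjugate of a translation that commutes with it has the same fixed point `∞`
  have h10 : γ 1 0 = 0 := by
    have : b ^ 2 * γ 1 0 ^ 2 = 0 := by linear_combination e1
    simpa [hb] using this
  exact h.eq_transl hb hbΓ hγ h10

lemma transl_mem_of {Γ : Subgroup SL2C} (h : IsFreeDiscrete Γ) {γ : SL2C} (hγ : γ ∈ Γ) {β : ℂ}
    (e : γ = transl β ∨ γ = -transl β) : transl β ∈ Γ := by
  rcases e with rfl | rfl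
  · exact hγ
  · have := Γ.mul_mem h.neg_one hγ
    simpa using this

lemma act_of_transl_or_neg {γ : SL2C} {β : ℂ} (e : γ = transl β ∨ γ = -transl β)
    (p : Fin 3 → ℝ) : act γ p = shift β + p := by
  rcases e with rfl | rfl
  · exact act_transl β p
  · rw [act_neg, act_transl]

lemma fro_of_transl_or_neg {γ : SL2C} {β : ℂ} (e : γ = transl β ∨ γ = -transl β) :
    fro γ = 2 + ‖β‖ ^ 2 := by
  rcases e with rfl | rfl
  · exact fro_transl β
  · rw [fro_neg, fro_transl]

/-- The integral of an invariant function over a prism in a precisely invariant horoball is bounded by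
a multiple of the integral over the quotient. -/
lemma lintegral_slab_le {Γ : Subgroup SL2C} (h : IsFreeDiscrete Γ) {b₁ b₂ : ℂ} (hb : Indep b₁ b₂)
    {T B : ℝ} (hT : 0 < T) (hprec : ∀ p : Fin 3 → ℝ, T < p 2 → ∀ γ ∈ Γ, T < act γ p 2 →
      ∃ β : ℂ, γ = transl β ∨ γ = -transl β)
    (hB : ∀ β : ℂ, transl β ∈ Γ → (∃ s₁ s₂ : ℝ, |s₁| ≤ 1 ∧ |s₂| ≤ 1 ∧ β = s₁ * b₁ + s₂ * b₂) →
      ‖β‖ ^ 2 ≤ B)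
    {f : (Fin 3 → ℝ) → ℝ≥0∞} (hf : InvariantFun Γ f) :
    ∫⁻ p in slab b₁ b₂ (Set.Ioi T), f p ∂(riemVol metric) ≤
      (h.finite (2 + B)).toFinset.card * quotLIntegral Γ Set.univ f := by
  refine lintegral_le_card_mul_quot _ hf (measurableSet_slab hb measurableSet_Ioi)
    (slab_subset _ _ (Set.Ioi_subset_Ioi hT.le)) (fun σ hσ => ((h.finite _).mem_toFinset.1 hσ).1) ?_
  rintro _ ⟨q, ⟨hq0, hq1, hq2⟩, rfl⟩ γ hγ ⟨q', ⟨hq0', hq1', hq2'⟩, e⟩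
  simp only at e hq2 hq2'
  have t1 : T < latPt b₁ b₂ (q 0, q 1) (q 2) 2 := by simpa [latPt] using hq2
  have t2 : T < act γ (latPt b₁ b₂ (q 0, q 1) (q 2)) 2 := by rw [← e]; simpa [latPt] using hq2'
  obtain ⟨β, hβ⟩ := hprec _ t1 γ hγ t2
  refine ⟨γ, (h.finite _).mem_toFinset.2 ⟨hγ, ?_⟩, rfl⟩
  rw [fro_of_transl_or_neg hβ]
  have hβΓ := transl_mem_of h hγ hβ
  refine add_le_add_right (hB β hβΓ ⟨q' 0 - q 0, q' 1 - q 1, ?_, ?_, ?_⟩) 2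
  · rw [abs_le]; constructor <;> linarith [hq0.1, hq0.2, hq0'.1, hq0'.2]
  · rw [abs_le]; constructor <;> linarith [hq1.1, hq1.2, hq1'.1, hq1'.2]
  · have e2 := congrArg zco e
    rw [act_of_transl_or_neg hβ, zco_shift_add] at e2
    have zl : ∀ s t, zco (latPt b₁ b₂ s t) = s.1 * b₁ + s.2 * b₂ := fun s t => by
      apply Complex.ext <;> simp [zco, latPt]
    rw [zl, zl] at e2
    push_cast
    linear_combination -e2

/-- In a quotient of finite volume, the translations in the stabilizer of a parabolic fixed point
form a lattice of rank two: otherwise there are prisms of arbitrarily large volume which are embedded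
up to a bounded multiplicity. -/
lemma IsFreeDiscrete.exists_indep {Γ : Subgroup SL2C} (h : IsFreeDiscrete Γ)
    (hvol : quotLIntegral Γ Set.univ (fun _ => 1) < ∞) {b : ℂ} (hb : b ≠ 0) (hbΓ : transl b ∈ Γ) :
    ∃ b₂ : ℂ, transl b₂ ∈ Γ ∧ Indep b b₂ := by
  by_contra hcon
  push Not at hcon
  obtain ⟨T, hT, hprec⟩ := h.exists_height hb hbΓ
  have hbn : 0 < ‖b‖ := norm_pos_iff.2 hb
  -- if all translations are real multiples of `b`, prisms with a long second side `n i b` are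
  -- embedded up to a multiplicity that does not depend on `n`
  have him : ∀ x y : ℝ, ((starRingEnd ℂ) b * (x * b + y * (Complex.I * b))).im = y * ‖b‖ ^ 2 := by
    intro x y
    rw [← Complex.normSq_eq_norm_sq, Complex.normSq_apply]
    simp [Complex.mul_im, Complex.mul_re]; ring
  set V := quotLIntegral Γ Set.univ (fun _ => 1) with hV
  set N := (h.finite (2 + ‖b‖ ^ 2)).toFinset.card with hN
  have key : ∀ n : ℕ, 0 < n → ENNReal.ofReal (n * ‖b‖ ^ 2) * ENNReal.ofReal (T⁻¹ ^ 2 / 2) ≤ N * V := by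
    intro n hn
    have harea : area b ((n : ℝ) * (Complex.I * b)) = n * ‖b‖ ^ 2 := by
      have := him 0 n
      rw [Complex.ofReal_zero, zero_mul, zero_add] at this
      rw [area, this, abs_of_nonneg (by positivity)]
    have hind : Indep b ((n : ℝ) * (Complex.I * b)) := by
      have := him 0 n
      rw [Complex.ofReal_zero, zero_mul, zero_add] at this
      unfold Indep
      rw [this]
      have : (0 : ℝ) < n := by exact_mod_cast hn
      positivity
    have h1 := lintegral_slab_le (B := ‖b‖ ^ 2) h hind hT hprec ?_ (f := fun _ => 1) (fun _ _ _ _ => rfl)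
    · have h2 := setLIntegral_slab hind measurableSet_Ioi (Set.Ioi_subset_Ioi hT.le) (u := fun _ => 1)
        continuousOn_const (fun _ _ => zero_le_one)
      simp only [ENNReal.ofReal_one, torusMean_const, one_mul] at h2
      rw [h2, setLIntegral_congr (Ioi_ae_eq_Ici (a := T)), lintegral_inv_pow_three hT, harea] at h1
      exact h1
    · rintro β hβ ⟨s₁, s₂, h₁, h₂, e⟩
      have h3 := hcon β hβ
      unfold Indep at h3
      rw [not_not, e] at h3
      have h4 := him s₁ (s₂ * n)
      have h5 : (s₁ * b + s₂ * ((n : ℝ) * (Complex.I * b)) : ℂ) =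
          s₁ * b + (s₂ * n : ℝ) * (Complex.I * b) := by push_cast; ring
      rw [h5, h4] at h3
      have h6 : s₂ * n = 0 := (mul_eq_zero.1 h3).resolve_right (by positivity)
      rw [e, h5, h6, Complex.ofReal_zero, zero_mul, add_zero, norm_mul, Complex.norm_real,
        Real.norm_eq_abs, mul_pow]
      have : |s₁| ^ 2 ≤ 1 := pow_le_one₀ (abs_nonneg _) h₁
      nlinarith [sq_nonneg ‖b‖]
  have hc : ENNReal.ofReal (‖b‖ ^ 2) * ENNReal.ofReal (T⁻¹ ^ 2 / 2) ≠ 0 :=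
    mul_ne_zero (by simpa using hbn.ne') (by simpa using by positivity)
  obtain ⟨n, hn⟩ := ENNReal.exists_nat_mul_gt hc (ENNReal.mul_ne_top (ENNReal.natCast_ne_top N) hvol.ne)
  have hn0 : 0 < n := by
    rcases Nat.eq_zero_or_pos n with h0 | h0
    · simp [h0] at hn
    · exact h0
  have := key n hn0
  rw [ENNReal.ofReal_mul (by positivity), ENNReal.ofReal_natCast, mul_assoc] at this
  exact this.not_gt hn

end Hyp3

/-! ### Boundedness of invariant solutions -/

namespace Hyp3

lemma jac_mul (γ η : SL2C) {p : Fin 3 → ℝ} (hp : p ∈ halfSpace) (i a : Fin 3) :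
    jac (act (γ * η)) p i a = ∑ j, jac (act γ) (act η p) i j * jac (act η) p j a := by
  unfold jac
  have hd := differentiableAt_act γ (act_mem η hp)
  rw [← pd_comp (f := fun x => act γ x i) (φ := act η) ((differentiableAt_pi.1 hd) i)
    (differentiableAt_act η hp)]
  refine pd_congr ?_ a
  filter_upwards [isOpen_halfSpace.mem_nhds hp] with x hx
  rw [act_mul _ _ hx]

lemma pull_mul (γ η : SL2C) (l : Tensor2 3) {p : Fin 3 → ℝ} (hp : p ∈ halfSpace) :
    pull (act (γ * η)) l p = pull (act η) (pull (act γ) l) p := by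
  ext a b
  unfold pull
  simp only [jac_mul γ η hp, act_mul γ η hp, Fin.sum_univ_three]
  ring

/-- Solutions on upper half-space that descend to the quotient by `Γ`. -/
structure IsInvSol (Γ : Subgroup SL2C) (l : Tensor2 3) : Prop extends IsSol l where
  invariant : ∀ γ ∈ Γ, ∀ p ∈ halfSpace, pull (act γ) l p = l p

/-- The square of the `L²` norm over the quotient. -/
noncomputable def energy (Γ : Subgroup SL2C) (l : Tensor2 3) : ℝ≥0∞ :=
  quotLIntegral Γ Set.univ fun p => ENNReal.ofReal (normSq2 metric l p)

lemma IsInvSol.normSq2_act {Γ : Subgroup SL2C} {l : Tensor2 3} (h : IsInvSol Γ l) {γ : SL2C}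
    (hγ : γ ∈ Γ) {p : Fin 3 → ℝ} (hp : p ∈ halfSpace) :
    normSq2 metric l (act γ p) = normSq2 metric l p := by
  rw [← normSq2_pull γ l hp, normSq2_metric hp, normSq2_metric hp, h.invariant γ hγ p hp]

lemma IsInvSol.invariantFun {Γ : Subgroup SL2C} {l : Tensor2 3} (h : IsInvSol Γ l) :
    InvariantFun Γ fun p => ENNReal.ofReal (normSq2 metric l p) :=
  fun γ hγ p hp => by simp only [h.normSq2_act hγ hp]

lemma IsInvSol.pull {Γ : Subgroup SL2C} {l : Tensor2 3} (h : IsInvSol Γ l) (κ : SL2C) :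
    IsInvSol (conjGroup κ Γ) (pull (act κ) l) where
  toIsSol := h.toIsSol.pull κ
  invariant γ hγ p hp := by
    have e : κ * γ = (κ * γ * κ⁻¹) * κ := by group
    rw [← pull_mul κ γ l hp, e, pull_mul _ _ _ hp]
    ext a b
    unfold Hyp3.pull
    simp only [← h.invariant _ (mem_conjGroup.1 hγ) _ (act_mem κ hp), Hyp3.pull]

/-- Conjugation of the group is an isometry of the quotients. -/
lemma quotLIntegral_conj_le (κ : SL2C) (Γ : Subgroup SL2C) (f : (Fin 3 → ℝ) → ℝ≥0∞) :
    quotLIntegral (conjGroup κ Γ) Set.univ (fun p => f (act κ p)) ≤ quotLIntegral Γ Set.univ f := by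
  refine iSup₂_le fun S hS => ?_
  obtain ⟨hSm, hSH, hinj⟩ := hS
  have hSH' : S ⊆ halfSpace := fun p hp => (hSH hp).2
  rw [← setLIntegral_act_image κ hSm hSH' f]
  refine le_quotLIntegral f (measurableSet_act_image κ hSm hSH') ?_ ?_
  · rintro _ ⟨p, hp, rfl⟩; exact ⟨trivial, act_mem κ (hSH' hp)⟩
  · rintro _ ⟨p, hp, rfl⟩ _ ⟨q, hq, rfl⟩ ⟨γ, hγ, e⟩
    rw [hinj p hp q hq ⟨κ⁻¹ * γ * κ, ?_, ?_⟩]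
    · rw [mem_conjGroup]
      have : κ * (κ⁻¹ * γ * κ) * κ⁻¹ = γ := by group
      rwa [this]
    · rw [act_mul _ _ (hSH' hp), act_mul _ _ (act_mem κ (hSH' hp)), e, act_inv_act _ (hSH' hq)]

lemma energy_pull_le (κ : SL2C) (Γ : Subgroup SL2C) (l : Tensor2 3) :
    energy (conjGroup κ Γ) (pull (act κ) l) ≤ energy Γ l := by
  refine le_trans (le_of_eq ?_) (quotLIntegral_conj_le κ Γ _)
  refine iSup_congr fun S => iSup_congr fun hS => ?_
  refine setLIntegral_congr_fun hS.1 fun p hp => ?_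
  rw [normSq2_pull κ l (hS.2.1 hp).2]

/-- On `A`, invariant solutions are bounded by their `L²` norm over the quotient. -/
def QBound (Γ : Subgroup SL2C) (A : Set (Fin 3 → ℝ)) : Prop :=
  ∃ C : ℝ, 0 < C ∧ ∀ l : Tensor2 3, IsInvSol Γ l → ∀ x ∈ A,
    ENNReal.ofReal (normSq2 metric l x) ≤ ENNReal.ofReal C * energy Γ l

lemma QBound.mono {Γ : Subgroup SL2C} {A B : Set (Fin 3 → ℝ)} (h : QBound Γ B) (hAB : A ⊆ B) :
    QBound Γ A := by
  obtain ⟨C, hC, hb⟩ := h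
  exact ⟨C, hC, fun l hl x hx => hb l hl x (hAB hx)⟩

lemma QBound.union {Γ : Subgroup SL2C} {A B : Set (Fin 3 → ℝ)} (hA : QBound Γ A)
    (hB : QBound Γ B) : QBound Γ (A ∪ B) := by
  obtain ⟨C, hC, hb⟩ := hA
  obtain ⟨C', hC', hb'⟩ := hB
  refine ⟨max C C', lt_max_of_lt_left hC, fun l hl x hx => ?_⟩
  rcases hx with hx | hx
  · exact (hb l hl x hx).trans (mul_le_mul_left (ENNReal.ofReal_le_ofReal (le_max_left _ _)) _)
  · exact (hb' l hl x hx).trans (mul_le_mul_left (ENNReal.ofReal_le_ofReal (le_max_right _ _)) _)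

lemma QBound.biUnion {Γ : Subgroup SL2C} {ι : Type*} {E : Set ι} (hE : E.Finite)
    {A : ι → Set (Fin 3 → ℝ)} (h : ∀ i ∈ E, QBound Γ (A i)) : QBound Γ (⋃ i ∈ E, A i) := by
  induction E, hE using Set.Finite.induction_on with
  | empty => exact ⟨1, one_pos, by simp⟩
  | @insert i E hi hE ih =>
    rw [Set.biUnion_insert]
    exact (h i (Set.mem_insert i E)).union (ih fun j hj => h j (Set.mem_insert_of_mem i hj))

lemma QBound.saturate {Γ : Subgroup SL2C} {A : Set (Fin 3 → ℝ)} (h : QBound Γ A) :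
    QBound Γ (saturation Γ A ∩ halfSpace) := by
  obtain ⟨C, hC, hb⟩ := h
  refine ⟨C, hC, fun l hl x hx => ?_⟩
  obtain ⟨⟨γ, hγ, hA⟩, hx⟩ := hx
  rw [← hl.normSq2_act hγ hx]
  exact hb l hl _ hA

/-- The bound may be proved after conjugation, which allows tubes to be put into standard position.
-/
lemma QBound.of_conj {Γ : Subgroup SL2C} {κ : SL2C} {A : Set (Fin 3 → ℝ)}
    (h : QBound (conjGroup κ Γ) A) (hA : A ⊆ halfSpace) : QBound Γ (act κ '' A) := by
  obtain ⟨C, hC, hb⟩ := h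
  refine ⟨C, hC, ?_⟩
  rintro l hl _ ⟨x, hx, rfl⟩
  rw [← normSq2_pull κ l (hA hx)]
  exact (hb _ (hl.pull κ) x hx).trans (mul_le_mul_right (energy_pull_le κ Γ l) _)

lemma eBall_subset_boxK {R : ℝ} (hR : 0 < R) {x : Fin 3 → ℝ} (hx : x ∈ boxK R) :
    eBall x ⊆ boxK (2 * R) := fun y hy => by
  have hxH := boxK_subset hR hx
  have h0 := abs_sub_lt_of_mem_eBall hxH hy 0
  have h1 := abs_sub_lt_of_mem_eBall hxH hy 1
  have h2 := height_of_mem_eBall hxH hy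
  obtain ⟨hz, ht1, ht2⟩ := hx
  refine ⟨?_, ?_, by linarith⟩
  · have h3 : ‖zco y - zco x‖ ≤ |y 0 - x 0| + |y 1 - x 1| := by
      refine (Complex.norm_le_abs_re_add_abs_im _).trans (le_of_eq ?_)
      simp [zco]
    have h4 := norm_add_le (zco x) (zco y - zco x)
    rw [add_sub_cancel] at h4
    linarith
  · rw [mul_inv]; linarith

/-- The mean value inequality for the squared norm of a solution. -/
lemma frame_mean_value : ∃ C : ℝ, 0 < C ∧ ∀ l : Tensor2 3, IsSol l → ∀ x ∈ halfSpace,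
    ENNReal.ofReal (normSq2 metric l x) ≤
      ENNReal.ofReal C * ∫⁻ p in eBall x, ENNReal.ofReal (normSq2 metric l p) ∂(riemVol metric) := by
  obtain ⟨C, hC, hmv⟩ := exists_mean_value (K := 7) (by norm_num)
  refine ⟨C, hC, fun l hl x hx => ?_⟩
  have h1 := hmv (fun p => sqNorm (frame l p)) (contDiffOn_sqNorm hl.isFrameSol)
    (fun p _ => sqNorm_nonneg _) (fun p hp => hl.isFrameSol.laplacian_ge hp) x hx
  rw [normSq2_eq_sqNorm hx]
  refine h1.trans (le_of_eq ?_)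
  congr 1
  refine setLIntegral_congr_fun (isOpen_eBall x).measurableSet fun p hp => ?_
  rw [normSq2_eq_sqNorm (eBall_subset hx hp)]

/-- Over a compact set, the covering of the quotient has bounded multiplicity, and the mean value
inequality suffices. -/
lemma IsFreeDiscrete.qBound_boxK {Γ : Subgroup SL2C} (h : IsFreeDiscrete Γ) {R : ℝ} (hR : 1 ≤ R) :
    QBound Γ (boxK R) := by
  obtain ⟨C, hC, hmv⟩ := frame_mean_value
  set s := (h.finite (18 * (2 * R) ^ 6)).toFinset with hs
  refine ⟨C * (s.card + 1), by positivity, fun l hl x hx => ?_⟩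
  refine (hmv l hl.toIsSol x (boxK_subset (by linarith) hx)).trans ?_
  rw [ENNReal.ofReal_mul hC.le, mul_assoc]
  refine mul_le_mul_right ?_ _
  refine (lintegral_mono_set (eBall_subset_boxK (by linarith) hx)).trans ?_
  refine (lintegral_le_card_mul_quot s hl.invariantFun (measurableSet_boxK _)
    (boxK_subset (by linarith)) (fun σ hσ => ((h.finite _).mem_toFinset.1 hσ).1) ?_).trans ?_
  · exact fun p hp γ hγ hγp => ⟨γ, (h.finite _).mem_toFinset.2
      ⟨hγ, fro_le_of_boxK (by linarith) hp hγp rfl⟩, rfl⟩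
  · refine mul_le_mul_left ?_ _
    rw [← ENNReal.ofReal_natCast]
    exact ENNReal.ofReal_le_ofReal (by linarith)

lemma jac_transl (b : ℂ) (p : Fin 3 → ℝ) (i a : Fin 3) :
    jac (act (transl b)) p i a = if i = a then 1 else 0 := by
  unfold jac
  have : (fun x => act (transl b) x i) = fun x => shift b i + x i := by
    funext x; rw [act_transl]; rfl
  rw [this, pd_add (by fun_prop) (by fun_prop), pd_const, pd_proj, zero_add]

lemma IsInvSol.periodicIn_frame {Γ : Subgroup SL2C} {l : Tensor2 3} (h : IsInvSol Γ l) {b : ℂ}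
    (hb : transl b ∈ Γ) (i j : Fin 3) : PeriodicIn b fun x => frame l x i j := fun p hp => by
  have h1 := congrFun (congrFun (h.invariant _ hb p hp) i) j
  unfold Hyp3.pull at h1
  simp only [jac_transl] at h1
  simp only [mul_ite, mul_one, mul_zero, Finset.sum_ite_eq', Finset.mem_univ, if_true] at h1
  simp only [frame, ← h1, act_transl]
  simp

lemma transl_add (b c : ℂ) : transl b * transl c = transl (b + c) := by
  obtain ⟨b00, b01, b10, b11⟩ := transl_entries b
  obtain ⟨c00, c01, c10, c11⟩ := transl_entries c
  obtain ⟨d00, d01, d10, d11⟩ := transl_entries (b + c)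
  refine ext_entries ?_ ?_ ?_ ?_ <;>
    simp only [Hyp3.mul_apply, b00, b01, b10, b11, c00, c01, c10, c11, d00, d01, d10, d11] <;> ring

lemma transl_zpow (b : ℂ) (n : ℤ) : transl b ^ n = transl (n * b) := by
  induction n with
  | zero => simp [transl_zero]
  | succ n ih => rw [_root_.zpow_add_one, ih, transl_add]; congr 1; push_cast; ring
  | pred n ih =>
    have hinv : (transl b)⁻¹ = transl (-b) :=
      inv_eq_of_mul_eq_one_right (by rw [transl_add, add_neg_cancel, transl_zero])
    rw [_root_.zpow_sub_one, ih, hinv, transl_add]; congr 1; push_cast; ring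

/-- Invariant solutions are bounded on horoballs at parabolic fixed points. -/
lemma IsFreeDiscrete.qBound_horoball {Γ : Subgroup SL2C} (h : IsFreeDiscrete Γ)
    (hvol : quotLIntegral Γ Set.univ (fun _ => 1) < ∞) {b : ℂ} (hb : b ≠ 0) (hbΓ : transl b ∈ Γ)
    {T₀ : ℝ} (hT₀ : 0 < T₀) : QBound Γ {p | T₀ ≤ p 2} := by
  obtain ⟨b₂, hb₂Γ, hind⟩ := h.exists_indep hvol hb hbΓ
  obtain ⟨T, hT, hprec⟩ := h.exists_height hb hbΓ
  obtain ⟨C, hC, T', hT', hcusp⟩ := exists_cusp_bound hind hT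
  have hhigh : QBound Γ {p | T' ≤ p 2} := by
    set N := (h.finite (2 + (‖b‖ + ‖b₂‖) ^ 2)).toFinset.card with hN
    refine ⟨C * (N + 1), by positivity, fun l hl x hx => ?_⟩
    -- for infinite energy there is nothing to prove
    by_cases htop : energy Γ l = ∞
    · rw [htop, ENNReal.mul_top (by simp; positivity)]; exact le_top
    have hxH : x ∈ halfSpace := lt_of_lt_of_le hT' hx
    have hI : ∫⁻ p in slab b b₂ (Set.Ioi T), ENNReal.ofReal (sqNorm (frame l p)) ∂(riemVol metric) ≤
        N * energy Γ l := by
      have h1 := lintegral_slab_le (B := (‖b‖ + ‖b₂‖) ^ 2) h hind hT hprec ?_ hl.invariantFun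
      · refine le_trans (le_of_eq ?_) h1
        refine setLIntegral_congr_fun (measurableSet_slab hind measurableSet_Ioi) fun p hp => ?_
        rw [normSq2_eq_sqNorm (slab_subset _ _ (Set.Ioi_subset_Ioi hT.le) hp)]
      · rintro β - ⟨s₁, s₂, h₁, h₂, rfl⟩
        refine pow_le_pow_left₀ (norm_nonneg _) ((norm_add_le _ _).trans ?_) 2
        rw [norm_mul, norm_mul, Complex.norm_real, Complex.norm_real]
        exact add_le_add (mul_le_of_le_one_left (norm_nonneg _) h₁)
          (mul_le_of_le_one_left (norm_nonneg _) h₂)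
    have hm : IsCuspSol b b₂ (frame l) :=
      { toIsFrameSol := hl.toIsSol.isFrameSol
        periodic₁ := hl.periodicIn_frame hbΓ
        periodic₂ := hl.periodicIn_frame hb₂Γ }
    have h2 := hcusp (frame l) hm (ne_top_of_le_ne_top
      (ENNReal.mul_ne_top (ENNReal.natCast_ne_top N) htop) hI) x hx
    rw [normSq2_eq_sqNorm hxH, ENNReal.ofReal_mul hC.le, mul_assoc]
    refine h2.trans (mul_le_mul_right (hI.trans (mul_le_mul_left ?_ _)) _)
    rw [← ENNReal.ofReal_natCast]
    exact ENNReal.ofReal_le_ofReal (by linarith)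
  obtain ⟨M, hM, hrep⟩ := exists_box_rep hind
  -- points of height between `T₀` and `T'` are moved into a compact box by the lattice
  set R := max 1 (max (2 * M) (max T' T₀⁻¹)) with hR
  have hR1 : 1 ≤ R := le_max_left _ _
  have hRM : 2 * M ≤ R := (le_max_left _ _).trans (le_max_right _ _)
  have hRT' : T' ≤ R := ((le_max_left _ _).trans (le_max_right _ _)).trans (le_max_right _ _)
  have hRT₀ : T₀⁻¹ ≤ R := ((le_max_right _ _).trans (le_max_right _ _)).trans (le_max_right _ _)
  refine (hhigh.union (h.qBound_boxK hR1).saturate).mono fun p hp => ?_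
  have hp0 : T₀ ≤ p 2 := hp
  by_cases hpT : T' ≤ p 2
  · exact Or.inl hpT
  push Not at hpT
  refine Or.inr ⟨?_, lt_of_lt_of_le hT₀ hp0⟩
  obtain ⟨n₁, n₂, hre, him⟩ := hrep (zco p)
  refine ⟨transl (n₁ * b + n₂ * b₂), ?_, ?_⟩
  · rw [← transl_add, ← transl_zpow, ← transl_zpow]
    exact Γ.mul_mem (Γ.zpow_mem hbΓ _) (Γ.zpow_mem hb₂Γ _)
  · have e2 : act (transl (n₁ * b + n₂ * b₂)) p 2 = p 2 := by rw [act_transl]; simp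
    refine ⟨?_, ?_, ?_⟩
    · rw [act_transl, zco_shift_add, add_comm]
      exact (Complex.norm_le_abs_re_add_abs_im _).trans (by linarith)
    · rw [e2]; exact (inv_le_of_inv_le₀ hT₀ hRT₀).trans hp0
    · rw [e2]; exact hpT.le.trans hRT'

/-- Invariant solutions are bounded on tubes: these are compact modulo the group, or contained in a
horoball. -/
lemma IsFreeDiscrete.qBound_tube {Γ : Subgroup SL2C} (h : IsFreeDiscrete Γ)
    (hvol : quotLIntegral Γ Set.univ (fun _ => 1) < ∞) {η : SL2C} (hη : η ∈ Γ) (h1 : η ≠ 1)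
    (h2 : η ≠ -1) : QBound Γ (tube Γ η) := by
  obtain ⟨κ, h10, hκ⟩ := exists_conj_diag_or_transl h1 h2
  set D := κ⁻¹ * η * κ with hD
  have hDΔ : D ∈ conjGroup κ Γ := by
    rw [mem_conjGroup]
    have : κ * (κ⁻¹ * η * κ) * κ⁻¹ = η := by group
    rwa [hD, this]
  have key : QBound (conjGroup κ Γ) (tube (conjGroup κ Γ) D) := by
    rcases hκ with ⟨h01, hne⟩ | ⟨h01, he⟩
    · obtain ⟨R, hR, hcov⟩ := (h.conj κ).tube_diag hDΔ h10 h01 hne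
      exact ((h.conj κ).qBound_boxK hR).saturate.mono fun x hx => ⟨hcov x hx, hx.1⟩
    · obtain ⟨T, hT, hsub⟩ := (h.conj κ).tube_transl h10 h01 he
      obtain ⟨b, hb, hb0⟩ := eq_transl_or_neg h10 he
      obtain ⟨n1, n2⟩ := ne_one_conj (κ := κ) h1 h2
      have hbne : b ≠ 0 := fun h0 => (hb0 h0).elim n1 n2
      have hvol' := (quotLIntegral_conj_le κ Γ fun _ => 1).trans_lt hvol
      exact ((h.conj κ).qBound_horoball hvol' hbne (transl_mem_of (h.conj κ) hDΔ hb) hT).mono hsub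
  refine (key.of_conj fun x hx => hx.1).mono fun x hx => ⟨act κ⁻¹ x, tube_conj κ hx, ?_⟩
  rw [act_act_inv _ hx.1]

/-- On a quotient of finite volume, solutions are bounded by their `L²` norm. -/
theorem IsFreeDiscrete.qBound {Γ : Subgroup SL2C} (h : IsFreeDiscrete Γ)
    (hvol : quotLIntegral Γ Set.univ (fun _ => 1) < ∞) : QBound Γ halfSpace := by
  obtain ⟨R, hR, E, hE, hEΓ, hcov⟩ := h.thin_subset hvol
  have hbd : QBound Γ (⋃ η ∈ E, saturation Γ (tube Γ η) ∩ halfSpace) :=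
    QBound.biUnion hE fun η hη =>
      (h.qBound_tube hvol (hEΓ η hη).1 (hEΓ η hη).2.1 (hEΓ η hη).2.2).saturate
  refine ((h.qBound_boxK hR).saturate.union hbd).mono fun x hx => ?_
  rcases hcov x hx with hc | ⟨η, hη, hc⟩
  · exact Or.inl ⟨hc, hx⟩
  · exact Or.inr (Set.mem_biUnion hη ⟨hc, hx⟩)

lemma IsEigentensor.isInvSol {Γ Γ' : Subgroup SL2C} {l : Tensor2 3} (h : IsEigentensor Γ l)
    (hΓ : ∀ γ ∈ Γ', ∃ η ∈ Γ, act γ = act η) : IsInvSol Γ' l where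
  toIsSol := h.isSol
  invariant γ hγ p hp := by
    obtain ⟨η, hη, e⟩ := hΓ γ hγ
    rw [e]
    ext a b
    exact h.invariant η hη p hp a b

/-- Fewer sets inject into the quotient by a larger group. -/
lemma quotLIntegral_anti {Γ Γ' : Subgroup SL2C} (hle : Γ ≤ Γ') (A : Set (Fin 3 → ℝ))
    (f : (Fin 3 → ℝ) → ℝ≥0∞) : quotLIntegral Γ' A f ≤ quotLIntegral Γ A f :=
  iSup₂_le fun _ hS => le_quotLIntegral f hS.1 hS.2.1
    fun p hp q hq ⟨γ, hγ, e⟩ => hS.2.2 p hp q hq ⟨γ, hle hγ, e⟩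

/-- The bound of the supremum, obtained for the group with `-1` adjoined; the quotient is the same.
-/
theorem IsFiniteVolume.exists_C0norm_le {Γ : Subgroup SL2C} (h : IsFiniteVolume Γ) :
    ∃ C : ℝ, 0 < C ∧ ∀ l : Tensor2 3, IsEigentensor Γ l →
      C0norm l ≤ ENNReal.ofReal C * L2norm Γ l := by
  obtain ⟨Γ', hle, hΓ', hact⟩ := h.toIsManifoldGroup.exists_isFreeDiscrete
  obtain ⟨C, hC, hb⟩ := hΓ'.qBound ((quotLIntegral_anti hle _ _).trans_lt h.finite_volume)
  refine ⟨Real.sqrt C, Real.sqrt_pos.2 hC, fun l hl => iSup₂_le fun p hp => ?_⟩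
  have h1 := (hb l (hl.isInvSol hact) p hp).trans
    (mul_le_mul_right (quotLIntegral_anti hle _ _) _)
  have h2 := ENNReal.rpow_le_rpow h1 (by norm_num : (0 : ℝ) ≤ 1 / 2)
  rw [ENNReal.mul_rpow_of_nonneg _ _ (by norm_num), ENNReal.ofReal_rpow_of_nonneg
    (normSq2_nonneg hp) (by norm_num), ENNReal.ofReal_rpow_of_nonneg hC.le (by norm_num),
    ← Real.sqrt_eq_rpow, ← Real.sqrt_eq_rpow] at h2
  exact h2

end Hyp3

theorem mainTheorem11 :
    ∃ α : ℝ, 0 < α ∧ ∀ Γ : Subgroup Hyp3.SL2C, Hyp3.IsFiniteVolume Γ →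
      (∀ 𝒞 : Hyp3.CuspFamily Γ, ∃ C : ℝ, 0 < C ∧
        ∀ l : ChartGeom.Tensor2 3, Hyp3.IsEigentensor Γ l → ∀ r : ℝ, 0 ≤ r →
          Hyp3.L1normOn Γ (𝒞.region r) l
            ≤ ENNReal.ofReal (C * Real.exp (-α * r)) * Hyp3.L2norm Γ l) ∧
      (∃ C : ℝ, 0 < C ∧
        ∀ l : ChartGeom.Tensor2 3, Hyp3.IsEigentensor Γ l →
          Hyp3.C0norm l ≤ ENNReal.ofReal C * Hyp3.L2norm Γ l ∧ Hyp3.L2norm Γ l < ∞) := by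
  refine ⟨1, one_pos, fun Γ hΓ => ⟨fun 𝒞 => ?_, ?_⟩⟩
  · have := hΓ.toIsManifoldGroup.countable
    exact L1normOn_region_le 𝒞
  · obtain ⟨C, hC, hb⟩ := hΓ.exists_C0norm_le
    exact ⟨C, hC, fun l hl => ⟨hb l hl, L2norm_lt_top hl⟩⟩
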